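/- Let $\mathcal{T}$ be a Grothendieck topos and $X$ a decidable object of $\mathcal{T}$ (internally, for all $x,y\in X$, either $x=y$ or $x\neq y$). Let $\mathbb{C}_{\mathcal{T}}=\mathbb{R}_{\mathcal{T}}\times\mathbb{R}_{\mathcal{T}}$, where $\mathbb{R}_{\mathcal{T}}$ is the object of Dedekind real numbers. A Hilbert space of $\mathcal{T}$ is an object of $\mathcal{T}$ with a $\mathbb{C}_{\mathcal{T}}$-module structure and a $\mathbb{C}_{\mathcal{T}}$-valued scalar product satisfying internally the axioms of a Hilbert space, completeness being understood in terms of Cauchy approximations. $\mathcal{H}(\mathcal{T})$ is the category of Hilbert spaces of $\mathcal{T}$; its morphisms are the internally linear maps $f$ which have an adjoint and for which there is an external number $K$ such that $\|f(x)\|\le K\|x\|$ holds internally. Let $\ell^2(X)\in\mathcal{H}(\mathcal{T})$ be the Hilbert space generated by elements $e_x$, $x\in X$, with $\langle e_x,e_y\rangle=\delta_{x,y}$. Let $\otimes$ be the (internal) tensor product of Hilbert spaces, and let $\Delta:\ell^2(X)\to\ell^2(X)\otimes\ell^2(X)$ be the operator $e_x\mapsto e_x\otimes e_x$, whose adjoint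 $\Delta^*$ makes $\ell^2(X)$ a (non-unital) monoid. The space $\ell^2(X)$, the tensor products $H\otimes\ell^2(X)$ for $H\in\mathcal{H}(\mathcal{T})$ and these operators exist, and for any choice of them the following three categories are equivalent: 1. the category of $\ell^2(X)$-modules: Hilbert spaces $H\in\mathcal{H}(\mathcal{T})$ with an action $M:H\otimes\ell^2(X)\to H$, in $\mathcal{H}(\mathcal{T})$, of the monoid $(\ell^2(X),\Delta^*)$, such that $MM^*=\mathrm{id}_H$ and $M^*M=(\mathrm{id}_H\otimes\Delta^*)\circ(M^*\otimes\mathrm{id}_{\ell^2(X)})$; the morphisms are the morphisms of $\mathcal{H}(\mathcal{T})$ that commute with the actions; 2. the category of non-degenerate representations of $C_0(X)$: Hilbert spaces $H\in\mathcal{H}(\mathcal{T})$ with an action of $C_0(X)$ (the internal $*$-algebra of functions $X\to\mathbb{C}_{\mathcal{T}}$ which are, for every $\varepsilon>0$, at most $\varepsilon$ in modulus outside some finite list of elements of $X$) which makes $H$, internally in $\mathcal{T}$, a $*$-representation such that the image of $C_0(X)\times H\to H$ spans a dense subspace of $H$; the morphisms are the morphisms of $\mathcal{H}(\mathcal{T})$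 that commute with the actions; 3. the category $\mathcal{H}(\mathcal{T}_{/X})$ of Hilbert spaces of the slice topos $\mathcal{T}_{/X}$. -/

import Mathlib

open CategoryTheory

universe v u

noncomputable section

namespace ToposHilbert

/-! ## Kripke-Joyal semantics

Internal statements are interpreted at generalized elements: an element of an object `Y` at stage `U`
is a morphism `U ⟶ Y`, and it is restricted along `f : V ⟶ U` by composition. -/

section Forcing

variable {C : Type u} [Category.{v} C]

/-- `P` holds locally on `U`: it holds on all members of some covering sieve.  This interprets
the internal existential quantifiers and disjunctions. -/
def Locally (J : GrothendieckTopology C) {U : C} (P : ∀ ⦃V : C⦄, (V ⟶ U) → Prop) : Prop :=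
  ∃ S ∈ J U, ∀ ⦃V : C⦄ (f : V ⟶ U), S f → P f

/-- The stage `U` forces a contradiction. -/
def Inconsistent (J : GrothendieckTopology C) (U : C) : Prop := (⊥ : Sieve U) ∈ J U

/-- The internal statement `x ≠ y`, for two elements of `X` at stage `U`. -/
def InternallyNe (J : GrothendieckTopology C) {U X : C} (x y : U ⟶ X) : Prop :=
  ∀ ⦃V : C⦄ (f : V ⟶ U), f ≫ x = f ≫ y → Inconsistent J V

variable {J : GrothendieckTopology C} {U : C}

theorem Locally.of_forall {P : ∀ ⦃V : C⦄, (V ⟶ U) → Prop} (h : ∀ ⦃V : C⦄ (f : V ⟶ U), P f) :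
    Locally J P := ⟨⊤, J.top_mem U, fun _ f _ => h f⟩

theorem Locally.mono {P Q : ∀ ⦃V : C⦄, (V ⟶ U) → Prop} (hP : Locally J P)
    (h : ∀ ⦃V : C⦄ (f : V ⟶ U), P f → Q f) : Locally J Q := by
  obtain ⟨S, hS, H⟩ := hP
  exact ⟨S, hS, fun V f hf => h f (H f hf)⟩

theorem Locally.restrict {P : ∀ ⦃V : C⦄, (V ⟶ U) → Prop} (hP : Locally J P) {V : C} (f : V ⟶ U) :
    Locally J (fun ⦃W : C⦄ (g : W ⟶ V) => P (g ≫ f)) := by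
  obtain ⟨S, hS, H⟩ := hP
  exact ⟨S.pullback f, J.pullback_stable f hS, fun W g hg => H _ hg⟩

theorem Locally.bind {P Q : ∀ ⦃V : C⦄, (V ⟶ U) → Prop} (hP : Locally J P)
    (h : ∀ ⦃V : C⦄ (f : V ⟶ U), P f → Locally J (fun ⦃W : C⦄ (g : W ⟶ V) => Q (g ≫ f))) :
    Locally J Q := by
  obtain ⟨S, hS, H⟩ := hP
  choose R hR HR using fun (V : C) (f : V ⟶ U) (hf : S f) => h f (H f hf)
  refine ⟨Sieve.bind S (fun V f hf => R V f hf), J.bind_covering hS (fun V f hf => hR V f hf), ?_⟩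
  rintro V f ⟨W, g, k, hk, hg, rfl⟩
  exact HR _ _ hk _ hg

theorem Locally.inconsistent (hP : Locally J (fun ⦃V : C⦄ (_ : V ⟶ U) => Inconsistent J V)) :
    Inconsistent J U := by
  obtain ⟨S, hS, H⟩ := hP
  refine J.transitive hS _ (fun V f hf => ?_)
  have := H f hf
  simpa [Inconsistent] using this

theorem Inconsistent.locally (h : Inconsistent J U) (P : ∀ ⦃V : C⦄, (V ⟶ U) → Prop) :
    Locally J P := ⟨⊥, h, fun _ _ hf => hf.elim⟩

theorem Inconsistent.restrict (h : Inconsistent J U) {V : C} (f : V ⟶ U) : Inconsistent J V := by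
  have := J.pullback_stable f h
  simpa [Inconsistent] using this

theorem InternallyNe.restrict {X : C} {x y : U ⟶ X} (h : InternallyNe J x y) {V : C} (f : V ⟶ U) :
    InternallyNe J (f ≫ x) (f ≫ y) := fun W g hg => h (g ≫ f) (by simpa using hg)

end Forcing

/-! ## Dedekind real numbers of a site -/

/-- A Dedekind real number at stage `U`: two families of subobjects of `U` indexed by the rational
numbers `q`, read as `q < x` and `x < q`, which satisfy internally the axioms of a Dedekind
cut.  (The rational numbers object is constant.) -/
structure DReal {C : Type u} [Category.{v} C] (J : GrothendieckTopology C) (U : C) where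
  lower : ℚ → Sieve U
  upper : ℚ → Sieve U
  lower_iff : ∀ (q : ℚ) ⦃V : C⦄ (f : V ⟶ U),
    lower q f ↔ Locally J (fun ⦃W : C⦄ (g : W ⟶ V) => ∃ r, q < r ∧ lower r (g ≫ f))
  upper_iff : ∀ (q : ℚ) ⦃V : C⦄ (f : V ⟶ U),
    upper q f ↔ Locally J (fun ⦃W : C⦄ (g : W ⟶ V) => ∃ r, r < q ∧ upper r (g ≫ f))
  lower_inhabited : Locally J (fun ⦃V : C⦄ (f : V ⟶ U) => ∃ q, lower q f)
  upper_inhabited : Locally J (fun ⦃V : C⦄ (f : V ⟶ U) => ∃ q, upper q f)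
  disjoint : ∀ (q : ℚ) ⦃V : C⦄ (f : V ⟶ U), lower q f → upper q f → Inconsistent J V
  located : ∀ q r : ℚ, q < r → Locally J (fun ⦃V : C⦄ (f : V ⟶ U) => lower q f ∨ upper r f)

namespace DReal

variable {C : Type u} [Category.{v} C] {J : GrothendieckTopology C} {U : C}

theorem lower_of_locally (x : DReal J U) {q : ℚ} {V : C} {f : V ⟶ U}
    (h : Locally J (fun ⦃W : C⦄ (g : W ⟶ V) => x.lower q (g ≫ f))) : x.lower q f := by
  rw [x.lower_iff]
  refine h.bind fun W g hg => ?_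
  have := (x.lower_iff q (g ≫ f)).1 hg
  simpa using this

theorem upper_of_locally (x : DReal J U) {q : ℚ} {V : C} {f : V ⟶ U}
    (h : Locally J (fun ⦃W : C⦄ (g : W ⟶ V) => x.upper q (g ≫ f))) : x.upper q f := by
  rw [x.upper_iff]
  refine h.bind fun W g hg => ?_
  have := (x.upper_iff q (g ≫ f)).1 hg
  simpa using this

theorem lower_mono (x : DReal J U) {q r : ℚ} (h : q ≤ r) {V : C} {f : V ⟶ U}
    (hf : x.lower r f) : x.lower q f := by
  rcases h.eq_or_lt with rfl | h
  · exact hf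
  · exact (x.lower_iff q f).2 (Locally.of_forall fun W g => ⟨r, h, (x.lower r).downward_closed hf g⟩)

theorem upper_mono (x : DReal J U) {q r : ℚ} (h : q ≤ r) {V : C} {f : V ⟶ U}
    (hf : x.upper q f) : x.upper r f := by
  rcases h.eq_or_lt with rfl | h
  · exact hf
  · exact (x.upper_iff r f).2 (Locally.of_forall fun W g => ⟨q, h, (x.upper q).downward_closed hf g⟩)

theorem inconsistent_of_le (x : DReal J U) {q r : ℚ} (h : r ≤ q) {V : C} {f : V ⟶ U}
    (hl : x.lower q f) (hu : x.upper r f) : Inconsistent J V :=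
  x.disjoint q f hl (x.upper_mono h hu)

/-- The order of the Dedekind reals: `q < x` implies `q < y` for every rational `q`. -/
instance : LE (DReal J U) where
  le x y := ∀ (q : ℚ) ⦃V : C⦄ (f : V ⟶ U), x.lower q f → y.lower q f

theorem upper_of_le {x y : DReal J U} (h : x ≤ y) {q : ℚ} {V : C} {f : V ⟶ U}
    (hf : y.upper q f) : x.upper q f := by
  apply x.upper_of_locally
  refine ((y.upper_iff q f).1 hf).bind fun W g ⟨r, hr, hg⟩ => ?_
  refine ((x.located r q hr).restrict (g ≫ f)).bind fun W' g' hg' => ?_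
  rcases hg' with h1 | h1
  · refine (y.disjoint r _ (h r _ h1) ((y.upper r).downward_closed hg g')).locally _
  · exact Locally.of_forall fun W'' g'' => by
      have := (x.upper q).downward_closed h1 g''
      simpa using this

instance : PartialOrder (DReal J U) where
  le_refl x := fun q V f h => h
  le_trans x y z h1 h2 := fun q V f h => h2 q f (h1 q f h)
  le_antisymm x y h1 h2 := by
    have hl : x.lower = y.lower := by
      funext q; ext V f; exact ⟨h1 q f, h2 q f⟩
    have hu : x.upper = y.upper := by
      funext q; ext V f; exact ⟨upper_of_le h2, upper_of_le h1⟩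
    cases x; cases y; cases hl; cases hu; rfl

/-- Restriction of a real number to a later stage. -/
def restrict (x : DReal J U) {V : C} (f : V ⟶ U) : DReal J V where
  lower q := (x.lower q).pullback f
  upper q := (x.upper q).pullback f
  lower_iff q W g := by
    simpa using x.lower_iff q (g ≫ f)
  upper_iff q W g := by
    simpa using x.upper_iff q (g ≫ f)
  lower_inhabited := x.lower_inhabited.restrict f
  upper_inhabited := x.upper_inhabited.restrict f
  disjoint q W g h1 h2 := x.disjoint q (g ≫ f) h1 h2
  located q r h := (x.located q r h).restrict f

theorem restrict_mono {x y : DReal J U} (h : x ≤ y) {V : C} (f : V ⟶ U) :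
    x.restrict f ≤ y.restrict f := fun q _ g hg => h q (g ≫ f) hg

theorem restrict_comp (x : DReal J U) {V W : C} (f : V ⟶ U) (g : W ⟶ V) :
    x.restrict (g ≫ f) = (x.restrict f).restrict g := by
  apply le_antisymm <;> intro q Z k hk
  · simpa [restrict] using hk
  · simpa [restrict] using hk

/-! ### Arithmetic

A continuous function `F` of finitely many real variables acts on Dedekind reals: `q < F x` holds
iff `x` lies in a rational open box on which `F` is at least some `q' > q`.  All operations are
instances of this; addition and multiplication are the usual interval arithmetic of cuts. -/

section Calculus

variable {ι κ : Type}

/-- The tuple `x` lies in the rational open box with corners `a` and `b`. -/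
def InBox (x : ι → DReal J U) (a b : ι → ℚ) {V : C} (f : V ⟶ U) : Prop :=
  ∀ i, (x i).lower (a i) f ∧ (x i).upper (b i) f

/-- The set of points of the rational open box with corners `a` and `b`. -/
def box (a b : ι → ℚ) : Set (ι → ℝ) := {s | ∀ i, (a i : ℝ) < s i ∧ s i < b i}

theorem InBox.restrict {x : ι → DReal J U} {a b : ι → ℚ} {V : C} {f : V ⟶ U} (h : InBox x a b f)
    {W : C} (g : W ⟶ V) : InBox x a b (g ≫ f) := fun i =>
  ⟨((x i).lower _).downward_closed (h i).1 g, ((x i).upper _).downward_closed (h i).2 g⟩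

theorem InBox.inter {x : ι → DReal J U} {a b a' b' : ι → ℚ} {V : C} {f : V ⟶ U}
    (h : InBox x a b f) (h' : InBox x a' b' f) :
    InBox x (fun i => max (a i) (a' i)) (fun i => min (b i) (b' i)) f := fun i => by
  constructor
  · rcases max_choice (a i) (a' i) with e | e <;> simp only [e]
    exacts [(h i).1, (h' i).1]
  · rcases min_choice (b i) (b' i) with e | e <;> simp only [e]
    exacts [(h i).2, (h' i).2]

theorem mem_box_inter {a b a' b' : ι → ℚ} {s : ι → ℝ} :
    s ∈ box (fun i => max (a i) (a' i)) (fun i => min (b i) (b' i)) ↔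
      s ∈ box a b ∧ s ∈ box a' b' := by
  simp only [box, Set.mem_ofPred_eq, Rat.cast_max, Rat.cast_min, max_lt_iff, lt_min_iff]
  exact ⟨fun h => ⟨fun i => ⟨(h i).1.1, (h i).2.1⟩, fun i => ⟨(h i).1.2, (h i).2.2⟩⟩,
    fun h i => ⟨⟨(h.1 i).1, (h.2 i).1⟩, (h.1 i).2, (h.2 i).2⟩⟩

theorem InBox.nonempty_or {x : ι → DReal J U} {a b : ι → ℚ} {V : C} {f : V ⟶ U}
    (h : InBox x a b f) : (box a b).Nonempty ∨ Inconsistent J V := by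
  by_cases hab : ∀ i, a i < b i
  · left
    refine ⟨fun i => ((a i : ℝ) + b i) / 2, fun i => ?_⟩
    have : (a i : ℝ) < b i := by exact_mod_cast hab i
    constructor <;> linarith
  · right
    push Not at hab
    obtain ⟨i, hi⟩ := hab
    exact (x i).inconsistent_of_le hi (h i).1 (h i).2

/-- A real number at stage `U` is locally known up to any precision. -/
theorem locally_near (x : DReal J U) {δ : ℚ} (hδ : 0 < δ) :
    Locally J (fun ⦃V : C⦄ (f : V ⟶ U) =>
      ∃ a b : ℚ, x.lower a f ∧ x.upper b f ∧ b - a < δ) := by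
  have key : ∀ n : ℕ, ∀ (a b : ℚ) ⦃V : C⦄ (f : V ⟶ U), x.lower a f → x.upper b f →
      b - a < (n + 1) * (δ / 2) →
      Locally J (fun ⦃W : C⦄ (g : W ⟶ V) =>
        ∃ a b : ℚ, x.lower a (g ≫ f) ∧ x.upper b (g ≫ f) ∧ b - a < δ) := by
    intro n
    induction n with
    | zero =>
      intro a b V f ha hb hab
      refine Locally.of_forall fun W g => ⟨a, b, (x.lower a).downward_closed ha g,
        (x.upper b).downward_closed hb g, ?_⟩
      push_cast at hab
      linarith
    | succ n ih =>
      intro a b V f ha hb hab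
      have hloc := (x.located (a + δ / 4) (a + δ / 2) (by linarith)).restrict f
      refine hloc.bind fun W g hg => ?_
      rcases hg with hg | hg
      · have := ih (a + δ / 4) b (g ≫ f) hg ((x.upper b).downward_closed hb g)
        by_cases hc : b - (a + δ / 4) < (n + 1) * (δ / 2)
        · simpa using this hc
        · have hloc2 := (x.located (a + δ / 2) (a + 3 * δ / 4) (by linarith)).restrict (g ≫ f)
          refine hloc2.bind fun W' g' hg' => ?_
          rcases hg' with hg' | hg'
          · have := ih (a + δ / 2) b (g' ≫ g ≫ f) hg' (by
              have := (x.upper b).downward_closed hb (g' ≫ g)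
              simpa using this) (by push_cast at hab; linarith)
            simpa using this
          · refine Locally.of_forall fun Z k => ⟨a, a + 3 * δ / 4, ?_, ?_, by linarith⟩
            · have := (x.lower a).downward_closed ha (k ≫ g' ≫ g)
              simpa using this
            · have := (x.upper _).downward_closed hg' k
              simpa using this
      · refine Locally.of_forall fun Z k => ⟨a, a + δ / 2, ?_, ?_, by linarith⟩
        · have := (x.lower a).downward_closed ha (k ≫ g)
          simpa using this
        · have := (x.upper _).downward_closed hg k
          simpa using this
  refine x.lower_inhabited.bind fun V f ⟨a, ha⟩ => ?_
  refine (x.upper_inhabited.restrict f).bind fun W g ⟨b, hb⟩ => ?_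
  obtain ⟨n, hn⟩ := exists_nat_gt ((b - a) / (δ / 2))
  rw [div_lt_iff₀ (by linarith)] at hn
  have := key n a b (g ≫ f) ((x.lower a).downward_closed ha g) hb (by
    have : (n : ℚ) * (δ / 2) ≤ (n + 1) * (δ / 2) := by gcongr; linarith
    linarith)
  simpa using this

theorem locally_forall_finite [Finite ι] {P : ι → ∀ ⦃V : C⦄, (V ⟶ U) → Prop}
    (hmono : ∀ i ⦃V : C⦄ (f : V ⟶ U), P i f → ∀ ⦃W : C⦄ (g : W ⟶ V), P i (g ≫ f))
    (h : ∀ i, Locally J (P i)) : Locally J (fun ⦃V : C⦄ (f : V ⟶ U) => ∀ i, P i f) := by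
  classical
  cases nonempty_fintype ι
  suffices H : ∀ s : Finset ι, Locally J (fun ⦃V : C⦄ (f : V ⟶ U) => ∀ i ∈ s, P i f) from
    (H Finset.univ).mono fun V f hf i => hf i (Finset.mem_univ i)
  intro s
  induction s using Finset.induction_on with
  | empty => exact Locally.of_forall fun V f i hi => by simp at hi
  | insert i s _ ih =>
    refine ih.bind fun V f hf => ((h i).restrict f).mono fun W g hg j hj => ?_
    rcases Finset.mem_insert.1 hj with rfl | hj
    · exact hg
    · exact hmono j f (hf j hj) g

theorem locally_inBox [Finite ι] (x : ι → DReal J U) {δ : ℚ} (hδ : 0 < δ) :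
    Locally J (fun ⦃V : C⦄ (f : V ⟶ U) =>
      ∃ a b : ι → ℚ, InBox x a b f ∧ ∀ i, b i - a i < δ) := by
  refine (locally_forall_finite (P := fun i V f => ∃ a b : ℚ, (x i).lower a f ∧ (x i).upper b f ∧
    b - a < δ) ?_ (fun i => (x i).locally_near hδ)).mono fun V f hf => ?_
  · rintro i V f ⟨a, b, ha, hb, hab⟩ W g
    exact ⟨a, b, ((x i).lower a).downward_closed ha g, ((x i).upper b).downward_closed hb g, hab⟩
  · choose a b ha hb hab using hf
    exact ⟨a, b, fun i => ⟨ha i, hb i⟩, hab⟩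

theorem box_subset_Icc (a b : ι → ℚ) :
    box a b ⊆ Set.Icc (fun i => (a i : ℝ)) (fun i => (b i : ℝ)) :=
  fun _ hs => ⟨fun i => (hs i).1.le, fun i => (hs i).2.le⟩

/-- A continuous function on a box is almost constant on sufficiently small sub-boxes. -/
theorem exists_small [Finite ι] (F : C(ι → ℝ, ℝ)) (A B : ι → ℚ) {η : ℝ} (hη : 0 < η) :
    ∃ δ : ℚ, 0 < δ ∧ ∀ a b : ι → ℚ, (∀ i, b i - a i < δ) → ∀ s ∈ box A B, s ∈ box a b →
      ∀ t ∈ box A B, t ∈ box a b → |F s - F t| < η := by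
  cases nonempty_fintype ι
  have hc : IsCompact (Set.Icc (fun i => (A i : ℝ)) (fun i => (B i : ℝ))) := isCompact_Icc
  have hu := hc.uniformContinuousOn_of_continuous F.continuous.continuousOn
  rw [Metric.uniformContinuousOn_iff] at hu
  obtain ⟨ε, hε, H⟩ := hu η hη
  obtain ⟨δ, hδ0, hδ⟩ := exists_rat_btwn hε
  refine ⟨δ, by exact_mod_cast hδ0, fun a b hab s hs hs' t ht ht' => ?_⟩
  have := H s (box_subset_Icc A B hs) t (box_subset_Icc A B ht) ?_
  · simpa [Real.dist_eq] using this
  · rw [dist_pi_lt_iff hε]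
    intro i
    have h1 := hs' i
    have h2 := ht' i
    have h3 : (b i : ℝ) - a i < δ := by exact_mod_cast hab i
    rw [Real.dist_eq, abs_lt]
    constructor <;> linarith

/-- The value `F x` of a continuous function of several real variables. -/
def map [Finite ι] (F : C(ι → ℝ, ℝ)) (x : ι → DReal J U) : DReal J U where
  lower q :=
    { arrows := fun V f => Locally J (fun ⦃W : C⦄ (g : W ⟶ V) => ∃ a b : ι → ℚ,
        InBox x a b (g ≫ f) ∧ ∃ q' : ℚ, q < q' ∧ ∀ s ∈ box a b, (q' : ℝ) ≤ F s)
      downward_closed := fun {V W f} h g => by simpa using h.restrict g }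
  upper q :=
    { arrows := fun V f => Locally J (fun ⦃W : C⦄ (g : W ⟶ V) => ∃ a b : ι → ℚ,
        InBox x a b (g ≫ f) ∧ ∃ q' : ℚ, q' < q ∧ ∀ s ∈ box a b, F s ≤ (q' : ℝ))
      downward_closed := fun {V W f} h g => by simpa using h.restrict g }
  lower_iff q V f := by
    constructor
    · refine fun h => h.mono fun W g ⟨a, b, hab, q', hq, H⟩ =>
        ⟨(q + q') / 2, by linarith, Locally.of_forall fun Z k =>
          ⟨a, b, hab.restrict k, q', by linarith, H⟩⟩
    · intro h
      refine h.bind fun W g ⟨r, hr, hg⟩ => ?_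
      exact Locally.mono hg fun Z k ⟨a, b, hab, q', hq, H⟩ =>
        ⟨a, b, by simpa using hab, q', hr.trans hq, H⟩
  upper_iff q V f := by
    constructor
    · refine fun h => h.mono fun W g ⟨a, b, hab, q', hq, H⟩ =>
        ⟨(q + q') / 2, by linarith, Locally.of_forall fun Z k =>
          ⟨a, b, hab.restrict k, q', by linarith, H⟩⟩
    · intro h
      refine h.bind fun W g ⟨r, hr, hg⟩ => ?_
      exact Locally.mono hg fun Z k ⟨a, b, hab, q', hq, H⟩ =>
        ⟨a, b, by simpa using hab, q', hq.trans hr, H⟩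
  lower_inhabited := by
    cases nonempty_fintype ι
    refine (locally_inBox x one_pos).mono fun V f ⟨a, b, hab, _⟩ => ?_
    have hc : IsCompact (Set.Icc (fun i => (a i : ℝ)) (fun i => (b i : ℝ))) := isCompact_Icc
    obtain ⟨m, hm⟩ := hc.bddBelow_image F.continuous.continuousOn
    obtain ⟨q', hq'⟩ := exists_rat_lt m
    refine ⟨q' - 1, Locally.of_forall fun W g => ⟨a, b, hab.restrict g, q', by linarith,
      fun s hs => ?_⟩⟩
    exact hq'.le.trans (hm ⟨s, box_subset_Icc a b hs, rfl⟩)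
  upper_inhabited := by
    cases nonempty_fintype ι
    refine (locally_inBox x one_pos).mono fun V f ⟨a, b, hab, _⟩ => ?_
    have hc : IsCompact (Set.Icc (fun i => (a i : ℝ)) (fun i => (b i : ℝ))) := isCompact_Icc
    obtain ⟨m, hm⟩ := hc.bddAbove_image F.continuous.continuousOn
    obtain ⟨q', hq'⟩ := exists_rat_gt m
    refine ⟨q' + 1, Locally.of_forall fun W g => ⟨a, b, hab.restrict g, q', by linarith,
      fun s hs => ?_⟩⟩
    exact (hm ⟨s, box_subset_Icc a b hs, rfl⟩).trans hq'.le
  disjoint q V f hl hu := by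
    refine Locally.inconsistent (Locally.bind hl fun W g ⟨a, b, hab, q', hq', H⟩ => ?_)
    refine Locally.mono (hu.restrict g) fun Z k ⟨a', b', hab', q'', hq'', H'⟩ => ?_
    have hin := (hab.restrict k).inter (a' := a') (b' := b') (by simpa using hab')
    rcases hin.nonempty_or with ⟨s, hs⟩ | hs
    · rw [mem_box_inter] at hs
      have h1 := H s hs.1
      have h2 := H' s hs.2
      have h3 : (q'' : ℝ) < q' := by exact_mod_cast hq''.trans hq'
      linarith
    · exact hs
  located q r hqr := by
    refine (locally_inBox x one_pos).bind fun V f ⟨A, B, hAB, _⟩ => ?_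
    have hqr' : (q : ℝ) < r := by exact_mod_cast hqr
    obtain ⟨δ, hδ, H⟩ := exists_small F A B (η := ((r : ℝ) - q) / 3) (by linarith)
    refine ((locally_inBox x hδ).restrict f).mono fun W g ⟨a, b, hab, hsmall⟩ => ?_
    have hin := (hAB.restrict g).inter hab
    rcases hin.nonempty_or with ⟨t, ht⟩ | hbad
    · rw [mem_box_inter] at ht
      rcases le_total ((q + r : ℝ) / 2) (F t) with hv | hv
      · left
        obtain ⟨q', h1, h2⟩ := exists_rat_btwn (show (q : ℝ) < F t - ((r : ℝ) - q) / 3 by linarith)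
        refine Locally.of_forall fun Z k => ⟨_, _, hin.restrict k, q', by exact_mod_cast h1,
          fun s hs => ?_⟩
        rw [mem_box_inter] at hs
        have := abs_lt.1 (H a b hsmall s hs.1 hs.2 t ht.1 ht.2)
        linarith
      · right
        obtain ⟨q', h1, h2⟩ := exists_rat_btwn (show F t + ((r : ℝ) - q) / 3 < (r : ℝ) by linarith)
        refine Locally.of_forall fun Z k => ⟨_, _, hin.restrict k, q', by exact_mod_cast h2,
          fun s hs => ?_⟩
        rw [mem_box_inter] at hs
        have := abs_lt.1 (H a b hsmall s hs.1 hs.2 t ht.1 ht.2)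
        linarith
    · exact Or.inl (hbad.locally _)

theorem map_mono [Finite ι] {F G : C(ι → ℝ, ℝ)} (h : ∀ s, F s ≤ G s) (x : ι → DReal J U) :
    map F x ≤ map G x := fun _ _ _ hf =>
  Locally.mono hf fun _ _ ⟨a, b, hab, q', hq, H⟩ => ⟨a, b, hab, q', hq, fun s hs =>
    (H s hs).trans (h s)⟩

theorem map_restrict [Finite ι] (F : C(ι → ℝ, ℝ)) (x : ι → DReal J U) {V : C} (f : V ⟶ U) :
    (map F x).restrict f = map F (fun i => (x i).restrict f) := by
  have key : ∀ (a b : ι → ℚ) ⦃W : C⦄ (g : W ⟶ V),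
      InBox (fun i => (x i).restrict f) a b g ↔ InBox x a b (g ≫ f) := fun a b W g => Iff.rfl
  apply le_antisymm <;> intro q W g hg
  · refine Locally.mono hg fun Z k ⟨a, b, hab, H⟩ => ⟨a, b, ?_, H⟩
    rw [key]; simpa using hab
  · refine Locally.mono hg fun Z k ⟨a, b, hab, H⟩ => ⟨a, b, ?_, H⟩
    rw [key] at hab; simpa using hab

/-- The projections act as they should. -/
theorem map_proj [Finite ι] (i : ι) (x : ι → DReal J U) :
    map ⟨fun s => s i, continuous_apply i⟩ x = x i := by
  classical
  apply le_antisymm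
  · intro q V f hf
    apply lower_of_locally
    refine Locally.bind hf fun W g ⟨a, b, hab, q', hq, H⟩ => ?_
    rcases hab.nonempty_or with ⟨s, hs⟩ | hbad
    · have : q' ≤ a i := by
        by_contra hlt
        push Not at hlt
        have h1 : (a i : ℝ) < q' := by exact_mod_cast hlt
        set t := min (((a i : ℝ) + q') / 2) (s i) with ht
        have hat : (a i : ℝ) < t := lt_min (by linarith) (hs i).1
        have := H (Function.update s i t) (fun j => by
          by_cases hj : j = i
          · subst hj
            simp only [Function.update_self]
            exact ⟨hat, (min_le_right _ _).trans_lt (hs j).2⟩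
          · simpa [Function.update_of_ne hj] using hs j)
        simp only [ContinuousMap.coe_mk, Function.update_self] at this
        have h2 : t ≤ ((a i : ℝ) + q') / 2 := min_le_left _ _
        linarith
      refine Locally.of_forall fun Z k => ?_
      have hk := ((x i).lower (a i)).downward_closed (hab i).1 k
      exact (x i).lower_mono (hq.le.trans this) (by simpa using hk)
    · exact hbad.locally _
  · intro q V f hf
    refine Locally.bind (((x i).lower_iff q f).1 hf) fun W g ⟨r, hr, hg⟩ => ?_
    refine ((locally_inBox x one_pos).restrict (g ≫ f)).mono fun Z k ⟨a, b, hab, _⟩ => ?_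
    refine ⟨Function.update a i r, b, ?_, r, hr, fun s hs => ?_⟩
    · intro j
      have h := hab j
      by_cases hj : j = i
      · subst hj
        have := ((x j).lower r).downward_closed hg k
        refine ⟨?_, by simpa using h.2⟩
        simpa using this
      · simpa [Function.update_of_ne hj] using h
    · have := (hs i).1
      simpa using this.le

/-- Compatibility of the calculus with composition. -/
theorem map_comp [Finite ι] [Finite κ] (F : C(κ → ℝ, ℝ)) (G : κ → C(ι → ℝ, ℝ))
    (x : ι → DReal J U) :
    map F (fun k => map (G k) x) = map (F.comp (ContinuousMap.pi G)) x := by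
  have key : ∀ (a b : κ → ℚ) ⦃V : C⦄ (f : V ⟶ U), InBox (fun k => map (G k) x) a b f →
      Locally J (fun ⦃W : C⦄ (g : W ⟶ V) => ∃ a' b' : ι → ℚ, InBox x a' b' (g ≫ f) ∧
        ∀ s ∈ box a' b', (fun k => G k s) ∈ box a b) := by
    intro a b V f h
    have step : ∀ k, Locally J (fun ⦃W : C⦄ (g : W ⟶ V) => ∃ a' b' : ι → ℚ,
        InBox x a' b' (g ≫ f) ∧ ∀ s ∈ box a' b', (a k : ℝ) < G k s ∧ G k s < b k) := by
      intro k
      refine Locally.bind (h k).1 fun W g ⟨a', b', hab, q', hq, H⟩ => ?_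
      refine Locally.mono (Locally.restrict (h k).2 g)
        fun Z l ⟨a'', b'', hab', q'', hq'', H'⟩ => ?_
      refine ⟨_, _, InBox.inter (a' := a'') (b' := b'')
        (by simpa using hab.restrict l) hab', fun s hs => ?_⟩
      rw [mem_box_inter] at hs
      have h1 := H s hs.1
      have h2 := H' s hs.2
      have h3 : (a k : ℝ) < q' := by exact_mod_cast hq
      have h4 : (q'' : ℝ) < b k := by exact_mod_cast hq''
      exact ⟨by linarith, by linarith⟩
    cases nonempty_fintype κ
    classical
    suffices Hs : ∀ t : Finset κ, Locally J (fun ⦃W : C⦄ (g : W ⟶ V) => ∃ a' b' : ι → ℚ,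
        InBox x a' b' (g ≫ f) ∧ ∀ s ∈ box a' b', ∀ k ∈ t, (a k : ℝ) < G k s ∧ G k s < b k) from
      (Hs Finset.univ).mono fun W g ⟨a', b', h1, h2⟩ =>
        ⟨a', b', h1, fun s hs k => h2 s hs k (Finset.mem_univ k)⟩
    intro t
    induction t using Finset.induction_on with
    | empty =>
      refine ((locally_inBox x one_pos).restrict f).mono fun W g ⟨a', b', h1, _⟩ =>
        ⟨a', b', h1, fun s hs k hk => by simp at hk⟩
    | insert k t _ ih =>
      refine ih.bind fun W g ⟨a', b', h1, h2⟩ => ?_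
      refine ((step k).restrict g).mono fun Z l ⟨a'', b'', h3, h4⟩ => ?_
      refine ⟨_, _, InBox.inter (a' := a'') (b' := b'')
        (by simpa using h1.restrict l) (by simpa using h3), fun s hs j hj => ?_⟩
      rw [mem_box_inter] at hs
      rcases Finset.mem_insert.1 hj with rfl | hj
      · exact h4 s hs.2
      · exact h2 s hs.1 j hj
  have hle : map F (fun k => map (G k) x) ≤ map (F.comp (ContinuousMap.pi G)) x := by
    intro q V f hf
    refine Locally.bind hf fun W g ⟨a, b, hab, q', hq, H⟩ => ?_
    refine (key a b (g ≫ f) hab).mono fun Z l ⟨a', b', h1, h2⟩ => ?_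
    exact ⟨a', b', by simpa using h1, q', hq, fun s hs => H _ (h2 s hs)⟩
  have hle' : ∀ (q : ℚ) ⦃V : C⦄ (f : V ⟶ U), (map F (fun k => map (G k) x)).upper q f →
      (map (F.comp (ContinuousMap.pi G)) x).upper q f := by
    intro q V f hf
    refine Locally.bind hf fun W g ⟨a, b, hab, q', hq, H⟩ => ?_
    refine (key a b (g ≫ f) hab).mono fun Z l ⟨a', b', h1, h2⟩ => ?_
    exact ⟨a', b', by simpa using h1, q', hq, fun s hs => H _ (h2 s hs)⟩
  refine le_antisymm hle fun q V f hf => ?_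
  set y := map F (fun k => map (G k) x) with hy
  set z := map (F.comp (ContinuousMap.pi G)) x with hz
  apply y.lower_of_locally
  refine Locally.bind ((z.lower_iff q f).1 hf) fun W g ⟨r, hr, hg⟩ => ?_
  refine ((y.located q r hr).restrict (g ≫ f)).bind fun Z l hl => ?_
  rcases hl with hl | hl
  · exact Locally.of_forall fun Z' l' => by
      have := (y.lower q).downward_closed hl l'
      simpa using this
  · have h1 := (z.lower r).downward_closed hg l
    exact (z.disjoint r _ h1 (hle' r _ hl)).locally _

end Calculus

section Ring

/-- The constant real number `r`. -/
def const (r : ℝ) : DReal J U := map (ι := Fin 0) (ContinuousMap.const _ r) ![]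

instance : Zero (DReal J U) := ⟨const 0⟩
instance : One (DReal J U) := ⟨const 1⟩
instance : Neg (DReal J U) := ⟨fun x => map ⟨fun s : Fin 1 → ℝ => -s 0, by fun_prop⟩ ![x]⟩
instance : Add (DReal J U) :=
  ⟨fun x y => map ⟨fun s : Fin 2 → ℝ => s 0 + s 1, by fun_prop⟩ ![x, y]⟩
instance : Mul (DReal J U) :=
  ⟨fun x y => map ⟨fun s : Fin 2 → ℝ => s 0 * s 1, by fun_prop⟩ ![x, y]⟩

section

variable {ι : Type} [Finite ι] (v : ι → DReal J U) (F G : C(ι → ℝ, ℝ))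

theorem const_eq_map (r : ℝ) : const r = map (ContinuousMap.const _ r) v := by
  have := map_comp (ContinuousMap.const (Fin 0 → ℝ) r) (fun k : Fin 0 => k.elim0) v
  rw [const, show (![] : Fin 0 → DReal J U) = fun k => map (k.elim0) v from
    funext fun k => k.elim0]
  exact this

theorem map_neg : -map F v = map (-F) v := by
  have := map_comp ⟨fun s : Fin 1 → ℝ => -s 0, by fun_prop⟩ ![F] v
  rw [show (fun k => map ((![F] : Fin 1 → _) k) v) = ![map F v] from by
    funext k; fin_cases k; rfl] at this
  exact this

theorem map_add : map F v + map G v = map (F + G) v := by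
  have := map_comp ⟨fun s : Fin 2 → ℝ => s 0 + s 1, by fun_prop⟩ ![F, G] v
  rw [show (fun k => map ((![F, G] : Fin 2 → _) k) v) = ![map F v, map G v] from by
    funext k; fin_cases k <;> rfl] at this
  exact this

theorem map_mul : map F v * map G v = map (F * G) v := by
  have := map_comp ⟨fun s : Fin 2 → ℝ => s 0 * s 1, by fun_prop⟩ ![F, G] v
  rw [show (fun k => map ((![F, G] : Fin 2 → _) k) v) = ![map F v, map G v] from by
    funext k; fin_cases k <;> rfl] at this
  exact this

end

theorem exists_map (x y z : DReal J U) : ∃ (v : Fin 3 → DReal J U) (F G H : C(Fin 3 → ℝ, ℝ)),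
    x = map F v ∧ y = map G v ∧ z = map H v :=
  ⟨![x, y, z], ⟨fun s => s 0, continuous_apply 0⟩, ⟨fun s => s 1, continuous_apply 1⟩,
    ⟨fun s => s 2, continuous_apply 2⟩, (map_proj (0 : Fin 3) ![x, y, z]).symm,
    (map_proj (1 : Fin 3) ![x, y, z]).symm, (map_proj (2 : Fin 3) ![x, y, z]).symm⟩

instance : CommRing (DReal J U) where
  add_assoc x y z := by
    obtain ⟨v, F, G, H, rfl, rfl, rfl⟩ := exists_map x y z
    simp only [map_add, add_assoc]
  zero_add x := by
    obtain ⟨v, F, -, -, rfl, -, -⟩ := exists_map x x x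
    change const 0 + _ = _
    rw [const_eq_map v, map_add]
    congr 1; ext s; simp
  add_zero x := by
    obtain ⟨v, F, -, -, rfl, -, -⟩ := exists_map x x x
    change _ + const 0 = _
    rw [const_eq_map v, map_add]
    congr 1; ext s; simp
  add_comm x y := by
    obtain ⟨v, F, G, H, rfl, rfl, -⟩ := exists_map x y y
    simp only [map_add, add_comm]
  nsmul := nsmulRec
  zsmul := zsmulRec
  neg_add_cancel x := by
    obtain ⟨v, F, -, -, rfl, -, -⟩ := exists_map x x x
    change _ = const 0
    rw [const_eq_map v, map_neg, map_add]
    congr 1; ext s; simp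
  mul_assoc x y z := by
    obtain ⟨v, F, G, H, rfl, rfl, rfl⟩ := exists_map x y z
    simp only [map_mul, mul_assoc]
  mul_comm x y := by
    obtain ⟨v, F, G, H, rfl, rfl, -⟩ := exists_map x y y
    simp only [map_mul, mul_comm]
  one_mul x := by
    obtain ⟨v, F, -, -, rfl, -, -⟩ := exists_map x x x
    change const 1 * _ = _
    rw [const_eq_map v, map_mul]
    congr 1; ext s; simp
  mul_one x := by
    obtain ⟨v, F, -, -, rfl, -, -⟩ := exists_map x x x
    change _ * const 1 = _
    rw [const_eq_map v, map_mul]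
    congr 1; ext s; simp
  zero_mul x := by
    obtain ⟨v, F, -, -, rfl, -, -⟩ := exists_map x x x
    change const 0 * _ = const 0
    rw [const_eq_map v, map_mul]
    congr 1; ext s; simp
  mul_zero x := by
    obtain ⟨v, F, -, -, rfl, -, -⟩ := exists_map x x x
    change _ * const 0 = const 0
    rw [const_eq_map v, map_mul]
    congr 1; ext s; simp
  left_distrib x y z := by
    obtain ⟨v, F, G, H, rfl, rfl, rfl⟩ := exists_map x y z
    simp only [map_mul, map_add, mul_add]
  right_distrib x y z := by
    obtain ⟨v, F, G, H, rfl, rfl, rfl⟩ := exists_map x y z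
    simp only [map_mul, map_add, add_mul]

theorem const_zero : (const 0 : DReal J U) = 0 := rfl
theorem const_one : (const 1 : DReal J U) = 1 := rfl

theorem const_add (r s : ℝ) : (const (r + s) : DReal J U) = const r + const s :=
  (map_add ![] (ContinuousMap.const _ r) (ContinuousMap.const _ s)).symm

theorem const_mul (r s : ℝ) : (const (r * s) : DReal J U) = const r * const s :=
  (map_mul ![] (ContinuousMap.const _ r) (ContinuousMap.const _ s)).symm

theorem const_mono {r s : ℝ} (h : r ≤ s) : (const r : DReal J U) ≤ const s :=
  map_mono (fun _ => h) _

theorem le_const_of_upper {x : DReal J U} {q : ℚ} {r : ℝ} (h : x.upper q (𝟙 U)) (hr : (q : ℝ) ≤ r) :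
    x ≤ const r := by
  intro p V f hf
  have hq := (x.upper q).downward_closed h f
  rw [Category.comp_id] at hq
  rcases lt_or_ge p q with hpq | hpq
  · have hlt : (p : ℝ) < q := by exact_mod_cast hpq
    exact Locally.of_forall fun W g => ⟨![], ![], fun i => i.elim0, q, hpq, fun s _ => hr⟩
  · exact (x.inconsistent_of_le hpq hf hq).locally _

theorem restrict_const (r : ℝ) {V : C} (f : V ⟶ U) :
    (const r : DReal J U).restrict f = const r := by
  rw [const, map_restrict, const]
  congr 1; funext i; exact i.elim0

theorem restrict_zero {V : C} (f : V ⟶ U) : (0 : DReal J U).restrict f = 0 := restrict_const 0 f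

theorem restrict_neg (x : DReal J U) {V : C} (f : V ⟶ U) :
    (-x).restrict f = -x.restrict f := by
  change (map _ _).restrict f = map _ _
  rw [map_restrict]
  congr 1; funext i; fin_cases i; rfl

theorem restrict_add (x y : DReal J U) {V : C} (f : V ⟶ U) :
    (x + y).restrict f = x.restrict f + y.restrict f := by
  change (map _ _).restrict f = map _ _
  rw [map_restrict]
  congr 1; funext i; fin_cases i <;> rfl

theorem restrict_mul (x y : DReal J U) {V : C} (f : V ⟶ U) :
    (x * y).restrict f = x.restrict f * y.restrict f := by
  change (map _ _).restrict f = map _ _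
  rw [map_restrict]
  congr 1; funext i; fin_cases i <;> rfl

theorem restrict_sub (x y : DReal J U) {V : C} (f : V ⟶ U) :
    (x - y).restrict f = x.restrict f - y.restrict f := by
  rw [sub_eq_add_neg, restrict_add, restrict_neg, ← sub_eq_add_neg]

/-- The order is expressed through the maximum. -/
theorem eq_max_of_le {x y : DReal J U} (h : x ≤ y) :
    y = map ⟨fun s : Fin 2 → ℝ => max (s 0) (s 1), by fun_prop⟩ ![x, y] := by
  apply le_antisymm
  · refine (map_proj (1 : Fin 2) ![x, y]).symm.le.trans (map_mono (fun s => ?_) _)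
    exact le_max_right _ _
  · intro q V f hf
    apply y.lower_of_locally
    refine Locally.bind hf fun W g ⟨a, b, hab, q', hq, H⟩ => ?_
    have hxy : ∀ i, (![x, y] i).lower (a i) (g ≫ f) → y.lower (a i) (g ≫ f) := by
      intro i hi; fin_cases i
      · exact h _ _ hi
      · exact hi
    rcases hab.nonempty_or with ⟨s, hs⟩ | hbad
    · have : ∃ i, q ≤ a i := by
        by_contra hlt
        push Not at hlt
        have h1 : ∀ i, (a i : ℝ) < q' := fun i => by exact_mod_cast (hlt i).trans hq
        have := H (fun i => min (((a i : ℝ) + q') / 2) (s i)) (fun i =>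
          ⟨lt_min (by linarith [h1 i]) (hs i).1, (min_le_right _ _).trans_lt (hs i).2⟩)
        simp only [ContinuousMap.coe_mk, le_max_iff] at this
        rcases this with h2 | h2
        · have := h2.trans (min_le_left _ _); linarith [h1 0]
        · have := h2.trans (min_le_left _ _); linarith [h1 1]
      obtain ⟨i, hi⟩ := this
      refine Locally.of_forall fun Z k => ?_
      have := (y.lower (a i)).downward_closed (hxy i (hab i).1) k
      exact y.lower_mono hi (by simpa using this)
    · exact hbad.locally _

instance : IsOrderedAddMonoid (DReal J U) where
  add_le_add_left x y h z := by
    obtain ⟨v, F, G, H, rfl, hy, rfl⟩ := exists_map x y z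
    have h' := eq_max_of_le h
    rw [hy] at h'
    have := map_comp ⟨fun s : Fin 2 → ℝ => max (s 0) (s 1), by fun_prop⟩ ![F, G] v
    rw [show (fun k => map ((![F, G] : Fin 2 → _) k) v) = ![map F v, map G v] from by
      funext k; fin_cases k <;> rfl] at this
    rw [hy, h', this, map_add, map_add]
    exact map_mono (fun s => by
      show F s + H s ≤ max (F s) (G s) + H s
      gcongr; exact le_max_left _ _) v

theorem mul_nonneg' {x y : DReal J U} (hx : 0 ≤ x) (hy : 0 ≤ y) : 0 ≤ x * y := by
  have key : ∀ {z : DReal J U}, 0 ≤ z → ∀ {ι : Type} [Finite ι] (v : ι → DReal J U)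
      (F : C(ι → ℝ, ℝ)), z = map F v → z = map ⟨fun s => max 0 (F s), by fun_prop⟩ v := by
    intro z hz ι _ v F hF
    have h' := eq_max_of_le hz
    have := map_comp ⟨fun s : Fin 2 → ℝ => max (s 0) (s 1), by fun_prop⟩
      ![ContinuousMap.const _ 0, F] v
    rw [show (fun k => map ((![ContinuousMap.const _ 0, F] : Fin 2 → _) k) v) = ![0, z] from by
      funext k; fin_cases k
      · exact (const_eq_map v 0).symm
      · exact hF.symm] at this
    rw [this] at h'
    exact h'
  obtain ⟨v, F, G, -, hF, hG, -⟩ := exists_map x y y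
  rw [key hx v F hF, key hy v G hG, map_mul]
  refine (const_eq_map v 0).le.trans (map_mono (fun s => ?_) v)
  exact mul_nonneg (le_max_left _ _) (le_max_left _ _)

instance : ZeroLEOneClass (DReal J U) := ⟨const_mono zero_le_one⟩

instance : IsOrderedRing (DReal J U) := IsOrderedRing.of_mul_nonneg fun _ _ => mul_nonneg'

theorem mul_self_nonneg' (x : DReal J U) : 0 ≤ x * x := by
  obtain ⟨v, F, -, -, rfl, -, -⟩ := exists_map x x x
  rw [map_mul]
  exact (const_eq_map v 0).le.trans (map_mono (fun s => mul_self_nonneg (F s)) v)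

end Ring

end DReal

/-! ## Complex numbers -/

/-- A complex number at stage `U`: a pair of Dedekind reals. -/
@[ext]
structure Cx {C : Type u} [Category.{v} C] (J : GrothendieckTopology C) (U : C) where
  re : DReal J U
  im : DReal J U

namespace Cx

variable {C : Type u} [Category.{v} C] {J : GrothendieckTopology C} {U : C}

instance : Zero (Cx J U) := ⟨⟨0, 0⟩⟩
instance : One (Cx J U) := ⟨⟨1, 0⟩⟩
instance : Neg (Cx J U) := ⟨fun z => ⟨-z.re, -z.im⟩⟩
instance : Add (Cx J U) := ⟨fun z w => ⟨z.re + w.re, z.im + w.im⟩⟩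
instance : Mul (Cx J U) := ⟨fun z w => ⟨z.re * w.re - z.im * w.im, z.re * w.im + z.im * w.re⟩⟩
/-- Complex conjugation. -/
instance : Star (Cx J U) := ⟨fun z => ⟨z.re, -z.im⟩⟩

@[simp] theorem zero_re : (0 : Cx J U).re = 0 := rfl
@[simp] theorem zero_im : (0 : Cx J U).im = 0 := rfl
@[simp] theorem one_re : (1 : Cx J U).re = 1 := rfl
@[simp] theorem one_im : (1 : Cx J U).im = 0 := rfl
@[simp] theorem neg_re (z : Cx J U) : (-z).re = -z.re := rfl
@[simp] theorem neg_im (z : Cx J U) : (-z).im = -z.im := rfl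
@[simp] theorem add_re (z w : Cx J U) : (z + w).re = z.re + w.re := rfl
@[simp] theorem add_im (z w : Cx J U) : (z + w).im = z.im + w.im := rfl
@[simp] theorem mul_re (z w : Cx J U) : (z * w).re = z.re * w.re - z.im * w.im := rfl
@[simp] theorem mul_im (z w : Cx J U) : (z * w).im = z.re * w.im + z.im * w.re := rfl
@[simp] theorem star_re (z : Cx J U) : (star z).re = z.re := rfl
@[simp] theorem star_im (z : Cx J U) : (star z).im = -z.im := rfl

instance : CommRing (Cx J U) where
  add_assoc x y z := by ext1 <;> simp [add_assoc]
  zero_add x := by ext1 <;> simp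
  add_zero x := by ext1 <;> simp
  add_comm x y := by ext1 <;> simp [add_comm]
  nsmul := nsmulRec
  zsmul := zsmulRec
  neg_add_cancel x := by ext1 <;> simp
  mul_assoc x y z := by ext1 <;> simp <;> ring
  mul_comm x y := by ext1 <;> simp <;> ring
  one_mul x := by ext1 <;> simp
  mul_one x := by ext1 <;> simp
  zero_mul x := by ext1 <;> simp
  mul_zero x := by ext1 <;> simp
  left_distrib x y z := by ext1 <;> simp <;> ring
  right_distrib x y z := by ext1 <;> simp <;> ring

instance : StarRing (Cx J U) where
  star_involutive x := by ext1 <;> simp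
  star_mul x y := by ext1 <;> simp <;> ring
  star_add x y := by ext1 <;> simp [add_comm]

/-- A real number, seen as a complex number. -/
def ofReal (x : DReal J U) : Cx J U := ⟨x, 0⟩

/-- The square of the modulus. -/
def absSq (z : Cx J U) : DReal J U := z.re * z.re + z.im * z.im

/-- Restriction to a later stage. -/
def restrict (z : Cx J U) {V : C} (f : V ⟶ U) : Cx J V := ⟨z.re.restrict f, z.im.restrict f⟩

section

variable {V : C} (f : V ⟶ U) (z w : Cx J U)

theorem restrict_comp {W : C} (g : W ⟶ V) : z.restrict (g ≫ f) = (z.restrict f).restrict g := by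
  ext1 <;> exact DReal.restrict_comp _ f g

theorem restrict_zero : (0 : Cx J U).restrict f = 0 := by
  ext1 <;> exact DReal.restrict_zero f

theorem restrict_add : (z + w).restrict f = z.restrict f + w.restrict f := by
  ext1 <;> exact DReal.restrict_add _ _ f

theorem restrict_mul : (z * w).restrict f = z.restrict f * w.restrict f := by
  ext1 <;> simp [restrict, DReal.restrict_add, DReal.restrict_mul, DReal.restrict_sub]

theorem restrict_star : (star z).restrict f = star (z.restrict f) := by
  ext1
  · rfl
  · exact DReal.restrict_neg _ f

theorem absSq_restrict : (z.restrict f).absSq = z.absSq.restrict f := by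
  rw [absSq, absSq, DReal.restrict_add, DReal.restrict_mul, DReal.restrict_mul]; rfl

theorem absSq_nonneg : 0 ≤ z.absSq := add_nonneg (DReal.mul_self_nonneg' _) (DReal.mul_self_nonneg' _)

theorem absSq_mul : (z * w).absSq = z.absSq * w.absSq := by
  simp only [absSq, mul_re, mul_im]; ring

theorem absSq_star : (star z).absSq = z.absSq := by
  simp only [absSq, star_re, star_im]; ring

theorem absSq_add_le : (z + w).absSq ≤ 2 * (z.absSq + w.absSq) := by
  have h1 := DReal.mul_self_nonneg' (z.re - w.re)
  have h2 := DReal.mul_self_nonneg' (z.im - w.im)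
  have h3 := add_nonneg h1 h2
  rw [← sub_nonneg]
  refine h3.trans_eq ?_
  simp only [absSq, add_re, add_im]; ring

end

end Cx

/-! ## Hilbert spaces of a topos -/

/-- `T` is a Grothendieck topos: it is equivalent to the category of sheaves on a small site. -/
def IsGrothendieckTopos (T : Type u) [Category.{v} T] : Prop :=
  ∃ (C : Type v) (_ : SmallCategory C) (J : GrothendieckTopology C),
    Nonempty (T ≌ Sheaf J (Type v))

/-- The internal logic of a topos is interpreted with its canonical topology, whose covering sieves
are the jointly epimorphic ones. -/
abbrev can (T : Type u) [Category.{v} T] : GrothendieckTopology T := Sheaf.canonicalTopology T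

/-- `X` is decidable: internally, any two elements of `X` are equal or different. -/
def IsDecidable {T : Type u} [Category.{v} T] (X : T) : Prop :=
  ∀ ⦃U : T⦄ (x y : U ⟶ X), Locally (can T) (fun ⦃V : T⦄ (f : V ⟶ U) =>
    f ≫ x = f ≫ y ∨ InternallyNe (can T) (f ≫ x) (f ≫ y))

/-- An object of `T` with the structure of an internal complex vector space and a positive definite
scalar product, linear in the second variable.  The operations are given on generalized elements,
naturally in the stage. -/
structure PreHilbertSpace (T : Type u) [Category.{v} T] where
  obj : T
  addCommGroup : ∀ U : T, AddCommGroup (U ⟶ obj)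
  module : ∀ U : T, Module (Cx (can T) U) (U ⟶ obj)
  inner : ∀ {U : T}, (U ⟶ obj) → (U ⟶ obj) → Cx (can T) U
  comp_add : ∀ {U V : T} (f : V ⟶ U) (x y : U ⟶ obj), f ≫ (x + y) = f ≫ x + f ≫ y
  comp_smul : ∀ {U V : T} (f : V ⟶ U) (c : Cx (can T) U) (x : U ⟶ obj),
    f ≫ (c • x) = c.restrict f • (f ≫ x)
  inner_restrict : ∀ {U V : T} (f : V ⟶ U) (x y : U ⟶ obj),
    (inner x y).restrict f = inner (f ≫ x) (f ≫ y)
  inner_add_right : ∀ {U : T} (x y z : U ⟶ obj), inner x (y + z) = inner x y + inner x z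
  inner_smul_right : ∀ {U : T} (c : Cx (can T) U) (x y : U ⟶ obj),
    inner x (c • y) = c * inner x y
  star_inner : ∀ {U : T} (x y : U ⟶ obj), star (inner x y) = inner y x
  inner_self_nonneg : ∀ {U : T} (x : U ⟶ obj), 0 ≤ (inner x x).re
  eq_zero_of_inner_self : ∀ {U : T} (x : U ⟶ obj), inner x x = 0 → x = 0

attribute [instance] PreHilbertSpace.addCommGroup PreHilbertSpace.module

namespace PreHilbertSpace

variable {T : Type u} [Category.{v} T] (H : PreHilbertSpace T)

/-- The square of the norm of a vector. -/
def normSq {U : T} (x : U ⟶ H.obj) : DReal (can T) U := (H.inner x x).re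

/-- `‖x‖ ≤ r`, for a number `r ≥ 0`. -/
def NormLE {U : T} (x : U ⟶ H.obj) (r : ℝ) : Prop := H.normSq x ≤ DReal.const (r ^ 2)

/-- A Cauchy approximation at stage `U`: a family of inhabited subsets `A ε` of the space, for
`ε > 0` rational, such that `‖a - b‖ ≤ ε + δ` for `a` in `A ε` and `b` in `A δ`. -/
structure IsCauchyApproximation {U : T}
    (A : ℚ → ∀ ⦃V : T⦄, (V ⟶ U) → (V ⟶ H.obj) → Prop) : Prop where
  restrict : ∀ ε > 0, ∀ ⦃V : T⦄ (f : V ⟶ U) (a : V ⟶ H.obj), A ε f a →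
    ∀ ⦃W : T⦄ (g : W ⟶ V), A ε (g ≫ f) (g ≫ a)
  glue : ∀ ε > 0, ∀ ⦃V : T⦄ (f : V ⟶ U) (a : V ⟶ H.obj),
    Locally (can T) (fun ⦃W : T⦄ (g : W ⟶ V) => A ε (g ≫ f) (g ≫ a)) → A ε f a
  inhabited : ∀ ε > 0, Locally (can T) (fun ⦃V : T⦄ (f : V ⟶ U) => ∃ a, A ε f a)
  cauchy : ∀ ε > 0, ∀ δ > 0, ∀ ⦃V : T⦄ (f : V ⟶ U) (a b : V ⟶ H.obj), A ε f a → A δ f b →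
    H.NormLE (a - b) (ε + δ : ℚ)

/-- The internal linear span of a family of subsets `S V` of the sets of elements of `H` at the
stages `V` is dense: every vector is locally at distance at most `ε` from a linear combination. -/
def DenseSpan (S : ∀ V : T, Set (V ⟶ H.obj)) : Prop :=
  ∀ ⦃U : T⦄ (x : U ⟶ H.obj) (ε : ℚ), 0 < ε → Locally (can T) (fun ⦃V : T⦄ (f : V ⟶ U) =>
    ∃ y ∈ Submodule.span (Cx (can T) V) (S V), H.NormLE (f ≫ x - y) ε)

variable {U : T} (x y z : U ⟶ H.obj)

theorem inner_neg_right : H.inner x (-y) = -H.inner x y := by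
  rw [← neg_one_smul (Cx (can T) U) y, H.inner_smul_right, neg_one_mul]

theorem inner_sub_right : H.inner x (y - z) = H.inner x y - H.inner x z := by
  rw [sub_eq_add_neg, H.inner_add_right, H.inner_neg_right, ← sub_eq_add_neg]

theorem inner_sub_left : H.inner (x - y) z = H.inner x z - H.inner y z := by
  rw [← H.star_inner, H.inner_sub_right, star_sub, H.star_inner, H.star_inner]

theorem inner_smul_left (c : Cx (can T) U) : H.inner (c • x) y = star c * H.inner x y := by
  rw [← H.star_inner, H.inner_smul_right, star_mul, H.star_inner, mul_comm]

theorem inner_add_left : H.inner (x + y) z = H.inner x z + H.inner y z := by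
  rw [← H.star_inner, H.inner_add_right, star_add, H.star_inner, H.star_inner]

theorem ext_inner (h : ∀ w : U ⟶ H.obj, H.inner w x = H.inner w y) : x = y := by
  rw [← sub_eq_zero]
  apply H.eq_zero_of_inner_self
  rw [H.inner_sub_right, h, sub_self]

theorem normSq_nonneg : 0 ≤ H.normSq x := H.inner_self_nonneg x

theorem normSq_sub_smul (r : DReal (can T) U) :
    H.normSq (x - Cx.ofReal r • y) =
      H.normSq x - 2 * (r * (H.inner x y).re) + r * r * H.normSq y := by
  have h : (H.inner y x).re = (H.inner x y).re := by rw [← H.star_inner]; rfl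
  rw [normSq, inner_sub_right, inner_sub_left, inner_sub_left, inner_smul_left,
    H.inner_smul_right, inner_smul_left, H.inner_smul_right]
  simp only [sub_eq_add_neg, Cx.add_re, Cx.neg_re, Cx.mul_re, Cx.mul_im, Cx.ofReal,
    Cx.star_re, Cx.star_im, h, normSq]
  ring

end PreHilbertSpace

/-- A Hilbert space of `T`: internally, every Cauchy approximation has a limit. -/
structure HilbertSpace (T : Type u) [Category.{v} T] extends PreHilbertSpace T where
  complete : ∀ {U : T} (A : ℚ → ∀ ⦃V : T⦄, (V ⟶ U) → (V ⟶ obj) → Prop),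
    toPreHilbertSpace.IsCauchyApproximation A →
    ∃ x : U ⟶ obj, ∀ ε > 0, ∀ ⦃V : T⦄ (f : V ⟶ U) (a : V ⟶ obj), A ε f a →
      toPreHilbertSpace.NormLE (f ≫ x - a) ε

/-- A globally bounded operator between Hilbert spaces: an internally linear map which admits an
adjoint and satisfies `‖f x‖ ≤ K ‖x‖` for some external number `K ≥ 0`. -/
@[ext]
structure BoundedOp {T : Type u} [Category.{v} T] (H K : HilbertSpace T) where
  map : H.obj ⟶ K.obj
  map_add : ∀ {U : T} (x y : U ⟶ H.obj), (x + y) ≫ map = x ≫ map + y ≫ map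
  map_smul : ∀ {U : T} (c : Cx (can T) U) (x : U ⟶ H.obj), (c • x) ≫ map = c • (x ≫ map)
  bounded : ∃ k : ℝ, 0 ≤ k ∧ ∀ {U : T} (x : U ⟶ H.obj),
    K.normSq (x ≫ map) ≤ DReal.const (k ^ 2) * H.normSq x
  exists_adjoint : ∃ g : K.obj ⟶ H.obj, ∀ {U : T} (x : U ⟶ H.obj) (y : U ⟶ K.obj),
    K.inner (x ≫ map) y = H.inner x (y ≫ g)

/-- The category of Hilbert spaces of `T` and globally bounded operators. -/
instance {T : Type u} [Category.{v} T] : Category (HilbertSpace T) where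
  Hom H K := BoundedOp H K
  id H :=
    { map := 𝟙 _
      map_add := fun x y => by simp
      map_smul := fun c x => by simp
      bounded := ⟨1, zero_le_one, fun x => by simp [DReal.const_one]⟩
      exists_adjoint := ⟨𝟙 _, fun x y => by simp⟩ }
  comp {H K L} f g :=
    { map := f.map ≫ g.map
      map_add := fun x y => by
        simp only [← Category.assoc, f.map_add, g.map_add]
      map_smul := fun c x => by
        simp only [← Category.assoc, f.map_smul, g.map_smul]
      bounded := by
        obtain ⟨k, hk, hf⟩ := f.bounded
        obtain ⟨l, hl, hg⟩ := g.bounded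
        refine ⟨l * k, mul_nonneg hl hk, fun {U} x => ?_⟩
        rw [← Category.assoc, mul_pow, DReal.const_mul, mul_assoc]
        refine (hg _).trans (mul_le_mul_of_nonneg_left (hf x) ?_)
        exact DReal.const_mono (sq_nonneg l)
      exists_adjoint := by
        obtain ⟨f', hf⟩ := f.exists_adjoint
        obtain ⟨g', hg⟩ := g.exists_adjoint
        refine ⟨g' ≫ f', fun {U} x y => ?_⟩
        rw [← Category.assoc, hg, hf, Category.assoc] }
  id_comp f := by apply BoundedOp.ext; exact Category.id_comp _
  comp_id f := by apply BoundedOp.ext; exact Category.comp_id _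
  assoc f g h := by apply BoundedOp.ext; exact Category.assoc _ _ _

/-- The value of an operator at a vector. -/
def BoundedOp.app {T : Type u} [Category.{v} T] {H K : HilbertSpace T} (f : H ⟶ K) {U : T}
    (x : U ⟶ H.obj) : U ⟶ K.obj := x ≫ BoundedOp.map f

/-- The adjoint of a globally bounded operator. -/
def adjoint {T : Type u} [Category.{v} T] {H K : HilbertSpace T} (f : H ⟶ K) : K ⟶ H :=
  BoundedOp.mk (BoundedOp.exists_adjoint f).choose
    (fun {U} x y => H.ext_inner _ _ fun w => by
      have hg := @(BoundedOp.exists_adjoint f).choose_spec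
      rw [H.inner_add_right, ← hg, ← hg, ← hg, K.inner_add_right])
    (fun {U} c x => H.ext_inner _ _ fun w => by
      have hg := @(BoundedOp.exists_adjoint f).choose_spec
      rw [H.inner_smul_right, ← hg, ← hg, K.inner_smul_right])
    (by
      have hg := @(BoundedOp.exists_adjoint f).choose_spec
      obtain ⟨k, hk, hf⟩ := BoundedOp.bounded f
      have hpos : 0 < k ^ 2 + 1 := by positivity
      refine ⟨Real.sqrt (k ^ 2 + 1), Real.sqrt_nonneg _, fun {U} y => ?_⟩
      rw [Real.sq_sqrt hpos.le]
      set g := (BoundedOp.exists_adjoint f).choose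
      set c : DReal (can T) U := DReal.const (k ^ 2 + 1) with hc
      set w := (y ≫ g) ≫ BoundedOp.map f with hw
      have h1 : K.normSq w ≤ c * H.normSq (y ≫ g) := by
        refine (hf (y ≫ g)).trans (mul_le_mul_of_nonneg_right ?_ (H.normSq_nonneg _))
        exact DReal.const_mono (by linarith)
      have h2 : (K.inner w y).re = H.normSq (y ≫ g) := by
        rw [hw, hg]; rfl
      have h3 := K.normSq_nonneg (w - Cx.ofReal c • y)
      rw [K.normSq_sub_smul, h2] at h3
      have h4 : c * H.normSq (y ≫ g) ≤ c * (c * K.normSq y) := by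
        rw [← sub_nonneg]
        rw [← sub_nonneg] at h1
        refine (add_nonneg h1 h3).trans_eq ?_
        ring
      have h5 : DReal.const (k ^ 2 + 1)⁻¹ * c = 1 := by
        rw [hc, ← DReal.const_mul, inv_mul_cancel₀ hpos.ne', DReal.const_one]
      have h6 : (0 : DReal (can T) U) ≤ DReal.const (k ^ 2 + 1)⁻¹ :=
        DReal.const_mono (inv_nonneg.2 hpos.le)
      have h7 := mul_le_mul_of_nonneg_left h4 h6
      rwa [← mul_assoc, h5, one_mul, ← mul_assoc, h5, one_mul] at h7)
    ⟨BoundedOp.map f, fun {U} x y => by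
      have hg := @(BoundedOp.exists_adjoint f).choose_spec
      rw [← H.star_inner, ← hg, K.star_inner]⟩

theorem inner_adjoint {T : Type u} [Category.{v} T] {H K : HilbertSpace T} (f : H ⟶ K) {U : T}
    (x : U ⟶ H.obj) (y : U ⟶ K.obj) :
    K.inner (BoundedOp.app f x) y = H.inner x (BoundedOp.app (adjoint f) y) :=
  (BoundedOp.exists_adjoint f).choose_spec x y

/-! ## Tensor products and the space of square summable sequences

Both are characterized, up to unique isomorphism, by generators and their scalar products. -/

/-- A tensor product of two Hilbert spaces: a Hilbert space with a bilinear map `(h, k) ↦ h ⊗ k`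
satisfying `⟨h ⊗ k, h' ⊗ k'⟩ = ⟨h, h'⟩ ⟨k, k'⟩`, the image of which spans a dense subspace. -/
structure HilbertTensor {T : Type u} [Category.{v} T] (H K : HilbertSpace T) where
  space : HilbertSpace T
  tmul : ∀ {U : T}, (U ⟶ H.obj) → (U ⟶ K.obj) → (U ⟶ space.obj)
  comp_tmul : ∀ {U V : T} (f : V ⟶ U) (h : U ⟶ H.obj) (k : U ⟶ K.obj),
    f ≫ tmul h k = tmul (f ≫ h) (f ≫ k)
  add_tmul : ∀ {U : T} (h h' : U ⟶ H.obj) (k : U ⟶ K.obj),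
    tmul (h + h') k = tmul h k + tmul h' k
  tmul_add : ∀ {U : T} (h : U ⟶ H.obj) (k k' : U ⟶ K.obj),
    tmul h (k + k') = tmul h k + tmul h k'
  smul_tmul : ∀ {U : T} (c : Cx (can T) U) (h : U ⟶ H.obj) (k : U ⟶ K.obj),
    tmul (c • h) k = c • tmul h k
  tmul_smul : ∀ {U : T} (c : Cx (can T) U) (h : U ⟶ H.obj) (k : U ⟶ K.obj),
    tmul h (c • k) = c • tmul h k
  inner_tmul : ∀ {U : T} (h h' : U ⟶ H.obj) (k k' : U ⟶ K.obj),
    space.inner (tmul h k) (tmul h' k') = H.inner h h' * K.inner k k'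
  dense : space.DenseSpan (fun V => {z | ∃ (h : V ⟶ H.obj) (k : V ⟶ K.obj), z = tmul h k})

/-- The Hilbert space `ℓ²(X)`: it is generated by elements `e x`, for `x` in `X`, whose scalar
products are `⟨e x, e y⟩ = 1` if `x = y` and `0` if `x ≠ y`. -/
structure L2 {T : Type u} [Category.{v} T] (X : T) where
  space : HilbertSpace T
  e : X ⟶ space.obj
  inner_eq : ∀ {U : T} (x : U ⟶ X), space.inner (x ≫ e) (x ≫ e) = 1
  inner_ne : ∀ {U : T} (x y : U ⟶ X), InternallyNe (can T) x y →
    space.inner (x ≫ e) (y ≫ e) = 0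
  dense : space.DenseSpan (fun V => {z | ∃ x : V ⟶ X, z = x ≫ e})

/-- The space `ℓ²(X)`, tensor products of all Hilbert spaces with `ℓ²(X)`, and the canonical
operators between them that enter the definition of modules.  All of these are determined by the
equations below up to unique isomorphism. -/
structure L2Tensor {T : Type u} [Category.{v} T] (X : T) where
  l2 : L2 X
  /-- `H ⊗ ℓ²(X)` -/
  tensor : ∀ H : HilbertSpace T, HilbertTensor H l2.space
  /-- `f ⊗ id` -/
  tensorMap : ∀ {H K : HilbertSpace T}, (H ⟶ K) → ((tensor H).space ⟶ (tensor K).space)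
  tensorMap_tmul : ∀ {H K : HilbertSpace T} (f : H ⟶ K) {U : T} (h : U ⟶ H.obj)
    (a : U ⟶ l2.space.obj), BoundedOp.app (tensorMap f) ((tensor H).tmul h a) =
      (tensor K).tmul (BoundedOp.app f h) a
  tensorMap_id : ∀ H : HilbertSpace T, tensorMap (𝟙 H) = 𝟙 (tensor H).space
  tensorMap_comp : ∀ {H K L : HilbertSpace T} (f : H ⟶ K) (g : K ⟶ L),
    tensorMap (f ≫ g) = tensorMap f ≫ tensorMap g
  /-- `Δ : ℓ²(X) ⟶ ℓ²(X) ⊗ ℓ²(X)`, which sends `e x` to `e x ⊗ e x` -/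
  comul : l2.space ⟶ (tensor l2.space).space
  comul_e : ∀ {U : T} (x : U ⟶ X), BoundedOp.app comul (x ≫ l2.e) =
    (tensor l2.space).tmul (x ≫ l2.e) (x ≫ l2.e)
  /-- `id ⊗ Δ* : H ⊗ ℓ²(X) ⊗ ℓ²(X) ⟶ H ⊗ ℓ²(X)` -/
  tensorMul : ∀ H : HilbertSpace T, (tensor (tensor H).space).space ⟶ (tensor H).space
  tensorMul_tmul : ∀ (H : HilbertSpace T) {U : T} (h : U ⟶ H.obj) (a b : U ⟶ l2.space.obj),
    BoundedOp.app (tensorMul H) ((tensor (tensor H).space).tmul ((tensor H).tmul h a) b) =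
      (tensor H).tmul h (BoundedOp.app (adjoint comul) ((tensor l2.space).tmul a b))

/-! ## Modules over `ℓ²(X)` -/

section Modules

variable {T : Type u} [Category.{v} T] {X : T}

/-- An `ℓ²(X)`-module: a Hilbert space with an action `M : H ⊗ ℓ²(X) ⟶ H` of the (non-unital)
monoid `(ℓ²(X), Δ*)` such that `M M* = id` and `M* M = (id ⊗ Δ*) (M* ⊗ id)`. -/
structure L2Module (D : L2Tensor X) where
  space : HilbertSpace T
  action : (D.tensor space).space ⟶ space
  assoc : D.tensorMap action ≫ action = D.tensorMul space ≫ action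
  adjoint_comp : adjoint action ≫ action = 𝟙 space
  comp_adjoint : action ≫ adjoint action = D.tensorMap (adjoint action) ≫ D.tensorMul space

/-- A morphism of `ℓ²(X)`-modules. -/
@[ext]
structure L2Module.Hom {D : L2Tensor X} (A B : L2Module D) where
  op : A.space ⟶ B.space
  comm : A.action ≫ op = D.tensorMap op ≫ B.action

instance (D : L2Tensor X) : Category (L2Module D) where
  Hom := L2Module.Hom
  id A := ⟨𝟙 A.space, by rw [D.tensorMap_id, Category.comp_id, Category.id_comp]⟩
  comp f g := ⟨f.op ≫ g.op, by
    rw [← Category.assoc, f.comm, Category.assoc, g.comm, D.tensorMap_comp, Category.assoc]⟩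
  id_comp f := by apply L2Module.Hom.ext; exact Category.id_comp _
  comp_id f := by apply L2Module.Hom.ext; exact Category.comp_id _
  assoc f g h := by apply L2Module.Hom.ext; exact Category.assoc _ _ _

end Modules

/-! ## The algebra `C₀(X)` and its representations -/

section Representations

variable {T : Type u} [Category.{v} T]

/-- An element at stage `U` of the algebra `C₀(X)` of complex functions on `X` which vanish at
infinity: a function `X ⟶ ℂ` at stage `U` such that, internally, for every `ε > 0` there is a finite
list of elements of `X` such that `|a x| ≤ ε` for all `x` different from the members of the list. -/
@[ext]
structure CZero (X U : T) where
  val : ∀ ⦃V : T⦄, (V ⟶ U) → (V ⟶ X) → Cx (can T) V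
  restrict_val : ∀ ⦃V W : T⦄ (f : V ⟶ U) (g : W ⟶ V) (x : V ⟶ X),
    (val f x).restrict g = val (g ≫ f) (g ≫ x)
  vanish : ∀ ε : ℚ, 0 < ε → Locally (can T) (fun ⦃V : T⦄ (f : V ⟶ U) => ∃ l : List (V ⟶ X),
    ∀ ⦃W : T⦄ (g : W ⟶ V) (x : W ⟶ X), (∀ y ∈ l, InternallyNe (can T) x (g ≫ y)) →
      (val (g ≫ f) x).absSq ≤ DReal.const ((ε : ℝ) ^ 2))

namespace CZero

variable {X U : T}

/-- Restriction to a later stage. -/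
def restrict (a : CZero X U) {V : T} (f : V ⟶ U) : CZero X V where
  val W g x := a.val (g ≫ f) x
  restrict_val W Z g h x := by simpa using a.restrict_val (g ≫ f) h x
  vanish ε hε := by simpa using (a.vanish ε hε).restrict f

instance : Add (CZero X U) where
  add a b :=
    { val := fun V f x => a.val f x + b.val f x
      restrict_val := fun V W f g x => by
        rw [Cx.restrict_add, a.restrict_val, b.restrict_val]
      vanish := fun ε hε => by
        refine (a.vanish (ε / 2) (by linarith)).bind fun V f ⟨l, hl⟩ => ?_
        refine ((b.vanish (ε / 2) (by linarith)).restrict f).mono fun W g ⟨m, hm⟩ => ?_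
        refine ⟨l.map (fun y => g ≫ y) ++ m, fun Z k x hx => ?_⟩
        have h1 := hl (k ≫ g) x (fun y hy => by
          have := hx (g ≫ y) (by simp only [List.mem_append, List.mem_map]; exact .inl ⟨y, hy, rfl⟩)
          simpa using this)
        have h2 := hm k x (fun y hy => hx y (by simp [hy]))
        simp only [Category.assoc] at h1
        refine (Cx.absSq_add_le _ _).trans ?_
        have h3 := mul_le_mul_of_nonneg_left (add_le_add h1 h2)
          (zero_le_two : (0 : DReal (can T) Z) ≤ 2)
        refine h3.trans_eq ?_
        rw [← one_add_one_eq_two, ← DReal.const_one, ← DReal.const_add, ← DReal.const_add,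
          ← DReal.const_mul]
        congr 1
        push_cast
        ring }

instance : Mul (CZero X U) where
  mul a b :=
    { val := fun V f x => a.val f x * b.val f x
      restrict_val := fun V W f g x => by
        rw [Cx.restrict_mul, a.restrict_val, b.restrict_val]
      vanish := fun ε hε => by
        refine (a.vanish ε hε).bind fun V f ⟨l, hl⟩ => ?_
        refine ((b.vanish 1 one_pos).restrict f).mono fun W g ⟨m, hm⟩ => ?_
        refine ⟨l.map (fun y => g ≫ y) ++ m, fun Z k x hx => ?_⟩
        have h1 := hl (k ≫ g) x (fun y hy => by
          have := hx (g ≫ y) (by simp only [List.mem_append, List.mem_map]; exact .inl ⟨y, hy, rfl⟩)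
          simpa using this)
        have h2 := hm k x (fun y hy => hx y (by simp [hy]))
        simp only [Category.assoc] at h1
        have h0 : (0 : DReal (can T) Z) ≤ DReal.const ((ε : ℝ) ^ 2) :=
          DReal.const_mono (sq_nonneg _)
        rw [Cx.absSq_mul]
        refine (mul_le_mul h1 h2 (Cx.absSq_nonneg _) h0).trans_eq ?_
        rw [← DReal.const_mul]
        congr 1
        push_cast
        ring }

/-- Scalar multiplication. -/
instance : SMul (Cx (can T) U) (CZero X U) where
  smul c a :=
    { val := fun V f x => c.restrict f * a.val f x
      restrict_val := fun V W f g x => by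
        rw [Cx.restrict_mul, a.restrict_val, Cx.restrict_comp]
      vanish := fun ε hε => by
        refine (c.absSq.upper_inhabited).bind fun V f ⟨q, hq⟩ => ?_
        obtain ⟨n, hn⟩ := exists_nat_gt q
        refine ((a.vanish (ε / (n + 1)) (by positivity)).restrict f).mono fun W g ⟨l, hl⟩ => ?_
        refine ⟨l, fun Z k x hx => ?_⟩
        have h1 := hl k x hx
        have hc : (c.restrict (k ≫ g ≫ f)).absSq ≤ DReal.const (((n : ℝ) + 1) ^ 2) := by
          rw [Cx.absSq_restrict]
          refine DReal.le_const_of_upper (q := q) ?_ ?_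
          · have := (c.absSq.upper q).downward_closed hq (k ≫ g)
            simpa [DReal.restrict] using this
          · have : (q : ℝ) < n := by exact_mod_cast hn
            nlinarith [(Nat.cast_nonneg n : (0 : ℝ) ≤ n)]
        have h0 : (0 : DReal (can T) Z) ≤ DReal.const (((n : ℝ) + 1) ^ 2) :=
          DReal.const_mono (sq_nonneg _)
        rw [Cx.absSq_mul]
        refine (mul_le_mul hc h1 (Cx.absSq_nonneg _) h0).trans_eq ?_
        rw [← DReal.const_mul]
        congr 1
        have : (n : ℝ) + 1 ≠ 0 := by positivity
        push_cast
        field_simp }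

/-- Pointwise conjugation. -/
instance : Star (CZero X U) where
  star a :=
    { val := fun V f x => star (a.val f x)
      restrict_val := fun V W f g x => by
        rw [Cx.restrict_star, a.restrict_val]
      vanish := fun ε hε => by simpa only [Cx.absSq_star] using a.vanish ε hε }

end CZero

/-- A Hilbert space of `T` with an action of `C₀(X)` which makes it, internally, a non-degenerate
`*`-representation: the vectors `a • h` span a dense subspace. -/
structure CZeroRep (X : T) where
  space : HilbertSpace T
  act : ∀ {U : T}, CZero X U → (U ⟶ space.obj) → (U ⟶ space.obj)
  comp_act : ∀ {U V : T} (f : V ⟶ U) (a : CZero X U) (h : U ⟶ space.obj),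
    f ≫ act a h = act (a.restrict f) (f ≫ h)
  act_add : ∀ {U : T} (a : CZero X U) (h k : U ⟶ space.obj), act a (h + k) = act a h + act a k
  act_smul : ∀ {U : T} (a : CZero X U) (c : Cx (can T) U) (h : U ⟶ space.obj),
    act a (c • h) = c • act a h
  add_act : ∀ {U : T} (a b : CZero X U) (h : U ⟶ space.obj), act (a + b) h = act a h + act b h
  smul_act : ∀ {U : T} (c : Cx (can T) U) (a : CZero X U) (h : U ⟶ space.obj),
    act (c • a) h = c • act a h
  mul_act : ∀ {U : T} (a b : CZero X U) (h : U ⟶ space.obj), act (a * b) h = act a (act b h)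
  inner_act : ∀ {U : T} (a : CZero X U) (h k : U ⟶ space.obj),
    space.inner (act a h) k = space.inner h (act (star a) k)
  nondegenerate : space.DenseSpan (fun V =>
    {z | ∃ (a : CZero X V) (h : V ⟶ space.obj), z = act a h})

/-- A morphism of representations: a globally bounded operator which commutes with the actions. -/
@[ext]
structure CZeroRep.Hom {X : T} (A B : CZeroRep X) where
  op : A.space ⟶ B.space
  comm : ∀ {U : T} (a : CZero X U) (h : U ⟶ A.space.obj),
    BoundedOp.app op (A.act a h) = B.act a (BoundedOp.app op h)

theorem BoundedOp.app_id {H : HilbertSpace T} {U : T} (x : U ⟶ H.obj) :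
    BoundedOp.app (𝟙 H) x = x := Category.comp_id _

theorem BoundedOp.app_comp {H K L : HilbertSpace T} (f : H ⟶ K) (g : K ⟶ L) {U : T}
    (x : U ⟶ H.obj) : BoundedOp.app (f ≫ g) x = BoundedOp.app g (BoundedOp.app f x) :=
  (Category.assoc _ _ _).symm

instance (X : T) : Category (CZeroRep X) where
  Hom := CZeroRep.Hom
  id A := ⟨𝟙 A.space, fun a h => by rw [BoundedOp.app_id, BoundedOp.app_id]⟩
  comp f g := ⟨f.op ≫ g.op, fun a h => by
    rw [BoundedOp.app_comp, f.comm, g.comm, BoundedOp.app_comp]⟩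
  id_comp f := by apply CZeroRep.Hom.ext; exact Category.id_comp _
  comp_id f := by apply CZeroRep.Hom.ext; exact Category.comp_id _
  assoc f g h := by apply CZeroRep.Hom.ext; exact Category.assoc _ _ _

end Representations

end ToposHilbert
end

/-!
All three categories are equivalent to the category `GradedHilbert X` of Hilbert spaces `H` with a
family of mutually orthogonal projections `P x`, for `x` in `X`, whose ranges span a dense
subspace; its morphisms are the operators which commute with the projections.

As `X` is decidable, the Kronecker symbol of `X` is a complex number and `C₀(X)` contains the
characteristic functions `δ x` of the points. A non-degenerate representation of `C₀(X)` is graded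
by the action of the `δ x`, since the functions of finite support are dense in `C₀(X)` and
representations do not increase norms. Conversely a function `a` acts on a graded Hilbert space by
multiplication with `a x` on the range of `P x` (`cZeroRepToGraded_isEquivalence`). An
`ℓ²(X)`-module with the action `M` is graded by `P x h = M (h ⊗ e x)`: by `M M* = id`, the adjoint
`M*` is an isometry, and by the condition on `M* M` it carries `P x` to the projection of `H ⊗
ℓ²(X)` onto `H ⊗ e x`, so that `P x` is an orthogonal projection. Conversely `h ⊗ e x ↦ P x h`
extends to an action of `ℓ²(X)` (`l2ModuleToGraded_isEquivalence`). The operators needed here are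
constructed from their components: an element of a graded Hilbert space is the limit of its finite
partial sums (`Grading.locally_normLE_E`), and the partial sums of a family of vectors which is
dominated by the components of an element form a Cauchy approximation
(`Grading.Dominated.exists_vector`). Completeness in terms of Cauchy approximations is what makes
this work without choice.

The ranges of the projections of a graded Hilbert space over `X` are the fibres of a Hilbert space
of the slice, whose elements over `x : U ⟶ X` are the `h : U ⟶ H` with `P x h = h`; the real
numbers of the slice are those of the base (`Cx.overEquiv`), as the canonical topologies
correspond (`mem_can_over_iff`). The functor `gradedToSlice` is fully faithful because operators
are given by their components. It is essentially surjective since a Hilbert space `K` of the slice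
is the space of components of its internal direct sum (`directSum`, `sliceSumIso`). The elements
of the direct sum at the stage `U` are the families of elements of `K` at the stage `X ⨯ U` whose
squared norms have locally, outside of finite lists of indices, arbitrarily small sums. These
families form a sheaf for the canonical topology (`isSheaf_sumFunctor`), which is representable in
a Grothendieck topos (`IsGrothendieckTopos.exists_representableBy`).

The complex numbers are a Hilbert space (`cxHilbert`) for the same reason. The direct sum of the
constant family with the value `H` serves as `H ⊗ ℓ²(X)`, and that of the complex numbers as
`ℓ²(X)`; the operator `Δ` and the tensor products of operators with the identity are given by
their components (`l2Tensor`).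
-/

noncomputable section

namespace ToposHilbert

/-! ### The order of the Dedekind reals -/

namespace DReal

variable {C : Type u} [Category.{v} C] {J : GrothendieckTopology C} {U : C}

theorem restrict_id (x : DReal J U) : x.restrict (𝟙 U) = x := by
  apply le_antisymm <;> intro q V f hf <;> simpa [restrict] using hf

theorem restrict_one {V : C} (f : V ⟶ U) : (1 : DReal J U).restrict f = 1 := restrict_const 1 f

theorem le_of_locally {x y : DReal J U}
    (h : Locally J (fun ⦃V : C⦄ (f : V ⟶ U) => x.restrict f ≤ y.restrict f)) : x ≤ y := by
  intro q V f hf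
  apply y.lower_of_locally
  refine (h.restrict f).mono fun W g hg => ?_
  have := hg q (𝟙 W) (by simpa [restrict] using (x.lower q).downward_closed hf g)
  simpa [restrict] using this

theorem eq_of_locally {x y : DReal J U}
    (h : Locally J (fun ⦃V : C⦄ (f : V ⟶ U) => x.restrict f = y.restrict f)) : x = y :=
  le_antisymm (le_of_locally (h.mono fun _ _ h => h.le))
    (le_of_locally (h.mono fun _ _ h => h.ge))

theorem const_le_of_lower {x : DReal J U} {q : ℚ} {r : ℝ} {V : C} {f : V ⟶ U}
    (h : x.lower q f) (hr : r ≤ q) : const r ≤ x.restrict f := by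
  intro p W g hg
  change x.lower p (g ≫ f)
  apply x.lower_of_locally
  refine Locally.mono hg fun Z k ⟨a, b, _, q', hq', H⟩ => ?_
  have h1 : (q' : ℝ) ≤ r := H ![] (fun i => i.elim0)
  have h2 : p ≤ q := by
    have h3 : (p : ℝ) < q' := by exact_mod_cast hq'
    exact_mod_cast (h3.le.trans h1).trans hr
  refine x.lower_mono h2 ?_
  have := (x.lower q).downward_closed h (k ≫ g)
  simpa using this

theorem lower_const {q : ℚ} {r : ℝ} (h : (q : ℝ) < r) {V : C} (f : V ⟶ U) :
    (const r : DReal J U).lower q f := by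
  obtain ⟨q', h1, h2⟩ := exists_rat_btwn h
  exact Locally.of_forall fun W g =>
    ⟨![], ![], fun i => i.elim0, q', by exact_mod_cast h1, fun s _ => h2.le⟩

theorem upper_const {q : ℚ} {r : ℝ} (h : r < (q : ℝ)) {V : C} (f : V ⟶ U) :
    (const r : DReal J U).upper q f := by
  obtain ⟨q', h1, h2⟩ := exists_rat_btwn h
  exact Locally.of_forall fun W g =>
    ⟨![], ![], fun i => i.elim0, q', by exact_mod_cast h2, fun s _ => h1.le⟩

theorem lower_of_const_le {x : DReal J U} {q : ℚ} {r : ℝ} (h : (q : ℝ) < r) {V : C} {f : V ⟶ U}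
    (hx : const r ≤ x.restrict f) : x.lower q f := by
  have := hx q (𝟙 V) (lower_const h _)
  simpa [restrict] using this

theorem le_const_of_upper' {x : DReal J U} {q : ℚ} {r : ℝ} {V : C} {f : V ⟶ U}
    (h : x.upper q f) (hr : (q : ℝ) ≤ r) : x.restrict f ≤ const r :=
  le_const_of_upper (q := q) (by simpa [restrict] using h) hr

theorem const_neg (r : ℝ) : (const (-r) : DReal J U) = -const r := by
  rw [eq_neg_iff_add_eq_zero, ← const_add, neg_add_cancel, const_zero]

theorem const_sub (r s : ℝ) : (const (r - s) : DReal J U) = const r - const s := by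
  rw [sub_eq_add_neg, const_add, const_neg, ← sub_eq_add_neg]

theorem const_two : (const 2 : DReal J U) = 2 := by
  rw [← one_add_one_eq_two, const_add, const_one, one_add_one_eq_two]

theorem const_nonneg {r : ℝ} (h : 0 ≤ r) : (0 : DReal J U) ≤ const r := const_mono h

theorem const_mul_inv_cancel {r : ℝ} (h : r ≠ 0) (x : DReal J U) :
    const r⁻¹ * (const r * x) = x := by
  rw [← mul_assoc, ← const_mul, inv_mul_cancel₀ h, const_one, one_mul]

theorem le_of_const_mul_le {r : ℝ} (h : 0 < r) {x y : DReal J U} (hxy : const r * x ≤ const r * y) :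
    x ≤ y := by
  have := mul_le_mul_of_nonneg_left hxy (const_nonneg (J := J) (U := U) (inv_nonneg.2 h.le))
  rwa [const_mul_inv_cancel h.ne', const_mul_inv_cancel h.ne'] at this

/-- The Dedekind reals are archimedean. -/
theorem le_of_forall_pos_le_add {x y : DReal J U} (h : ∀ ε : ℝ, 0 < ε → x ≤ y + const ε) :
    x ≤ y := by
  intro q V f hf
  apply y.lower_of_locally
  refine Locally.mono ((x.lower_iff q f).1 hf) fun W g ⟨r, hr, hg⟩ => ?_
  have hr' : (q : ℝ) < r := by exact_mod_cast hr
  have h1 := (const_le_of_lower hg le_rfl).trans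
    (restrict_mono (h (((r : ℝ) - q) / 2) (by linarith)) (g ≫ f))
  rw [restrict_add, restrict_const, ← sub_le_iff_le_add, ← const_sub] at h1
  exact lower_of_const_le (by linarith) h1

theorem le_of_forall_le_mul_const {x y z : DReal J U}
    (h : ∀ ε : ℝ, 0 < ε → x ≤ y + const ε * z) : x ≤ y := by
  refine le_of_locally ((z.upper_inhabited).mono fun V f ⟨q, hq⟩ => ?_)
  obtain ⟨n, hn⟩ := exists_nat_gt q
  have hn' : (q : ℝ) ≤ n := by exact_mod_cast hn.le
  have hz := le_const_of_upper' hq (hn'.trans (le_add_of_nonneg_right zero_le_one))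
  refine le_of_forall_pos_le_add fun ε hε => ?_
  have hn0 : (0 : ℝ) < n + 1 := by positivity
  have h1 := restrict_mono (h (ε / (n + 1)) (by positivity)) f
  rw [restrict_add, restrict_mul, restrict_const] at h1
  refine h1.trans (add_le_add le_rfl ?_)
  refine (mul_le_mul_of_nonneg_left hz (const_nonneg (by positivity))).trans_eq ?_
  rw [← const_mul, div_mul_cancel₀ _ hn0.ne']

theorem locally_le_const (x : DReal J U) :
    Locally J (fun ⦃V : C⦄ (f : V ⟶ U) => ∃ n : ℕ, x.restrict f ≤ const n) :=
  (x.upper_inhabited).mono fun V f ⟨q, hq⟩ => by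
    obtain ⟨n, hn⟩ := exists_nat_gt q
    exact ⟨n, le_const_of_upper' hq (by exact_mod_cast hn.le)⟩

theorem add_self_eq_zero {x : DReal J U} (h : x + x = 0) : x = 0 := by
  have := const_mul_inv_cancel (J := J) (U := U) two_ne_zero x
  rw [const_two, two_mul, h, mul_zero] at this
  exact this.symm

theorem nonpos_of_forall_le_sq {x : DReal J U} (h : ∀ ε : ℝ, 0 < ε → x ≤ const (ε ^ 2)) :
    x ≤ 0 := by
  refine le_of_forall_pos_le_add fun ε hε => ?_
  rw [zero_add]
  simpa [Real.sq_sqrt hε.le] using h (Real.sqrt ε) (Real.sqrt_pos.2 hε)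

/-! ### Completeness of the Dedekind reals -/

/-- Every Cauchy approximation of Dedekind reals has a limit.  A number belongs to the lower cut of
the limit when it stays below some approximation after its error has been added. -/
theorem exists_limit (B : ℚ → ∀ ⦃V : C⦄, (V ⟶ U) → DReal J V → Prop)
    (hres : ∀ ε > 0, ∀ ⦃V : C⦄ (f : V ⟶ U) (a : DReal J V), B ε f a →
      ∀ ⦃W : C⦄ (g : W ⟶ V), B ε (g ≫ f) (a.restrict g))
    (hinh : ∀ ε > 0, Locally J (fun ⦃V : C⦄ (f : V ⟶ U) => ∃ a, B ε f a))
    (hcau : ∀ ε > 0, ∀ δ > 0, ∀ ⦃V : C⦄ (f : V ⟶ U) (a b : DReal J V), B ε f a → B δ f b →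
      a ≤ b + const ((ε + δ : ℚ) : ℝ)) :
    ∃ r : DReal J U, ∀ ε > 0, ∀ ⦃V : C⦄ (f : V ⟶ U) (a : DReal J V), B ε f a →
      r.restrict f ≤ a + const ε ∧ a ≤ r.restrict f + const ε := by
  let L : ℚ → Sieve U := fun q =>
    { arrows := fun V f => Locally J (fun ⦃W : C⦄ (g : W ⟶ V) =>
        ∃ ε > 0, ∃ a, B ε (g ≫ f) a ∧ ∃ r : ℚ, q + ε < r ∧ const r ≤ a)
      downward_closed := fun {V W f} h g => by simpa using h.restrict g }
  let R : ℚ → Sieve U := fun q =>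
    { arrows := fun V f => Locally J (fun ⦃W : C⦄ (g : W ⟶ V) =>
        ∃ ε > 0, ∃ a, B ε (g ≫ f) a ∧ ∃ r : ℚ, r + ε < q ∧ a ≤ const r)
      downward_closed := fun {V W f} h g => by simpa using h.restrict g }
  let r : DReal J U :=
    { lower := L
      upper := R
      lower_iff := fun q V f => by
        constructor
        · refine fun h => h.mono fun W g ⟨ε, hε, a, ha, r, hr, h'⟩ =>
            ⟨(q + (r - ε)) / 2, by linarith, Locally.of_forall fun Z k =>
              ⟨ε, hε, a.restrict k, hres ε hε _ a ha k, r, by linarith, ?_⟩⟩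
          simpa only [restrict_const] using restrict_mono h' k
        · intro h
          refine h.bind fun W g ⟨r', hr, hg⟩ => ?_
          refine Locally.mono hg fun Z k ⟨ε, hε, a, ha, r, hr', h'⟩ =>
            ⟨ε, hε, a, by simpa using ha, r, by linarith, h'⟩
      upper_iff := fun q V f => by
        constructor
        · refine fun h => h.mono fun W g ⟨ε, hε, a, ha, r, hr, h'⟩ =>
            ⟨(q + (r + ε)) / 2, by linarith, Locally.of_forall fun Z k =>
              ⟨ε, hε, a.restrict k, hres ε hε _ a ha k, r, by linarith, ?_⟩⟩
          simpa only [restrict_const] using restrict_mono h' k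
        · intro h
          refine h.bind fun W g ⟨r', hr, hg⟩ => ?_
          refine Locally.mono hg fun Z k ⟨ε, hε, a, ha, r, hr', h'⟩ =>
            ⟨ε, hε, a, by simpa using ha, r, by linarith, h'⟩
      lower_inhabited := by
        refine (hinh 1 one_pos).bind fun V f ⟨a, ha⟩ => ?_
        refine a.lower_inhabited.mono fun W g ⟨q, hq⟩ => ⟨q - 2, ?_⟩
        refine Locally.of_forall fun Z k => ⟨1, one_pos, a.restrict (k ≫ g), ?_, q, by linarith, ?_⟩
        · simpa using hres 1 one_pos _ a ha (k ≫ g)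
        · have := restrict_mono (const_le_of_lower hq le_rfl) k
          rwa [restrict_const, ← restrict_comp] at this
      upper_inhabited := by
        refine (hinh 1 one_pos).bind fun V f ⟨a, ha⟩ => ?_
        refine a.upper_inhabited.mono fun W g ⟨q, hq⟩ => ⟨q + 2, ?_⟩
        refine Locally.of_forall fun Z k => ⟨1, one_pos, a.restrict (k ≫ g), ?_, q, by linarith, ?_⟩
        · simpa using hres 1 one_pos _ a ha (k ≫ g)
        · have := restrict_mono (le_const_of_upper' hq le_rfl) k
          rwa [restrict_const, ← restrict_comp] at this
      disjoint := fun q V f hl hu => by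
        refine Locally.inconsistent (Locally.bind hl fun W g ⟨ε, hε, a, ha, r, hr, h⟩ => ?_)
        refine Locally.mono (Locally.restrict hu g) fun Z k ⟨δ, hδ, b, hb, s, hs, h'⟩ => ?_
        have h1 := hres ε hε _ a ha k
        rw [← Category.assoc] at h1
        have h2 := hcau ε hε δ hδ _ _ _ h1 hb
        have h3 := restrict_mono h k
        rw [restrict_const] at h3
        have h4 := (h3.trans h2).trans (add_le_add h' le_rfl)
        rw [← const_add] at h4
        have h5 : (s : ℝ) + ((ε + δ : ℚ) : ℝ) < r := by
          have : s + (ε + δ) < r := by linarith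
          exact_mod_cast this
        obtain ⟨p, hp1, hp2⟩ := exists_rat_btwn h5
        exact (const (J := J) (U := Z) _).disjoint p (𝟙 Z) (h4 p _ (lower_const hp2 _))
          (upper_const hp1 _)
      located := fun q r hqr => by
        have hε : 0 < (r - q) / 8 := by linarith
        refine (hinh _ hε).bind fun V f ⟨a, ha⟩ => ?_
        refine (a.located (q + 3 * ((r - q) / 8)) (q + 5 * ((r - q) / 8)) (by linarith)).mono
          fun W g hg => ?_
        rcases hg with hg | hg
        · left
          refine Locally.of_forall fun Z k => ⟨_, hε, a.restrict (k ≫ g), ?_, _, ?_,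
            const_le_of_lower ((a.lower _).downward_closed hg k) le_rfl⟩
          · simpa using hres _ hε _ a ha (k ≫ g)
          · linarith
        · right
          refine Locally.of_forall fun Z k => ⟨_, hε, a.restrict (k ≫ g), ?_, _, ?_,
            le_const_of_upper' ((a.upper _).downward_closed hg k) le_rfl⟩
          · simpa using hres _ hε _ a ha (k ≫ g)
          · linarith }
  refine ⟨r, fun ε hε V f a ha => ⟨?_, ?_⟩⟩
  · refine le_of_forall_pos_le_add fun η hη => ?_
    intro q W g hg
    apply lower_of_locally
    refine Locally.mono hg fun Z k ⟨δ, hδ, b, hb, s, hs, h'⟩ => ?_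
    have h1 := hres ε hε _ a ha (k ≫ g)
    simp only [Category.assoc] at h1 hb
    have h2 := h'.trans (hcau δ hδ ε hε _ _ _ hb h1)
    refine lower_of_const_le (r := q + η) (by linarith) ?_
    rw [restrict_add, restrict_add, restrict_const, restrict_const, const_add]
    refine add_le_add ?_ le_rfl
    rw [← sub_le_iff_le_add, ← const_sub] at h2 ⊢
    refine le_trans (const_mono ?_) h2
    have : ((q + δ : ℚ) : ℝ) < s := by exact_mod_cast hs
    push_cast at this ⊢
    linarith
  · refine le_of_forall_pos_le_add fun η hη => ?_
    intro q W g hg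
    apply lower_of_locally
    refine Locally.mono ((a.lower_iff q g).1 hg) fun Z k ⟨s, hs, hk⟩ => ?_
    have hs' : (q : ℝ) < s := by exact_mod_cast hs
    obtain ⟨p, hp1, hp2⟩ := exists_rat_btwn (show (q : ℝ) - ε < s - ε by linarith)
    obtain ⟨p', hp1', hp2'⟩ := exists_rat_btwn hp2
    have hr : r.lower p ((k ≫ g) ≫ f) := by
      refine Locally.of_forall fun Z' k' => ⟨ε, hε, a.restrict (k' ≫ k ≫ g), ?_, s, ?_, ?_⟩
      · simpa using hres _ hε _ a ha (k' ≫ k ≫ g)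
      · have : (p : ℝ) + ε < s := by linarith
        exact_mod_cast this
      · exact const_le_of_lower ((a.lower _).downward_closed hk k') le_rfl
    refine lower_of_const_le (r := p + ε + η) (by linarith) ?_
    rw [restrict_add, restrict_add, restrict_const, restrict_const, const_add, const_add]
    refine add_le_add (add_le_add ?_ le_rfl) le_rfl
    rw [← restrict_comp]
    exact const_le_of_lower hr le_rfl

end DReal


/-! ### Locality -/

section Locality

variable {T : Type u} [Category.{v} T] {U Y : T}

theorem hom_ext_of_locally {x y : U ⟶ Y}
    (h : Locally (can T) (fun ⦃V : T⦄ (f : V ⟶ U) => f ≫ x = f ≫ y)) : x = y := by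
  obtain ⟨S, hS, H⟩ := h
  exact ((Sheaf.isSheaf_yoneda_obj Y).isSeparated S hS).ext fun V f hf => H f hf

/-- Local unique existence implies existence. -/
theorem exists_of_locally_unique (P : ∀ ⦃V : T⦄, (V ⟶ U) → (V ⟶ Y) → Prop)
    (hres : ∀ ⦃V : T⦄ (f : V ⟶ U) (a : V ⟶ Y), P f a → ∀ ⦃W : T⦄ (g : W ⟶ V),
      P (g ≫ f) (g ≫ a))
    (hex : Locally (can T) (fun ⦃V : T⦄ (f : V ⟶ U) => ∃ a, P f a))
    (huniq : ∀ ⦃V : T⦄ (f : V ⟶ U) (a b : V ⟶ Y), P f a → P f b → a = b) :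
    ∃ a : U ⟶ Y, Locally (can T) (fun ⦃V : T⦄ (f : V ⟶ U) => P f (f ≫ a)) := by
  obtain ⟨S, hS, H⟩ := hex
  choose t ht using H
  have hc : Presieve.FamilyOfElements.Compatible (P := yoneda.obj Y) (R := S.arrows) t := by
    intro Y₁ Y₂ Z g₁ g₂ f₁ f₂ h₁ h₂ e
    have h1 := hres _ _ (ht f₁ h₁) g₁
    have h2 := hres _ _ (ht f₂ h₂) g₂
    rw [← e] at h2
    exact huniq _ _ _ h1 h2
  obtain ⟨a, ha, -⟩ := Sheaf.isSheaf_yoneda_obj Y S hS t hc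
  refine ⟨a, S, hS, fun V f hf => ?_⟩
  have : f ≫ a = t f hf := ha f hf
  beta_reduce
  rw [this]
  exact ht f hf

end Locality

namespace Cx

variable {C : Type u} [Category.{v} C] {J : GrothendieckTopology C} {U V : C}

theorem restrict_id (z : Cx J U) : z.restrict (𝟙 U) = z := by
  ext1 <;> exact DReal.restrict_id _

theorem restrict_one (f : V ⟶ U) : (1 : Cx J U).restrict f = 1 := by
  ext1
  · exact DReal.restrict_one f
  · exact DReal.restrict_zero f

theorem restrict_neg (f : V ⟶ U) (z : Cx J U) : (-z).restrict f = -z.restrict f := by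
  ext1 <;> exact DReal.restrict_neg _ f

theorem restrict_ofReal (f : V ⟶ U) (x : DReal J U) :
    (ofReal x).restrict f = ofReal (x.restrict f) := by
  ext1
  · rfl
  · exact DReal.restrict_zero f

theorem eq_of_locally {z w : Cx J U}
    (h : Locally J (fun ⦃V : C⦄ (f : V ⟶ U) => z.restrict f = w.restrict f)) : z = w := by
  ext1
  · exact DReal.eq_of_locally (h.mono fun _ _ h => congrArg Cx.re h)
  · exact DReal.eq_of_locally (h.mono fun _ _ h => congrArg Cx.im h)

theorem star_mul_self (z : Cx J U) : star z * z = ofReal z.absSq := by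
  ext1
  · simp only [mul_re, star_re, star_im, ofReal, absSq]; ring
  · simp only [mul_im, star_re, star_im, ofReal]; ring

theorem star_ofReal (x : DReal J U) : star (ofReal x) = ofReal x := by
  ext1
  · rfl
  · exact neg_zero

theorem ofReal_mul_re (x : DReal J U) (z : Cx J U) : (ofReal x * z).re = x * z.re := by
  simp [ofReal]

theorem ofReal_mul (x y : DReal J U) : ofReal (x * y) = ofReal x * ofReal y := by
  ext1 <;> simp [ofReal]

theorem ofReal_one : (ofReal 1 : Cx J U) = 1 := rfl

theorem ofReal_zero : (ofReal 0 : Cx J U) = 0 := rfl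

theorem absSq_zero : (0 : Cx J U).absSq = 0 := by simp [absSq]

/-- The imaginary unit. -/
def I : Cx J U := ⟨0, 1⟩

theorem I_restrict (f : V ⟶ U) : (I : Cx J U).restrict f = I := by
  ext1
  · exact DReal.restrict_zero f
  · exact DReal.restrict_one f

theorem sub_re (z w : Cx J U) : (z - w).re = z.re - w.re := by
  rw [sub_eq_add_neg, add_re, neg_re, ← sub_eq_add_neg]

theorem sub_im (z w : Cx J U) : (z - w).im = z.im - w.im := by
  rw [sub_eq_add_neg, add_im, neg_im, ← sub_eq_add_neg]

end Cx

namespace PreHilbertSpace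

/-! ### Norms -/

variable {T : Type u} [Category.{v} T] (H : PreHilbertSpace T) {U V : T}

theorem comp_zero (f : V ⟶ U) : f ≫ (0 : U ⟶ H.obj) = 0 := by
  have := H.comp_add f 0 0
  rwa [add_zero, left_eq_add] at this

theorem comp_neg (f : V ⟶ U) (x : U ⟶ H.obj) : f ≫ (-x) = -(f ≫ x) := by
  rw [eq_neg_iff_add_eq_zero, ← H.comp_add, neg_add_cancel, H.comp_zero]

theorem comp_sub (f : V ⟶ U) (x y : U ⟶ H.obj) : f ≫ (x - y) = f ≫ x - f ≫ y := by
  rw [sub_eq_add_neg, H.comp_add, H.comp_neg, ← sub_eq_add_neg]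

theorem inner_zero_right (x : U ⟶ H.obj) : H.inner x 0 = 0 := by
  have := H.inner_sub_right x 0 0
  simpa using this

theorem inner_zero_left (x : U ⟶ H.obj) : H.inner 0 x = 0 := by
  rw [← H.star_inner, H.inner_zero_right, star_zero]

theorem ext_inner_left {x y : U ⟶ H.obj} (h : ∀ w : U ⟶ H.obj, H.inner x w = H.inner y w) :
    x = y :=
  H.ext_inner x y fun w => by rw [← H.star_inner, h, H.star_inner]

theorem normSq_restrict (f : V ⟶ U) (x : U ⟶ H.obj) :
    (H.normSq x).restrict f = H.normSq (f ≫ x) := congrArg Cx.re (H.inner_restrict f x x)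

theorem inner_self_im (x : U ⟶ H.obj) : (H.inner x x).im = 0 := by
  have h : -(H.inner x x).im = (H.inner x x).im := congrArg Cx.im (H.star_inner x x)
  apply DReal.add_self_eq_zero
  nth_rw 1 [← h]
  exact neg_add_cancel _

theorem inner_self (x : U ⟶ H.obj) : H.inner x x = Cx.ofReal (H.normSq x) :=
  Cx.ext rfl (H.inner_self_im x)

theorem eq_zero_of_normSq_le {x : U ⟶ H.obj} (h : H.normSq x ≤ 0) : x = 0 := by
  apply H.eq_zero_of_inner_self
  rw [H.inner_self, le_antisymm h (H.normSq_nonneg x), Cx.ofReal_zero]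

theorem normSq_zero : H.normSq (0 : U ⟶ H.obj) = 0 := by
  rw [normSq, H.inner_zero_right, Cx.zero_re]

theorem normSq_neg (x : U ⟶ H.obj) : H.normSq (-x) = H.normSq x := by
  rw [normSq, H.inner_neg_right, ← H.star_inner, H.inner_neg_right, star_neg, neg_neg,
    H.star_inner, normSq]

theorem normSq_sub_comm (x y : U ⟶ H.obj) : H.normSq (x - y) = H.normSq (y - x) := by
  rw [← H.normSq_neg, neg_sub]

theorem inner_re_comm (x y : U ⟶ H.obj) : (H.inner x y).re = (H.inner y x).re := by
  rw [← H.star_inner]; rfl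

theorem normSq_add (x y : U ⟶ H.obj) :
    H.normSq (x + y) = H.normSq x + H.normSq y + 2 * (H.inner x y).re := by
  rw [normSq, H.inner_add_right, H.inner_add_left, H.inner_add_left]
  simp only [Cx.add_re, H.inner_re_comm y x, normSq]
  ring

theorem normSq_sub (x y : U ⟶ H.obj) :
    H.normSq (x - y) = H.normSq x + H.normSq y - 2 * (H.inner x y).re := by
  rw [sub_eq_add_neg, normSq_add, normSq_neg, inner_neg_right, Cx.neg_re]
  ring

theorem normSq_smul (c : Cx (can T) U) (x : U ⟶ H.obj) :
    H.normSq (c • x) = c.absSq * H.normSq x := by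
  rw [normSq, H.inner_smul_right, H.inner_smul_left, ← mul_assoc, mul_comm c, Cx.star_mul_self,
    Cx.ofReal_mul_re, normSq]

theorem normSq_add_of_inner_eq_zero {x y : U ⟶ H.obj} (h : H.inner x y = 0) :
    H.normSq (x + y) = H.normSq x + H.normSq y := by
  rw [normSq_add, h, Cx.zero_re, mul_zero, add_zero]

/-- The inequality between the geometric and the arithmetic mean, with a weight `t`. -/
theorem two_mul_inner_re_le (x y : U ⟶ H.obj) {t : ℝ} (ht : 0 < t) :
    2 * (H.inner x y).re ≤
      (DReal.const t : DReal (can T) U) * H.normSq x + DReal.const t⁻¹ * H.normSq y := by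
  have h1 := H.normSq_nonneg (y - (Cx.ofReal (DReal.const t) : Cx (can T) U) • x)
  rw [normSq_sub_smul, H.inner_re_comm y x] at h1
  have h2 := mul_nonneg (DReal.const_nonneg (J := can T) (U := U) (inv_nonneg.2 ht.le)) h1
  rw [← sub_nonneg]
  refine h2.trans_eq ?_
  have h3 : (DReal.const t⁻¹ * DReal.const t : DReal (can T) U) = 1 := by
    rw [← DReal.const_mul, inv_mul_cancel₀ ht.ne', DReal.const_one]
  linear_combination ((DReal.const t) * H.normSq x - 2 * (H.inner x y).re) * h3

theorem normSq_add_le (x y : U ⟶ H.obj) {t : ℝ} (ht : 0 < t) :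
    H.normSq (x + y) ≤
      DReal.const (1 + t) * H.normSq x + DReal.const (1 + t⁻¹) * H.normSq y := by
  rw [normSq_add, DReal.const_add, DReal.const_add, DReal.const_one]
  refine (add_le_add le_rfl (H.two_mul_inner_re_le x y ht)).trans_eq ?_
  ring

variable {H}

theorem NormLE.comp {x : U ⟶ H.obj} {r : ℝ} (h : H.NormLE x r) (f : V ⟶ U) :
    H.NormLE (f ≫ x) r := by
  have := DReal.restrict_mono h f
  rwa [H.normSq_restrict, DReal.restrict_const] at this

theorem NormLE.of_locally {x : U ⟶ H.obj} {r : ℝ}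
    (h : Locally (can T) (fun ⦃V : T⦄ (f : V ⟶ U) => H.NormLE (f ≫ x) r)) : H.NormLE x r :=
  DReal.le_of_locally (h.mono fun V f hf => by
    rw [H.normSq_restrict, DReal.restrict_const]; exact hf)

theorem NormLE.mono {x : U ⟶ H.obj} {r s : ℝ} (h : H.NormLE x r) (hr : 0 ≤ r) (hs : r ≤ s) :
    H.NormLE x s :=
  le_trans h (DReal.const_mono (by gcongr))

theorem NormLE.add {x y : U ⟶ H.obj} {r s : ℝ} (hx : H.NormLE x r) (hy : H.NormLE y s)
    (hr : 0 < r) (hs : 0 < s) : H.NormLE (x + y) (r + s) := by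
  refine (H.normSq_add_le x y (t := s / r) (by positivity)).trans ?_
  refine (add_le_add (mul_le_mul_of_nonneg_left hx (DReal.const_nonneg (by positivity)))
    (mul_le_mul_of_nonneg_left hy (DReal.const_nonneg (by positivity)))).trans_eq ?_
  rw [← DReal.const_mul, ← DReal.const_mul, ← DReal.const_add]
  congr 1
  field_simp
  ring

theorem NormLE.neg {x : U ⟶ H.obj} {r : ℝ} (h : H.NormLE x r) : H.NormLE (-x) r := by
  rwa [NormLE, normSq_neg]

theorem NormLE.sub_comm {x y : U ⟶ H.obj} {r : ℝ} (h : H.NormLE (x - y) r) :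
    H.NormLE (y - x) r := by
  rwa [NormLE, normSq_sub_comm]

theorem NormLE.sub_trans {x y z : U ⟶ H.obj} {r s : ℝ} (hx : H.NormLE (x - y) r)
    (hy : H.NormLE (y - z) s) (hr : 0 < r) (hs : 0 < s) : H.NormLE (x - z) (r + s) := by
  simpa using hx.add hy hr hs

theorem eq_zero_of_forall_normLE {x : U ⟶ H.obj} (h : ∀ ε : ℝ, 0 < ε → H.NormLE x ε) : x = 0 :=
  H.eq_zero_of_normSq_le (DReal.nonpos_of_forall_le_sq h)

theorem eq_of_forall_normLE {x y : U ⟶ H.obj} (h : ∀ ε : ℝ, 0 < ε → H.NormLE (x - y) ε) :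
    x = y :=
  sub_eq_zero.1 (eq_zero_of_forall_normLE h)

theorem normLE_zero {r : ℝ} : H.NormLE (0 : U ⟶ H.obj) r := by
  rw [NormLE, normSq_zero]; exact DReal.const_nonneg (sq_nonneg r)

/-! ### Dense subsets -/

theorem span_comp {S : ∀ V : T, Set (V ⟶ H.obj)}
    (hS : ∀ ⦃V W : T⦄ (g : W ⟶ V), ∀ s ∈ S V, g ≫ s ∈ S W) (f : V ⟶ U) {y : U ⟶ H.obj}
    (hy : y ∈ Submodule.span (Cx (can T) U) (S U)) :
    f ≫ y ∈ Submodule.span (Cx (can T) V) (S V) := by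
  induction hy using Submodule.span_induction with
  | mem x hx => exact Submodule.subset_span (hS f x hx)
  | zero => rw [H.comp_zero]; exact zero_mem _
  | add x y _ _ hx hy => rw [H.comp_add]; exact add_mem hx hy
  | smul c x _ hx => rw [H.comp_smul]; exact Submodule.smul_mem _ _ hx

/-- A vector orthogonal to a set with dense span vanishes. -/
theorem DenseSpan.eq_zero {S : ∀ V : T, Set (V ⟶ H.obj)} (hS : H.DenseSpan S) {w : U ⟶ H.obj}
    (hw : ∀ ⦃V : T⦄ (f : V ⟶ U), ∀ s ∈ S V, H.inner (f ≫ w) s = 0) : w = 0 := by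
  refine eq_zero_of_forall_normLE fun ε hε => ?_
  obtain ⟨δ, hδ, hδε⟩ := exists_rat_btwn hε
  refine NormLE.of_locally ((hS w δ (by exact_mod_cast hδ)).mono fun V f ⟨y, hy, hle⟩ => ?_)
  have h0 : H.inner (f ≫ w) y = 0 := by
    clear hle
    induction hy using Submodule.span_induction with
    | mem x hx => exact hw f x hx
    | zero => exact H.inner_zero_right _
    | add x y _ _ hx hy => rw [H.inner_add_right, hx, hy, add_zero]
    | smul c x _ hx => rw [H.inner_smul_right, hx, mul_zero]
  refine NormLE.mono ?_ hδ.le hδε.le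
  refine le_trans ?_ hle
  rw [normSq_sub, h0, Cx.zero_re, mul_zero, sub_zero]
  exact le_add_of_nonneg_right (H.normSq_nonneg y)

/-- The span of `S` is dense as soon as it approximates the members of a set with dense span. -/
theorem DenseSpan.of_approx {S S' : ∀ V : T, Set (V ⟶ H.obj)} (hS' : H.DenseSpan S')
    (hS : ∀ ⦃V W : T⦄ (g : W ⟶ V), ∀ s ∈ S V, g ≫ s ∈ S W)
    (h : ∀ ⦃V : T⦄, ∀ s ∈ S' V, ∀ ε : ℝ, 0 < ε → Locally (can T) (fun ⦃W : T⦄ (f : W ⟶ V) =>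
      ∃ y ∈ Submodule.span (Cx (can T) W) (S W), H.NormLE (f ≫ s - y) ε)) :
    H.DenseSpan S := by
  have key : ∀ ⦃V : T⦄, ∀ s ∈ Submodule.span (Cx (can T) V) (S' V), ∀ ε : ℝ, 0 < ε →
      Locally (can T) (fun ⦃W : T⦄ (f : W ⟶ V) =>
        ∃ y ∈ Submodule.span (Cx (can T) W) (S W), H.NormLE (f ≫ s - y) ε) := by
    intro V s hs
    induction hs using Submodule.span_induction with
    | mem x hx => exact h x hx
    | zero =>
      intro ε hε
      refine Locally.of_forall fun W f => ⟨0, zero_mem _, ?_⟩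
      rw [H.comp_zero, sub_zero]; exact normLE_zero
    | add x y _ _ hx hy =>
      intro ε hε
      refine (hx (ε / 2) (half_pos hε)).bind fun W f ⟨x', hx', hxle⟩ => ?_
      refine ((hy (ε / 2) (half_pos hε)).restrict f).mono fun Z g ⟨y', hy', hyle⟩ => ?_
      refine ⟨g ≫ x' + y', add_mem (span_comp hS g hx') hy', ?_⟩
      have := (hxle.comp g).add hyle (half_pos hε) (half_pos hε)
      rw [add_halves, H.comp_sub] at this
      rw [H.comp_add]
      convert this using 1
      simp only [Category.assoc]
      abel
    | smul c x _ hx =>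
      intro ε hε
      refine c.absSq.locally_le_const.bind fun W f ⟨n, hn⟩ => ?_
      have hn1 : (0 : ℝ) < n + 1 := by positivity
      refine ((hx (ε / (n + 1)) (by positivity)).restrict f).mono fun Z g ⟨y', hy', hyle⟩ => ?_
      refine ⟨c.restrict (g ≫ f) • y', Submodule.smul_mem _ _ hy', ?_⟩
      rw [H.comp_smul, ← smul_sub, NormLE, normSq_smul, Cx.absSq_restrict, DReal.restrict_comp]
      have h1 := DReal.restrict_mono hn g
      rw [DReal.restrict_const] at h1
      refine (mul_le_mul h1 hyle (H.normSq_nonneg _)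
        (DReal.const_nonneg (Nat.cast_nonneg n))).trans ?_
      rw [← DReal.const_mul]
      apply DReal.const_mono
      rw [div_pow, mul_div_assoc', div_le_iff₀ (by positivity)]
      nlinarith [(Nat.cast_nonneg n : (0 : ℝ) ≤ n), mul_nonneg (sq_nonneg ε)
        (sq_nonneg (n : ℝ)), mul_nonneg (sq_nonneg ε) (Nat.cast_nonneg n : (0 : ℝ) ≤ n)]
  intro U x ε hε
  have hε' : (0 : ℝ) < ε := by exact_mod_cast hε
  refine (hS' x (ε / 2) (half_pos hε)).bind fun V f ⟨y, hy, hle⟩ => ?_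
  refine (key y hy (ε / 2) (half_pos hε')).mono fun W g ⟨z, hz, hle'⟩ => ⟨z, hz, ?_⟩
  have h1 := (hle.comp g)
  rw [H.comp_sub, ← Category.assoc] at h1
  have := h1.sub_trans hle' (by push_cast; linarith) (half_pos hε')
  push_cast at this
  rwa [add_halves] at this

theorem DenseSpan.mono {S S' : ∀ V : T, Set (V ⟶ H.obj)} (hS' : H.DenseSpan S')
    (h : ∀ V, S' V ⊆ S V) : H.DenseSpan S := fun _ x ε hε =>
  (hS' x ε hε).mono fun V _ ⟨y, hy, hle⟩ => ⟨y, Submodule.span_mono (h V) hy, hle⟩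

/-- Continuity of the scalar product: scalar products of vectors which have equal approximations are
equal. -/
theorem inner_re_le_of_approx {H K : PreHilbertSpace T} {a b : U ⟶ H.obj} {a' b' : U ⟶ K.obj}
    (h : ∀ ε : ℝ, 0 < ε → Locally (can T) (fun ⦃V : T⦄ (f : V ⟶ U) => ∃ y y',
      H.NormLE (f ≫ b - y) ε ∧ K.NormLE (f ≫ b' - y') ε ∧
        H.inner (f ≫ a) y = K.inner (f ≫ a') y')) :
    (H.inner a b).re ≤ (K.inner a' b').re := by
  apply DReal.le_of_const_mul_le two_pos
  rw [DReal.const_two]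
  refine DReal.le_of_forall_le_mul_const (z := 2 + (H.normSq a + K.normSq a')) fun t ht => ?_
  refine DReal.le_of_locally ((h t ht).mono fun W p ⟨y, y', hy, hy', e⟩ => ?_)
  have c1 := H.two_mul_inner_re_le (p ≫ a) (p ≫ b - y) ht
  have c2 := K.two_mul_inner_re_le (p ≫ a') (y' - p ≫ b') ht
  have d1 := mul_le_mul_of_nonneg_left hy
    (DReal.const_nonneg (J := can T) (U := W) (inv_pos.2 ht).le)
  have d2 := mul_le_mul_of_nonneg_left hy'.sub_comm
    (DReal.const_nonneg (J := can T) (U := W) (inv_pos.2 ht).le)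
  have e4 : (DReal.const t⁻¹ : DReal (can T) W) * DReal.const (t ^ 2) = DReal.const t := by
    rw [← DReal.const_mul]; congr 1; field_simp
  rw [e4] at d1 d2
  rw [H.inner_sub_right, Cx.sub_re] at c1
  rw [K.inner_sub_right, Cx.sub_re, ← e] at c2
  rw [← DReal.const_two, DReal.restrict_mul, DReal.restrict_add, DReal.restrict_mul,
    DReal.restrict_mul, DReal.restrict_add, DReal.restrict_add, DReal.restrict_const,
    DReal.restrict_const, DReal.const_two, H.normSq_restrict, K.normSq_restrict]
  have e5 : (H.inner a b).re.restrict p = (H.inner (p ≫ a) (p ≫ b)).re :=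
    congrArg Cx.re (H.inner_restrict p a b)
  have e6 : (K.inner a' b').re.restrict p = (K.inner (p ≫ a') (p ≫ b')).re :=
    congrArg Cx.re (K.inner_restrict p a' b')
  rw [e5, e6]
  have d3 := add_le_add d1 d2
  have c3 := add_le_add c1 c2
  rw [← sub_nonneg] at c3 d3 ⊢
  refine (add_nonneg c3 d3).trans_eq ?_
  ring

theorem inner_eq_of_approx {H K : PreHilbertSpace T} {a b : U ⟶ H.obj} {a' b' : U ⟶ K.obj}
    (h : ∀ ε : ℝ, 0 < ε → Locally (can T) (fun ⦃V : T⦄ (f : V ⟶ U) => ∃ y y',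
      H.NormLE (f ≫ b - y) ε ∧ K.NormLE (f ≫ b' - y') ε ∧
        H.inner (f ≫ a) y = K.inner (f ≫ a') y')) :
    H.inner a b = K.inner a' b' := by
  have h' : ∀ c : Cx (can T) U, (c * H.inner a b).re = (c * K.inner a' b').re := by
    intro c
    have key : ∀ ε : ℝ, 0 < ε → Locally (can T) (fun ⦃V : T⦄ (f : V ⟶ U) => ∃ y y',
      H.NormLE (f ≫ b - y) ε ∧ K.NormLE (f ≫ b' - y') ε ∧
        H.inner (f ≫ (star c • a)) y = K.inner (f ≫ (star c • a')) y') := fun ε hε =>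
      (h ε hε).mono fun V f ⟨y, y', hy, hy', e⟩ => ⟨y, y', hy, hy', by
        rw [H.comp_smul, K.comp_smul, H.inner_smul_left, K.inner_smul_left, e]⟩
    have h2 := le_antisymm (inner_re_le_of_approx key) (inner_re_le_of_approx fun ε hε =>
      (key ε hε).mono fun V f ⟨y, y', hy, hy', e⟩ => ⟨y', y, hy', hy, e.symm⟩)
    rwa [H.inner_smul_left, K.inner_smul_left, star_star] at h2
  ext1
  · simpa using h' 1
  · simpa [Cx.I] using h' Cx.I

end PreHilbertSpace

/-! ### Operators -/

section Operators

variable {T : Type u} [Category.{v} T] {H K : HilbertSpace T} {U V : T}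

theorem BoundedOp.comp_app (f : V ⟶ U) (t : H ⟶ K) (x : U ⟶ H.obj) :
    f ≫ BoundedOp.app t x = BoundedOp.app t (f ≫ x) := (Category.assoc _ _ _).symm

theorem BoundedOp.app_add (t : H ⟶ K) (x y : U ⟶ H.obj) :
    BoundedOp.app t (x + y) = BoundedOp.app t x + BoundedOp.app t y := BoundedOp.map_add t x y

theorem BoundedOp.app_smul (t : H ⟶ K) (c : Cx (can T) U) (x : U ⟶ H.obj) :
    BoundedOp.app t (c • x) = c • BoundedOp.app t x := BoundedOp.map_smul t c x

theorem BoundedOp.app_zero (t : H ⟶ K) : BoundedOp.app t (0 : U ⟶ H.obj) = 0 := by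
  have := BoundedOp.app_add t (0 : U ⟶ H.obj) 0
  rwa [add_zero, left_eq_add] at this

theorem BoundedOp.app_sub (t : H ⟶ K) (x y : U ⟶ H.obj) :
    BoundedOp.app t (x - y) = BoundedOp.app t x - BoundedOp.app t y := by
  rw [eq_sub_iff_add_eq, ← BoundedOp.app_add, sub_add_cancel]

theorem inner_adjoint_left (t : H ⟶ K) (x : U ⟶ K.obj) (y : U ⟶ H.obj) :
    H.inner (BoundedOp.app (adjoint t) x) y = K.inner x (BoundedOp.app t y) := by
  rw [← H.star_inner, ← inner_adjoint, K.star_inner]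

theorem BoundedOp.hom_ext {s t : H ⟶ K}
    (h : ∀ ⦃U : T⦄ (x : U ⟶ H.obj), BoundedOp.app s x = BoundedOp.app t x) : s = t := by
  apply BoundedOp.ext
  have := h (𝟙 H.obj)
  rwa [BoundedOp.app, BoundedOp.app, Category.id_comp, Category.id_comp] at this

/-- Operators which agree on a set with dense span are equal. -/
theorem BoundedOp.hom_ext_of_denseSpan {S : ∀ V : T, Set (V ⟶ H.obj)} (hS : H.DenseSpan S)
    {s t : H ⟶ K} (h : ∀ ⦃V : T⦄, ∀ x ∈ S V, BoundedOp.app s x = BoundedOp.app t x) : s = t := by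
  refine BoundedOp.hom_ext fun U x => K.ext_inner_left fun w => ?_
  rw [inner_adjoint, inner_adjoint]
  congr 1
  rw [← sub_eq_zero]
  refine hS.eq_zero fun V f y hy => ?_
  rw [H.comp_sub, BoundedOp.comp_app, BoundedOp.comp_app, H.inner_sub_left, inner_adjoint_left,
    inner_adjoint_left, h y hy, sub_self]

/-- An operator given by its values on generalized elements, together with its adjoint. -/
def opMk (t : ∀ {U : T}, (U ⟶ H.obj) → (U ⟶ K.obj)) (s : ∀ {U : T}, (U ⟶ K.obj) → (U ⟶ H.obj))
    (ht : ∀ {U V : T} (f : V ⟶ U) (x : U ⟶ H.obj), f ≫ t x = t (f ≫ x))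
    (hs : ∀ {U V : T} (f : V ⟶ U) (x : U ⟶ K.obj), f ≫ s x = s (f ≫ x))
    (hts : ∀ {U : T} (x : U ⟶ H.obj) (y : U ⟶ K.obj), K.inner (t x) y = H.inner x (s y))
    (k : ℝ) (hk : 0 ≤ k)
    (hb : ∀ {U : T} (x : U ⟶ H.obj), K.normSq (t x) ≤ DReal.const (k ^ 2) * H.normSq x) :
    H ⟶ K :=
  have e : ∀ {U : T} (x : U ⟶ H.obj), x ≫ t (𝟙 H.obj) = t x := fun x => by
    rw [ht, Category.comp_id]
  have e' : ∀ {U : T} (x : U ⟶ K.obj), x ≫ s (𝟙 K.obj) = s x := fun x => by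
    rw [hs, Category.comp_id]
  BoundedOp.mk (t (𝟙 H.obj))
    (fun x y => by
      rw [e, e, e]
      exact K.ext_inner_left fun w => by
        rw [hts, H.inner_add_left, K.inner_add_left, hts, hts])
    (fun c x => by
      rw [e, e]
      exact K.ext_inner_left fun w => by
        rw [hts, H.inner_smul_left, K.inner_smul_left, hts])
    ⟨k, hk, fun x => by rw [e]; exact hb x⟩
    ⟨s (𝟙 K.obj), fun x y => by rw [e, e', hts]⟩

section

variable (t : ∀ {U : T}, (U ⟶ H.obj) → (U ⟶ K.obj)) (s : ∀ {U : T}, (U ⟶ K.obj) → (U ⟶ H.obj))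
    (ht : ∀ {U V : T} (f : V ⟶ U) (x : U ⟶ H.obj), f ≫ t x = t (f ≫ x))
    (hs : ∀ {U V : T} (f : V ⟶ U) (x : U ⟶ K.obj), f ≫ s x = s (f ≫ x))
    (hts : ∀ {U : T} (x : U ⟶ H.obj) (y : U ⟶ K.obj), K.inner (t x) y = H.inner x (s y))
    (k : ℝ) (hk : 0 ≤ k)
    (hb : ∀ {U : T} (x : U ⟶ H.obj), K.normSq (t x) ≤ DReal.const (k ^ 2) * H.normSq x)

theorem opMk_app (x : U ⟶ H.obj) :
    BoundedOp.app (opMk t s ht hs hts k hk hb) x = t x := by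
  change x ≫ t (𝟙 H.obj) = t x
  rw [ht, Category.comp_id]

theorem adjoint_opMk_app (x : U ⟶ K.obj) :
    BoundedOp.app (adjoint (opMk t s ht hs hts k hk hb)) x = s x :=
  H.ext_inner _ _ fun w => by
    rw [← inner_adjoint, opMk_app, hts]

end

theorem BoundedOp.exists_bound (t : H ⟶ K) : ∃ k : ℝ, 0 < k ∧ ∀ {U : T} (x : U ⟶ H.obj),
    K.normSq (BoundedOp.app t x) ≤ DReal.const (k ^ 2) * H.normSq x := by
  obtain ⟨k, hk, h⟩ := BoundedOp.bounded t
  refine ⟨k + 1, by positivity, fun x => (h x).trans ?_⟩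
  exact mul_le_mul_of_nonneg_right (DReal.const_mono (by nlinarith)) (H.normSq_nonneg x)

/-- The range of an isometric embedding into a Hilbert space is closed: a vector which is locally
approximated by vectors of the range belongs to it. -/
theorem exists_preimage_of_isometry {L : HilbertSpace T} (i : ∀ ⦃V : T⦄, (V ⟶ U) → (V ⟶ H.obj) → (V ⟶ L.obj))
    (hi : ∀ ⦃V : T⦄ (f : V ⟶ U) (x : V ⟶ H.obj) ⦃W : T⦄ (g : W ⟶ V),
      g ≫ i f x = i (g ≫ f) (g ≫ x))
    (hiso : ∀ ⦃V : T⦄ (f : V ⟶ U) (x y : V ⟶ H.obj), L.normSq (i f x - i f y) = H.normSq (x - y))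
    (w : U ⟶ L.obj)
    (hw : ∀ ε : ℝ, 0 < ε → Locally (can T) (fun ⦃V : T⦄ (f : V ⟶ U) =>
      ∃ x, L.NormLE (f ≫ w - i f x) ε)) :
    ∃ x, i (𝟙 U) x = w := by
  obtain ⟨x, hx⟩ := H.complete (U := U) (fun ε V f a => L.NormLE (f ≫ w - i f a) ε)
    { restrict := fun ε hε V f a ha W g => by
        have := ha.comp g
        rwa [L.comp_sub, hi, ← Category.assoc] at this
      glue := fun ε hε V f a ha => by
        refine PreHilbertSpace.NormLE.of_locally (ha.mono fun W g hg => ?_)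
        rwa [L.comp_sub, hi, ← Category.assoc]
      inhabited := fun ε hε => hw ε (by exact_mod_cast hε)
      cauchy := fun ε hε δ hδ V f a b ha hb => by
        have hε' : (0 : ℝ) < ε := by exact_mod_cast hε
        have hδ' : (0 : ℝ) < δ := by exact_mod_cast hδ
        have := ha.sub_comm.sub_trans hb hε' hδ'
        push_cast
        rwa [PreHilbertSpace.NormLE, hiso] at this }
  refine ⟨x, (PreHilbertSpace.eq_of_forall_normLE fun ε hε => ?_)⟩
  obtain ⟨δ, hδ, hδε⟩ := exists_rat_btwn (half_pos hε)
  have hδ0 : (0 : ℚ) < δ := by exact_mod_cast hδ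
  refine PreHilbertSpace.NormLE.of_locally ((hw δ hδ).mono fun V f ⟨a, ha⟩ => ?_)
  have h1 := hx δ hδ0 f a ha
  rw [PreHilbertSpace.NormLE, ← hiso] at h1
  have h2 := (PreHilbertSpace.NormLE.sub_trans h1 ha.sub_comm hδ hδ).mono (by linarith)
    (show (δ : ℝ) + δ ≤ ε by linarith)
  rw [L.comp_sub, hi, Category.comp_id]
  exact h2

end Operators


/-! ### Graded Hilbert spaces -/

section Decidable

variable {T : Type u} [Category.{v} T] {X U : T}

theorem InternallyNe.symm {x y : U ⟶ X} (h : InternallyNe (can T) x y) :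
    InternallyNe (can T) y x := fun _ f hf => h f hf.symm

/-- Membership in a list of elements of a decidable object is decidable. -/
theorem IsDecidable.locally_mem_or (hX : IsDecidable X) (l : List (U ⟶ X)) (x : U ⟶ X) :
    Locally (can T) (fun ⦃V : T⦄ (f : V ⟶ U) => f ≫ x ∈ l.map (f ≫ ·) ∨
      ∀ y ∈ l.map (f ≫ ·), InternallyNe (can T) (f ≫ x) y) := by
  induction l with
  | nil => exact Locally.of_forall fun V f => Or.inr (by simp)
  | cons a l ih =>
    refine ih.bind fun V f hf => ?_
    refine ((hX x a).restrict f).mono fun W g hg => ?_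
    have e : (a :: l).map ((g ≫ f) ≫ ·) = ((g ≫ f) ≫ a) :: (l.map (f ≫ ·)).map (g ≫ ·) := by
      simp
    rw [e]
    rcases hg with hg | hg
    · exact Or.inl (by rw [hg]; exact List.mem_cons_self)
    · rcases hf with hf | hf
      · refine Or.inl (List.mem_cons_of_mem _ ?_)
        rw [Category.assoc]
        exact List.mem_map_of_mem hf
      · refine Or.inr fun y hy => ?_
        rcases List.mem_cons.1 hy with rfl | hy
        · exact hg
        · obtain ⟨z, hz, rfl⟩ := List.mem_map.1 hy
          rw [Category.assoc]
          exact (hf z hz).restrict g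

end Decidable

/-- A family of orthogonal projections of a Hilbert space, indexed by an object. -/
structure ProjFamily {T : Type u} [Category.{v} T] (H : HilbertSpace T) (X : T) where
  P : ∀ {U : T}, (U ⟶ X) → (U ⟶ H.obj) → (U ⟶ H.obj)
  comp_P : ∀ {U V : T} (f : V ⟶ U) (x : U ⟶ X) (h : U ⟶ H.obj), f ≫ P x h = P (f ≫ x) (f ≫ h)
  inner_P : ∀ {U : T} (x : U ⟶ X) (h k : U ⟶ H.obj), H.inner (P x h) k = H.inner h (P x k)
  P_P : ∀ {U : T} (x : U ⟶ X) (h : U ⟶ H.obj), P x (P x h) = P x h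

namespace ProjFamily

variable {T : Type u} [Category.{v} T] {H : HilbertSpace T} {X : T} (Q : ProjFamily H X)

theorem P_add {U : T} (x : U ⟶ X) (h k : U ⟶ H.obj) : Q.P x (h + k) = Q.P x h + Q.P x k :=
  H.ext_inner_left fun w => by
    rw [Q.inner_P, H.inner_add_left, H.inner_add_left, Q.inner_P, Q.inner_P]

theorem P_smul {U : T} (x : U ⟶ X) (c : Cx (can T) U) (h : U ⟶ H.obj) :
    Q.P x (c • h) = c • Q.P x h :=
  H.ext_inner_left fun w => by rw [Q.inner_P, H.inner_smul_left, H.inner_smul_left, Q.inner_P]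

theorem P_sub {U : T} (x : U ⟶ X) (h k : U ⟶ H.obj) : Q.P x (h - k) = Q.P x h - Q.P x k := by
  rw [eq_sub_iff_add_eq, ← Q.P_add, sub_add_cancel]

theorem P_zero {U : T} (x : U ⟶ X) : Q.P x (0 : U ⟶ H.obj) = 0 := by
  have := Q.P_sub x 0 0
  rwa [sub_self, sub_self] at this

theorem normSq_P_le {U : T} (x : U ⟶ X) (h : U ⟶ H.obj) : H.normSq (Q.P x h) ≤ H.normSq h := by
  have h1 := H.normSq_nonneg (h - Q.P x h)
  rw [H.normSq_sub, ← Q.P_P x h, ← Q.inner_P, Q.P_P, ← PreHilbertSpace.normSq] at h1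
  rw [← sub_nonneg]
  refine h1.trans_eq ?_
  ring

end ProjFamily

/-- A grading of a Hilbert space by an object `X`: a family of orthogonal projections `P x`, for `x`
in `X`, which are mutually orthogonal for different `x` and whose ranges span a dense subspace. -/
structure Grading {T : Type u} [Category.{v} T] (H : HilbertSpace T) (X : T) extends
    ProjFamily H X where
  P_ne : ∀ {U : T} (x y : U ⟶ X) (h : U ⟶ H.obj), InternallyNe (can T) x y → P x (P y h) = 0
  dense : H.DenseSpan (fun V => {z | ∃ (x : V ⟶ X) (h : V ⟶ H.obj), z = P x h})

namespace Grading

variable {T : Type u} [Category.{v} T] {X : T} {H H' : HilbertSpace T} (G : Grading H X)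
  (G' : Grading H' X) {U V : T}

theorem P_comm (hX : IsDecidable X) (x y : U ⟶ X) (h : U ⟶ H.obj) :
    G.P x (G.P y h) = G.P y (G.P x h) := by
  refine hom_ext_of_locally ((hX x y).mono fun V f hf => ?_)
  simp only [G.comp_P]
  rcases hf with hf | hf
  · rw [hf]
  · rw [G.P_ne _ _ _ hf, G.P_ne _ _ _ hf.symm]

/-- Vectors with the same components are equal. -/
theorem ext {h k : U ⟶ H.obj}
    (e : ∀ ⦃V : T⦄ (f : V ⟶ U) (x : V ⟶ X), G.P x (f ≫ h) = G.P x (f ≫ k)) : h = k := by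
  rw [← sub_eq_zero]
  refine G.dense.eq_zero fun V f s hs => ?_
  obtain ⟨x, z, rfl⟩ := hs
  rw [← G.inner_P, H.comp_sub, G.P_sub, e, sub_self, H.inner_zero_left]

/-- The projection onto the complement of the components with index in a list. -/
def E (l : List (U ⟶ X)) (h : U ⟶ H.obj) : U ⟶ H.obj :=
  match l with
  | [] => h
  | x :: l => E l h - G.P x (E l h)

@[simp] theorem E_nil (h : U ⟶ H.obj) : G.E [] h = h := rfl

theorem E_cons (x : U ⟶ X) (l : List (U ⟶ X)) (h : U ⟶ H.obj) :
    G.E (x :: l) h = G.E l h - G.P x (G.E l h) := rfl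

theorem comp_E (f : V ⟶ U) (l : List (U ⟶ X)) (h : U ⟶ H.obj) :
    f ≫ G.E l h = G.E (l.map (f ≫ ·)) (f ≫ h) := by
  induction l with
  | nil => rfl
  | cons x l ih => rw [E_cons, H.comp_sub, G.comp_P, ih]; rfl

theorem E_sub (l : List (U ⟶ X)) (h k : U ⟶ H.obj) : G.E l (h - k) = G.E l h - G.E l k := by
  induction l with
  | nil => rfl
  | cons x l ih => rw [E_cons, ih, G.P_sub, E_cons, E_cons]; abel

theorem E_add (l : List (U ⟶ X)) (h k : U ⟶ H.obj) : G.E l (h + k) = G.E l h + G.E l k := by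
  induction l with
  | nil => rfl
  | cons x l ih => rw [E_cons, ih, G.P_add, E_cons, E_cons]; abel

theorem E_smul (l : List (U ⟶ X)) (c : Cx (can T) U) (h : U ⟶ H.obj) :
    G.E l (c • h) = c • G.E l h := by
  induction l with
  | nil => rfl
  | cons x l ih => rw [E_cons, ih, G.P_smul, E_cons, smul_sub]

theorem E_zero (l : List (U ⟶ X)) : G.E l (0 : U ⟶ H.obj) = 0 := by
  have := G.E_sub l 0 0
  rwa [sub_self, sub_self] at this

variable (hX : IsDecidable X)
include hX

theorem P_E (x : U ⟶ X) (l : List (U ⟶ X)) (h : U ⟶ H.obj) :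
    G.P x (G.E l h) = G.E l (G.P x h) := by
  induction l with
  | nil => rfl
  | cons y l ih => rw [E_cons, G.P_sub, G.P_comm hX, ih, E_cons]

theorem inner_E (l : List (U ⟶ X)) (h k : U ⟶ H.obj) :
    H.inner (G.E l h) k = H.inner h (G.E l k) := by
  induction l generalizing h k with
  | nil => rfl
  | cons x l ih =>
    rw [E_cons, H.inner_sub_left, ih, G.inner_P, ih, E_cons, H.inner_sub_right, G.P_E hX]

omit hX in
theorem E_append (l m : List (U ⟶ X)) (h : U ⟶ H.obj) :
    G.E (l ++ m) h = G.E l (G.E m h) := by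
  induction l with
  | nil => rfl
  | cons x l ih => rw [List.cons_append, E_cons, ih, E_cons]

theorem E_comm (l m : List (U ⟶ X)) (h : U ⟶ H.obj) :
    G.E l (G.E m h) = G.E m (G.E l h) := by
  induction l with
  | nil => rfl
  | cons x l ih => rw [E_cons, ih, G.P_E hX, E_cons, G.E_sub]

theorem E_E (l : List (U ⟶ X)) (h : U ⟶ H.obj) : G.E l (G.E l h) = G.E l h := by
  induction l with
  | nil => rfl
  | cons x l ih =>
    rw [E_cons, E_cons, G.E_sub, ih, ← G.P_E hX, ih, G.P_sub, G.P_P, sub_self, sub_zero]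

theorem normSq_eq_add (l : List (U ⟶ X)) (h : U ⟶ H.obj) :
    H.normSq h = H.normSq (G.E l h) + H.normSq (h - G.E l h) := by
  rw [← H.normSq_add_of_inner_eq_zero, add_sub_cancel]
  rw [G.inner_E hX, G.E_sub, G.E_E hX, sub_self, H.inner_zero_right]

theorem normSq_E_le (l : List (U ⟶ X)) (h : U ⟶ H.obj) : H.normSq (G.E l h) ≤ H.normSq h := by
  rw [G.normSq_eq_add hX l h]
  exact le_add_of_nonneg_right (H.normSq_nonneg _)

theorem normSq_sub_E_le (l : List (U ⟶ X)) (h : U ⟶ H.obj) :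
    H.normSq (h - G.E l h) ≤ H.normSq h := by
  conv_rhs => rw [G.normSq_eq_add hX l h]
  exact le_add_of_nonneg_left (H.normSq_nonneg _)

theorem E_P_of_mem {x : U ⟶ X} {l : List (U ⟶ X)} (hx : x ∈ l) (h : U ⟶ H.obj) :
    G.E l (G.P x h) = 0 := by
  induction l with
  | nil => simp at hx
  | cons y l ih =>
    rcases List.mem_cons.1 hx with rfl | hx
    · rw [E_cons, ← G.P_E hX, G.P_P, sub_self]
    · rw [E_cons, ih hx, G.P_zero, sub_zero]

omit hX in
theorem E_P_of_ne {x : U ⟶ X} {l : List (U ⟶ X)} (hx : ∀ y ∈ l, InternallyNe (can T) x y)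
    (h : U ⟶ H.obj) : G.E l (G.P x h) = G.P x h := by
  induction l with
  | nil => rfl
  | cons y l ih =>
    rw [E_cons, ih fun z hz => hx z (List.mem_cons_of_mem _ hz),
      G.P_ne _ _ _ (hx y List.mem_cons_self).symm, sub_zero]

theorem exists_E_eq_zero {y : U ⟶ H.obj}
    (hy : y ∈ Submodule.span (Cx (can T) U) {z | ∃ (x : U ⟶ X) (h : U ⟶ H.obj), z = G.P x h}) :
    ∃ l : List (U ⟶ X), G.E l y = 0 := by
  induction hy using Submodule.span_induction with
  | mem z hz =>
    obtain ⟨x, h, rfl⟩ := hz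
    exact ⟨[x], G.E_P_of_mem hX (by simp) h⟩
  | zero => exact ⟨[], rfl⟩
  | add a b _ _ ha hb =>
    obtain ⟨l, hl⟩ := ha
    obtain ⟨m, hm⟩ := hb
    refine ⟨l ++ m, ?_⟩
    rw [G.E_append, G.E_add, hm, add_zero, G.E_comm hX, hl, G.E_zero]
  | smul c a _ ha =>
    obtain ⟨l, hl⟩ := ha
    exact ⟨l, by rw [G.E_smul, hl, smul_zero]⟩

/-- Every vector is locally approximated by its finite partial sums. -/
theorem locally_normLE_E (h : U ⟶ H.obj) {ε : ℝ} (hε : 0 < ε) :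
    Locally (can T) (fun ⦃V : T⦄ (f : V ⟶ U) => ∃ l : List (V ⟶ X),
      H.NormLE (G.E l (f ≫ h)) ε) := by
  obtain ⟨δ, hδ, hδε⟩ := exists_rat_btwn hε
  refine (G.dense h δ (by exact_mod_cast hδ)).mono fun V f ⟨y, hy, hle⟩ => ?_
  obtain ⟨l, hl⟩ := G.exists_E_eq_zero hX hy
  refine ⟨l, PreHilbertSpace.NormLE.mono (le_trans ?_ hle) hδ.le hδε.le⟩
  have := G.normSq_E_le hX l (f ≫ h - y)
  rwa [G.E_sub, hl, sub_zero] at this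

omit hX in
theorem sub_E_cons (x : U ⟶ X) (l : List (U ⟶ X)) (h : U ⟶ H.obj) :
    h - G.E (x :: l) h = (h - G.E l h) + G.P x (G.E l h) := by
  rw [E_cons]; abel

/-! ### Scalar products and components -/

theorem inner_sub_E_eq {v w : U ⟶ H.obj} {v' w' : U ⟶ H'.obj}
    (e : ∀ ⦃V : T⦄ (f : V ⟶ U) (x : V ⟶ X),
      H.inner (G.P x (f ≫ v)) (f ≫ w) = H'.inner (G'.P x (f ≫ v')) (f ≫ w'))
    (f : V ⟶ U) (l : List (V ⟶ X)) :
    H.inner (f ≫ v - G.E l (f ≫ v)) (f ≫ w) =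
      H'.inner (f ≫ v' - G'.E l (f ≫ v')) (f ≫ w') := by
  induction l with
  | nil =>
    rw [E_nil, E_nil, sub_self, sub_self, H.inner_zero_left, H'.inner_zero_left]
  | cons x l ih =>
    rw [sub_E_cons, sub_E_cons, H.inner_add_left, H'.inner_add_left, ih]
    congr 1
    refine Cx.eq_of_locally ((hX.locally_mem_or l x).mono fun W g hg => ?_)
    rw [H.inner_restrict, H'.inner_restrict, G.comp_P, G'.comp_P, comp_E, comp_E, P_E _ hX,
      P_E _ hX]
    rcases hg with hg | hg
    · rw [G.E_P_of_mem hX hg, G'.E_P_of_mem hX hg, H.inner_zero_left, H'.inner_zero_left]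
    · rw [G.E_P_of_ne hg, G'.E_P_of_ne hg]
      simpa only [Category.assoc] using e (g ≫ f) (g ≫ x)

/-- The scalar product is determined by the components. -/
theorem inner_eq_of_P {v w : U ⟶ H.obj} {v' w' : U ⟶ H'.obj}
    (e : ∀ ⦃V : T⦄ (f : V ⟶ U) (x : V ⟶ X),
      H.inner (G.P x (f ≫ v)) (f ≫ w) = H'.inner (G'.P x (f ≫ v')) (f ≫ w')) :
    H.inner v w = H'.inner v' w' := by
  rw [← H.star_inner, ← H'.star_inner]
  congr 1
  refine PreHilbertSpace.inner_eq_of_approx fun t ht => ?_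
  refine (G.locally_normLE_E hX v ht).bind fun V f ⟨l, hl⟩ => ?_
  refine ((G'.locally_normLE_E hX v' ht).restrict f).mono fun W g ⟨m, hm⟩ => ?_
  have e1 := G.inner_sub_E_eq G' hX e (g ≫ f) (m ++ l.map (g ≫ ·))
  refine ⟨_, _, ?_, ?_, by rw [← H.star_inner, e1, H'.star_inner]⟩
  · rw [sub_sub_cancel, E_append]
    refine (G.normSq_E_le hX _ _).trans ?_
    have := hl.comp g
    rwa [comp_E, ← Category.assoc] at this
  · rw [sub_sub_cancel, E_append, G'.E_comm hX]
    exact (G'.normSq_E_le hX _ _).trans hm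

end Grading


/-! ### Vectors with prescribed components -/

theorem PreHilbertSpace.NormLE.of_forall_add {T : Type u} [Category.{v} T] {H : PreHilbertSpace T}
    {U : T} {x : U ⟶ H.obj} {r : ℝ} (hr : 0 ≤ r)
    (h : ∀ η : ℝ, 0 < η → H.NormLE x (r + η)) : H.NormLE x r := by
  refine DReal.le_of_forall_pos_le_add fun ε hε => ?_
  have hpos : 0 < ε / (2 * r + 1 + ε) := by positivity
  refine (h _ hpos).trans ?_
  rw [← DReal.const_add]
  apply DReal.const_mono
  have h1 : ε / (2 * r + 1 + ε) ≤ 1 := by rw [div_le_one (by positivity)]; linarith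
  have h2 : ε / (2 * r + 1 + ε) * (2 * r + 1 + ε) = ε := div_mul_cancel₀ _ (by positivity)
  nlinarith

namespace Grading

variable {T : Type u} [Category.{v} T] {X : T} {H H' : HilbertSpace T} (G : Grading H X)
  (G' : Grading H' X) {U : T}

/-- A family of vectors `k x`, for `x` in `X`, in the components of a graded Hilbert space, which is
dominated by the family of components of a vector `h` of another graded Hilbert space. -/
structure Dominated (h : U ⟶ H.obj) where
  k : ∀ ⦃V : T⦄, (V ⟶ U) → (V ⟶ X) → (V ⟶ H'.obj)
  comp_k : ∀ ⦃V W : T⦄ (f : V ⟶ U) (x : V ⟶ X) (g : W ⟶ V), g ≫ k f x = k (g ≫ f) (g ≫ x)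
  P_k : ∀ ⦃V : T⦄ (f : V ⟶ U) (x : V ⟶ X), G'.P x (k f x) = k f x
  c : DReal (can T) U
  c_nonneg : 0 ≤ c
  bound : ∀ ⦃V : T⦄ (f : V ⟶ U) (x : V ⟶ X),
    H'.normSq (k f x) ≤ c.restrict f * H.normSq (G.P x (f ≫ h))

namespace Dominated

variable {G G'} {h : U ⟶ H.obj} (D : Dominated G G' h) {V W : T}

/-- The partial sum of the family over the elements of a list, each of which is counted once. -/
def sum (f : V ⟶ U) (l : List (V ⟶ X)) : V ⟶ H'.obj :=
  match l with
  | [] => 0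
  | x :: l => sum f l + G'.E l (D.k f x)

@[simp] theorem sum_nil (f : V ⟶ U) : D.sum f [] = 0 := rfl

theorem sum_cons (f : V ⟶ U) (x : V ⟶ X) (l : List (V ⟶ X)) :
    D.sum f (x :: l) = D.sum f l + G'.E l (D.k f x) := rfl

theorem comp_sum (f : V ⟶ U) (l : List (V ⟶ X)) (g : W ⟶ V) :
    g ≫ D.sum f l = D.sum (g ≫ f) (l.map (g ≫ ·)) := by
  induction l with
  | nil => exact H'.comp_zero g
  | cons x l ih => rw [sum_cons, H'.comp_add, ih, G'.comp_E, D.comp_k]; rfl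

variable (hX : IsDecidable X)
include hX

theorem P_k_comm (f : V ⟶ U) (x y : V ⟶ X) : G'.P x (D.k f y) = G'.P y (D.k f x) := by
  refine hom_ext_of_locally ((hX x y).mono fun W g hg => ?_)
  rw [G'.comp_P, G'.comp_P, D.comp_k, D.comp_k]
  rcases hg with hg | hg
  · rw [hg]
  · rw [← D.P_k _ (g ≫ y), G'.P_ne _ _ _ hg, ← D.P_k _ (g ≫ x), G'.P_ne _ _ _ hg.symm]

theorem P_sum (f : V ⟶ U) (x : V ⟶ X) (l : List (V ⟶ X)) :
    G'.P x (D.sum f l) = D.k f x - G'.E l (D.k f x) := by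
  induction l with
  | nil => rw [sum_nil, G'.P_zero, E_nil, sub_self]
  | cons y l ih =>
    rw [sum_cons, G'.P_add, ih, G'.P_E hX, D.P_k_comm hX, G'.E_cons, G'.P_E hX]
    abel

theorem E_sum (f : V ⟶ U) (l : List (V ⟶ X)) : G'.E l (D.sum f l) = 0 := by
  induction l with
  | nil => rfl
  | cons x l ih =>
    rw [sum_cons, E_cons, G'.E_add, ih, G'.E_E hX, zero_add, G'.P_E hX, D.P_k, sub_self]

theorem sub_E_sum (f : V ⟶ U) (l m : List (V ⟶ X)) :
    D.sum f m - G'.E l (D.sum f m) = D.sum f l - G'.E m (D.sum f l) := by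
  induction l with
  | nil => rw [E_nil, sum_nil, G'.E_zero, sub_self, sub_self]
  | cons x l ih =>
    rw [G'.sub_E_cons, ih, G'.P_E hX, D.P_sum hX, sum_cons, G'.E_add, G'.E_sub, G'.E_comm hX l m]
    abel

theorem normSq_E_sum_le (f : V ⟶ U) (l m : List (V ⟶ X)) :
    H'.normSq (G'.E l (D.sum f m)) ≤
      D.c.restrict f * H.normSq (G.E l (f ≫ h - G.E m (f ≫ h))) := by
  induction m with
  | nil =>
    rw [sum_nil, G'.E_zero, H'.normSq_zero, E_nil, sub_self, G.E_zero, H.normSq_zero, mul_zero]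
  | cons x m ih =>
    have o1 : H'.inner (G'.E l (D.sum f m)) (G'.E l (G'.E m (D.k f x))) = 0 := by
      rw [G'.E_comm hX l m, ← G'.inner_E hX, G'.E_comm hX m l, D.E_sum hX, G'.E_zero,
        H'.inner_zero_left]
    have o2 : H.inner (G.E l (f ≫ h - G.E m (f ≫ h))) (G.E l (G.P x (G.E m (f ≫ h)))) = 0 := by
      rw [G.P_E hX, G.E_comm hX l m, ← G.inner_E hX, G.E_comm hX m l, G.E_sub m, G.E_E hX,
        sub_self, G.E_zero, H.inner_zero_left]
    rw [sum_cons, G'.E_add, H'.normSq_add_of_inner_eq_zero o1, G.sub_E_cons, G.E_add,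
      H.normSq_add_of_inner_eq_zero o2, mul_add]
    refine add_le_add ih ?_
    rw [G.P_E hX, ← E_append, ← E_append]
    refine DReal.le_of_locally ((hX.locally_mem_or (l ++ m) x).mono fun W g hg => ?_)
    rw [H'.normSq_restrict, DReal.restrict_mul, H.normSq_restrict, G'.comp_E, G.comp_E, D.comp_k,
      G.comp_P, ← D.P_k]
    rcases hg with hg | hg
    · rw [G.E_P_of_mem hX hg, G'.E_P_of_mem hX hg, H'.normSq_zero, H.normSq_zero, mul_zero]
    · rw [G.E_P_of_ne hg, G'.E_P_of_ne hg, D.P_k, ← DReal.restrict_comp, ← Category.assoc]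
      exact D.bound (g ≫ f) (g ≫ x)

theorem normSq_E_sum_le' (f : V ⟶ U) (l m : List (V ⟶ X)) :
    H'.normSq (G'.E l (D.sum f m)) ≤ D.c.restrict f * H.normSq (G.E l (f ≫ h)) := by
  refine (D.normSq_E_sum_le hX f l m).trans (mul_le_mul_of_nonneg_left ?_ ?_)
  · rw [G.E_sub, G.E_comm hX l m]
    exact G.normSq_sub_E_le hX m _
  · exact (DReal.restrict_zero f).symm.le.trans (DReal.restrict_mono D.c_nonneg f)

omit hX in
theorem sub_E_eq_sum {f : V ⟶ U} {w : V ⟶ H'.obj}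
    (hw : ∀ x : V ⟶ X, G'.P x w = D.k f x) (hX : IsDecidable X) (l : List (V ⟶ X)) :
    w - G'.E l w = D.sum f l := by
  induction l with
  | nil => rw [E_nil, sub_self, sum_nil]
  | cons x l ih => rw [G'.sub_E_cons, ih, G'.P_E hX, hw, sum_cons]

/-- A dominated family of vectors is the family of components of a vector.  The vectors whose finite
partial sums are within `ε` of those of the family form a Cauchy approximation. -/
theorem exists_vector : ∃ w : U ⟶ H'.obj,
    ∀ ⦃V : T⦄ (f : V ⟶ U) (x : V ⟶ X), G'.P x (f ≫ w) = D.k f x := by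
  let A : ℚ → ∀ ⦃V : T⦄, (V ⟶ U) → (V ⟶ H'.obj) → Prop := fun ε V f a =>
    ∀ ⦃W : T⦄ (g : W ⟶ V) (m : List (W ⟶ X)),
      H'.NormLE ((g ≫ a - G'.E m (g ≫ a)) - D.sum (g ≫ f) m) ε
  have hA : H'.IsCauchyApproximation A :=
    { restrict := fun ε _ V f a ha W g Z k m => by
        simpa only [Category.assoc] using ha (k ≫ g) m
      glue := fun ε _ V f a ha W g m => by
        refine PreHilbertSpace.NormLE.of_locally ((ha.restrict g).mono fun Z k hk => ?_)
        have := hk (𝟙 Z) (m.map (k ≫ ·))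
        simpa only [Category.id_comp, Category.assoc, H'.comp_sub, G'.comp_E, D.comp_sum] using this
      inhabited := fun ε hε => by
        have hε' : (0 : ℝ) < ε := by exact_mod_cast hε
        refine D.c.locally_le_const.bind fun V f ⟨n, hn⟩ => ?_
        have hn1 : (0 : ℝ) < n + 1 := by positivity
        refine ((G.locally_normLE_E hX h (ε := ε / (n + 1)) (by positivity)).restrict f).mono
          fun W g ⟨l, hl⟩ => ⟨D.sum (g ≫ f) l, fun Z k m => ?_⟩
        rw [D.comp_sum, ← D.sub_E_sum hX, ← neg_sub, sub_sub_cancel, ← Category.assoc k g f]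
        refine PreHilbertSpace.NormLE.neg ?_
        refine (D.normSq_E_sum_le' hX _ _ _).trans ?_
        have h1 := DReal.restrict_mono hn (k ≫ g)
        rw [DReal.restrict_const, ← DReal.restrict_comp] at h1
        have h2 := hl.comp k
        rw [G.comp_E, ← Category.assoc, ← Category.assoc] at h2
        refine (mul_le_mul h1 h2 (H.normSq_nonneg _)
          (DReal.const_nonneg (Nat.cast_nonneg n))).trans ?_
        rw [← DReal.const_mul]
        apply DReal.const_mono
        rw [div_pow, mul_div_assoc', div_le_iff₀ (by positivity)]
        nlinarith [(Nat.cast_nonneg n : (0 : ℝ) ≤ n), mul_nonneg (sq_nonneg (ε : ℝ))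
          (sq_nonneg (n : ℝ)), mul_nonneg (sq_nonneg (ε : ℝ)) (Nat.cast_nonneg n : (0 : ℝ) ≤ n)]
      cauchy := fun ε hε δ hδ V f a b ha hb => by
        have hε' : (0 : ℝ) < ε := by exact_mod_cast hε
        have hδ' : (0 : ℝ) < δ := by exact_mod_cast hδ
        push_cast
        refine PreHilbertSpace.NormLE.of_forall_add (by positivity) fun η hη => ?_
        refine PreHilbertSpace.NormLE.of_locally
          ((G'.locally_normLE_E hX (a - b) hη).mono fun W g ⟨m, hm⟩ => ?_)
        have := ((ha g m).sub_trans (hb g m).sub_comm hε' hδ' |>.add hm (by positivity) hη)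
        convert this using 1
        rw [H'.comp_sub, G'.E_sub]
        abel }
  obtain ⟨w, hw⟩ := H'.complete A hA
  refine ⟨w, fun V f x => PreHilbertSpace.eq_of_forall_normLE fun ε hε => ?_⟩
  obtain ⟨δ, hδ, hδε⟩ := exists_rat_btwn (half_pos hε)
  have hδ0 : (0 : ℚ) < δ := by exact_mod_cast hδ
  refine PreHilbertSpace.NormLE.of_locally
    (((hA.inhabited δ hδ0).restrict f).mono fun W g ⟨a, ha⟩ => ?_)
  have h1 : H'.NormLE (G'.P (g ≫ x) ((g ≫ f) ≫ w) - G'.P (g ≫ x) a) δ := by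
    rw [← G'.P_sub]
    exact (G'.normSq_P_le _ _).trans (hw δ hδ0 (g ≫ f) a ha)
  have h2 := ha (𝟙 W) [g ≫ x]
  rw [sum_cons, sum_nil, E_cons, E_nil, zero_add, E_nil, sub_sub_cancel, Category.id_comp,
    Category.id_comp] at h2
  have := (h1.sub_trans h2 hδ hδ).mono (by linarith) (show (δ : ℝ) + δ ≤ ε by linarith)
  rw [H'.comp_sub, G'.comp_P, D.comp_k, ← Category.assoc]
  exact this

/-- The vector whose components are a given dominated family. -/
def vector : U ⟶ H'.obj := (D.exists_vector hX).choose

theorem P_vector (f : V ⟶ U) (x : V ⟶ X) : G'.P x (f ≫ D.vector hX) = D.k f x :=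
  (D.exists_vector hX).choose_spec f x

theorem normSq_vector_le : H'.normSq (D.vector hX) ≤ D.c * H.normSq h := by
  refine DReal.le_of_forall_pos_le_add fun ε hε => ?_
  refine DReal.le_of_locally ((G'.locally_normLE_E hX (D.vector hX) (Real.sqrt_pos.2 hε)).mono
    fun V f ⟨l, hl⟩ => ?_)
  rw [PreHilbertSpace.NormLE, Real.sq_sqrt hε.le] at hl
  rw [H'.normSq_restrict, DReal.restrict_add, DReal.restrict_mul, H.normSq_restrict,
    DReal.restrict_const, G'.normSq_eq_add hX l, add_comm]
  refine add_le_add ?_ hl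
  rw [D.sub_E_eq_sum (fun x => D.P_vector hX f x) hX]
  have := D.normSq_E_sum_le' hX f [] l
  simpa using this

end Dominated

variable {G G'}

/-- An operator between graded Hilbert spaces is given by its components `t x : h ↦ P x (t h)` and
those of its adjoint. -/
structure Components (G : Grading H X) (G' : Grading H' X) where
  t : ∀ {U : T}, (U ⟶ X) → (U ⟶ H.obj) → (U ⟶ H'.obj)
  s : ∀ {U : T}, (U ⟶ X) → (U ⟶ H'.obj) → (U ⟶ H.obj)
  comp_t : ∀ {U V : T} (f : V ⟶ U) (x : U ⟶ X) (h : U ⟶ H.obj), f ≫ t x h = t (f ≫ x) (f ≫ h)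
  comp_s : ∀ {U V : T} (f : V ⟶ U) (x : U ⟶ X) (h : U ⟶ H'.obj), f ≫ s x h = s (f ≫ x) (f ≫ h)
  P_t : ∀ {U : T} (x : U ⟶ X) (h : U ⟶ H.obj), G'.P x (t x h) = t x h
  P_s : ∀ {U : T} (x : U ⟶ X) (h : U ⟶ H'.obj), G.P x (s x h) = s x h
  inner_t : ∀ {U : T} (x : U ⟶ X) (h : U ⟶ H.obj) (h' : U ⟶ H'.obj),
    H'.inner (t x h) h' = H.inner h (s x h')
  c : ℝ
  c_nonneg : 0 ≤ c
  bound_t : ∀ {U : T} (x : U ⟶ X) (h : U ⟶ H.obj),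
    H'.normSq (t x h) ≤ DReal.const (c ^ 2) * H.normSq (G.P x h)
  bound_s : ∀ {U : T} (x : U ⟶ X) (h : U ⟶ H'.obj),
    H.normSq (s x h) ≤ DReal.const (c ^ 2) * H'.normSq (G'.P x h)

namespace Components

variable (A : Components G G')

/-- The components of the image of a vector under the operator to be constructed. -/
def dominated (h : U ⟶ H.obj) : Dominated G G' h where
  k V f x := A.t x (f ≫ h)
  comp_k V W f x g := by rw [A.comp_t, Category.assoc]
  P_k V f x := A.P_t x _
  c := DReal.const (A.c ^ 2)
  c_nonneg := DReal.const_nonneg (sq_nonneg _)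
  bound V f x := by rw [DReal.restrict_const]; exact A.bound_t x _

/-- The components of the adjoint operator. -/
def symm : Components G' G where
  t := A.s
  s := A.t
  comp_t := A.comp_s
  comp_s := A.comp_t
  P_t := A.P_s
  P_s := A.P_t
  inner_t x h h' := by rw [← H.star_inner, ← A.inner_t, H'.star_inner]
  c := A.c
  c_nonneg := A.c_nonneg
  bound_t := A.bound_s
  bound_s := A.bound_t

variable (hX : IsDecidable X)

/-- The value at a vector of the operator with given components. -/
def vec (h : U ⟶ H.obj) : U ⟶ H'.obj := (A.dominated h).vector hX

theorem P_vec (x : U ⟶ X) (h : U ⟶ H.obj) : G'.P x (A.vec hX h) = A.t x h := by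
  have := (A.dominated h).P_vector hX (𝟙 U) x
  rw [Category.id_comp] at this
  exact this.trans (congrArg (A.t x) (Category.id_comp h))

theorem comp_vec {V : T} (f : V ⟶ U) (h : U ⟶ H.obj) : f ≫ A.vec hX h = A.vec hX (f ≫ h) := by
  refine G'.ext fun W g x => ?_
  rw [vec, vec, Dominated.P_vector, ← Category.assoc, Dominated.P_vector]
  simp only [dominated, Category.assoc]

theorem inner_vec (h : U ⟶ H.obj) (k : U ⟶ H'.obj) :
    H'.inner (A.vec hX h) k = H.inner h (A.symm.vec hX k) :=
  G'.inner_eq_of_P G hX fun V f x => by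
    rw [comp_vec, comp_vec, P_vec, G.inner_P, P_vec]
    exact A.inner_t x _ _

theorem normSq_vec_le (h : U ⟶ H.obj) :
    H'.normSq (A.vec hX h) ≤ DReal.const (A.c ^ 2) * H.normSq h :=
  (A.dominated h).normSq_vector_le hX

/-- The operator with given components. -/
def op : H ⟶ H' :=
  opMk (fun h => A.vec hX h) (fun h => A.symm.vec hX h) (A.comp_vec hX) (A.symm.comp_vec hX)
    (A.inner_vec hX) A.c A.c_nonneg (A.normSq_vec_le hX)

theorem P_op (x : U ⟶ X) (h : U ⟶ H.obj) : G'.P x (BoundedOp.app (A.op hX) h) = A.t x h := by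
  refine (congrArg (G'.P x) ?_).trans (A.P_vec hX x h)
  exact opMk_app _ _ _ (A.symm.comp_vec hX) _ _ _ _ h

theorem P_adjoint_op (x : U ⟶ X) (h : U ⟶ H'.obj) :
    G.P x (BoundedOp.app (adjoint (A.op hX)) h) = A.s x h := by
  refine (congrArg (G.P x) ?_).trans (A.symm.P_vec hX x h)
  exact adjoint_opMk_app _ _ _ (A.symm.comp_vec hX) _ _ _ _ h

end Components

/-- Vectors with the same components at all stages are equal; a version for naturally given vectors. -/
theorem ext_app {H₁ : HilbertSpace T} (G : Grading H X) {s t : H₁ ⟶ H}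
    (h : ∀ ⦃U : T⦄ (x : U ⟶ X) (a : U ⟶ H₁.obj),
      G.P x (BoundedOp.app s a) = G.P x (BoundedOp.app t a)) : s = t :=
  BoundedOp.hom_ext fun U a => G.ext fun V f x => by
    rw [BoundedOp.comp_app, BoundedOp.comp_app, h]

end Grading


/-! ### The Kronecker symbol of a decidable object -/

section Kronecker

variable {T : Type u} [Category.{v} T] {X U V : T}

theorem DReal.eq_of_inconsistent {C : Type u} [Category.{v} C] {J : GrothendieckTopology C} {U : C}
    (x y : DReal J U) (h : Inconsistent J U) : x = y :=
  DReal.eq_of_locally (h.locally _)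

theorem IsDecidable.exists_kronecker (hX : IsDecidable X) (x y : U ⟶ X) :
    ∃ r : DReal (can T) U, ∀ ⦃V : T⦄ (f : V ⟶ U), (f ≫ x = f ≫ y → r.restrict f = 1) ∧
      (InternallyNe (can T) (f ≫ x) (f ≫ y) → r.restrict f = 0) := by
  obtain ⟨r, hr⟩ := DReal.exists_limit (J := can T) (U := U) (fun _ V f a =>
      ∀ ⦃W : T⦄ (g : W ⟶ V), ((g ≫ f) ≫ x = (g ≫ f) ≫ y → a.restrict g = 1) ∧
        (InternallyNe (can T) ((g ≫ f) ≫ x) ((g ≫ f) ≫ y) → a.restrict g = 0))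
    (fun ε _ V f a ha W g Z k => by
      rw [← DReal.restrict_comp, ← Category.assoc]
      exact ha (k ≫ g))
    (fun ε _ => (hX x y).mono fun V f hf => by
      rcases hf with hf | hf
      · refine ⟨1, fun W g => ⟨fun _ => DReal.restrict_one g, fun h => ?_⟩⟩
        refine DReal.eq_of_inconsistent _ _ (h (𝟙 W) ?_)
        rw [Category.assoc, Category.assoc, hf]
      · refine ⟨0, fun W g => ⟨fun h => ?_, fun _ => DReal.restrict_zero g⟩⟩
        refine DReal.eq_of_inconsistent _ _ (hf g ?_)
        rw [← Category.assoc, ← Category.assoc, h])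
    (fun ε hε δ hδ V f a b ha hb => by
      refine DReal.le_of_locally ((hX (f ≫ x) (f ≫ y)).mono fun W g hg => ?_)
      have hpos : (0 : DReal (can T) W) ≤ DReal.const ((ε + δ : ℚ) : ℝ) := by
        apply DReal.const_nonneg
        exact_mod_cast (add_pos hε hδ).le
      rw [DReal.restrict_add, DReal.restrict_const]
      simp only [← Category.assoc] at hg
      rcases hg with hg | hg
      · rw [(ha g).1 hg, (hb g).1 hg]
        exact le_add_of_nonneg_right hpos
      · rw [(ha g).2 hg, (hb g).2 hg]
        exact le_add_of_nonneg_right hpos)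
  have key : ∀ ⦃V : T⦄ (f : V ⟶ U) (a : DReal (can T) V), (∀ ⦃W : T⦄ (g : W ⟶ V),
      ((g ≫ f) ≫ x = (g ≫ f) ≫ y → a.restrict g = 1) ∧
        (InternallyNe (can T) ((g ≫ f) ≫ x) ((g ≫ f) ≫ y) → a.restrict g = 0)) →
      r.restrict f = a := by
    intro V f a ha
    refine le_antisymm ?_ ?_ <;>
    · refine DReal.le_of_forall_pos_le_add fun ε hε => ?_
      obtain ⟨δ, hδ, hδε⟩ := exists_rat_btwn hε
      have := hr δ (by exact_mod_cast hδ) f a ha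
      first
      | exact this.1.trans (add_le_add le_rfl (DReal.const_mono hδε.le))
      | exact this.2.trans (add_le_add le_rfl (DReal.const_mono hδε.le))
  refine ⟨r, fun V f => ⟨fun hf => key f 1 fun W g => ⟨fun _ => DReal.restrict_one g, fun h => ?_⟩,
    fun hf => key f 0 fun W g => ⟨fun h => ?_, fun _ => DReal.restrict_zero g⟩⟩⟩
  · refine DReal.eq_of_inconsistent _ _ (h (𝟙 W) ?_)
    rw [Category.assoc, Category.assoc, hf]
  · refine DReal.eq_of_inconsistent _ _ (hf g ?_)
    rw [← Category.assoc, ← Category.assoc, h]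

/-- The Kronecker symbol: `1` if `x = y` and `0` if `x ≠ y`. -/
def IsDecidable.kron (hX : IsDecidable X) (x y : U ⟶ X) : Cx (can T) U :=
  Cx.ofReal (hX.exists_kronecker x y).choose

variable (hX : IsDecidable X)

theorem IsDecidable.kron_self (x : U ⟶ X) : hX.kron x x = 1 := by
  have := ((hX.exists_kronecker x x).choose_spec (𝟙 U)).1 rfl
  rw [DReal.restrict_id] at this
  rw [kron, this, Cx.ofReal_one]

theorem IsDecidable.kron_ne {x y : U ⟶ X} (h : InternallyNe (can T) x y) : hX.kron x y = 0 := by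
  have := ((hX.exists_kronecker x y).choose_spec (𝟙 U)).2 (by simpa using h)
  rw [DReal.restrict_id] at this
  rw [kron, this, Cx.ofReal_zero]

theorem IsDecidable.kron_restrict (x y : U ⟶ X) (f : V ⟶ U) :
    (hX.kron x y).restrict f = hX.kron (f ≫ x) (f ≫ y) := by
  refine Cx.eq_of_locally ((hX (f ≫ x) (f ≫ y)).mono fun W g hg => ?_)
  rw [← Cx.restrict_comp]
  have h1 := (hX.exists_kronecker x y).choose_spec (g ≫ f)
  have h2 := (hX.exists_kronecker (f ≫ x) (f ≫ y)).choose_spec g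
  rw [kron, kron, Cx.restrict_ofReal, Cx.restrict_ofReal]
  rcases hg with hg | hg
  · rw [h1.1 (by simpa using hg), h2.1 hg]
  · rw [h1.2 (by simpa using hg), h2.2 hg]

theorem IsDecidable.kron_comm (x y : U ⟶ X) : hX.kron x y = hX.kron y x := by
  refine Cx.eq_of_locally ((hX x y).mono fun W g hg => ?_)
  rw [hX.kron_restrict, hX.kron_restrict]
  rcases hg with hg | hg
  · rw [hg]
  · rw [hX.kron_ne hg, hX.kron_ne hg.symm]

theorem IsDecidable.star_kron (x y : U ⟶ X) : star (hX.kron x y) = hX.kron x y :=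
  Cx.star_ofReal _

end Kronecker

/-! ### The category of graded Hilbert spaces -/

/-- A Hilbert space with a grading by `X`. -/
structure GradedHilbert {T : Type u} [Category.{v} T] (X : T) where
  space : HilbertSpace T
  grading : Grading space X

section GradedCategory

variable {T : Type u} [Category.{v} T] {X : T}

/-- A morphism of graded Hilbert spaces: an operator which commutes with the projections. -/
@[ext]
structure GradedHilbert.Hom (A B : GradedHilbert X) where
  op : A.space ⟶ B.space
  comm : ∀ {U : T} (x : U ⟶ X) (h : U ⟶ A.space.obj),
    BoundedOp.app op (A.grading.P x h) = B.grading.P x (BoundedOp.app op h)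

instance : Category (GradedHilbert X) where
  Hom := GradedHilbert.Hom
  id A := ⟨𝟙 A.space, fun x h => by rw [BoundedOp.app_id, BoundedOp.app_id]⟩
  comp f g := ⟨f.op ≫ g.op, fun x h => by
    rw [BoundedOp.app_comp, f.comm, g.comm, BoundedOp.app_comp]⟩
  id_comp f := by apply GradedHilbert.Hom.ext; exact Category.id_comp _
  comp_id f := by apply GradedHilbert.Hom.ext; exact Category.comp_id _
  assoc f g h := by apply GradedHilbert.Hom.ext; exact Category.assoc _ _ _

end GradedCategory

/-! ### Representations of `C₀(X)` are gradings -/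

section CZeroGraded

variable {T : Type u} [Category.{v} T] {X : T} (hX : IsDecidable X) {U : T}

/-- The characteristic function of an element of `X`. -/
def CZero.delta (x : U ⟶ X) : CZero X U where
  val V f y := hX.kron (f ≫ x) y
  restrict_val V W f g y := by rw [hX.kron_restrict, Category.assoc]
  vanish ε hε := Locally.of_forall fun V f => ⟨[f ≫ x], fun W g y hy => by
    have := hy (f ≫ x) (by simp)
    rw [hX.kron_ne (x := (g ≫ f) ≫ x) (by simpa using this.symm), Cx.absSq_zero]
    exact DReal.const_nonneg (sq_nonneg _)⟩

theorem CZero.delta_restrict (x : U ⟶ X) {V : T} (f : V ⟶ U) :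
    (CZero.delta hX x).restrict f = CZero.delta hX (f ≫ x) := by
  apply CZero.ext
  funext W g y
  change hX.kron ((g ≫ f) ≫ x) y = hX.kron (g ≫ f ≫ x) y
  rw [Category.assoc]

theorem CZero.star_delta (x : U ⟶ X) : star (CZero.delta hX x) = CZero.delta hX x := by
  apply CZero.ext
  funext W g y
  exact hX.star_kron _ _

theorem CZero.mul_delta (a : CZero X U) (x : U ⟶ X) :
    a * CZero.delta hX x = a.val (𝟙 U) x • CZero.delta hX x := by
  apply CZero.ext
  funext V f y
  change a.val f y * hX.kron (f ≫ x) y = (a.val (𝟙 U) x).restrict f * hX.kron (f ≫ x) y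
  rw [a.restrict_val, Category.comp_id]
  refine Cx.eq_of_locally ((hX (f ≫ x) y).mono fun W g hg => ?_)
  rw [Cx.restrict_mul, Cx.restrict_mul, a.restrict_val, a.restrict_val, hX.kron_restrict]
  rcases hg with hg | hg
  · rw [hg]
  · rw [hX.kron_ne hg, mul_zero, mul_zero]

theorem CZero.delta_mul_delta (x y : U ⟶ X) :
    CZero.delta hX x * CZero.delta hX y = hX.kron x y • CZero.delta hX y := by
  rw [CZero.mul_delta]
  congr 1
  change hX.kron (𝟙 U ≫ x) y = _
  rw [Category.id_comp]

namespace CZero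

/-- The function `ε - √(max 0 (ε² - |z|²))` of a complex number. -/
def capFun (ε : ℝ) : C(Fin 2 → ℝ, ℝ) :=
  ⟨fun s => ε - Real.sqrt (max 0 (ε ^ 2 - (s 0 * s 0 + s 1 * s 1))), by fun_prop⟩

theorem capFun_sq_le {ε : ℝ} (hε : 0 < ε) (s : Fin 2 → ℝ) :
    capFun ε s * capFun ε s ≤ s 0 * s 0 + s 1 * s 1 := by
  have ht : 0 ≤ s 0 * s 0 + s 1 * s 1 := add_nonneg (mul_self_nonneg _) (mul_self_nonneg _)
  simp only [capFun, ContinuousMap.coe_mk]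
  generalize s 0 * s 0 + s 1 * s 1 = t at ht ⊢
  rcases le_total (ε ^ 2 - t) 0 with h | h
  · rw [max_eq_left h, Real.sqrt_zero]; nlinarith
  · rw [max_eq_right h]
    have h1 := Real.sq_sqrt h
    have h2 := Real.sqrt_nonneg (ε ^ 2 - t)
    have h3 : Real.sqrt (ε ^ 2 - t) ≤ ε := by
      rw [Real.sqrt_le_left hε.le]; linarith
    nlinarith

/-- `ε - √(max 0 (ε² - |b|²))` for an element `b` of `C₀(X)`.  It vanishes at infinity since it is
bounded by `|b|`. -/
def cap {ε : ℝ} (hε : 0 < ε) (b : CZero X U) : CZero X U where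
  val V f x := Cx.ofReal (DReal.map (capFun ε) ![(b.val f x).re, (b.val f x).im])
  restrict_val V W f g x := by
    rw [Cx.restrict_ofReal, DReal.map_restrict, ← b.restrict_val]
    congr 2
    funext i; fin_cases i <;> rfl
  vanish η hη := by
    refine (b.vanish η hη).mono fun V f ⟨l, hl⟩ => ⟨l, fun W g x hx => le_trans ?_ (hl g x hx)⟩
    set z := b.val (g ≫ f) x
    have e1 : z.re = DReal.map ⟨fun s : Fin 2 → ℝ => s 0, by fun_prop⟩ ![z.re, z.im] :=
      (DReal.map_proj 0 ![z.re, z.im]).symm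
    have e2 : z.im = DReal.map ⟨fun s : Fin 2 → ℝ => s 1, by fun_prop⟩ ![z.re, z.im] :=
      (DReal.map_proj 1 ![z.re, z.im]).symm
    have e3 : z.absSq = DReal.map (⟨fun s : Fin 2 → ℝ => s 0, by fun_prop⟩ *
        ⟨fun s : Fin 2 → ℝ => s 0, by fun_prop⟩ + ⟨fun s : Fin 2 → ℝ => s 1, by fun_prop⟩ *
        ⟨fun s : Fin 2 → ℝ => s 1, by fun_prop⟩) ![z.re, z.im] := by
      rw [← DReal.map_add, ← DReal.map_mul, ← DReal.map_mul, ← e1, ← e2]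
      rfl
    rw [e3]
    have e4 : (Cx.ofReal (DReal.map (capFun ε) ![z.re, z.im])).absSq =
        DReal.map (capFun ε * capFun ε) ![z.re, z.im] := by
      rw [← DReal.map_mul]
      change _ + (0 : DReal (can T) W) * 0 = _
      rw [mul_zero, add_zero]
      rfl
    rw [e4]
    exact DReal.map_mono (fun s => capFun_sq_le hε s) _

theorem cap_mul_cap {ε : ℝ} (hε : 0 < ε) (b : CZero X U)
    (hb : ∀ ⦃V : T⦄ (f : V ⟶ U) (x : V ⟶ X), (b.val f x).absSq ≤ (DReal.const (ε ^ 2) : DReal (can T) V)) :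
    cap hε b * cap hε b + star b * b =
      (Cx.ofReal (DReal.const (2 * ε)) : Cx (can T) U) • cap hε b := by
  apply CZero.ext
  funext V f x
  set z := b.val f x with hz
  set v : Fin 2 → DReal (can T) V := ![z.re, z.im] with hv
  change Cx.ofReal (DReal.map (capFun ε) v) * Cx.ofReal (DReal.map (capFun ε) v) + star z * z =
    (Cx.ofReal (DReal.const (2 * ε))).restrict f * Cx.ofReal (DReal.map (capFun ε) v)
  rw [Cx.star_mul_self, Cx.restrict_ofReal, DReal.restrict_const, ← Cx.ofReal_mul, ← Cx.ofReal_mul]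
  suffices h : DReal.map (capFun ε) v * DReal.map (capFun ε) v + z.absSq =
      DReal.const (2 * ε) * DReal.map (capFun ε) v by
    rw [← h]; ext1 <;> simp [Cx.ofReal]
  let P0 : C(Fin 2 → ℝ, ℝ) := ⟨fun s => s 0, by fun_prop⟩
  let P1 : C(Fin 2 → ℝ, ℝ) := ⟨fun s => s 1, by fun_prop⟩
  let D : C(Fin 2 → ℝ, ℝ) := ContinuousMap.const _ (ε ^ 2) + -(P0 * P0 + P1 * P1)
  have e1 : z.re = DReal.map P0 v := (DReal.map_proj 0 v).symm
  have e2 : z.im = DReal.map P1 v := (DReal.map_proj 1 v).symm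
  have e3 : z.absSq = DReal.map (P0 * P0 + P1 * P1) v := by
    rw [← DReal.map_add, ← DReal.map_mul, ← DReal.map_mul, ← e1, ← e2]; rfl
  have e4 : DReal.const (ε ^ 2) - z.absSq = DReal.map D v := by
    rw [← DReal.map_add, ← DReal.map_neg, ← e3, ← DReal.const_eq_map, sub_eq_add_neg]
  have e5 : (0 : DReal (can T) V) ≤ DReal.map D v := by
    rw [← e4, sub_nonneg]; exact hb f x
  have e6 := DReal.eq_max_of_le e5
  rw [show (![0, DReal.map D v] : Fin 2 → DReal (can T) V) =
      fun k => DReal.map (![ContinuousMap.const _ 0, D] k) v from by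
    funext k; fin_cases k
    · exact DReal.const_eq_map v 0
    · rfl, DReal.map_comp] at e6
  have e7 : DReal.map (capFun ε) v * DReal.map (capFun ε) v + z.absSq +
      -(DReal.const (2 * ε) * DReal.map (capFun ε) v) + (DReal.const (ε ^ 2) - z.absSq) =
      DReal.const (ε ^ 2) - z.absSq := by
    rw [e4]
    conv_rhs => rw [e6]
    rw [← e4, sub_eq_add_neg, e3, DReal.const_eq_map v, DReal.const_eq_map v]
    simp only [DReal.map_mul, DReal.map_neg, DReal.map_add]
    congr 1
    ext s
    have hs := Real.sq_sqrt (le_max_left 0 (ε ^ 2 - (s 0 * s 0 + s 1 * s 1)))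
    change (ε - √(max 0 (ε ^ 2 - (s 0 * s 0 + s 1 * s 1)))) *
      (ε - √(max 0 (ε ^ 2 - (s 0 * s 0 + s 1 * s 1)))) + (s 0 * s 0 + s 1 * s 1) +
      -(2 * ε * (ε - √(max 0 (ε ^ 2 - (s 0 * s 0 + s 1 * s 1))))) +
      (ε ^ 2 + -(s 0 * s 0 + s 1 * s 1)) = max 0 (ε ^ 2 + -(s 0 * s 0 + s 1 * s 1))
    rw [← sub_eq_add_neg (ε ^ 2)]
    linear_combination hs
  have e8 := add_eq_right.1 e7
  rwa [← sub_eq_add_neg, sub_eq_zero] at e8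

end CZero

end CZeroGraded


/-! ### The functor from representations to graded Hilbert spaces -/

section CZeroGraded

variable {T : Type u} [Category.{v} T] {X : T} {U : T}

namespace CZeroRep

variable (R : CZeroRep X)

/-- A representation of `C₀(X)` does not increase norms: if `|b| ≤ ε`, then `ε² - b* b` is the square
of `ε - c` for an element `c` of `C₀(X)`. -/
theorem normSq_act_le {ε : ℝ} (hε : 0 < ε) (b : CZero X U)
    (hb : ∀ ⦃V : T⦄ (f : V ⟶ U) (x : V ⟶ X),
      (b.val f x).absSq ≤ (DReal.const (ε ^ 2) : DReal (can T) V))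
    (h : U ⟶ R.space.obj) :
    R.space.normSq (R.act b h) ≤ DReal.const (ε ^ 2) * R.space.normSq h := by
  set c := CZero.cap hε b
  have hc : star c = c := by
    apply CZero.ext; funext V f x; exact Cx.star_ofReal _
  have h1 : R.space.normSq (R.act c h) + R.space.normSq (R.act b h) =
      DReal.const (2 * ε) * (R.space.inner h (R.act c h)).re := by
    have e1 : R.space.inner (R.act c h) (R.act c h) = R.space.inner h (R.act (c * c) h) := by
      rw [R.inner_act, hc, R.mul_act]
    have e2 : R.space.inner (R.act b h) (R.act b h) = R.space.inner h (R.act (star b * b) h) := by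
      rw [R.inner_act, R.mul_act]
    rw [PreHilbertSpace.normSq, PreHilbertSpace.normSq, e1, e2, ← Cx.add_re,
      ← R.space.inner_add_right, ← R.add_act, CZero.cap_mul_cap hε b hb, R.smul_act,
      R.space.inner_smul_right, Cx.ofReal_mul_re]
  have h2 := R.space.normSq_nonneg
    (R.act c h - (Cx.ofReal (DReal.const ε) : Cx (can T) U) • h)
  rw [R.space.normSq_sub_smul, R.space.inner_re_comm, ← DReal.const_mul, ← sq] at h2
  rw [DReal.const_mul, DReal.const_two] at h1
  rw [← sub_nonneg]
  refine h2.trans_eq ?_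
  linear_combination h1

variable (hX : IsDecidable X)

/-- The difference of `a` and its restriction to the elements of a list. -/
def tail (a : CZero X U) : List (U ⟶ X) → CZero X U
  | [] => a
  | y :: l => tail a l + (-1 : Cx (can T) U) • (CZero.delta hX y * tail a l)

theorem tail_val (a : CZero X U) (l : List (U ⟶ X)) {V : T} (f : V ⟶ U) (x : V ⟶ X) :
    (x ∈ l.map (f ≫ ·) → (tail hX a l).val f x = 0) ∧
      ((∀ y ∈ l.map (f ≫ ·), InternallyNe (can T) x y) → (tail hX a l).val f x = a.val f x) := by
  induction l with
  | nil => simp [tail]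
  | cons y l ih =>
    have e : (tail hX a (y :: l)).val f x = (tail hX a l).val f x +
        (-1 : Cx (can T) U).restrict f * (hX.kron (f ≫ y) x * (tail hX a l).val f x) := rfl
    rw [Cx.restrict_neg, Cx.restrict_one] at e
    rw [e]
    refine ⟨fun hx => ?_, fun hx => ?_⟩
    · rw [List.map_cons, List.mem_cons] at hx
      rcases hx with rfl | hx
      · rw [hX.kron_self]; ring
      · rw [ih.1 hx]; ring
    · rw [ih.2 fun z hz => hx z (List.mem_cons_of_mem _ hz),
        hX.kron_ne (hx _ List.mem_cons_self).symm]
      ring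

theorem dense_delta : R.space.DenseSpan (fun V => {z | ∃ (x : V ⟶ X) (h : V ⟶ R.space.obj),
    z = R.act (CZero.delta hX x) h}) := by
  refine R.nondegenerate.of_approx ?_ ?_
  · rintro V W g _ ⟨x, h, rfl⟩
    exact ⟨g ≫ x, g ≫ h, by rw [R.comp_act, CZero.delta_restrict]⟩
  · rintro V _ ⟨a, h, rfl⟩ ε hε
    refine (R.space.normSq h).locally_le_const.bind fun W f ⟨n, hn⟩ => ?_
    have hn1 : (0 : ℝ) < n + 1 := by positivity
    obtain ⟨δ, hδ, hδε⟩ := exists_rat_btwn (show 0 < ε / (n + 1) by positivity)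
    refine ((a.vanish δ (by exact_mod_cast hδ)).restrict f).mono fun Z g ⟨l, hl⟩ => ?_
    set p := g ≫ f
    have hsplit : ∀ m : List (Z ⟶ X), p ≫ R.act a h - R.act (tail hX (a.restrict p) m) (p ≫ h) ∈
        Submodule.span (Cx (can T) Z) {z | ∃ (x : Z ⟶ X) (h : Z ⟶ R.space.obj),
          z = R.act (CZero.delta hX x) h} := by
      intro m
      induction m with
      | nil => rw [tail, R.comp_act, sub_self]; exact zero_mem _
      | cons y m ih =>
        rw [tail, R.add_act, R.smul_act, neg_one_smul, ← sub_eq_add_neg, sub_sub_eq_add_sub,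
          add_sub_right_comm]
        refine add_mem ih (Submodule.subset_span ⟨y, _, R.mul_act _ _ _⟩)
    refine ⟨_, hsplit l, ?_⟩
    rw [sub_sub_cancel]
    have hb : ∀ ⦃V' : T⦄ (f' : V' ⟶ Z) (x : V' ⟶ X),
        ((tail hX (a.restrict p) l).val f' x).absSq ≤
          (DReal.const ((δ : ℝ) ^ 2) : DReal (can T) V') := by
      intro V' f' x
      refine DReal.le_of_locally ((hX.locally_mem_or (l.map (f' ≫ ·)) x).mono fun W' g' hg' => ?_)
      rw [← Cx.absSq_restrict, CZero.restrict_val, DReal.restrict_const]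
      have e : (l.map (f' ≫ ·)).map (g' ≫ ·) = l.map ((g' ≫ f') ≫ ·) := by simp
      rw [e] at hg'
      have ht := tail_val hX (a.restrict p) l (g' ≫ f') (g' ≫ x)
      rcases hg' with hg' | hg'
      · rw [ht.1 hg', Cx.absSq_zero]; exact DReal.const_nonneg (sq_nonneg _)
      · rw [ht.2 hg']
        exact hl (g' ≫ f') (g' ≫ x) fun y hy => hg' _ (List.mem_map_of_mem hy)
    refine (R.normSq_act_le hδ _ hb _).trans ?_
    have h1 := DReal.restrict_mono hn g
    rw [DReal.restrict_const, ← DReal.restrict_comp, R.space.normSq_restrict] at h1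
    refine (mul_le_mul_of_nonneg_left h1 (DReal.const_nonneg (sq_nonneg _))).trans ?_
    rw [← DReal.const_mul]
    apply DReal.const_mono
    have h2 : (δ : ℝ) * (n + 1) ≤ ε := by rw [← le_div_iff₀ hn1]; exact hδε.le
    have h3 : ((δ : ℝ) * (n + 1)) ^ 2 ≤ ε ^ 2 := by gcongr
    nlinarith [mul_nonneg (sq_nonneg (δ : ℝ)) (sq_nonneg (n : ℝ)),
      mul_nonneg (sq_nonneg (δ : ℝ)) (Nat.cast_nonneg n : (0 : ℝ) ≤ n), sq_nonneg (δ : ℝ)]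

theorem zero_smul_act (a : CZero X U) (h : U ⟶ R.space.obj) :
    R.act ((0 : Cx (can T) U) • a) h = 0 := by rw [R.smul_act, zero_smul]

/-- The grading defined by the characteristic functions of the elements of `X`. -/
def toGrading : Grading R.space X where
  P x h := R.act (CZero.delta hX x) h
  comp_P f x h := by rw [R.comp_act, CZero.delta_restrict]
  inner_P x h k := by rw [R.inner_act, CZero.star_delta]
  P_P x h := by rw [← R.mul_act, CZero.delta_mul_delta, hX.kron_self, R.smul_act, one_smul]
  P_ne x y h hxy := by
    rw [← R.mul_act, CZero.delta_mul_delta, hX.kron_ne hxy, R.zero_smul_act]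
  dense := R.dense_delta hX

variable {R} in
theorem act_delta (a : CZero X U) (x : U ⟶ X) (h : U ⟶ R.space.obj) :
    R.act a (R.act (CZero.delta hX x) h) = a.val (𝟙 U) x • R.act (CZero.delta hX x) h := by
  rw [← R.mul_act, CZero.mul_delta, R.smul_act]

variable {R} in
/-- An operator which commutes with the actions of the characteristic functions commutes with the
actions of all elements of `C₀(X)`. -/
theorem comm_of_comm_delta {R' : CZeroRep X} (t : R.space ⟶ R'.space)
    (ht : ∀ {U : T} (x : U ⟶ X) (h : U ⟶ R.space.obj), BoundedOp.app t
      (R.act (CZero.delta hX x) h) = R'.act (CZero.delta hX x) (BoundedOp.app t h))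
    (a : CZero X U) (h : U ⟶ R.space.obj) :
    BoundedOp.app t (R.act a h) = R'.act a (BoundedOp.app t h) := by
  refine R'.space.ext_inner_left fun k => ?_
  rw [inner_adjoint, R.inner_act, R'.inner_act, inner_adjoint]
  congr 1
  rw [← sub_eq_zero]
  refine (R.dense_delta hX).eq_zero fun V f s hs => ?_
  obtain ⟨x, z, rfl⟩ := hs
  have star_star' : ∀ b : CZero X V, star (star b) = b := fun b => by
    apply CZero.ext; funext W g y; exact star_star _
  rw [R.space.comp_sub, BoundedOp.comp_app, R.comp_act, R'.comp_act, BoundedOp.comp_app,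
    R.space.inner_sub_left, sub_eq_zero, R.inner_act, inner_adjoint_left, inner_adjoint_left,
    R'.inner_act]
  have e1 : star ((star a).restrict f) = a.restrict f := star_star' (a.restrict f)
  rw [e1, act_delta hX, BoundedOp.app_smul, ht, act_delta hX]

end CZeroRep

/-! ### Gradings are representations of `C₀(X)` -/

namespace Grading

variable {H : HilbertSpace T} (G : Grading H X) (hX : IsDecidable X)
include hX

omit hX in
theorem exists_bound_list (a : CZero X U) (l : List (U ⟶ X)) :
    ∃ c : DReal (can T) U, 1 ≤ c ∧ ∀ y ∈ l, (a.val (𝟙 U) y).absSq ≤ c := by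
  induction l with
  | nil => exact ⟨1, le_rfl, by simp⟩
  | cons y l ih =>
    obtain ⟨c, h1, h2⟩ := ih
    have hp := Cx.absSq_nonneg (a.val (𝟙 U) y)
    refine ⟨c + (a.val (𝟙 U) y).absSq, h1.trans (le_add_of_nonneg_right hp), fun z hz => ?_⟩
    rcases List.mem_cons.1 hz with rfl | hz
    · exact le_add_of_nonneg_left (zero_le_one.trans h1)
    · exact (h2 z hz).trans (le_add_of_nonneg_right hp)

theorem locally_bounded (a : CZero X U) :
    Locally (can T) (fun ⦃V : T⦄ (f : V ⟶ U) => ∃ c : DReal (can T) V, 0 ≤ c ∧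
      ∀ ⦃W : T⦄ (g : W ⟶ V) (x : W ⟶ X), (a.val (g ≫ f) x).absSq ≤ c.restrict g) := by
  refine (a.vanish 1 one_pos).mono fun V f ⟨l, hl⟩ => ?_
  obtain ⟨c, h1, h2⟩ := exists_bound_list (a.restrict f) l
  refine ⟨c, zero_le_one.trans h1, fun W g x => ?_⟩
  refine DReal.le_of_locally ((hX.locally_mem_or (l.map (g ≫ ·)) x).mono fun Z k hk => ?_)
  rw [← Cx.absSq_restrict, a.restrict_val, ← DReal.restrict_comp]
  have e : (l.map (g ≫ ·)).map (k ≫ ·) = l.map ((k ≫ g) ≫ ·) := by simp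
  rw [e] at hk
  rcases hk with hk | hk
  · obtain ⟨y, hy, hyx⟩ := List.mem_map.1 hk
    have := DReal.restrict_mono (h2 y hy) (k ≫ g)
    rw [← Cx.absSq_restrict, CZero.restrict_val, hyx] at this
    simpa [CZero.restrict] using this
  · have := hl (k ≫ g) (k ≫ x) fun y hy => hk _ (List.mem_map_of_mem hy)
    rw [Category.assoc] at this
    refine this.trans ?_
    have h3 := DReal.restrict_mono h1 (k ≫ g)
    rw [DReal.restrict_one] at h3
    simpa [DReal.const_one] using h3

theorem exists_act (a : CZero X U) (h : U ⟶ H.obj) : ∃ w : U ⟶ H.obj,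
    ∀ ⦃V : T⦄ (f : V ⟶ U) (x : V ⟶ X), G.P x (f ≫ w) = a.val f x • G.P x (f ≫ h) := by
  obtain ⟨w, hw⟩ := exists_of_locally_unique (U := U) (Y := H.obj)
    (fun V f w => ∀ ⦃W : T⦄ (g : W ⟶ V) (x : W ⟶ X),
      G.P x (g ≫ w) = a.val (g ≫ f) x • G.P x ((g ≫ f) ≫ h))
    (fun V f w hw W g Z k x => by simpa only [Category.assoc] using hw (k ≫ g) x)
    ((locally_bounded hX a).mono fun V f ⟨c, hc0, hc⟩ => by
      let D : Dominated G G (f ≫ h) :=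
        { k := fun W g x => a.val (g ≫ f) x • G.P x (g ≫ f ≫ h)
          comp_k := fun W Z g x k => by
            rw [H.comp_smul, a.restrict_val, G.comp_P, Category.assoc, Category.assoc]
          P_k := fun W g x => by rw [G.P_smul, G.P_P]
          c := c
          c_nonneg := hc0
          bound := fun W g x => by
            rw [H.normSq_smul]
            exact mul_le_mul_of_nonneg_right (hc g x) (H.normSq_nonneg _) }
      refine ⟨D.vector hX, fun W g x => ?_⟩
      rw [D.P_vector, Category.assoc])
    (fun V f w w' hw hw' => G.ext fun W g x => by rw [hw, hw'])
  refine ⟨w, fun V f x => hom_ext_of_locally ((hw.restrict f).mono fun W g hg => ?_)⟩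
  have := hg (𝟙 W) (g ≫ x)
  rw [G.comp_P, H.comp_smul, a.restrict_val, G.comp_P, ← Category.assoc, ← Category.assoc]
  simpa only [Category.id_comp] using this

/-- The action of `C₀(X)` on a graded Hilbert space: `a` acts on the component with index `x` by
multiplication with `a x`. -/
def act (a : CZero X U) (h : U ⟶ H.obj) : U ⟶ H.obj := (G.exists_act hX a h).choose

theorem P_act (a : CZero X U) (h : U ⟶ H.obj) {V : T} (f : V ⟶ U) (x : V ⟶ X) :
    G.P x (f ≫ G.act hX a h) = a.val f x • G.P x (f ≫ h) :=
  (G.exists_act hX a h).choose_spec f x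

theorem act_delta (x : U ⟶ X) (h : U ⟶ H.obj) : G.act hX (CZero.delta hX x) h = G.P x h := by
  refine G.ext fun V f y => ?_
  rw [G.P_act, G.comp_P]
  change hX.kron (f ≫ x) y • _ = _
  refine hom_ext_of_locally ((hX (f ≫ x) y).mono fun W g hg => ?_)
  rw [H.comp_smul, hX.kron_restrict, G.comp_P, G.comp_P, G.comp_P]
  rcases hg with hg | hg
  · rw [hg, hX.kron_self, one_smul, G.P_P]
  · rw [hX.kron_ne hg, zero_smul, G.P_ne _ _ _ hg.symm]

/-- The representation of `C₀(X)` on a graded Hilbert space. -/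
def toCZeroRep : CZeroRep X where
  space := H
  act a h := G.act hX a h
  comp_act f a h := G.ext fun W g x => by
    rw [← Category.assoc, G.P_act, G.P_act, Category.assoc]; rfl
  act_add a h k := G.ext fun W g x => by
    rw [H.comp_add, G.P_add, G.P_act, G.P_act, G.P_act, H.comp_add, G.P_add, smul_add]
  act_smul a c h := G.ext fun W g x => by
    rw [H.comp_smul, G.P_smul, G.P_act, G.P_act, H.comp_smul, G.P_smul, smul_comm]
  add_act a b h := G.ext fun W g x => by
    rw [H.comp_add, G.P_add, G.P_act, G.P_act, G.P_act, ← add_smul]; rfl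
  smul_act c a h := G.ext fun W g x => by
    rw [H.comp_smul, G.P_smul, G.P_act, G.P_act, smul_smul]; rfl
  mul_act a b h := G.ext fun W g x => by
    rw [G.P_act, G.P_act, G.P_act, smul_smul]; rfl
  inner_act a h k := G.inner_eq_of_P G hX fun V f x => by
    rw [G.P_act, H.inner_smul_left, G.inner_P, G.inner_P, G.P_act, H.inner_smul_right]; rfl
  nondegenerate := G.dense.mono fun V z ⟨x, h, hz⟩ => ⟨CZero.delta hX x, h, by
    rw [hz, G.act_delta]⟩

end Grading

/-- Two gradings of a space with the same projections. -/
def GradedHilbert.isoOfEq {H : HilbertSpace T} (G G' : Grading H X)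
    (e : ∀ {U : T} (x : U ⟶ X) (h : U ⟶ H.obj), G.P x h = G'.P x h) :
    (⟨H, G⟩ : GradedHilbert X) ≅ ⟨H, G'⟩ where
  hom := ⟨𝟙 H, fun x h => by rw [BoundedOp.app_id, BoundedOp.app_id, e]⟩
  inv := ⟨𝟙 H, fun x h => by rw [BoundedOp.app_id, BoundedOp.app_id, e]⟩
  hom_inv_id := by apply GradedHilbert.Hom.ext; exact Category.comp_id _
  inv_hom_id := by apply GradedHilbert.Hom.ext; exact Category.comp_id _

/-- Non-degenerate representations of `C₀(X)` are the same as graded Hilbert spaces. -/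
def cZeroRepToGraded (hX : IsDecidable X) : CZeroRep X ⥤ GradedHilbert X where
  obj R := ⟨R.space, R.toGrading hX⟩
  map f := ⟨CZeroRep.Hom.op f, fun x h => CZeroRep.Hom.comm f _ h⟩

theorem cZeroRepToGraded_isEquivalence (hX : IsDecidable X) :
    (cZeroRepToGraded hX).IsEquivalence where
  faithful := ⟨fun {A B f g} h => CZeroRep.Hom.ext (congrArg GradedHilbert.Hom.op h)⟩
  full := ⟨fun {A B} f => ⟨⟨GradedHilbert.Hom.op f,
    CZeroRep.comm_of_comm_delta hX _ (GradedHilbert.Hom.comm f)⟩, rfl⟩⟩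
  essSurj := ⟨fun A => by
    exact ⟨A.grading.toCZeroRep hX, ⟨GradedHilbert.isoOfEq _ A.grading fun x h =>
      A.grading.act_delta hX x h⟩⟩⟩

end CZeroGraded


/-! ### Tensor products with `ℓ²(X)` -/

section TensorGraded

variable {T : Type u} [Category.{v} T] {X : T} {U V : T}

theorem exists_pos_rat_lt_mul_le {k ε : ℝ} (hk : 0 < k) (hε : 0 < ε) :
    ∃ δ : ℚ, 0 < δ ∧ (δ : ℝ) ≤ ε ∧ k * δ ≤ ε := by
  obtain ⟨δ, hδ, h⟩ := exists_rat_btwn (show 0 < min ε (ε / k) by positivity)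
  refine ⟨δ, by exact_mod_cast hδ, h.le.trans (min_le_left _ _), ?_⟩
  have := h.le.trans (min_le_right _ _)
  rwa [le_div_iff₀ hk, mul_comm] at this

/-- Linear maps which are formally selfadjoint on a set with dense span are selfadjoint. -/
theorem PreHilbertSpace.DenseSpan.selfadjoint {H : PreHilbertSpace T} {S : ∀ V : T, Set (V ⟶ H.obj)}
    (hS : H.DenseSpan S) (hcomp : ∀ ⦃V W : T⦄ (g : W ⟶ V), ∀ s ∈ S V, g ≫ s ∈ S W)
    (P : ∀ {U : T}, (U ⟶ X) → (U ⟶ H.obj) → (U ⟶ H.obj))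
    (comp_P : ∀ {U V : T} (f : V ⟶ U) (x : U ⟶ X) (h : U ⟶ H.obj), f ≫ P x h = P (f ≫ x) (f ≫ h))
    (P_add : ∀ {U : T} (x : U ⟶ X) (h k : U ⟶ H.obj), P x (h + k) = P x h + P x k)
    (P_smul : ∀ {U : T} (x : U ⟶ X) (c : Cx (can T) U) (h : U ⟶ H.obj), P x (c • h) = c • P x h)
    {k : ℝ} (hk : 0 < k) (bound : ∀ {U : T} (x : U ⟶ X) (h : U ⟶ H.obj),
      H.normSq (P x h) ≤ DReal.const (k ^ 2) * H.normSq h)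
    (h : ∀ ⦃V : T⦄ (x : V ⟶ X), ∀ s ∈ S V, ∀ t ∈ S V, H.inner (P x s) t = H.inner s (P x t))
    (x : U ⟶ X) (v w : U ⟶ H.obj) : H.inner (P x v) w = H.inner v (P x w) := by
  have key : ∀ {U : T} (x : U ⟶ X) (a a' w : U ⟶ H.obj), (∀ ⦃V : T⦄ (f : V ⟶ U), ∀ t ∈ S V,
      H.inner (f ≫ a) t = H.inner (f ≫ a') (P (f ≫ x) t)) → H.inner a w = H.inner a' (P x w) := by
    intro U x a a' w hw
    refine inner_eq_of_approx fun ε hε => ?_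
    obtain ⟨δ, hδ, h1, h2⟩ := exists_pos_rat_lt_mul_le hk hε
    have hδ' : (0 : ℝ) < δ := by exact_mod_cast hδ
    refine (hS w δ hδ).mono fun V f ⟨y, hy, hle⟩ => ⟨y, P (f ≫ x) y,
      hle.mono hδ'.le h1, ?_, ?_⟩
    · have e : f ≫ P x w - P (f ≫ x) y = P (f ≫ x) (f ≫ w - y) := by
        rw [comp_P, eq_comm, eq_sub_iff_add_eq, ← P_add, sub_add_cancel]
      rw [e]
      refine (bound _ _).trans ((mul_le_mul_of_nonneg_left hle
        (DReal.const_nonneg (sq_nonneg k))).trans ?_)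
      rw [← DReal.const_mul, ← mul_pow]
      exact DReal.const_mono (by gcongr)
    · clear hle
      induction hy using Submodule.span_induction with
      | mem t ht => exact hw f t ht
      | zero =>
        have := P_add (f ≫ x) 0 0
        rw [add_zero, left_eq_add] at this
        rw [this, H.inner_zero_right, H.inner_zero_right]
      | add a b _ _ ha hb => rw [P_add, H.inner_add_right, H.inner_add_right, ha, hb]
      | smul c a _ ha => rw [P_smul, H.inner_smul_right, H.inner_smul_right, ha]
  have h1 : ∀ ⦃V : T⦄ (x : V ⟶ X), ∀ s ∈ S V, ∀ w, H.inner (P x s) w = H.inner s (P x w) :=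
    fun V x s hs w => key x _ _ w fun W f t ht => by
      rw [comp_P]; exact h _ _ (hcomp f s hs) t ht
  refine key x _ _ w fun W f t ht => ?_
  rw [comp_P, ← H.star_inner, ← h1 _ _ ht, H.star_inner]

theorem IsDecidable.kron_smul_P {H : HilbertSpace T} (G : Grading H X) (hX : IsDecidable X)
    (x y : U ⟶ X) (h : U ⟶ H.obj) : hX.kron y x • G.P x h = G.P y (G.P x h) := by
  refine hom_ext_of_locally ((hX y x).mono fun W g hg => ?_)
  rw [H.comp_smul, hX.kron_restrict, G.comp_P, G.comp_P, G.comp_P]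
  rcases hg with hg | hg
  · rw [hg, hX.kron_self, one_smul, G.P_P]
  · rw [hX.kron_ne hg, zero_smul, G.P_ne _ _ _ hg]

namespace L2

theorem inner_e (L : L2 X) (hX : IsDecidable X) (x y : U ⟶ X) :
    L.space.inner (x ≫ L.e) (y ≫ L.e) = hX.kron x y := by
  refine Cx.eq_of_locally ((hX x y).mono fun W g hg => ?_)
  rw [L.space.inner_restrict, hX.kron_restrict, ← Category.assoc, ← Category.assoc]
  rcases hg with hg | hg
  · rw [hg, hX.kron_self, L.inner_eq]
  · rw [hX.kron_ne hg, L.inner_ne _ _ hg]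

theorem normSq_e (L : L2 X) (x : U ⟶ X) : L.space.normSq (x ≫ L.e) = 1 := by
  rw [PreHilbertSpace.normSq, L.inner_eq]; rfl

end L2

theorem HilbertTensor.normSq_tmul {H K : HilbertSpace T} (t : HilbertTensor H K) (h : U ⟶ H.obj)
    (k : U ⟶ K.obj) : t.space.normSq (t.tmul h k) = H.normSq h * K.normSq k := by
  rw [PreHilbertSpace.normSq, t.inner_tmul, H.inner_self, Cx.ofReal_mul_re, PreHilbertSpace.normSq,
    PreHilbertSpace.normSq]

theorem HilbertTensor.tmul_zero {H K : HilbertSpace T} (t : HilbertTensor H K) (h : U ⟶ H.obj) :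
    t.tmul h (0 : U ⟶ K.obj) = 0 := by
  have := t.tmul_add h (0 : U ⟶ K.obj) 0
  rwa [add_zero, left_eq_add] at this

theorem HilbertTensor.tmul_sub {H K : HilbertSpace T} (t : HilbertTensor H K) (h : U ⟶ H.obj)
    (k k' : U ⟶ K.obj) : t.tmul h (k - k') = t.tmul h k - t.tmul h k' := by
  rw [eq_sub_iff_add_eq, ← t.tmul_add, sub_add_cancel]

theorem HilbertTensor.sub_tmul {H K : HilbertSpace T} (t : HilbertTensor H K) (h h' : U ⟶ H.obj)
    (k : U ⟶ K.obj) : t.tmul (h - h') k = t.tmul h k - t.tmul h' k := by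
  rw [eq_sub_iff_add_eq, ← t.add_tmul, sub_add_cancel]

namespace L2Tensor

variable (D : L2Tensor X) (H : HilbertSpace T)

/-- The vector `h ⊗ e x`. -/
def gen {H : HilbertSpace T} (x : U ⟶ X) (h : U ⟶ H.obj) : U ⟶ (D.tensor H).space.obj :=
  (D.tensor H).tmul h (x ≫ D.l2.e)

variable {H}

theorem comp_gen (f : V ⟶ U) (x : U ⟶ X) (h : U ⟶ H.obj) :
    f ≫ D.gen x h = D.gen (f ≫ x) (f ≫ h) := by
  rw [gen, HilbertTensor.comp_tmul, gen, Category.assoc]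

theorem gen_add (x : U ⟶ X) (h k : U ⟶ H.obj) : D.gen x (h + k) = D.gen x h + D.gen x k :=
  (D.tensor H).add_tmul h k _

theorem gen_sub (x : U ⟶ X) (h k : U ⟶ H.obj) : D.gen x (h - k) = D.gen x h - D.gen x k :=
  (D.tensor H).sub_tmul h k _

theorem gen_smul (x : U ⟶ X) (c : Cx (can T) U) (h : U ⟶ H.obj) :
    D.gen x (c • h) = c • D.gen x h := (D.tensor H).smul_tmul c h _

theorem normSq_gen (x : U ⟶ X) (h : U ⟶ H.obj) :
    (D.tensor H).space.normSq (D.gen x h) = H.normSq h := by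
  rw [gen, HilbertTensor.normSq_tmul, L2.normSq_e, mul_one]

theorem gen_injective (x : U ⟶ X) : Function.Injective (D.gen (H := H) x) := fun h k e => by
  rw [← sub_eq_zero]
  refine H.eq_zero_of_normSq_le ?_
  rw [← D.normSq_gen x, gen_sub, e, sub_self, PreHilbertSpace.normSq_zero]

theorem inner_gen (hX : IsDecidable X) (x y : U ⟶ X) (h k : U ⟶ H.obj) :
    (D.tensor H).space.inner (D.gen x h) (D.gen y k) = H.inner h k * hX.kron x y := by
  rw [gen, gen, HilbertTensor.inner_tmul, L2.inner_e _ hX]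

theorem inner_gen_same (x : U ⟶ X) (h k : U ⟶ H.obj) :
    (D.tensor H).space.inner (D.gen x h) (D.gen x k) = H.inner h k := by
  rw [gen, gen, HilbertTensor.inner_tmul, L2.inner_eq, mul_one]

variable (H) in
theorem dense_gen : (D.tensor H).space.DenseSpan
    (fun V => {z | ∃ (x : V ⟶ X) (h : V ⟶ H.obj), z = D.gen x h}) := by
  refine (D.tensor H).dense.of_approx ?_ ?_
  · rintro V W g _ ⟨x, h, rfl⟩
    exact ⟨_, _, D.comp_gen g x h⟩
  · rintro V _ ⟨h, a, rfl⟩ ε hε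
    refine (H.normSq h).locally_le_const.bind fun W f ⟨n, hn⟩ => ?_
    obtain ⟨δ, hδ, h1, h2⟩ := exists_pos_rat_lt_mul_le (show (0 : ℝ) < n + 1 by positivity) hε
    refine ((D.l2.dense a δ hδ).restrict f).mono fun Z g ⟨y, hy, hle⟩ =>
      ⟨(D.tensor H).tmul ((g ≫ f) ≫ h) y, ?_, ?_⟩
    · clear hle
      induction hy using Submodule.span_induction with
      | mem s hs => obtain ⟨x, rfl⟩ := hs; exact Submodule.subset_span ⟨x, _, rfl⟩
      | zero => rw [HilbertTensor.tmul_zero]; exact zero_mem _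
      | add a b _ _ ha hb => rw [HilbertTensor.tmul_add]; exact add_mem ha hb
      | smul c a _ ha => rw [HilbertTensor.tmul_smul]; exact Submodule.smul_mem _ _ ha
    · rw [HilbertTensor.comp_tmul, ← HilbertTensor.tmul_sub]
      rw [PreHilbertSpace.NormLE, HilbertTensor.normSq_tmul]
      have h3 := DReal.restrict_mono hn g
      rw [DReal.restrict_const, ← DReal.restrict_comp, H.normSq_restrict] at h3
      refine (mul_le_mul h3 hle (PreHilbertSpace.normSq_nonneg _ _)
        (DReal.const_nonneg (Nat.cast_nonneg n))).trans ?_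
      rw [← DReal.const_mul]
      apply DReal.const_mono
      have h4 : (((n : ℝ) + 1) * δ) ^ 2 ≤ ε ^ 2 := by
        have : (0 : ℝ) ≤ δ := by exact_mod_cast hδ.le
        gcongr
      nlinarith [mul_nonneg (sq_nonneg (δ : ℝ)) (sq_nonneg (n : ℝ)),
        mul_nonneg (sq_nonneg (δ : ℝ)) (Nat.cast_nonneg n : (0 : ℝ) ≤ n), sq_nonneg (δ : ℝ)]

variable (hX : IsDecidable X)
include hX

theorem adjoint_comul_app (x : U ⟶ X) (a : U ⟶ D.l2.space.obj) :
    BoundedOp.app (adjoint D.comul) (D.gen x a) =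
      D.l2.space.inner (x ≫ D.l2.e) a • (x ≫ D.l2.e) := by
  rw [← sub_eq_zero]
  refine D.l2.dense.eq_zero fun V f s hs => ?_
  obtain ⟨z, rfl⟩ := hs
  rw [PreHilbertSpace.comp_sub, PreHilbertSpace.inner_sub_left, sub_eq_zero, BoundedOp.comp_app,
    inner_adjoint_left, D.comul_e, comp_gen, ← gen, D.inner_gen hX, D.l2.space.comp_smul,
    D.l2.space.inner_restrict, D.l2.space.inner_smul_left, D.l2.space.star_inner,
    ← Category.assoc f, L2.inner_e _ hX]
  refine Cx.eq_of_locally ((hX (f ≫ x) z).mono fun W g hg => ?_)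
  rw [Cx.restrict_mul, Cx.restrict_mul, D.l2.space.inner_restrict, D.l2.space.inner_restrict,
    ← Category.assoc g, ← Category.assoc g, hX.kron_restrict]
  rcases hg with hg | hg
  · rw [← hg]
    simp only [Category.assoc]
  · rw [hX.kron_ne hg, mul_zero, mul_zero]

/-- The projection of `H ⊗ ℓ²(X)` onto `H ⊗ e x`. -/
def proj (H : HilbertSpace T) (x : U ⟶ X) (v : U ⟶ (D.tensor H).space.obj) :
    U ⟶ (D.tensor H).space.obj :=
  BoundedOp.app (D.tensorMul H) (D.gen x v)

theorem proj_gen (x y : U ⟶ X) (h : U ⟶ H.obj) :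
    D.proj H x (D.gen y h) = D.gen x (hX.kron x y • h) := by
  rw [proj, gen, gen, D.tensorMul_tmul, ← gen, D.adjoint_comul_app hX, L2.inner_e _ hX,
    HilbertTensor.tmul_smul, gen_smul, gen]

variable (H) in
/-- The grading of `H ⊗ ℓ²(X)` by the subspaces `H ⊗ e x`. -/
def grading : Grading (D.tensor H).space X := by
  have hcomp : ∀ {U V : T} (f : V ⟶ U) (x : U ⟶ X) (v : U ⟶ (D.tensor H).space.obj),
      f ≫ D.proj H x v = D.proj H (f ≫ x) (f ≫ v) := fun f x v => by
    rw [proj, BoundedOp.comp_app, comp_gen, proj]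
  have hsub : ∀ ⦃V W : T⦄ (g : W ⟶ V), ∀ s ∈ {z | ∃ (x : V ⟶ X) (h : V ⟶ H.obj), z = D.gen x h},
      g ≫ s ∈ {z | ∃ (x : W ⟶ X) (h : W ⟶ H.obj), z = D.gen x h} := by
    rintro V W g _ ⟨x, h, rfl⟩
    exact ⟨_, _, D.comp_gen g x h⟩
  have hself : ∀ {U : T} (x : U ⟶ X) (v w : U ⟶ (D.tensor H).space.obj),
      (D.tensor H).space.inner (D.proj H x v) w = (D.tensor H).space.inner v (D.proj H x w) := by
    obtain ⟨k, hk, hb⟩ := BoundedOp.exists_bound (D.tensorMul H)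
    intro U x v w
    refine (D.dense_gen H).selfadjoint hsub (fun x v => D.proj H x v) hcomp
      (fun x v w => ?_) (fun x c v => ?_) hk (fun x v => ?_) ?_ x v w
    · rw [proj, gen_add, BoundedOp.app_add, proj, proj]
    · rw [proj, gen_smul, BoundedOp.app_smul, proj]
    · have := hb (D.gen x v)
      rwa [normSq_gen] at this
    · rintro V x _ ⟨y, h, rfl⟩ _ ⟨z, k, rfl⟩
      simp only [D.proj_gen hX, D.inner_gen hX]
      rw [H.inner_smul_left, H.inner_smul_right, hX.star_kron, hX.kron_comm y x]
      ring
  exact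
    { P := fun x v => D.proj H x v
      comp_P := hcomp
      inner_P := hself
      P_P := fun x v => by
        rw [← sub_eq_zero]
        refine (D.dense_gen H).eq_zero fun V f s hs => ?_
        obtain ⟨y, h, rfl⟩ := hs
        rw [PreHilbertSpace.comp_sub, hcomp, hcomp, PreHilbertSpace.inner_sub_left, hself, hself,
          hself, D.proj_gen hX, D.proj_gen hX, hX.kron_self, one_smul, sub_self]
      P_ne := fun x y v hxy => by
        refine (D.dense_gen H).eq_zero fun V f s hs => ?_
        obtain ⟨z, h, rfl⟩ := hs
        rw [hcomp, hcomp, hself, hself, D.proj_gen hX, D.proj_gen hX,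
          hX.kron_ne (hxy.restrict f).symm, zero_smul, ← zero_smul (Cx (can T) V) (0 : V ⟶ H.obj),
          gen_smul, zero_smul, PreHilbertSpace.inner_zero_right]
      dense := (D.dense_gen H).mono fun V => by
        rintro _ ⟨x, h, rfl⟩
        exact ⟨x, D.gen x h, by rw [D.proj_gen hX, hX.kron_self, one_smul]⟩ }

theorem grading_P (x : U ⟶ X) (v : U ⟶ (D.tensor H).space.obj) :
    (D.grading H hX).P x v = BoundedOp.app (D.tensorMul H) (D.gen x v) := rfl

theorem grading_P_gen (x y : U ⟶ X) (h : U ⟶ H.obj) :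
    (D.grading H hX).P x (D.gen y h) = D.gen x (hX.kron x y • h) := D.proj_gen hX x y h

theorem grading_P_gen_same (x : U ⟶ X) (h : U ⟶ H.obj) :
    (D.grading H hX).P x (D.gen x h) = D.gen x h := by
  rw [grading_P_gen, hX.kron_self, one_smul]

theorem exists_coord (x : U ⟶ X) (v : U ⟶ (D.tensor H).space.obj) :
    ∃ h : U ⟶ H.obj, D.gen x h = (D.grading H hX).P x v := by
  obtain ⟨h, hh⟩ := exists_preimage_of_isometry (H := H) (L := (D.tensor H).space) (U := U)
    (fun V f h => D.gen (f ≫ x) h)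
    (fun V f h W g => by rw [comp_gen, Category.assoc])
    (fun V f h k => by rw [← gen_sub, normSq_gen]) ((D.grading H hX).P x v) (fun ε hε => by
      obtain ⟨δ, hδ, hδε⟩ := exists_rat_btwn hε
      refine (D.dense_gen H v δ (by exact_mod_cast hδ)).mono fun V f ⟨y, hy, hle⟩ => ?_
      have : ∃ h, (D.grading H hX).P (f ≫ x) y = D.gen (f ≫ x) h := by
        clear hle
        induction hy using Submodule.span_induction with
        | mem s hs => obtain ⟨z, h, rfl⟩ := hs; exact ⟨_, D.grading_P_gen hX _ _ _⟩
        | zero =>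
          refine ⟨0, ?_⟩
          rw [ProjFamily.P_zero, ← zero_smul (Cx (can T) V) (0 : V ⟶ H.obj), gen_smul, zero_smul]
        | add a b _ _ ha hb =>
          obtain ⟨h, ha⟩ := ha
          obtain ⟨k, hb⟩ := hb
          exact ⟨h + k, by rw [ProjFamily.P_add, ha, hb, gen_add]⟩
        | smul c a _ ha =>
          obtain ⟨h, ha⟩ := ha
          exact ⟨c • h, by rw [ProjFamily.P_smul, ha, gen_smul]⟩
      obtain ⟨h, hh⟩ := this
      refine ⟨h, ?_⟩
      rw [← hh, ProjFamily.comp_P, ← ProjFamily.P_sub]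
      exact le_trans (ProjFamily.normSq_P_le _ _ _) (hle.mono hδ.le hδε.le))
  exact ⟨h, by rwa [Category.id_comp] at hh⟩

/-- The coordinate of a vector of `H ⊗ ℓ²(X)` with index `x`. -/
def coord (x : U ⟶ X) (v : U ⟶ (D.tensor H).space.obj) : U ⟶ H.obj :=
  (D.exists_coord hX x v).choose

theorem gen_coord (x : U ⟶ X) (v : U ⟶ (D.tensor H).space.obj) :
    D.gen x (D.coord hX x v) = (D.grading H hX).P x v := (D.exists_coord hX x v).choose_spec

theorem comp_coord (f : V ⟶ U) (x : U ⟶ X) (v : U ⟶ (D.tensor H).space.obj) :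
    f ≫ D.coord hX x v = D.coord hX (f ≫ x) (f ≫ v) := by
  apply D.gen_injective (f ≫ x)
  rw [← comp_gen, gen_coord, gen_coord, ProjFamily.comp_P]

theorem inner_coord (x : U ⟶ X) (v : U ⟶ (D.tensor H).space.obj) (h : U ⟶ H.obj) :
    H.inner (D.coord hX x v) h = (D.tensor H).space.inner v (D.gen x h) := by
  rw [← D.inner_gen_same x, gen_coord, ProjFamily.inner_P, grading_P_gen_same]

theorem normSq_coord (x : U ⟶ X) (v : U ⟶ (D.tensor H).space.obj) :
    H.normSq (D.coord hX x v) = (D.tensor H).space.normSq ((D.grading H hX).P x v) := by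
  rw [← D.normSq_gen x, gen_coord]

theorem coord_eq_iff (x : U ⟶ X) (v : U ⟶ (D.tensor H).space.obj) (h : U ⟶ H.obj) :
    D.coord hX x v = h ↔ (D.grading H hX).P x v = D.gen x h := by
  rw [← gen_coord, (D.gen_injective x).eq_iff]

end L2Tensor

/-! ### Modules over `ℓ²(X)` are gradings -/

namespace L2Module

variable {D : L2Tensor X} (A : L2Module D) (hX : IsDecidable X)

theorem action_adjoint (h : U ⟶ A.space.obj) :
    BoundedOp.app A.action (BoundedOp.app (adjoint A.action) h) = h := by
  rw [← BoundedOp.app_comp, A.adjoint_comp, BoundedOp.app_id]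

theorem inner_adjoint_adjoint (h k : U ⟶ A.space.obj) :
    (D.tensor A.space).space.inner (BoundedOp.app (adjoint A.action) h)
      (BoundedOp.app (adjoint A.action) k) = A.space.inner h k := by
  rw [← inner_adjoint, action_adjoint]

theorem adjoint_action (x : U ⟶ X) (h : U ⟶ A.space.obj) :
    BoundedOp.app (adjoint A.action) (BoundedOp.app A.action (D.gen x h)) =
      (D.grading A.space hX).P x (BoundedOp.app (adjoint A.action) h) := by
  rw [← BoundedOp.app_comp, A.comp_adjoint, BoundedOp.app_comp, L2Tensor.gen, D.tensorMap_tmul]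
  rfl

theorem adjoint_injective : Function.Injective
    (BoundedOp.app (adjoint A.action) : (U ⟶ A.space.obj) → _) := fun h k e => by
  rw [← A.action_adjoint h, e, A.action_adjoint]

/-- The grading of a module: the projection with index `x` is the action of `e x`.  It is a projection
because the adjoint of the action is an isometry that carries it to the one of the tensor product. -/
def toGrading : Grading A.space X where
  P x h := BoundedOp.app A.action (D.gen x h)
  comp_P f x h := by rw [BoundedOp.comp_app, L2Tensor.comp_gen]
  inner_P x h k := by
    rw [← inner_adjoint_adjoint, A.adjoint_action hX, ProjFamily.inner_P, ← A.adjoint_action hX,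
      inner_adjoint_adjoint]
  P_P x h := A.adjoint_injective <| by
    rw [A.adjoint_action hX, A.adjoint_action hX, ProjFamily.P_P]
  P_ne x y h hxy := A.adjoint_injective <| by
    rw [A.adjoint_action hX, A.adjoint_action hX, Grading.P_ne _ _ _ _ hxy, BoundedOp.app_zero]
  dense := by
    intro U h ε hε
    have hε' : (0 : ℝ) < ε := by exact_mod_cast hε
    obtain ⟨k, hk, hb⟩ := BoundedOp.exists_bound A.action
    obtain ⟨δ, hδ, -, h2⟩ := exists_pos_rat_lt_mul_le hk hε'
    have hδ' : (0 : ℝ) < δ := by exact_mod_cast hδ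
    refine (D.dense_gen A.space (BoundedOp.app (adjoint A.action) h) δ hδ).mono
      fun V f ⟨y, hy, hle⟩ => ⟨BoundedOp.app A.action y, ?_, ?_⟩
    · clear hle
      induction hy using Submodule.span_induction with
      | mem s hs => obtain ⟨x, z, rfl⟩ := hs; exact Submodule.subset_span ⟨x, z, rfl⟩
      | zero => rw [BoundedOp.app_zero]; exact zero_mem _
      | add a b _ _ ha hb => rw [BoundedOp.app_add]; exact add_mem ha hb
      | smul c a _ ha => rw [BoundedOp.app_smul]; exact Submodule.smul_mem _ _ ha
    · rw [← A.action_adjoint (f ≫ h), ← BoundedOp.app_sub, ← BoundedOp.comp_app]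
      refine (hb _).trans ((mul_le_mul_of_nonneg_left hle
        (DReal.const_nonneg (sq_nonneg k))).trans ?_)
      rw [← DReal.const_mul, ← mul_pow]
      exact DReal.const_mono (by gcongr)

theorem comm_of_comm_gen {A B : L2Module D} (t : A.space ⟶ B.space)
    (ht : ∀ {U : T} (x : U ⟶ X) (h : U ⟶ A.space.obj), BoundedOp.app t
      (BoundedOp.app A.action (D.gen x h)) = BoundedOp.app B.action (D.gen x (BoundedOp.app t h))) :
    A.action ≫ t = D.tensorMap t ≫ B.action := by
  refine BoundedOp.hom_ext_of_denseSpan (D.dense_gen _) fun V s hs => ?_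
  obtain ⟨x, h, rfl⟩ := hs
  rw [BoundedOp.app_comp, BoundedOp.app_comp, ht, L2Tensor.gen, L2Tensor.gen, D.tensorMap_tmul]

end L2Module

namespace Grading

variable {H : HilbertSpace T} (G : Grading H X) (D : L2Tensor X) (hX : IsDecidable X)

/-- The components of the action of `ℓ²(X)` on a graded Hilbert space. -/
def actionComponents : Components (D.grading H hX) G where
  t x v := G.P x (D.coord hX x v)
  s x h := D.gen x (G.P x h)
  comp_t f x v := by rw [G.comp_P, D.comp_coord]
  comp_s f x h := by rw [D.comp_gen, G.comp_P]
  P_t x v := G.P_P x _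
  P_s x h := D.grading_P_gen_same hX x _
  inner_t x v h := by rw [G.inner_P, D.inner_coord]
  c := 1
  c_nonneg := zero_le_one
  bound_t x v := by
    rw [one_pow, DReal.const_one, one_mul, ← D.normSq_coord]
    exact G.normSq_P_le _ _
  bound_s x h := by
    rw [one_pow, DReal.const_one, one_mul, D.normSq_gen]

theorem action_gen (x : U ⟶ X) (h : U ⟶ H.obj) :
    BoundedOp.app ((G.actionComponents D hX).op hX) (D.gen x h) = G.P x h := by
  refine G.ext fun V f y => ?_
  rw [BoundedOp.comp_app, D.comp_gen, Components.P_op, G.comp_P]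
  have : D.coord hX y (D.gen (f ≫ x) (f ≫ h)) = hX.kron y (f ≫ x) • (f ≫ h) := by
    rw [D.coord_eq_iff, D.grading_P_gen]
  change G.P y (D.coord hX y _) = _
  rw [this, G.P_comm hX, ← hX.kron_smul_P, hX.kron_comm, G.P_smul]

theorem P_adjoint_action (x : U ⟶ X) (h : U ⟶ H.obj) :
    (D.grading H hX).P x (BoundedOp.app (adjoint ((G.actionComponents D hX).op hX)) h) =
      D.gen x (G.P x h) := (G.actionComponents D hX).P_adjoint_op hX x h

theorem action_P (x : U ⟶ X) (v : U ⟶ (D.tensor H).space.obj) :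
    BoundedOp.app ((G.actionComponents D hX).op hX) ((D.grading H hX).P x v) =
      G.P x (BoundedOp.app ((G.actionComponents D hX).op hX) v) := by
  rw [← D.gen_coord, action_gen, Components.P_op]
  rfl

/-- The `ℓ²(X)`-module defined by a graded Hilbert space: `e x` acts by the projection with
index `x`. -/
def toL2Module : L2Module D where
  space := H
  action := (G.actionComponents D hX).op hX
  assoc := by
    refine BoundedOp.hom_ext_of_denseSpan (D.dense_gen _) fun V s hs => ?_
    obtain ⟨x, v, rfl⟩ := hs
    rw [BoundedOp.app_comp, BoundedOp.app_comp, ← D.grading_P hX, action_P, L2Tensor.gen,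
      D.tensorMap_tmul, ← L2Tensor.gen, action_gen]
  adjoint_comp := by
    refine G.ext_app fun U x h => ?_
    rw [BoundedOp.app_comp, BoundedOp.app_id, ← action_P, P_adjoint_action, action_gen, G.P_P]
  comp_adjoint := by
    refine BoundedOp.hom_ext_of_denseSpan (D.dense_gen _) fun V s hs => ?_
    obtain ⟨x, h, rfl⟩ := hs
    refine (D.grading H hX).ext fun W f y => ?_
    rw [BoundedOp.app_comp, BoundedOp.app_comp, L2Tensor.gen, D.tensorMap_tmul, ← L2Tensor.gen,
      ← L2Tensor.gen, ← D.grading_P hX, P_adjoint_action, action_gen, BoundedOp.comp_app,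
      P_adjoint_action, D.comp_gen, D.grading_P_gen, G.comp_P, hX.kron_smul_P]

end Grading

/-- The modules over `ℓ²(X)` are the same as graded Hilbert spaces. -/
def l2ModuleToGraded (D : L2Tensor X) (hX : IsDecidable X) : L2Module D ⥤ GradedHilbert X where
  obj A := ⟨A.space, A.toGrading hX⟩
  map {A B} f := ⟨L2Module.Hom.op f, fun x h => by
    have := congrArg (fun t => BoundedOp.app t (D.gen x h)) (L2Module.Hom.comm f)
    simp only [BoundedOp.app_comp] at this
    refine this.trans ?_
    rw [L2Tensor.gen, D.tensorMap_tmul]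
    rfl⟩

theorem l2ModuleToGraded_isEquivalence (D : L2Tensor X) (hX : IsDecidable X) :
    (l2ModuleToGraded D hX).IsEquivalence where
  faithful := ⟨fun {A B f g} h => L2Module.Hom.ext (congrArg GradedHilbert.Hom.op h)⟩
  full := ⟨fun {A B} f => ⟨⟨GradedHilbert.Hom.op f,
    L2Module.comm_of_comm_gen _ (GradedHilbert.Hom.comm f)⟩, rfl⟩⟩
  essSurj := ⟨fun A => by
    exact ⟨A.grading.toL2Module D hX, ⟨GradedHilbert.isoOfEq _ A.grading fun x h =>
      A.grading.action_gen D hX x h⟩⟩⟩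

end TensorGraded


/-! ### The real numbers of a slice -/

section Slice

variable {T : Type u} [Category.{v} T] [Limits.HasFiniteLimits T] {X : T}

omit [Limits.HasFiniteLimits T] in
theorem overEquiv_left_iff {U V : Over X} (S : Sieve U) (f : V ⟶ U) :
    Sieve.overEquiv U S f.left ↔ S f := by
  obtain ⟨S, rfl⟩ := (Sieve.overEquiv U).symm.surjective S
  simp

/-- The covering sieves of the canonical topology of a slice are those of the canonical topology of
the base: a map `V ⟶ Y` is the same as a map from `V` to `X × Y` over `X`. -/
theorem mem_can_over_iff {U : Over X} (S : Sieve U) :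
    S ∈ can (Over X) U ↔ Sieve.overEquiv U S ∈ can T U.left := by
  refine ⟨fun hS => ?_, fun hS => (inferInstance :
    ((can T).over X).Subcanonical).le_canonical U ((can T).mem_over_iff S |>.2 hS)⟩
  refine Sheaf.mem_finestTopology_of_forall_isSheafFor ?_
  rintro _ ⟨Y, rfl⟩ V f
  let f' : Over.mk (f ≫ U.hom) ⟶ U := Over.homMk f
  have hS' := (can (Over X)).pullback_stable f' hS
  have e : (Sieve.overEquiv U S).pullback f = Sieve.overEquiv _ (S.pullback f') :=
    (Sieve.overEquiv_pullback f' S).symm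
  rw [e]
  set R := S.pullback f'
  intro x hx
  let Z : Over X := Over.mk (Limits.prod.fst : X ⨯ Y ⟶ X)
  have hZ : Presieve.IsSheafFor _ _ := Sheaf.isSheaf_yoneda_obj Z R hS'
  let y : Presieve.FamilyOfElements (yoneda.obj Z) R.arrows := fun W h hh =>
    Over.homMk (Limits.prod.lift W.hom (x h.left ((overEquiv_left_iff R h).2 hh)))
      (Limits.prod.lift_fst _ _)
  have hy : y.Compatible := by
    intro W₁ W₂ W g₁ g₂ h₁ h₂ hh₁ hh₂ e
    apply Over.OverMorphism.ext
    have e' : g₁.left ≫ h₁.left = g₂.left ≫ h₂.left := by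
      rw [← Over.comp_left, e, Over.comp_left]
    have := hx g₁.left g₂.left ((overEquiv_left_iff R h₁).2 hh₁)
      ((overEquiv_left_iff R h₂).2 hh₂) e'
    change g₁.left ≫ Limits.prod.lift W₁.hom (x h₁.left _) =
      g₂.left ≫ Limits.prod.lift W₂.hom (x h₂.left _)
    rw [Limits.prod.comp_lift, Limits.prod.comp_lift, Over.w, Over.w]
    exact congrArg _ this
  obtain ⟨t, ht, -⟩ := hZ y hy
  refine ⟨t.left ≫ Limits.prod.snd, fun W g hg => ?_, fun s hs => ?_⟩
  · have := congrArg (fun k => k.left ≫ Limits.prod.snd) (ht _ ((Sieve.overEquiv_iff R g).1 hg))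
    change (g ≫ t.left) ≫ Limits.prod.snd = Limits.prod.lift _ _ ≫ Limits.prod.snd at this
    rw [Limits.prod.lift_snd, Category.assoc] at this
    exact this
  · let s' : (yoneda.obj Z).obj (Opposite.op (Over.mk (f ≫ U.hom))) :=
      (Over.homMk (Limits.prod.lift (f ≫ U.hom) s) (Limits.prod.lift_fst _ _) :
        Over.mk (f ≫ U.hom) ⟶ Z)
    have hs' : y.IsAmalgamation s' := by
      intro W h hh
      apply Over.OverMorphism.ext
      have e1 := hs h.left ((overEquiv_left_iff R h).2 hh)
      change h.left ≫ s = _ at e1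
      change h.left ≫ Limits.prod.lift (f ≫ U.hom) s = Limits.prod.lift W.hom _
      have e2 : h.left ≫ f ≫ U.hom = W.hom := Over.w h
      rw [Limits.prod.comp_lift, e1, e2]
    have := hZ.isSeparatedFor y t s' ht hs'
    rw [this]
    exact (Limits.prod.lift_snd _ _).symm

theorem locally_over_iff {U : Over X} {P : ∀ ⦃V : Over X⦄, (V ⟶ U) → Prop} :
    Locally (can (Over X)) P ↔ Locally (can T) (fun ⦃V : T⦄ (f : V ⟶ U.left) =>
      P (Over.homMk f : Over.mk (f ≫ U.hom) ⟶ U)) := by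
  constructor
  · rintro ⟨S, hS, H⟩
    exact ⟨_, (mem_can_over_iff S).1 hS, fun V f hf => H _ ((Sieve.overEquiv_iff S f).1 hf)⟩
  · rintro ⟨S, hS, H⟩
    refine ⟨(Sieve.overEquiv U).symm S, (mem_can_over_iff _).2 (by simpa using hS),
      fun V f hf => ?_⟩
    obtain ⟨V, p, rfl⟩ := V.mk_surjective
    obtain ⟨(g : V ⟶ U.left), (rfl : g ≫ U.hom = p), rfl⟩ := Over.homMk_surjective f
    exact H g hf

theorem locally_left_iff {U : Over X} {P : ∀ ⦃V : T⦄, (V ⟶ U.left) → Prop} :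
    Locally (can (Over X)) (fun ⦃V : Over X⦄ (f : V ⟶ U) => P f.left) ↔ Locally (can T) P :=
  locally_over_iff

theorem inconsistent_over_iff {U : Over X} :
    Inconsistent (can (Over X)) U ↔ Inconsistent (can T) U.left := by
  rw [Inconsistent, mem_can_over_iff, map_bot, Inconsistent]

namespace DReal

/-- A real number at the stage `U.left` as a real number of the slice. -/
def toOver {U : Over X} (x : DReal (can T) U.left) : DReal (can (Over X)) U where
  lower q := (Sieve.overEquiv U).symm (x.lower q)
  upper q := (Sieve.overEquiv U).symm (x.upper q)
  lower_iff q _ f := (x.lower_iff q f.left).trans locally_left_iff.symm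
  upper_iff q _ f := (x.upper_iff q f.left).trans locally_left_iff.symm
  lower_inhabited := locally_left_iff.2 x.lower_inhabited
  upper_inhabited := locally_left_iff.2 x.upper_inhabited
  disjoint q _ f h1 h2 := inconsistent_over_iff.2 (x.disjoint q f.left h1 h2)
  located q r h := locally_left_iff.2 (x.located q r h)

/-- A real number of the slice as a real number of the base. -/
def ofOver {U : Over X} (x : DReal (can (Over X)) U) : DReal (can T) U.left where
  lower q := Sieve.overEquiv U (x.lower q)
  upper q := Sieve.overEquiv U (x.upper q)
  lower_iff q V f := by
    rw [Sieve.overEquiv_iff, x.lower_iff, locally_over_iff]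
    simp only [← overEquiv_left_iff]
    rfl
  upper_iff q V f := by
    rw [Sieve.overEquiv_iff, x.upper_iff, locally_over_iff]
    simp only [← overEquiv_left_iff]
    rfl
  lower_inhabited := by
    have := locally_over_iff.1 x.lower_inhabited
    simp only [← overEquiv_left_iff] at this
    exact this
  upper_inhabited := by
    have := locally_over_iff.1 x.upper_inhabited
    simp only [← overEquiv_left_iff] at this
    exact this
  disjoint q V f h1 h2 := inconsistent_over_iff.1 (x.disjoint q _
    ((Sieve.overEquiv_iff _ f).1 h1) ((Sieve.overEquiv_iff _ f).1 h2))
  located q r h := by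
    have := locally_over_iff.1 (x.located q r h)
    simp only [← overEquiv_left_iff] at this
    exact this

theorem toOver_le_toOver {U : Over X} {x y : DReal (can T) U.left} :
    x.toOver ≤ y.toOver ↔ x ≤ y :=
  ⟨fun h q _ f hf => h q (Over.homMk f : Over.mk (f ≫ U.hom) ⟶ U) hf,
    fun h q _ f hf => h q f.left hf⟩

theorem toOver_ofOver {U : Over X} (x : DReal (can (Over X)) U) : x.ofOver.toOver = x := by
  apply le_antisymm <;> intro q V f hf
  · exact (overEquiv_left_iff _ f).1 hf
  · exact (overEquiv_left_iff _ f).2 hf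

theorem toOver_map {U : Over X} {ι : Type} [Finite ι] (F : C(ι → ℝ, ℝ))
    (x : ι → DReal (can T) U.left) : (map F x).toOver = map F (fun i => (x i).toOver) := by
  apply le_antisymm <;> intro q V f hf
  · exact locally_left_iff.2 hf
  · exact locally_left_iff.1 hf

theorem toOver_restrict {U V : Over X} (x : DReal (can T) U.left) (f : V ⟶ U) :
    (x.restrict f.left).toOver = x.toOver.restrict f := by
  apply le_antisymm <;> intro q W g hg <;> exact hg

theorem toOver_const {U : Over X} (r : ℝ) :
    (const r : DReal (can T) U.left).toOver = const r := by
  rw [const, toOver_map, const]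
  congr 1; funext i; exact i.elim0

/-- The real numbers of the slice over `X` at the stage `U` are those of the base at the stage
`U.left`. -/
def overEquiv (U : Over X) : DReal (can T) U.left ≃+* DReal (can (Over X)) U where
  toFun := toOver
  invFun := ofOver
  left_inv x := le_antisymm (toOver_le_toOver.1 (toOver_ofOver _).le)
    (toOver_le_toOver.1 (toOver_ofOver _).ge)
  right_inv := toOver_ofOver
  map_add' x y := by
    refine (toOver_map _ ![x, y]).trans ?_
    change map _ _ = map _ _
    congr 1; funext i; fin_cases i <;> rfl
  map_mul' x y := by
    refine (toOver_map _ ![x, y]).trans ?_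
    change map _ _ = map _ _
    congr 1; funext i; fin_cases i <;> rfl

theorem overEquiv_le_iff {U : Over X} {x y : DReal (can T) U.left} :
    overEquiv U x ≤ overEquiv U y ↔ x ≤ y := toOver_le_toOver

theorem overEquiv_symm_le_iff {U : Over X} {x y : DReal (can (Over X)) U} :
    (overEquiv U).symm x ≤ (overEquiv U).symm y ↔ x ≤ y := by
  rw [← overEquiv_le_iff, RingEquiv.apply_symm_apply, RingEquiv.apply_symm_apply]

theorem overEquiv_restrict {U V : Over X} (x : DReal (can T) U.left) (f : V ⟶ U) :
    overEquiv V (x.restrict f.left) = (overEquiv U x).restrict f := toOver_restrict x f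

theorem overEquiv_symm_restrict {U V : Over X} (x : DReal (can (Over X)) U) (f : V ⟶ U) :
    (overEquiv V).symm (x.restrict f) = ((overEquiv U).symm x).restrict f.left := by
  rw [RingEquiv.symm_apply_eq, overEquiv_restrict, RingEquiv.apply_symm_apply]

theorem overEquiv_const {U : Over X} (r : ℝ) :
    overEquiv U (const r) = const r := toOver_const r

theorem overEquiv_symm_const {U : Over X} (r : ℝ) :
    (overEquiv U).symm (const r) = const r := by
  rw [RingEquiv.symm_apply_eq, overEquiv_const]

end DReal

namespace Cx

/-- The complex numbers of the slice over `X` at the stage `U` are those of the base at the stage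
`U.left`. -/
def overEquiv (U : Over X) : Cx (can T) U.left ≃+* Cx (can (Over X)) U where
  toFun z := ⟨DReal.overEquiv U z.re, DReal.overEquiv U z.im⟩
  invFun z := ⟨(DReal.overEquiv U).symm z.re, (DReal.overEquiv U).symm z.im⟩
  left_inv z := by ext1 <;> exact RingEquiv.symm_apply_apply _ _
  right_inv z := by ext1 <;> exact RingEquiv.apply_symm_apply _ _
  map_add' z w := by ext1 <;> exact map_add _ _ _
  map_mul' z w := by
    ext1
    · simp only [mul_re, map_sub, map_mul]
    · simp only [mul_im, map_add, map_mul]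

variable {U V : Over X}

theorem overEquiv_re (z : Cx (can T) U.left) : (overEquiv U z).re = DReal.overEquiv U z.re := rfl

theorem overEquiv_restrict (z : Cx (can T) U.left) (f : V ⟶ U) :
    overEquiv V (z.restrict f.left) = (overEquiv U z).restrict f := by
  ext1 <;> exact DReal.overEquiv_restrict _ f

theorem overEquiv_symm_restrict (z : Cx (can (Over X)) U) (f : V ⟶ U) :
    (overEquiv V).symm (z.restrict f) = ((overEquiv U).symm z).restrict f.left := by
  ext1 <;> exact DReal.overEquiv_symm_restrict _ f

theorem overEquiv_star (z : Cx (can T) U.left) : overEquiv U (star z) = star (overEquiv U z) := by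
  ext1
  · rfl
  · exact map_neg _ _

theorem overEquiv_symm_star (z : Cx (can (Over X)) U) :
    (overEquiv U).symm (star z) = star ((overEquiv U).symm z) := by
  ext1
  · rfl
  · exact map_neg _ _

end Cx

end Slice


/-! ### Unordered sums over a decidable object

A family of real numbers indexed by `X` at the stage `U` is a real number at the stage `X ⨯ U`. -/

section Sums

open Limits

variable {T : Type u} [Category.{v} T] {X U V W : T}

namespace IsDecidable

variable (hX : IsDecidable X)

/-- The Kronecker symbol as a real number. -/
def kronRe (x y : U ⟶ X) : DReal (can T) U := (hX.kron x y).re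

theorem kronRe_self (x : U ⟶ X) : hX.kronRe x x = 1 := by rw [kronRe, hX.kron_self, Cx.one_re]

theorem kronRe_ne {x y : U ⟶ X} (h : InternallyNe (can T) x y) : hX.kronRe x y = 0 := by
  rw [kronRe, hX.kron_ne h, Cx.zero_re]

theorem kronRe_restrict (x y : U ⟶ X) (f : V ⟶ U) :
    (hX.kronRe x y).restrict f = hX.kronRe (f ≫ x) (f ≫ y) :=
  congrArg Cx.re (hX.kron_restrict x y f)

theorem kronRe_comm (x y : U ⟶ X) : hX.kronRe x y = hX.kronRe y x :=
  congrArg Cx.re (hX.kron_comm x y)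

theorem kronRe_mul_self (x y : U ⟶ X) : hX.kronRe x y * hX.kronRe x y = hX.kronRe x y := by
  refine DReal.eq_of_locally ((hX x y).mono fun V f hf => ?_)
  rw [DReal.restrict_mul, kronRe_restrict]
  rcases hf with hf | hf
  · rw [hf, kronRe_self, one_mul]
  · rw [hX.kronRe_ne hf, zero_mul]

theorem one_sub_kronRe_mul_self (x y : U ⟶ X) :
    (1 - hX.kronRe x y) * (1 - hX.kronRe x y) = 1 - hX.kronRe x y := by
  linear_combination hX.kronRe_mul_self x y

theorem kronRe_le_one (x y : U ⟶ X) : hX.kronRe x y ≤ 1 := by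
  rw [← sub_nonneg, ← one_sub_kronRe_mul_self]; exact DReal.mul_self_nonneg' _

/-- The characteristic function of the complement of a list. -/
def chi (l : List (U ⟶ X)) (x : U ⟶ X) : DReal (can T) U :=
  (l.map fun y => 1 - hX.kronRe y x).prod

theorem chi_nil (x : U ⟶ X) : hX.chi [] x = 1 := rfl

theorem chi_cons (y : U ⟶ X) (l : List (U ⟶ X)) (x : U ⟶ X) :
    hX.chi (y :: l) x = (1 - hX.kronRe y x) * hX.chi l x := List.prod_cons

theorem chi_append (l m : List (U ⟶ X)) (x : U ⟶ X) :
    hX.chi (l ++ m) x = hX.chi l x * hX.chi m x := by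
  rw [chi, List.map_append, List.prod_append, chi, chi]

theorem chi_restrict (f : V ⟶ U) (l : List (U ⟶ X)) (x : U ⟶ X) :
    (hX.chi l x).restrict f = hX.chi (l.map (f ≫ ·)) (f ≫ x) := by
  induction l with
  | nil => exact DReal.restrict_one f
  | cons y l ih =>
    rw [chi_cons, DReal.restrict_mul, ih, DReal.restrict_sub, DReal.restrict_one, kronRe_restrict,
      List.map_cons, chi_cons]

theorem chi_mul_self (l : List (U ⟶ X)) (x : U ⟶ X) : hX.chi l x * hX.chi l x = hX.chi l x := by
  induction l with
  | nil => exact one_mul 1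
  | cons y l ih => rw [chi_cons, mul_mul_mul_comm, ih, one_sub_kronRe_mul_self]

theorem chi_nonneg (l : List (U ⟶ X)) (x : U ⟶ X) : 0 ≤ hX.chi l x := by
  rw [← chi_mul_self]; exact DReal.mul_self_nonneg' _

theorem chi_of_mem {l : List (U ⟶ X)} {x : U ⟶ X} (h : x ∈ l) : hX.chi l x = 0 := by
  induction l with
  | nil => simp at h
  | cons y l ih =>
    rw [chi_cons]
    rcases List.mem_cons.1 h with rfl | h
    · rw [kronRe_self, sub_self, zero_mul]
    · rw [ih h, mul_zero]

end IsDecidable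

variable [HasFiniteLimits T]

/-- The base change of a map of stages to the index object. -/
def bc (X : T) {U V : T} (f : V ⟶ U) : X ⨯ V ⟶ X ⨯ U := prod.map (𝟙 X) f

/-- The point of the index object over the stage `U` given by `x`. -/
def pt (x : U ⟶ X) : U ⟶ X ⨯ U := prod.lift x (𝟙 U)

theorem pt_bc (f : V ⟶ U) (x : V ⟶ X) : pt x ≫ bc X f = prod.lift x f := by
  rw [pt, bc, prod.lift_map, Category.comp_id, Category.id_comp]

theorem comp_pt (f : V ⟶ U) (x : U ⟶ X) : f ≫ pt x = pt (f ≫ x) ≫ bc X f := by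
  rw [pt_bc, pt, prod.comp_lift, Category.comp_id]

theorem bc_comp (f : V ⟶ U) (g : W ⟶ V) : bc X (g ≫ f) = bc X g ≫ bc X f := by
  simp [bc]

theorem bc_id : bc X (𝟙 U) = 𝟙 (X ⨯ U) := by simp [bc]

theorem pt_fst (x : U ⟶ X) : pt x ≫ prod.fst = x := prod.lift_fst _ _

theorem pt_snd (x : U ⟶ X) : pt x ≫ prod.snd = 𝟙 U := prod.lift_snd _ _

theorem bc_fst (f : V ⟶ U) : bc X f ≫ prod.fst = prod.fst := by simp [bc]

theorem bc_snd (f : V ⟶ U) : bc X f ≫ prod.snd = prod.snd ≫ f := by simp [bc]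

namespace IsDecidable

variable (hX : IsDecidable X)

/-- The characteristic function of the complement of a list, as a family indexed by `X`. -/
def co (l : List (U ⟶ X)) : DReal (can T) (X ⨯ U) := hX.chi (l.map (prod.snd ≫ ·)) prod.fst

/-- The characteristic function of an element of `X`, as a family indexed by `X`. -/
def single (x : U ⟶ X) : DReal (can T) (X ⨯ U) := hX.kronRe (prod.snd ≫ x) prod.fst

theorem co_cons (x : U ⟶ X) (l : List (U ⟶ X)) :
    hX.co (x :: l) = (1 - hX.single x) * hX.co l := by
  rw [co, List.map_cons, chi_cons]; rfl

theorem co_append (l m : List (U ⟶ X)) : hX.co (l ++ m) = hX.co l * hX.co m := by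
  rw [co, List.map_append, chi_append]; rfl

theorem co_nonneg (l : List (U ⟶ X)) : 0 ≤ hX.co l := hX.chi_nonneg _ _

theorem co_mul_self (l : List (U ⟶ X)) : hX.co l * hX.co l = hX.co l := hX.chi_mul_self _ _

theorem co_restrict (f : V ⟶ U) (l : List (U ⟶ X)) :
    (hX.co l).restrict (bc X f) = hX.co (l.map (f ≫ ·)) := by
  rw [co, chi_restrict, bc_fst, co, List.map_map, List.map_map]
  congr 1
  refine List.map_congr_left fun y _ => ?_
  change bc X f ≫ prod.snd ≫ y = prod.snd ≫ f ≫ y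
  rw [← Category.assoc, bc_snd, Category.assoc]

theorem single_restrict (f : V ⟶ U) (x : U ⟶ X) :
    (hX.single x).restrict (bc X f) = hX.single (f ≫ x) := by
  rw [single, kronRe_restrict, bc_fst, ← Category.assoc, bc_snd, Category.assoc, single]

end IsDecidable

/-- The member with index `x` of a family of real numbers. -/
def ev (a : DReal (can T) (X ⨯ U)) (x : U ⟶ X) : DReal (can T) U := a.restrict (pt x)

theorem ev_restrict (a : DReal (can T) (X ⨯ U)) (x : U ⟶ X) (f : V ⟶ U) :
    (ev a x).restrict f = ev (a.restrict (bc X f)) (f ≫ x) := by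
  rw [ev, ← DReal.restrict_comp, comp_pt, DReal.restrict_comp, ev]

theorem ev_add (a b : DReal (can T) (X ⨯ U)) (x : U ⟶ X) : ev (a + b) x = ev a x + ev b x :=
  DReal.restrict_add _ _ _

theorem ev_mul (a b : DReal (can T) (X ⨯ U)) (x : U ⟶ X) : ev (a * b) x = ev a x * ev b x :=
  DReal.restrict_mul _ _ _

theorem ev_mono {a b : DReal (can T) (X ⨯ U)} (h : a ≤ b) (x : U ⟶ X) : ev a x ≤ ev b x :=
  DReal.restrict_mono h _

theorem ev_const (c : DReal (can T) U) (x : U ⟶ X) : ev (c.restrict prod.snd) x = c := by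
  rw [ev, ← DReal.restrict_comp, pt_snd, DReal.restrict_id]

/-- Inequalities between families are tested on their members. -/
theorem le_of_ev {a b : DReal (can T) (X ⨯ U)}
    (h : ∀ ⦃V : T⦄ (f : V ⟶ U) (x : V ⟶ X),
      ev (a.restrict (bc X f)) x ≤ ev (b.restrict (bc X f)) x) : a ≤ b := by
  have := h (prod.snd : X ⨯ U ⟶ U) prod.fst
  have e : pt (prod.fst : X ⨯ U ⟶ X) ≫ bc X (prod.snd : X ⨯ U ⟶ U) = 𝟙 _ := by
    rw [pt_bc]; ext <;> simp
  rwa [ev, ev, ← DReal.restrict_comp, ← DReal.restrict_comp, e, DReal.restrict_id,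
    DReal.restrict_id] at this

variable (hX : IsDecidable X)

theorem IsDecidable.ev_co (l : List (U ⟶ X)) (x : U ⟶ X) : ev (hX.co l) x = hX.chi l x := by
  rw [ev, co, chi_restrict, pt_fst, List.map_map]
  congr 1
  conv_rhs => rw [← List.map_id l]
  refine List.map_congr_left fun y _ => ?_
  change pt x ≫ prod.snd ≫ y = y
  rw [← Category.assoc, pt_snd, Category.id_comp]

theorem IsDecidable.ev_single (x y : U ⟶ X) : ev (hX.single x) y = hX.kronRe x y := by
  rw [ev, single, kronRe_restrict, pt_fst, ← Category.assoc, pt_snd, Category.id_comp]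

theorem IsDecidable.kronRe_mul_ev (a : DReal (can T) (X ⨯ U)) (x y : U ⟶ X) :
    hX.kronRe x y * ev a y = hX.kronRe x y * ev a x := by
  refine DReal.eq_of_locally ((hX x y).mono fun V f hf => ?_)
  rw [DReal.restrict_mul, DReal.restrict_mul, kronRe_restrict, ev_restrict, ev_restrict]
  rcases hf with hf | hf
  · rw [hf]
  · rw [hX.kronRe_ne hf, zero_mul, zero_mul]

/-- The sum of the members of a family with index in a list, each of which is counted once. -/
def finSum (a : DReal (can T) (X ⨯ U)) : List (U ⟶ X) → DReal (can T) U
  | [] => 0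
  | x :: l => finSum a l + hX.chi l x * ev a x

variable (a b : DReal (can T) (X ⨯ U))

theorem finSum_nil : finSum hX a [] = 0 := rfl

theorem finSum_cons (x : U ⟶ X) (l : List (U ⟶ X)) :
    finSum hX a (x :: l) = finSum hX a l + hX.chi l x * ev a x := rfl

theorem finSum_restrict (f : V ⟶ U) (l : List (U ⟶ X)) :
    (finSum hX a l).restrict f = finSum hX (a.restrict (bc X f)) (l.map (f ≫ ·)) := by
  induction l with
  | nil => exact DReal.restrict_zero f
  | cons x l ih =>
    rw [finSum_cons, DReal.restrict_add, ih, DReal.restrict_mul, hX.chi_restrict, ev_restrict,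
      List.map_cons, finSum_cons]

theorem finSum_add (l : List (U ⟶ X)) : finSum hX (a + b) l = finSum hX a l + finSum hX b l := by
  induction l with
  | nil => exact (add_zero 0).symm
  | cons x l ih => rw [finSum_cons, finSum_cons, finSum_cons, ih, ev_add]; ring

theorem finSum_const_mul (c : DReal (can T) U) (l : List (U ⟶ X)) :
    finSum hX (c.restrict prod.snd * a) l = c * finSum hX a l := by
  induction l with
  | nil => exact (mul_zero c).symm
  | cons x l ih => rw [finSum_cons, finSum_cons, ih, ev_mul, ev_const]; ring

theorem finSum_zero (l : List (U ⟶ X)) : finSum hX 0 l = 0 := by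
  have := finSum_add hX 0 0 l
  rwa [add_zero, left_eq_add] at this

theorem finSum_neg (l : List (U ⟶ X)) : finSum hX (-a) l = -finSum hX a l := by
  rw [eq_neg_iff_add_eq_zero, ← finSum_add, neg_add_cancel, finSum_zero]

theorem finSum_sub (l : List (U ⟶ X)) : finSum hX (a - b) l = finSum hX a l - finSum hX b l := by
  rw [sub_eq_add_neg, finSum_add, finSum_neg, ← sub_eq_add_neg]

variable {a b} in
theorem finSum_mono (h : a ≤ b) (l : List (U ⟶ X)) : finSum hX a l ≤ finSum hX b l := by
  induction l with
  | nil => exact le_rfl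
  | cons x l ih =>
    exact add_le_add ih (mul_le_mul_of_nonneg_left (ev_mono h x) (hX.chi_nonneg _ _))

theorem finSum_nonneg (h : 0 ≤ a) (l : List (U ⟶ X)) : 0 ≤ finSum hX a l :=
  (finSum_zero hX l).symm.le.trans (finSum_mono hX h l)

theorem finSum_append (m l : List (U ⟶ X)) :
    finSum hX a (m ++ l) = finSum hX a l + finSum hX (hX.co l * a) m := by
  induction m with
  | nil => rw [List.nil_append, finSum_nil, add_zero]
  | cons x m ih =>
    rw [List.cons_append, finSum_cons, ih, finSum_cons, hX.chi_append, ev_mul, hX.ev_co]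
    ring

theorem finSum_single_mul (x : U ⟶ X) (m : List (U ⟶ X)) :
    finSum hX (hX.single x * a) m = (1 - hX.chi m x) * ev a x := by
  induction m with
  | nil => rw [finSum_nil, hX.chi_nil, sub_self, zero_mul]
  | cons y m ih =>
    have h : hX.kronRe x y * (hX.chi m y * ev a y) = hX.kronRe x y * (hX.chi m x * ev a x) := by
      have := hX.kronRe_mul_ev (hX.co m * a) x y
      rwa [ev_mul, ev_mul, hX.ev_co, hX.ev_co] at this
    rw [finSum_cons, ih, ev_mul, hX.ev_single, hX.chi_cons, hX.kronRe_comm y x]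
    linear_combination h

theorem finSum_add_finSum_co (l m : List (U ⟶ X)) :
    finSum hX a l + finSum hX (hX.co l * a) m = finSum hX a m + finSum hX (hX.co m * a) l := by
  induction l with
  | nil =>
    rw [finSum_nil, finSum_nil, zero_add, add_zero]
    congr 1
    exact one_mul a
  | cons x l ih =>
    have e : hX.co (x :: l) * a = hX.co l * a - hX.single x * (hX.co l * a) := by
      rw [hX.co_cons]; ring
    rw [e, finSum_sub, finSum_single_mul, finSum_cons, finSum_cons, ev_mul, ev_mul, hX.ev_co,
      hX.ev_co]
    linear_combination ih

theorem finSum_append_comm (l m : List (U ⟶ X)) :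
    finSum hX a (l ++ m) = finSum hX a (m ++ l) := by
  rw [finSum_append, finSum_append, finSum_add_finSum_co]

variable {a} in
theorem finSum_co_le (h : 0 ≤ a) (l m : List (U ⟶ X)) :
    finSum hX (hX.co l * a) m ≤ finSum hX a m := by
  have := finSum_add_finSum_co hX a l m
  rw [← sub_nonneg]
  have h1 : 0 ≤ finSum hX a l - finSum hX (hX.co m * a) l := by
    rw [← finSum_sub]
    refine finSum_nonneg hX _ ?_ l
    have h2 : 0 ≤ 1 - hX.co m := by
      have : (1 - hX.co m) * (1 - hX.co m) = 1 - hX.co m := by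
        linear_combination hX.co_mul_self m
      rw [← this]; exact DReal.mul_self_nonneg' _
    refine (mul_nonneg h2 h).trans_eq ?_
    ring
  refine h1.trans_eq ?_
  linear_combination this

variable {a} in
/-- A sum of terms which are at most `c` is at most `c` times the number of terms. -/
theorem finSum_le_length_mul {c : ℝ} (hc : 0 ≤ c) (h : a ≤ DReal.const c) (l : List (U ⟶ X)) :
    finSum hX a l ≤ DReal.const (l.length * c) := by
  have hchi : ∀ (l : List (U ⟶ X)) (x : U ⟶ X), hX.chi l x ≤ 1 := fun l x => by
    have : (1 - hX.chi l x) * (1 - hX.chi l x) = 1 - hX.chi l x := by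
      linear_combination hX.chi_mul_self l x
    rw [← sub_nonneg, ← this]; exact DReal.mul_self_nonneg' _
  induction l with
  | nil => exact DReal.const_nonneg (by simp)
  | cons x l ih =>
    have h1 := ev_mono h x
    rw [ev, ev, DReal.restrict_const] at h1
    have h2 := (mul_le_mul_of_nonneg_left h1 (hX.chi_nonneg l x)).trans
      (mul_le_mul_of_nonneg_right (hchi l x) (DReal.const_nonneg hc))
    rw [one_mul] at h2
    refine (add_le_add ih h2).trans_eq ?_
    rw [← DReal.const_add]
    congr 1
    push_cast [List.length_cons]
    ring

/-! ### Limits of sums -/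

/-- `r` is the sum of the family `a`: the sums over all sufficiently large lists are close to `r`. -/
def HasSum (a : DReal (can T) (X ⨯ U)) (r : DReal (can T) U) : Prop :=
  ∀ ε : ℝ, 0 < ε → Locally (can T) (fun ⦃V : T⦄ (f : V ⟶ U) => ∃ l : List (V ⟶ X),
    ∀ ⦃W : T⦄ (g : W ⟶ V) (m : List (W ⟶ X)),
      r.restrict (g ≫ f) ≤ finSum hX (a.restrict (bc X (g ≫ f))) (m ++ l.map (g ≫ ·)) +
        DReal.const ε ∧
      finSum hX (a.restrict (bc X (g ≫ f))) (m ++ l.map (g ≫ ·)) ≤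
        r.restrict (g ≫ f) + DReal.const ε)

/-- The nonnegative family `a` is summable: the sums over finite lists outside of a sufficiently
large list are small. -/
def HasSmallTails (a : DReal (can T) (X ⨯ U)) : Prop :=
  ∀ ε : ℝ, 0 < ε → Locally (can T) (fun ⦃V : T⦄ (f : V ⟶ U) => ∃ l : List (V ⟶ X),
    ∀ ⦃W : T⦄ (g : W ⟶ V) (m : List (W ⟶ X)),
      finSum hX ((hX.co l * a.restrict (bc X f)).restrict (bc X g)) m ≤ DReal.const ε)

variable {a b hX}

theorem HasSum.restrict {r : DReal (can T) U} (h : HasSum hX a r) (f : V ⟶ U) :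
    HasSum hX (a.restrict (bc X f)) (r.restrict f) := fun ε hε => by
  refine ((h ε hε).restrict f).mono fun W g ⟨l, hl⟩ => ⟨l, fun Z k m => ?_⟩
  rw [← DReal.restrict_comp, ← DReal.restrict_comp, ← bc_comp, Category.assoc]
  exact hl k m

theorem HasSum.neg {r : DReal (can T) U} (h : HasSum hX a r) : HasSum hX (-a) (-r) :=
  fun ε hε => (h ε hε).mono fun W g ⟨l, hl⟩ => ⟨l, fun Z k m => by
    obtain ⟨h1, h2⟩ := hl k m
    rw [DReal.restrict_neg, DReal.restrict_neg, finSum_neg]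
    constructor
    · rw [neg_add_eq_sub, le_sub_iff_add_le, neg_add_eq_sub, sub_le_iff_le_add, add_comm]
      exact h2
    · rw [neg_add_eq_sub, le_sub_iff_add_le, neg_add_eq_sub, sub_le_iff_le_add, add_comm]
      exact h1⟩

theorem HasSum.add {r s : DReal (can T) U} (ha : HasSum hX a r) (hb : HasSum hX b s) :
    HasSum hX (a + b) (r + s) := fun ε hε => by
  refine (ha _ (half_pos hε)).bind fun V f ⟨l, hl⟩ => ?_
  refine ((hb _ (half_pos hε)).restrict f).mono fun W g ⟨m, hm⟩ => ⟨l.map (g ≫ ·) ++ m,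
    fun Z k n => ?_⟩
  have e1 : (l.map (g ≫ ·) ++ m).map (k ≫ ·) = l.map ((k ≫ g) ≫ ·) ++ m.map (k ≫ ·) := by simp
  obtain ⟨h1, h2⟩ := hl (k ≫ g) (n ++ m.map (k ≫ ·))
  obtain ⟨h3, h4⟩ := hm k (n ++ l.map ((k ≫ g) ≫ ·))
  have hperm : ∀ c : DReal (can T) (X ⨯ Z),
      finSum hX c ((n ++ m.map (k ≫ ·)) ++ l.map ((k ≫ g) ≫ ·)) =
        finSum hX c (n ++ (l.map ((k ≫ g) ≫ ·) ++ m.map (k ≫ ·))) := fun c => by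
    rw [List.append_assoc, finSum_append_comm, finSum_append, finSum_append_comm, ← finSum_append,
      finSum_append_comm]
  have hc : (DReal.const ε : DReal (can T) Z) = DReal.const (ε / 2) + DReal.const (ε / 2) := by
    rw [← DReal.const_add, add_halves]
  rw [hperm, Category.assoc] at h1 h2
  rw [List.append_assoc] at h3 h4
  rw [e1, DReal.restrict_add, DReal.restrict_add, finSum_add, hc]
  constructor
  · refine (add_le_add h1 h3).trans_eq ?_
    ring
  · refine (add_le_add h2 h4).trans_eq ?_
    ring

theorem HasSum.le {r s : DReal (can T) U} (ha : HasSum hX a r) (hb : HasSum hX b s)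
    (hab : a ≤ b) : r ≤ s := by
  have h := hb.add ha.neg
  rw [← sub_nonneg, sub_eq_add_neg]
  refine DReal.le_of_forall_pos_le_add fun ε hε => DReal.le_of_locally
    ((h ε hε).mono fun V f ⟨l, hl⟩ => ?_)
  have h1 := (hl (𝟙 V) []).2
  rw [Category.id_comp] at h1
  rw [DReal.restrict_zero, DReal.restrict_add _ (DReal.const ε), DReal.restrict_const]
  refine le_trans (finSum_nonneg hX _ ?_ _) h1
  have h2 := DReal.restrict_mono (sub_nonneg.2 hab) (bc X f)
  rwa [DReal.restrict_zero, sub_eq_add_neg] at h2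

theorem HasSum.unique {r s : DReal (can T) U} (ha : HasSum hX a r) (hb : HasSum hX a s) : r = s :=
  le_antisymm (ha.le hb le_rfl) (hb.le ha le_rfl)

theorem HasSum.le_const {r : DReal (can T) U} (ha : HasSum hX a r) {c : ℝ}
    (h : ∀ ⦃V : T⦄ (f : V ⟶ U) (l : List (V ⟶ X)),
      finSum hX (a.restrict (bc X f)) l ≤ DReal.const c) : r ≤ DReal.const c := by
  refine DReal.le_of_forall_pos_le_add fun ε hε => DReal.le_of_locally
    ((ha ε hε).mono fun V f ⟨l, hl⟩ => ?_)
  have h1 := (hl (𝟙 V) []).1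
  rw [Category.id_comp] at h1
  rw [DReal.restrict_add, DReal.restrict_const, DReal.restrict_const]
  exact h1.trans (add_le_add (h _ _) le_rfl)

theorem hasSum_single_mul (a : DReal (can T) (X ⨯ U)) (x : U ⟶ X) :
    HasSum hX (hX.single x * a) (ev a x) := fun ε hε => by
  refine Locally.of_forall fun V f => ⟨[f ≫ x], fun W g m => ?_⟩
  rw [DReal.restrict_mul, hX.single_restrict, finSum_single_mul, ev_restrict]
  have : (g ≫ f) ≫ x ∈ m ++ [f ≫ x].map (g ≫ ·) := by simp
  rw [hX.chi_of_mem this, sub_zero, one_mul]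
  exact ⟨le_add_of_nonneg_right (DReal.const_nonneg hε.le),
    le_add_of_nonneg_right (DReal.const_nonneg hε.le)⟩

theorem HasSum.mul_left {r : DReal (can T) U} (h : HasSum hX a r) (c : DReal (can T) U) :
    HasSum hX (c.restrict prod.snd * a) (c * r) := by
  -- The difference of `c * r` and a partial sum is `c * (r - s)`, where `r - s` is at most `δ` in
  -- modulus and `c` is locally bounded by a number `n`.
  intro ε hε
  refine c.locally_le_const.bind fun V f ⟨n, hn⟩ => ?_
  refine ((-c).locally_le_const.restrict f).bind fun V' f' ⟨n', hn'⟩ => ?_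
  have hδ : 0 < ε / (n + n' + 1) := by positivity
  set δ := ε / (n + n' + 1)
  refine ((h δ hδ).restrict (f' ≫ f)).mono fun W g ⟨l, hl⟩ => ⟨l, fun Z k m => ?_⟩
  obtain ⟨h1, h2⟩ := hl k m
  set p := k ≫ g ≫ f' ≫ f with hp
  have e1 : (c.restrict (prod.snd : X ⨯ U ⟶ U) * a).restrict (bc X p) =
      (c.restrict p).restrict prod.snd * a.restrict (bc X p) := by
    rw [DReal.restrict_mul, ← DReal.restrict_comp, ← DReal.restrict_comp, bc_snd]
  rw [show k ≫ (g ≫ f') ≫ f = p by rw [hp, Category.assoc], e1, finSum_const_mul,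
    DReal.restrict_mul]
  set s := finSum hX (a.restrict (bc X p)) (m ++ l.map (k ≫ ·))
  have hb1 : c.restrict p ≤ (DReal.const ((n : ℝ) + n') : DReal (can T) Z) := by
    have := DReal.restrict_mono hn (k ≫ g ≫ f')
    rw [DReal.restrict_const, ← DReal.restrict_comp, Category.assoc, Category.assoc] at this
    exact this.trans (DReal.const_mono (by simp))
  have hb2 : -c.restrict p ≤ (DReal.const ((n : ℝ) + n') : DReal (can T) Z) := by
    have := DReal.restrict_mono hn' (k ≫ g)
    rw [DReal.restrict_const, ← DReal.restrict_comp, DReal.restrict_neg, Category.assoc] at this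
    exact this.trans (DReal.const_mono (by simp))
  set C : DReal (can T) Z := DReal.const ((n : ℝ) + n')
  set d : DReal (can T) Z := DReal.const δ
  have hCd : C * d ≤ DReal.const ε := by
    rw [← DReal.const_mul]
    apply DReal.const_mono
    have : (n + n' + 1 : ℝ) * δ = ε := mul_div_cancel₀ _ (by positivity)
    linarith
  have p1 : 0 ≤ C - c.restrict p := sub_nonneg.2 hb1
  have p2 : 0 ≤ C + c.restrict p := by
    have := sub_nonneg.2 hb2
    rwa [sub_neg_eq_add] at this
  have p3 : 0 ≤ s + d - r.restrict p := sub_nonneg.2 h1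
  have p4 : 0 ≤ r.restrict p + d - s := sub_nonneg.2 h2
  -- `2 (C d - c (r - s)) = (C + c) (s + d - r) + (C - c) (r + d - s)`
  have key1 := add_nonneg (mul_nonneg p2 p3) (mul_nonneg p1 p4)
  have key2 := add_nonneg (mul_nonneg p1 p3) (mul_nonneg p2 p4)
  constructor
  · refine le_trans ?_ (add_le_add le_rfl hCd)
    apply DReal.le_of_const_mul_le two_pos
    rw [DReal.const_two, ← sub_nonneg]
    refine key1.trans_eq ?_
    ring
  · refine le_trans ?_ (add_le_add le_rfl hCd)
    apply DReal.le_of_const_mul_le two_pos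
    rw [DReal.const_two, ← sub_nonneg]
    refine key2.trans_eq ?_
    ring

/-- A family which is dominated by a summable family has a sum. -/
theorem HasSmallTails.exists_hasSum (ha : HasSmallTails hX a) (h1 : b ≤ a) (h2 : -b ≤ a) :
    ∃ r, HasSum hX b r := by
  let B : ℚ → ∀ ⦃V : T⦄, (V ⟶ U) → DReal (can T) V → Prop := fun ε V f s =>
    ∃ l : List (V ⟶ X), ∀ ⦃W : T⦄ (g : W ⟶ V) (m : List (W ⟶ X)),
      s.restrict g ≤ finSum hX (b.restrict (bc X (g ≫ f))) (m ++ l.map (g ≫ ·)) +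
        DReal.const (ε : ℝ) ∧
      finSum hX (b.restrict (bc X (g ≫ f))) (m ++ l.map (g ≫ ·)) ≤
        s.restrict g + DReal.const (ε : ℝ)
  have hB : ∀ ε > 0, Locally (can T) (fun ⦃V : T⦄ (f : V ⟶ U) => ∃ l : List (V ⟶ X),
      ∀ ⦃W : T⦄ (g : W ⟶ V) (m : List (W ⟶ X)),
      (finSum hX (b.restrict (bc X f)) l).restrict g ≤
        finSum hX (b.restrict (bc X (g ≫ f))) (m ++ l.map (g ≫ ·)) + DReal.const (ε : ℝ) ∧
      finSum hX (b.restrict (bc X (g ≫ f))) (m ++ l.map (g ≫ ·)) ≤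
        (finSum hX (b.restrict (bc X f)) l).restrict g + DReal.const (ε : ℝ)) := by
    intro ε hε
    refine (ha ε hε).mono fun V f ⟨l, hl⟩ => ⟨l, fun W g m => ?_⟩
    have e1 : (hX.co l * a.restrict (bc X f)).restrict (bc X g) =
        hX.co (l.map (g ≫ ·)) * a.restrict (bc X (g ≫ f)) := by
      rw [DReal.restrict_mul, hX.co_restrict, ← DReal.restrict_comp, bc_comp]
    have h := hl g m
    rw [e1] at h
    rw [finSum_restrict, ← DReal.restrict_comp, ← bc_comp, finSum_append]
    have h3 := mul_le_mul_of_nonneg_left (DReal.restrict_mono h1 (bc X (g ≫ f)))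
      (hX.co_nonneg (l.map (g ≫ ·)))
    have h4 := mul_le_mul_of_nonneg_left (DReal.restrict_mono h2 (bc X (g ≫ f)))
      (hX.co_nonneg (l.map (g ≫ ·)))
    rw [DReal.restrict_neg, mul_neg] at h4
    have h5 := (finSum_mono hX h3 m).trans h
    have h6 := (finSum_mono hX h4 m).trans h
    rw [finSum_neg] at h6
    refine ⟨?_, add_le_add le_rfl h5⟩
    rw [add_assoc]
    refine le_add_of_nonneg_right ?_
    have := sub_nonneg.2 h6
    rwa [sub_neg_eq_add, add_comm] at this
  obtain ⟨r, hr⟩ := DReal.exists_limit B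
    (fun ε _ V f s ⟨l, hl⟩ W g => ⟨l.map (g ≫ ·), fun Z k m => by
      have := hl (k ≫ g) m
      rw [← DReal.restrict_comp, List.map_map]
      simpa [Function.comp_def] using this⟩)
    (fun ε hε => (hB ε (by exact_mod_cast hε)).mono fun V f ⟨l, hl⟩ => ⟨_, l, hl⟩)
    (fun ε hε δ hδ V f s s' ⟨l, hl⟩ ⟨l', hl'⟩ => by
      have h3 := (hl (𝟙 V) l').1
      have h4 := (hl' (𝟙 V) l).2
      have e : ∀ l : List (V ⟶ X), l.map (𝟙 V ≫ ·) = l := fun l => by simp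
      rw [DReal.restrict_id, e] at h3 h4
      rw [finSum_append_comm] at h4
      push_cast
      rw [DReal.const_add]
      refine h3.trans ((add_le_add h4 le_rfl).trans_eq ?_)
      ring)
  refine ⟨r, fun ε hε => ?_⟩
  obtain ⟨δ, hδ, hδε⟩ := exists_rat_btwn (half_pos hε)
  have hδ0 : (0 : ℚ) < δ := by exact_mod_cast hδ
  refine (hB δ hδ).mono fun V f ⟨l, hl⟩ => ⟨l, fun W g m => ?_⟩
  obtain ⟨h3, h4⟩ := hr δ hδ0 f _ ⟨l, hl⟩
  have h3' := DReal.restrict_mono h3 g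
  have h4' := DReal.restrict_mono h4 g
  rw [DReal.restrict_add, DReal.restrict_const, ← DReal.restrict_comp] at h3' h4'
  obtain ⟨h5, h6⟩ := hl g m
  have hc : (DReal.const (δ : ℝ) + DReal.const (δ : ℝ) : DReal (can T) W) ≤ DReal.const ε := by
    rw [← DReal.const_add]; exact DReal.const_mono (by linarith)
  constructor
  · refine (h3'.trans (add_le_add h5 le_rfl)).trans ?_
    rw [add_assoc]
    exact add_le_add le_rfl hc
  · refine (h6.trans (add_le_add h4' le_rfl)).trans ?_
    rw [add_assoc]
    exact add_le_add le_rfl hc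

theorem HasSmallTails.restrict (h : HasSmallTails hX a) (f : V ⟶ U) :
    HasSmallTails hX (a.restrict (bc X f)) := fun ε hε => by
  refine ((h ε hε).restrict f).mono fun W g ⟨l, hl⟩ => ⟨l, fun Z k m => ?_⟩
  have := hl k m
  rwa [bc_comp, DReal.restrict_comp] at this

theorem HasSmallTails.of_locally (h : Locally (can T) (fun ⦃V : T⦄ (f : V ⟶ U) =>
    HasSmallTails hX (a.restrict (bc X f)))) : HasSmallTails hX a := fun ε hε =>
  h.bind fun V f hf => (hf ε hε).mono fun W g ⟨l, hl⟩ => ⟨l, fun Z k m => by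
    have := hl k m
    rwa [← DReal.restrict_comp, ← bc_comp] at this⟩

theorem HasSmallTails.mono (hb : HasSmallTails hX b) (h : a ≤ b) : HasSmallTails hX a :=
  fun ε hε => (hb ε hε).mono fun _ _ ⟨l, hl⟩ => ⟨l, fun _ g m =>
    (finSum_mono hX (DReal.restrict_mono (mul_le_mul_of_nonneg_left
      (DReal.restrict_mono h _) (hX.co_nonneg l)) _) m).trans (hl g m)⟩

theorem HasSmallTails.add (ha : HasSmallTails hX a) (hb : HasSmallTails hX b) (ha0 : 0 ≤ a)
    (hb0 : 0 ≤ b) : HasSmallTails hX (a + b) := fun ε hε => by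
  refine (ha _ (half_pos hε)).bind fun V f ⟨l, hl⟩ => ?_
  refine ((hb _ (half_pos hε)).restrict f).mono fun W g ⟨m, hm⟩ => ⟨l.map (g ≫ ·) ++ m,
    fun Z k n => ?_⟩
  have h1 := hl (k ≫ g) n
  have h2 := hm k n
  rw [DReal.restrict_mul, hX.co_restrict, ← DReal.restrict_comp, ← bc_comp] at h1 h2
  have e1 : (l.map (g ≫ ·) ++ m).map (k ≫ ·) = l.map ((k ≫ g) ≫ ·) ++ m.map (k ≫ ·) := by simp
  rw [DReal.restrict_mul, hX.co_restrict, e1, ← DReal.restrict_comp, ← bc_comp,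
    DReal.restrict_add, mul_add, finSum_add, hX.co_append]
  rw [Category.assoc] at h1
  have n1 : (0 : DReal (can T) (X ⨯ Z)) ≤ a.restrict (bc X (k ≫ g ≫ f)) :=
    (DReal.restrict_zero _).symm.le.trans (DReal.restrict_mono ha0 _)
  have n2 : (0 : DReal (can T) (X ⨯ Z)) ≤ b.restrict (bc X (k ≫ g ≫ f)) :=
    (DReal.restrict_zero _).symm.le.trans (DReal.restrict_mono hb0 _)
  rw [← add_halves ε, DReal.const_add]
  refine add_le_add (le_trans ?_ h1) (le_trans ?_ h2)
  · rw [mul_comm (hX.co _), mul_assoc]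
    exact finSum_co_le hX (mul_nonneg (hX.co_nonneg _) n1) _ _
  · rw [mul_assoc]
    exact finSum_co_le hX (mul_nonneg (hX.co_nonneg _) n2) _ _

theorem HasSmallTails.const_mul (ha : HasSmallTails hX a) (ha0 : 0 ≤ a) (c : DReal (can T) U) :
    HasSmallTails hX (c.restrict prod.snd * a) := fun ε hε => by
  refine c.locally_le_const.bind fun V f ⟨n, hn⟩ => ?_
  have hδ : 0 < ε / (n + 1) := by positivity
  refine ((ha _ hδ).restrict f).mono fun W g ⟨l, hl⟩ => ⟨l, fun Z k m => ?_⟩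
  have h1 := hl k m
  have e : (hX.co l * (c.restrict (prod.snd : X ⨯ U ⟶ U) * a).restrict (bc X (g ≫ f))).restrict
      (bc X k) = (c.restrict (k ≫ g ≫ f)).restrict prod.snd *
        (hX.co l * a.restrict (bc X (g ≫ f))).restrict (bc X k) := by
    have e0 : bc X k ≫ bc X (g ≫ f) ≫ (prod.snd : X ⨯ U ⟶ U) = prod.snd ≫ k ≫ g ≫ f := by
      rw [← Category.assoc, ← bc_comp, bc_snd]
    rw [DReal.restrict_mul (c.restrict _), DReal.restrict_mul, DReal.restrict_mul,
      DReal.restrict_mul, ← DReal.restrict_comp _ _ (bc X (g ≫ f)),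
      ← DReal.restrict_comp _ _ (bc X k), e0, ← DReal.restrict_comp c _ prod.snd]
    ring
  rw [e, finSum_const_mul]
  have h2 := DReal.restrict_mono hn (k ≫ g)
  rw [DReal.restrict_const, ← DReal.restrict_comp, Category.assoc] at h2
  refine (mul_le_mul h2 h1 (finSum_nonneg hX _ ?_ _)
    (DReal.const_nonneg (Nat.cast_nonneg n))).trans ?_
  · refine (DReal.restrict_zero _).symm.le.trans (DReal.restrict_mono (mul_nonneg
      (hX.co_nonneg _) ((DReal.restrict_zero _).symm.le.trans (DReal.restrict_mono ha0 _))) _)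
  · rw [← DReal.const_mul]
    apply DReal.const_mono
    rw [mul_div_assoc', div_le_iff₀ (by positivity)]
    nlinarith

/-- A family which vanishes outside of an element has small tails. -/
theorem hasSmallTails_single_mul (a : DReal (can T) (X ⨯ U)) (x : U ⟶ X) :
    HasSmallTails hX (hX.single x * a) := fun ε hε =>
  Locally.of_forall fun _ f => ⟨[f ≫ x], fun _ g m => by
    have e : (hX.co [f ≫ x] * (hX.single x * a).restrict (bc X f)) = 0 := by
      rw [DReal.restrict_mul, hX.single_restrict, hX.co_cons, ← mul_assoc]
      have : (1 - hX.single (f ≫ x)) * hX.co [] * hX.single (f ≫ x) = 0 := by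
        have := hX.kronRe_mul_self (prod.snd ≫ f ≫ x) (prod.fst : X ⨯ _ ⟶ X)
        change hX.single (f ≫ x) * hX.single (f ≫ x) = hX.single (f ≫ x) at this
        linear_combination -hX.co [] * this
      rw [this, zero_mul]
    rw [e, DReal.restrict_zero, finSum_zero]
    exact DReal.const_nonneg hε.le⟩

end Sums


/-! ### Representability of sheaves on a topos -/

section Site

open Opposite

variable {T : Type u} [Category.{v} T] {C : Type v} [SmallCategory C] {J : GrothendieckTopology C}
  {L : (Cᵒᵖ ⥤ Type v) ⥤ T} {R : T ⥤ Cᵒᵖ ⥤ Type v} (adj : L ⊣ R)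

/-- Generalized elements at the stage given by an object of the site are sections. -/
def secEquiv (c : C) (A : T) : (L.obj (yoneda.obj c) ⟶ A) ≃ (R.obj A).obj (op c) :=
  (adj.homEquiv _ _).trans yonedaEquiv

theorem secEquiv_comp {c : C} {A B : T} (s : L.obj (yoneda.obj c) ⟶ A) (f : A ⟶ B) :
    secEquiv adj c B (s ≫ f) = (R.map f).app (op c) (secEquiv adj c A s) := by
  simp only [secEquiv, Equiv.trans_apply, adj.homEquiv_naturality_right, yonedaEquiv_comp]

theorem secEquiv_map_comp {c d : C} {A : T} (g : d ⟶ c) (s : L.obj (yoneda.obj c) ⟶ A) :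
    secEquiv adj d A (L.map (yoneda.map g) ≫ s) = (R.obj A).map g.op (secEquiv adj c A s) := by
  simp only [secEquiv, Equiv.trans_apply, adj.homEquiv_naturality_left, yonedaEquiv_naturality]

theorem secEquiv_map {c d : C} (g : d ⟶ c) :
    secEquiv adj d _ (L.map (yoneda.map g)) = (adj.unit.app (yoneda.obj c)).app (op d) g := by
  have h := secEquiv_map_comp adj g (𝟙 (L.obj (yoneda.obj c)))
  have h' : secEquiv adj c _ (𝟙 (L.obj (yoneda.obj c))) =
      (adj.unit.app (yoneda.obj c)).app (op c) (𝟙 c) := by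
    simp [secEquiv, yonedaEquiv, adj.homEquiv_unit]
  rw [Category.comp_id, h', ← NatTrans.naturality_apply] at h
  rw [h]
  simp

include adj

/-- A criterion for a sieve to cover: it covers on sections. -/
theorem mem_can_of_functorPullback_mem [R.Full] [R.Faithful]
    (hR : ∀ Y, Presieve.IsSheaf J (R.obj Y)) {A : T} (S : Sieve A)
    (hS : ∀ (c : C) (s : (yoneda ⋙ L).obj c ⟶ A),
      (S.pullback s).functorPullback (yoneda ⋙ L) ∈ J c) : S ∈ can T A := by
  refine Sheaf.mem_finestTopology_of_forall_isSheafFor ?_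
  rintro _ ⟨Y, rfl⟩ B f
  have hS' : ∀ (c : C) (s : (yoneda ⋙ L).obj c ⟶ B),
      ((S.pullback f).pullback s).functorPullback (yoneda ⋙ L) ∈ J c := fun c s => by
    rw [← Sieve.pullback_comp]; exact hS c _
  generalize S.pullback f = S at hS'
  clear hS f
  intro x hx
  rw [Presieve.compatible_iff_sieveCompatible] at hx
  have hx' : ∀ {V W : T} (f : V ⟶ B) (g : W ⟶ V) (hf : S f),
      x (g ≫ f) (S.downward_closed hf g) = g ≫ x f hf := fun f g hf => hx f g hf
  let t : ∀ (c : C) (s : (yoneda ⋙ L).obj c ⟶ B), Presieve.FamilyOfElements (R.obj Y)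
      ((S.pullback s).functorPullback (yoneda ⋙ L)).arrows :=
    fun c s d g hg => secEquiv adj d Y (x ((yoneda ⋙ L).map g ≫ s) hg)
  have ht : ∀ c s, (t c s).Compatible := by
    intro c s
    rw [Presieve.compatible_iff_sieveCompatible]
    intro d e g h hg
    dsimp only [t]
    rw [← secEquiv_map_comp]
    congr 1
    refine Eq.trans ?_ (hx' ((yoneda ⋙ L).map g ≫ s) ((yoneda ⋙ L).map h) hg)
    congr 1
    simp
  have hu : ∀ c s, ∃! u : (R.obj Y).obj (op c), (t c s).IsAmalgamation u := fun c s =>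
    hR Y _ (hS' c s) (t c s) (ht c s)
  choose u hu huniq using hu
  obtain ⟨φ, hφ⟩ : ∃ φ : B ⟶ Y, ∀ c (s : (yoneda ⋙ L).obj c ⟶ B),
      secEquiv adj c Y (s ≫ φ) = u c s := by
    let α : R.obj B ⟶ R.obj Y :=
      { app := fun c => TypeCat.ofHom fun a => u c.unop ((secEquiv adj c.unop B).symm a)
        naturality := by
          rintro ⟨c⟩ ⟨d⟩ ⟨g : d ⟶ c⟩
          ext a
          obtain ⟨s, rfl⟩ := (secEquiv adj c B).surjective a
          have e : (secEquiv adj d B).symm ((R.obj B).map g.op (secEquiv adj c B s)) =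
              (yoneda ⋙ L).map g ≫ s := by
            rw [← secEquiv_map_comp, Equiv.symm_apply_apply]; rfl
          change u d ((secEquiv adj d B).symm ((R.obj B).map g.op (secEquiv adj c B s))) =
            (R.obj Y).map g.op (u c ((secEquiv adj c B).symm (secEquiv adj c B s)))
          rw [e, Equiv.symm_apply_apply]
          symm
          apply huniq
          intro e k hk
          have hk' : S ((yoneda ⋙ L).map (k ≫ g) ≫ s) := by
            have : S ((yoneda ⋙ L).map k ≫ (yoneda ⋙ L).map g ≫ s) := hk
            simpa using this
          have := hu c s (k ≫ g) hk'
          rw [op_comp, Functor.map_comp_apply] at this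
          refine this.trans ?_
          dsimp only [t]
          congr 2
          simp }
    obtain ⟨φ, hφ⟩ := R.map_surjective α
    refine ⟨φ, fun c s => ?_⟩
    rw [secEquiv_comp, hφ]
    change u c ((secEquiv adj c B).symm (secEquiv adj c B s)) = _
    rw [Equiv.symm_apply_apply]
  have hext : ∀ {V : T} (a b : V ⟶ Y), (∀ c (s : (yoneda ⋙ L).obj c ⟶ V), s ≫ a = s ≫ b) →
      a = b := by
    intro V a b h
    apply R.map_injective
    ext c z
    obtain ⟨s, rfl⟩ := (secEquiv adj c.unop V).surjective z
    have := congrArg (secEquiv adj c.unop Y) (h c.unop s)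
    rwa [secEquiv_comp, secEquiv_comp] at this
  refine ⟨φ, fun V f hf => ?_, fun ψ hψ => ?_⟩
  · change f ≫ φ = x f hf
    refine hext _ _ fun c s => (secEquiv adj c Y).injective ?_
    rw [← Category.assoc, hφ]
    have hid : S ((yoneda ⋙ L).map (𝟙 c) ≫ s ≫ f) :=
      S.downward_closed (S.downward_closed hf s) _
    have := hu c (s ≫ f) (𝟙 c) hid
    rw [op_id, Functor.map_id_apply] at this
    rw [this, ← hx' f s hf]
    dsimp only [t]
    congr 2
    simp
  · refine hext _ _ fun c s => (secEquiv adj c Y).injective ?_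
    rw [hφ]
    apply huniq
    intro d g hg
    rw [← secEquiv_map_comp]
    dsimp only [t]
    congr 1
    have := hψ _ hg
    rw [← this]
    simp

section

variable [R.Full] [R.Faithful] (hR : ∀ Y, Presieve.IsSheaf J (R.obj Y))
include hR

theorem isCoverDense_of_adj : (yoneda ⋙ L).IsCoverDense (can T) where
  is_cover U := by
    refine mem_can_of_functorPullback_mem adj hR _ fun c s => ?_
    convert J.top_mem c
    rw [← Sieve.id_mem_iff_eq_top]
    exact (Sieve.coverByImage (yoneda ⋙ L) U).downward_closed
      (Presieve.in_coverByImage (yoneda ⋙ L) s) _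

variable (hs : ∀ c : C, Presheaf.IsLocallySurjective J (adj.unit.app (yoneda.obj c)))
include hs

theorem coverPreserving_of_adj : CoverPreserving J (can T) (yoneda ⋙ L) where
  cover_preserve {c S} hS := by
    refine mem_can_of_functorPullback_mem adj hR _ fun d s => ?_
    refine J.transitive (Presheaf.imageSieve_mem J (adj.unit.app (yoneda.obj c))
      (secEquiv adj d _ s)) _ ?_
    rintro e g ⟨l, hl⟩
    have hl' : (yoneda ⋙ L).map g ≫ s = (yoneda ⋙ L).map l := by
      apply (secEquiv adj e _).injective
      refine (secEquiv_map_comp adj g s).trans (hl.symm.trans ?_)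
      exact (secEquiv_map adj l).symm
    refine J.superset_covering ?_ (J.pullback_stable l hS)
    intro W k hk
    refine ⟨W, k ≫ l, 𝟙 _, hk, ?_⟩
    rw [Category.id_comp, Functor.map_comp, Functor.map_comp, ← hl', Category.assoc]

theorem isLocallyFull_of_adj : (yoneda ⋙ L).IsLocallyFull (can T) where
  functorPushforward_imageSieve_mem {c d} f := by
    refine (coverPreserving_of_adj adj hR hs).cover_preserve ?_
    refine J.superset_covering ?_ (Presheaf.imageSieve_mem J (adj.unit.app (yoneda.obj d))
      (secEquiv adj c _ f))
    rintro e g ⟨l, hl⟩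
    refine ⟨l, (secEquiv adj e _).injective ?_⟩
    refine (secEquiv_map adj l).trans (Eq.trans hl ?_)
    exact (secEquiv_map_comp adj g f).symm

theorem isLocallyFaithful_of_adj
    (hi : ∀ c : C, Presheaf.IsLocallyInjective J (adj.unit.app (yoneda.obj c))) :
    (yoneda ⋙ L).IsLocallyFaithful (can T) where
  functorPushforward_equalizer_mem {c d} f g h := by
    refine (coverPreserving_of_adj adj hR hs).cover_preserve ?_
    refine J.superset_covering ?_ (Presheaf.equalizerSieve_mem J (adj.unit.app (yoneda.obj d))
      (X := op c) f g ?_)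
    · intro e k hk
      exact hk
    · refine (secEquiv_map adj f).symm.trans (Eq.trans ?_ (secEquiv_map adj g))
      exact congrArg _ h

end

end Site

section Topos

open Opposite

variable {T : Type u} [Category.{v} T]

theorem IsGrothendieckTopos.hasFiniteLimits (hT : IsGrothendieckTopos T) :
    Limits.HasFiniteLimits T := by
  obtain ⟨C, _, J, ⟨e⟩⟩ := hT
  exact ⟨fun K _ _ => Adjunction.hasLimitsOfShape_of_equivalence e.functor⟩

/-- A Grothendieck topos has a small site of definition, given by a dense functor `G` to it;
every sheaf on the site is the restriction along `G` of a representable functor. -/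
theorem IsGrothendieckTopos.exists_site (hT : IsGrothendieckTopos T) :
    ∃ (C : Type v) (_ : SmallCategory C) (J : GrothendieckTopology C) (G : C ⥤ T),
      G.IsCoverDense (can T) ∧ G.IsLocallyFull (can T) ∧ G.IsLocallyFaithful (can T) ∧
        CoverPreserving J (can T) G ∧
        ∃ (R : T ⥤ Cᵒᵖ ⥤ Type v), (∀ F : Cᵒᵖ ⥤ Type v, Presieve.IsSheaf J F →
          ∃ Y, Nonempty (R.obj Y ≅ F)) ∧
          ∀ Y, Nonempty (R.obj Y ≅ G.op ⋙ yoneda.obj Y) := by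
  obtain ⟨C, _, J, ⟨e⟩⟩ := hT
  let adj := (sheafificationAdjunction J (Type v)).comp e.symm.toAdjunction
  have hR : ∀ Y, Presieve.IsSheaf J ((e.functor ⋙ sheafToPresheaf J (Type v)).obj Y) := fun Y =>
    (isSheaf_iff_isSheaf_of_type _ _).1 (e.functor.obj Y).property
  have hunit : ∀ P : Cᵒᵖ ⥤ Type v, adj.unit.app P = toSheafify J P ≫
      (sheafToPresheaf J (Type v)).map (e.counitIso.inv.app ((presheafToSheaf J _).obj P)) := by
    intro P
    rw [Adjunction.comp_unit_app]
    rfl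
  have hs : ∀ c : C, Presheaf.IsLocallySurjective J (adj.unit.app (yoneda.obj c)) := fun c => by
    rw [hunit]
    have := Presheaf.isLocallySurjective_toSheafify' J (yoneda.obj c)
    have : Presheaf.IsLocallySurjective J ((sheafToPresheaf J (Type v)).map
        (e.counitIso.inv.app ((presheafToSheaf J _).obj (yoneda.obj c)))) :=
      Presheaf.isLocallySurjective_of_iso J _
    exact Presheaf.isLocallySurjective_comp J _ _
  have hi : ∀ c : C, Presheaf.IsLocallyInjective J (adj.unit.app (yoneda.obj c)) := fun c => by
    rw [hunit]
    have := Presheaf.isLocallyInjective_toSheafify' J (yoneda.obj c)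
    have : Presheaf.IsLocallyInjective J ((sheafToPresheaf J (Type v)).map
        (e.counitIso.inv.app ((presheafToSheaf J _).obj (yoneda.obj c)))) :=
      inferInstance
    exact Presheaf.isLocallyInjective_comp J _ _
  refine ⟨C, _, J, _, isCoverDense_of_adj adj hR, isLocallyFull_of_adj adj hR hs,
    isLocallyFaithful_of_adj adj hR hs hi, coverPreserving_of_adj adj hR hs,
    e.functor ⋙ sheafToPresheaf J (Type v), fun F hF => ?_, fun Y => ⟨?_⟩⟩
  · let F' : Sheaf J (Type v) := ⟨F, (isSheaf_iff_isSheaf_of_type _ _).2 hF⟩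
    exact ⟨e.inverse.obj F', ⟨(sheafToPresheaf J (Type v)).mapIso (e.counitIso.app F')⟩⟩
  · refine (NatIso.ofComponents (fun c => (secEquiv adj c.unop Y).toIso) ?_).symm
    rintro ⟨c⟩ ⟨d⟩ ⟨g : d ⟶ c⟩
    ext s
    exact secEquiv_map_comp adj g s

/-- Every sheaf on a Grothendieck topos, for the canonical topology, is representable. -/
theorem IsGrothendieckTopos.exists_representableBy (hT : IsGrothendieckTopos T)
    {F : Tᵒᵖ ⥤ Type v} (hF : Presieve.IsSheaf (can T) F) : ∃ Y, Nonempty (F.RepresentableBy Y) := by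
  obtain ⟨C, _, J, G, _, _, _, hG, R, hR, hR'⟩ := hT.exists_site
  have := Functor.IsCoverDense.isContinuous J (can T) G hG
  let F' : Sheaf (can T) (Type v) := ⟨F, (isSheaf_iff_isSheaf_of_type _ _).2 hF⟩
  obtain ⟨Y, ⟨i⟩⟩ := hR (G.op ⋙ F) (Functor.op_comp_isSheaf_of_types G J (can T) F')
  obtain ⟨j⟩ := hR' Y
  let Y' : Sheaf (can T) (Type v) := ⟨yoneda.obj Y, (isSheaf_iff_isSheaf_of_type _ _).2
    (Sheaf.isSheaf_yoneda_obj Y)⟩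
  let k : yoneda.obj Y ≅ F := Functor.IsCoverDense.Types.presheafIso (K := can T) (G := G)
    (ℱ := Y') (ℱ' := F') (j.symm ≪≫ i)
  exact ⟨Y, ⟨⟨fun {Z} => (k.app (op Z)).toEquiv, fun f g => k.hom.naturality_apply f.op g⟩⟩⟩

/-- The real numbers at each stage form a small set, as a cut is determined by its restrictions to
the stages given by a small site. -/
theorem IsGrothendieckTopos.small_dReal (hT : IsGrothendieckTopos T) (U : T) :
    Small.{v} (DReal (can T) U) := by
  obtain ⟨C, _, J, G, _, _, _, hG, -⟩ := hT.exists_site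
  let φ : DReal (can T) U → (∀ (_ : ℚ) (c : C) (_ : G.obj c ⟶ U), Prop) :=
    fun x q c f => x.lower q f
  refine small_of_injective (f := φ) fun x y h => ?_
  have key : ∀ {x y : DReal (can T) U}, φ x = φ y → x ≤ y := by
    intro x y h q V f hf
    refine y.lower_of_locally ⟨_, Functor.IsCoverDense.is_cover (G := G) (K := can T) V, ?_⟩
    rintro W g ⟨c, l, m, rfl⟩
    have h1 := (x.lower q).downward_closed hf m
    rw [Category.assoc]
    refine (y.lower q).downward_closed ?_ l
    exact (congrFun (congrFun (congrFun h q) c) (m ≫ f)).mp h1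
  exact le_antisymm (key h) (key h.symm)

end Topos


/-! ### Hilbert spaces given by their generalized elements -/

/-- A pre-Hilbert space presented by its generalized elements: a representable family of vector
spaces with scalar products, natural in the stage. -/
structure PreHilbertPresheaf.{w} (T : Type u) [Category.{v} T] where
  vec : T → Type w
  addCommGroup : ∀ U : T, AddCommGroup (vec U)
  module : ∀ U : T, Module (Cx (can T) U) (vec U)
  inner : ∀ {U : T}, vec U → vec U → Cx (can T) U
  res : ∀ {U V : T}, (V ⟶ U) → vec U → vec V
  res_add : ∀ {U V : T} (f : V ⟶ U) (x y : vec U), res f (x + y) = res f x + res f y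
  res_smul : ∀ {U V : T} (f : V ⟶ U) (c : Cx (can T) U) (x : vec U),
    res f (c • x) = c.restrict f • res f x
  inner_restrict : ∀ {U V : T} (f : V ⟶ U) (x y : vec U),
    (inner x y).restrict f = inner (res f x) (res f y)
  inner_add_right : ∀ {U : T} (x y z : vec U), inner x (y + z) = inner x y + inner x z
  inner_smul_right : ∀ {U : T} (c : Cx (can T) U) (x y : vec U),
    inner x (c • y) = c * inner x y
  star_inner : ∀ {U : T} (x y : vec U), star (inner x y) = inner y x
  inner_self_nonneg : ∀ {U : T} (x : vec U), 0 ≤ (inner x x).re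
  eq_zero_of_inner_self : ∀ {U : T} (x : vec U), inner x x = 0 → x = 0
  obj : T
  equiv : ∀ {U : T}, (U ⟶ obj) ≃ vec U
  equiv_comp : ∀ {U V : T} (f : V ⟶ U) (x : U ⟶ obj), equiv (f ≫ x) = res f (equiv x)

namespace PreHilbertPresheaf

attribute [instance] PreHilbertPresheaf.addCommGroup PreHilbertPresheaf.module

variable {T : Type u} [Category.{v} T] (P : PreHilbertPresheaf T)

/-- The object representing a presheaf of pre-Hilbert spaces, with the transported structure. -/
def toPreHilbertSpace : PreHilbertSpace T where
  obj := P.obj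
  addCommGroup U := P.equiv.addCommGroup
  module U :=
    letI := P.equiv (U := U).addCommGroup
    P.equiv.module (Cx (can T) U)
  inner x y := P.inner (P.equiv x) (P.equiv y)
  comp_add {U V} f x y := by
    apply P.equiv.injective
    change P.equiv (f ≫ P.equiv.symm (P.equiv x + P.equiv y)) =
      P.equiv (P.equiv.symm (P.equiv (f ≫ x) + P.equiv (f ≫ y)))
    rw [P.equiv_comp, Equiv.apply_symm_apply, Equiv.apply_symm_apply, P.res_add, P.equiv_comp,
      P.equiv_comp]
  comp_smul {U V} f c x := by
    apply P.equiv.injective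
    change P.equiv (f ≫ P.equiv.symm (c • P.equiv x)) =
      P.equiv (P.equiv.symm (c.restrict f • P.equiv (f ≫ x)))
    rw [P.equiv_comp, Equiv.apply_symm_apply, Equiv.apply_symm_apply, P.res_smul, P.equiv_comp]
  inner_restrict f x y := by rw [P.inner_restrict, P.equiv_comp, P.equiv_comp]
  inner_add_right x y z := by
    change P.inner _ (P.equiv (P.equiv.symm (P.equiv y + P.equiv z))) = _
    rw [Equiv.apply_symm_apply, P.inner_add_right]
  inner_smul_right c x y := by
    change P.inner _ (P.equiv (P.equiv.symm (c • P.equiv y))) = _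
    rw [Equiv.apply_symm_apply, P.inner_smul_right]
  star_inner x y := P.star_inner _ _
  inner_self_nonneg x := P.inner_self_nonneg _
  eq_zero_of_inner_self x h := by
    apply P.equiv.injective
    change _ = P.equiv (P.equiv.symm 0)
    rw [Equiv.apply_symm_apply, P.eq_zero_of_inner_self _ h]

theorem equiv_add {U : T} (x y : U ⟶ P.toPreHilbertSpace.obj) :
    P.equiv (x + y) = P.equiv x + P.equiv y := P.equiv.apply_symm_apply _

theorem equiv_smul {U : T} (c : Cx (can T) U) (x : U ⟶ P.toPreHilbertSpace.obj) :
    P.equiv (c • x) = c • P.equiv x := P.equiv.apply_symm_apply _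

theorem equiv_sub {U : T} (x y : U ⟶ P.toPreHilbertSpace.obj) :
    P.equiv (x - y) = P.equiv x - P.equiv y := by
  rw [eq_sub_iff_add_eq, ← equiv_add, sub_add_cancel]

end PreHilbertPresheaf

/-! ### The components of a graded Hilbert space as a Hilbert space of the slice -/

namespace ProjFamily

open Limits

variable {T : Type u} [Category.{v} T] {H : HilbertSpace T} {X : T} (Q : ProjFamily H X)

/-- The range of the projection with index `x`. -/
def range {U : T} (x : U ⟶ X) : Submodule (Cx (can T) U) (U ⟶ H.obj) where
  carrier := {h | Q.P x h = h}
  add_mem' {a b} ha hb := by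
    change Q.P x (a + b) = a + b
    rw [Q.P_add, show Q.P x a = a from ha, show Q.P x b = b from hb]
  zero_mem' := Q.P_zero x
  smul_mem' c a ha := by
    change Q.P x (c • a) = c • a
    rw [Q.P_smul, show Q.P x a = a from ha]

theorem comp_mem_range {U V : T} (f : V ⟶ U) {x : U ⟶ X} {h : U ⟶ H.obj} (hh : h ∈ Q.range x) :
    f ≫ h ∈ Q.range (f ≫ x) := by
  change Q.P (f ≫ x) (f ≫ h) = f ≫ h
  rw [← Q.comp_P, show Q.P x h = h from hh]

variable [HasFiniteLimits T]

/-- The object of pairs of an index and a vector in the range of the projection with that index. -/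
def totalObj : T := equalizer (Q.P prod.fst (prod.snd : X ⨯ H.obj ⟶ H.obj)) prod.snd

/-- The inclusion of the total object into the product. -/
def totalι : Q.totalObj ⟶ X ⨯ H.obj := equalizer.ι _ _

/-- The total object, as an object over `X`. -/
def total : Over X := Over.mk (Q.totalι ≫ prod.fst)

theorem P_totalι {U : T} (f : U ⟶ Q.totalObj) :
    Q.P (f ≫ Q.totalι ≫ prod.fst) (f ≫ Q.totalι ≫ prod.snd) = f ≫ Q.totalι ≫ prod.snd := by
  have h : Q.totalι ≫ Q.P prod.fst prod.snd = Q.totalι ≫ prod.snd := equalizer.condition _ _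
  rw [← Q.comp_P, ← Q.comp_P, h]

theorem totalObj_ext {U : T} {f g : U ⟶ Q.totalObj}
    (h1 : f ≫ Q.totalι ≫ prod.fst = g ≫ Q.totalι ≫ prod.fst)
    (h2 : f ≫ Q.totalι ≫ prod.snd = g ≫ Q.totalι ≫ prod.snd) : f = g := by
  have : f ≫ Q.totalι = g ≫ Q.totalι := by
    apply Limits.prod.hom_ext
    · rw [Category.assoc, Category.assoc, h1]
    · rw [Category.assoc, Category.assoc, h2]
  exact equalizer.hom_ext this

theorem exists_totalι {U : T} (x : U ⟶ X) (h : U ⟶ H.obj) (hh : Q.P x h = h) :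
    ∃ f : U ⟶ Q.totalObj, f ≫ Q.totalι = prod.lift x h :=
  ⟨equalizer.lift (prod.lift x h) (by rw [Q.comp_P, prod.lift_fst, prod.lift_snd, hh]),
    equalizer.lift_ι _ _⟩

/-- The maps to the total object are vectors in the ranges of the projections. -/
def totalEquiv {U : Over X} : (U ⟶ Q.total) ≃ Q.range U.hom :=
  Equiv.ofBijective (fun g => ⟨(g.left : U.left ⟶ Q.totalObj) ≫ Q.totalι ≫ prod.snd, by
      have h : (g.left : U.left ⟶ Q.totalObj) ≫ Q.totalι ≫ prod.fst = U.hom := Over.w g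
      change Q.P _ _ = _
      rw [← h]
      exact Q.P_totalι g.left⟩) (by
    constructor
    · intro f g h
      have hf : (f.left : U.left ⟶ Q.totalObj) ≫ Q.totalι ≫ prod.fst = U.hom := Over.w f
      have hg : (g.left : U.left ⟶ Q.totalObj) ≫ Q.totalι ≫ prod.fst = U.hom := Over.w g
      apply Over.OverMorphism.ext
      exact Q.totalObj_ext (hf.trans hg.symm) (congrArg Subtype.val h)
    · rintro ⟨h, hh⟩
      obtain ⟨f, hf⟩ := Q.exists_totalι U.hom h hh
      refine ⟨Over.homMk f ?_, Subtype.ext ?_⟩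
      · change f ≫ Q.totalι ≫ prod.fst = _
        rw [← Category.assoc, hf, prod.lift_fst]
      · change f ≫ Q.totalι ≫ prod.snd = h
        rw [← Category.assoc, hf, prod.lift_snd])

/-- The presheaf of vectors in the ranges of the projections. -/
def presheaf : PreHilbertPresheaf (Over X) where
  vec U := Q.range U.hom
  addCommGroup U := inferInstance
  module U := Module.compHom _ (Cx.overEquiv U).symm.toRingHom
  inner {U} x y := Cx.overEquiv U (H.inner x.1 y.1)
  res {U V} f x := ⟨f.left ≫ x.1, by rw [← Over.w f]; exact Q.comp_mem_range _ x.2⟩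
  res_add f x y := Subtype.ext (H.comp_add _ _ _)
  res_smul {U V} f c x := Subtype.ext (by
    change f.left ≫ ((Cx.overEquiv U).symm c • x.1) =
      (Cx.overEquiv V).symm (c.restrict f) • (f.left ≫ x.1)
    rw [H.comp_smul, Cx.overEquiv_symm_restrict])
  inner_restrict f x y := by rw [← Cx.overEquiv_restrict, H.inner_restrict]
  inner_add_right x y z := by
    rw [← map_add, ← H.inner_add_right]; rfl
  inner_smul_right {U} c x y := by
    change Cx.overEquiv U (H.inner x.1 ((Cx.overEquiv U).symm c • y.1)) = _
    rw [H.inner_smul_right, map_mul, RingEquiv.apply_symm_apply]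
  star_inner x y := by rw [← Cx.overEquiv_star, H.star_inner]
  inner_self_nonneg {U} x := by
    rw [Cx.overEquiv_re, ← map_zero (DReal.overEquiv U), DReal.overEquiv_le_iff]
    exact H.normSq_nonneg _
  eq_zero_of_inner_self x h := by
    apply Subtype.ext
    apply H.eq_zero_of_inner_self
    exact (map_eq_zero_iff _ (Cx.overEquiv _).injective).1 h
  obj := Q.total
  equiv := Q.totalEquiv
  equiv_comp f x := Subtype.ext (Category.assoc f.left _ _)

/-- The vector of `H` underlying an element of the total object. -/
def val {U : Over X} (x : U ⟶ Q.presheaf.toPreHilbertSpace.obj) : U.left ⟶ H.obj :=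
  (Q.totalEquiv x).1

/-- The element of the total object given by a vector in the range of a projection. -/
def ofFixed {U : Over X} (h : U.left ⟶ H.obj) (hh : Q.P U.hom h = h) :
    U ⟶ Q.presheaf.toPreHilbertSpace.obj := Q.totalEquiv.symm ⟨h, hh⟩

section

variable {U V : Over X} (x y : U ⟶ Q.presheaf.toPreHilbertSpace.obj)

theorem val_ofFixed (h : U.left ⟶ H.obj) (hh : Q.P U.hom h = h) : Q.val (Q.ofFixed h hh) = h := by
  rw [val, ofFixed, Equiv.apply_symm_apply]

theorem P_val : Q.P U.hom (Q.val x) = Q.val x := (Q.totalEquiv x).2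

variable {x y} in
theorem val_injective (h : Q.val x = Q.val y) : x = y :=
  Q.totalEquiv.injective (Subtype.ext h)

theorem val_comp (f : V ⟶ U) : Q.val (f ≫ x) = f.left ≫ Q.val x :=
  congrArg Subtype.val (Q.presheaf.equiv_comp f x)

theorem val_sub : Q.val (x - y) = Q.val x - Q.val y :=
  congrArg Subtype.val (Q.presheaf.equiv_sub x y)

theorem normSq_val : Q.presheaf.toPreHilbertSpace.normSq x =
    DReal.overEquiv U (H.normSq (Q.val x)) := rfl

theorem normLE_val {r : ℝ} :
    Q.presheaf.toPreHilbertSpace.NormLE x r ↔ H.NormLE (Q.val x) r := by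
  rw [PreHilbertSpace.NormLE, normSq_val, ← DReal.overEquiv_const, DReal.overEquiv_le_iff]
  rfl

end

/-- The Hilbert space of the slice over `X` formed by the ranges of a family of projections of a
Hilbert space. -/
def slice : HilbertSpace (Over X) where
  toPreHilbertSpace := Q.presheaf.toPreHilbertSpace
  complete {U} A hA := by
    obtain ⟨x, hx⟩ := H.complete (U := U.left)
      (fun ε V f b => ∀ (p : V ⟶ X) (hp : f ≫ U.hom = p),
        ∃ a : Over.mk p ⟶ Q.presheaf.toPreHilbertSpace.obj, Q.val a = b ∧
          A ε (Over.homMk f hp : Over.mk p ⟶ U) a)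
      { restrict := by
          rintro ε hε V f b hb W g p rfl
          obtain ⟨a, rfl, ha⟩ := hb _ rfl
          let g' : Over.mk ((g ≫ f) ≫ U.hom) ⟶ Over.mk (f ≫ U.hom) :=
            Over.homMk g (Category.assoc _ _ _).symm
          refine ⟨g' ≫ a, Q.val_comp a g', ?_⟩
          convert hA.restrict ε hε _ _ ha g' using 1
          exact Over.OverMorphism.ext rfl
        glue := by
          rintro ε hε V f b h p rfl
          have hb : Q.P (f ≫ U.hom) b = b := hom_ext_of_locally (h.mono fun W g hg => by
            obtain ⟨a, ha, -⟩ := hg _ rfl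
            have := Q.P_val a
            rw [ha] at this
            rw [Q.comp_P, ← Category.assoc]
            exact this)
          let b' := Q.ofFixed (U := Over.mk (f ≫ U.hom)) b hb
          refine ⟨b', Q.val_ofFixed _ _, hA.glue ε hε _ _ (locally_over_iff.2 ?_)⟩
          refine h.mono fun W g hg => ?_
          obtain ⟨a, ha, ha'⟩ := hg (g ≫ (Over.mk (f ≫ U.hom)).hom) (Category.assoc _ _ _)
          convert ha' using 1
          · exact Over.OverMorphism.ext rfl
          · apply Q.val_injective
            rw [Q.val_comp, Q.val_ofFixed]
            exact ha.symm
        inhabited := by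
          intro ε hε
          refine (locally_over_iff.1 (hA.inhabited ε hε)).mono fun V f ⟨a, ha⟩ => ?_
          refine ⟨Q.val a, ?_⟩
          rintro p rfl
          exact ⟨a, rfl, ha⟩
        cauchy := by
          rintro ε hε δ hδ V f b b' ha hb
          obtain ⟨a, rfl, ha'⟩ := ha _ rfl
          obtain ⟨b, rfl, hb'⟩ := hb _ rfl
          have := hA.cauchy ε hε δ hδ _ _ _ ha' hb'
          rwa [normLE_val, val_sub] at this }
    refine ⟨Q.ofFixed (Q.P U.hom x) (Q.P_P _ _), fun ε hε V f a ha => ?_⟩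
    obtain ⟨V, p, rfl⟩ := V.mk_surjective
    obtain ⟨(g : V ⟶ U.left), (rfl : g ≫ U.hom = p), rfl⟩ := Over.homMk_surjective f
    have h1 := hx ε hε g (Q.val a) (by rintro p rfl; exact ⟨a, rfl, ha⟩)
    rw [normLE_val, val_sub, val_comp, val_ofFixed]
    refine le_trans ?_ h1
    let b : V ⟶ H.obj := Q.val a
    have e : Q.P (g ≫ U.hom) b = b := Q.P_val a
    change H.normSq (g ≫ Q.P U.hom x - b) ≤ H.normSq (g ≫ x - b)
    conv_lhs => rw [Q.comp_P, ← e, ← Q.P_sub]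
    exact Q.normSq_P_le _ _

end ProjFamily


/-! ### Graded Hilbert spaces and Hilbert spaces of the slice -/

theorem Grading.Components.op_comm {T : Type u} [Category.{v} T] {X : T}
    {H H' : HilbertSpace T} {G : Grading H X} {G' : Grading H' X}
    (A : Grading.Components G G') (hX : IsDecidable X)
    (hA : ∀ {U : T} (x : U ⟶ X) (h : U ⟶ H.obj), A.t x (G.P x h) = A.t x h) {U : T} (x : U ⟶ X)
    (h : U ⟶ H.obj) :
    BoundedOp.app (A.op hX) (G.P x h) = G'.P x (BoundedOp.app (A.op hX) h) := by
  refine G'.ext fun V f y => ?_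
  rw [BoundedOp.comp_app, G'.comp_P, BoundedOp.comp_app, G.comp_P, A.P_op]
  refine hom_ext_of_locally ((hX y (f ≫ x)).mono fun W g hg => ?_)
  rw [A.comp_t, G'.comp_P, G'.comp_P, G.comp_P, BoundedOp.comp_app]
  rcases hg with hg | hg
  · rw [hg, hA, G'.P_P, A.P_op]
  · rw [G'.P_ne _ _ _ hg, ← hA, G.P_ne _ _ _ hg]
    refine H'.eq_zero_of_normSq_le ((A.bound_t _ _).trans_eq ?_)
    rw [G.P_zero, H.normSq_zero, mul_zero]

namespace ProjFamily

section Elements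

variable {T : Type u} [Category.{v} T] {H : HilbertSpace T} {X : T} (Q : ProjFamily H X)
  [Limits.HasFiniteLimits T] {U V : Over X}

/-- The vector of `H` underlying an element of the slice Hilbert space. -/
def toVec (x : U ⟶ Q.slice.obj) : U.left ⟶ H.obj := Q.val x

/-- The element of the slice Hilbert space given by the projection of a vector. -/
def el (h : U.left ⟶ H.obj) : U ⟶ Q.slice.obj := Q.ofFixed (Q.P U.hom h) (Q.P_P _ _)

variable (x y : U ⟶ Q.slice.obj)

theorem toVec_el (h : U.left ⟶ H.obj) : Q.toVec (Q.el h) = Q.P U.hom h := Q.val_ofFixed _ _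

theorem P_toVec : Q.P U.hom (Q.toVec x) = Q.toVec x := Q.P_val x

variable {x y} in
theorem toVec_injective (h : Q.toVec x = Q.toVec y) : x = y := Q.val_injective h

theorem el_toVec : Q.el (Q.toVec x) = x := Q.toVec_injective (by rw [toVec_el, P_toVec])

theorem toVec_comp (f : V ⟶ U) : Q.toVec (f ≫ x) = f.left ≫ Q.toVec x := Q.val_comp x f

theorem inner_toVec : Q.slice.inner x y = Cx.overEquiv U (H.inner (Q.toVec x) (Q.toVec y)) := rfl

theorem normSq_toVec : Q.slice.normSq x = DReal.overEquiv U (H.normSq (Q.toVec x)) := rfl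

theorem comp_el (f : V ⟶ U) (h : U.left ⟶ H.obj) : f ≫ Q.el h = Q.el (f.left ≫ h) :=
  Q.toVec_injective (by rw [toVec_comp, toVec_el, toVec_el, Q.comp_P, Over.w])

/-- The vector underlying an element of the slice Hilbert space at the stage given by `x`. -/
def vecAt {U : T} (x : U ⟶ X) (z : Over.mk x ⟶ Q.slice.obj) : U ⟶ H.obj := Q.toVec z

/-- The element of the slice Hilbert space at the stage given by `x` which is the component of a
vector with index `x`. -/
def elAt {U : T} (x : U ⟶ X) (h : U ⟶ H.obj) : Over.mk x ⟶ Q.slice.obj := Q.el (U := Over.mk x) h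

end Elements

section ElementsAt

variable {T : Type u} [Category.{v} T] {H H' : HilbertSpace T} {X : T} (Q : ProjFamily H X)
  (Q' : ProjFamily H' X) [Limits.HasFiniteLimits T] {U V : T} (x : U ⟶ X)

theorem vecAt_elAt (h : U ⟶ H.obj) : Q.vecAt x (Q.elAt x h) = Q.P x h :=
  Q.toVec_el (U := Over.mk x) h

theorem P_vecAt (z : Over.mk x ⟶ Q.slice.obj) : Q.P x (Q.vecAt x z) = Q.vecAt x z := Q.P_toVec z

theorem elAt_vecAt (z : Over.mk x ⟶ Q.slice.obj) : Q.elAt x (Q.vecAt x z) = z := Q.el_toVec z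

theorem elAt_P (h : U ⟶ H.obj) : Q.elAt x (Q.P x h) = Q.elAt x h := by
  rw [← vecAt_elAt, elAt_vecAt]

variable {x} in
theorem vecAt_injective {z w : Over.mk x ⟶ Q.slice.obj} (h : Q.vecAt x z = Q.vecAt x w) : z = w :=
  Q.toVec_injective h

theorem comp_vecAt (f : V ⟶ U) (z : Over.mk x ⟶ Q.slice.obj) :
    f ≫ Q.vecAt x z = Q.vecAt (f ≫ x) ((Over.homMk f : Over.mk (f ≫ x) ⟶ Over.mk x) ≫ z) :=
  (Q.toVec_comp z (Over.homMk f : Over.mk (f ≫ x) ⟶ Over.mk x)).symm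

theorem comp_elAt (f : V ⟶ U) (h : U ⟶ H.obj) :
    (Over.homMk f : Over.mk (f ≫ x) ⟶ Over.mk x) ≫ Q.elAt x h = Q.elAt (f ≫ x) (f ≫ h) :=
  Q.vecAt_injective (by rw [← comp_vecAt, vecAt_elAt, vecAt_elAt, Q.comp_P])

variable {x} in
theorem inner_vecAt_eq {z w : Over.mk x ⟶ Q.slice.obj} {z' w' : Over.mk x ⟶ Q'.slice.obj}
    (h : Q.slice.inner z w = Q'.slice.inner z' w') :
    H.inner (Q.vecAt x z) (Q.vecAt x w) = H'.inner (Q'.vecAt x z') (Q'.vecAt x w') :=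
  (Cx.overEquiv (Over.mk x)).injective h

variable {x} in
theorem normSq_vecAt_le_mul {z : Over.mk x ⟶ Q.slice.obj} {z' : Over.mk x ⟶ Q'.slice.obj} {c : ℝ}
    (h : Q.slice.normSq z ≤ DReal.const c * Q'.slice.normSq z') :
    H.normSq (Q.vecAt x z) ≤ DReal.const c * H'.normSq (Q'.vecAt x z') := by
  rw [normSq_toVec, normSq_toVec, ← DReal.overEquiv_const, ← map_mul, DReal.overEquiv_le_iff] at h
  exact h

end ElementsAt

end ProjFamily

section

variable {T : Type u} [Category.{v} T] {X : T}

namespace Grading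

variable {H H' : HilbertSpace T} (G : Grading H X) (G' : Grading H' X)

variable {G G'} in
theorem adjoint_comm {t : H ⟶ H'} (ht : ∀ {U : T} (x : U ⟶ X) (h : U ⟶ H.obj),
      BoundedOp.app t (G.P x h) = G'.P x (BoundedOp.app t h)) {U : T} (x : U ⟶ X)
    (h : U ⟶ H'.obj) :
    BoundedOp.app (adjoint t) (G'.P x h) = G.P x (BoundedOp.app (adjoint t) h) :=
  H.ext_inner_left fun w => by
    rw [G.inner_P, inner_adjoint_left, inner_adjoint_left, G'.inner_P, ht]

variable [Limits.HasFiniteLimits T]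

/-- The components of a graded Hilbert space, as a Hilbert space of the slice. -/
abbrev slice : HilbertSpace (Over X) := G.toProjFamily.slice

/-- An operator which commutes with the gradings restricts to the components. -/
def sliceMap (t : H ⟶ H') (ht : ∀ {U : T} (x : U ⟶ X) (h : U ⟶ H.obj),
      BoundedOp.app t (G.P x h) = G'.P x (BoundedOp.app t h)) : G.slice ⟶ G'.slice :=
  opMk (fun x => G'.el (BoundedOp.app t (G.toVec x)))
    (fun x => G.el (BoundedOp.app (adjoint t) (G'.toVec x)))
    (fun f x => by rw [ProjFamily.comp_el, BoundedOp.comp_app, ProjFamily.toVec_comp])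
    (fun f x => by rw [ProjFamily.comp_el, BoundedOp.comp_app, ProjFamily.toVec_comp])
    (fun x y => by
      rw [ProjFamily.inner_toVec, ProjFamily.inner_toVec, ProjFamily.toVec_el,
        ProjFamily.toVec_el, ← ht, ← adjoint_comm ht, ProjFamily.P_toVec, ProjFamily.P_toVec,
        inner_adjoint])
    (BoundedOp.exists_bound t).choose (BoundedOp.exists_bound t).choose_spec.1.le
    (fun {U} x => by
      rw [ProjFamily.normSq_toVec, ProjFamily.normSq_toVec, ProjFamily.toVec_el, ← ht,
        ProjFamily.P_toVec, ← DReal.overEquiv_const, ← map_mul, DReal.overEquiv_le_iff]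
      exact (BoundedOp.exists_bound t).choose_spec.2 _)

theorem toVec_sliceMap (t : H ⟶ H') (ht : ∀ {U : T} (x : U ⟶ X) (h : U ⟶ H.obj),
      BoundedOp.app t (G.P x h) = G'.P x (BoundedOp.app t h)) {U : Over X}
    (x : U ⟶ G.slice.obj) :
    G'.toVec (BoundedOp.app (G.sliceMap G' t ht) x) = BoundedOp.app t (G.toVec x) := by
  change G'.toVec (x ≫ G'.el (BoundedOp.app t (G.toVec (𝟙 G.slice.obj)))) = _
  rw [ProjFamily.comp_el, BoundedOp.comp_app, ← ProjFamily.toVec_comp, Category.comp_id,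
    ProjFamily.toVec_el, ← ht, ProjFamily.P_toVec]

/-- An operator between the components of graded Hilbert spaces comes from an operator between the
spaces. -/
def sliceComponents (t : G.slice ⟶ G'.slice) : Components G G' where
  t x h := G'.vecAt x (BoundedOp.app t (G.elAt x h))
  s x h := G.vecAt x (BoundedOp.app (adjoint t) (G'.elAt x h))
  comp_t f x h := by rw [ProjFamily.comp_vecAt, BoundedOp.comp_app, ProjFamily.comp_elAt]
  comp_s f x h := by rw [ProjFamily.comp_vecAt, BoundedOp.comp_app, ProjFamily.comp_elAt]
  P_t x h := G'.P_vecAt x _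
  P_s x h := G.P_vecAt x _
  inner_t x h h' := by
    have e := ProjFamily.inner_vecAt_eq _ _ (inner_adjoint t (G.elAt x h) (G'.elAt x h'))
    rw [ProjFamily.vecAt_elAt, ProjFamily.vecAt_elAt, ← G'.inner_P, G.inner_P, ProjFamily.P_vecAt,
      ProjFamily.P_vecAt] at e
    exact e
  c := max (BoundedOp.exists_bound t).choose (BoundedOp.exists_bound (adjoint t)).choose
  c_nonneg := (BoundedOp.exists_bound t).choose_spec.1.le.trans (le_max_left _ _)
  bound_t x h := by
    have e := ProjFamily.normSq_vecAt_le_mul _ _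
      ((BoundedOp.exists_bound t).choose_spec.2 (G.elAt x h))
    rw [ProjFamily.vecAt_elAt] at e
    refine le_trans e (mul_le_mul_of_nonneg_right (DReal.const_mono ?_) (H.normSq_nonneg _))
    exact pow_le_pow_left₀ (BoundedOp.exists_bound t).choose_spec.1.le (le_max_left _ _) 2
  bound_s x h := by
    have e := ProjFamily.normSq_vecAt_le_mul _ _
      ((BoundedOp.exists_bound (adjoint t)).choose_spec.2 (G'.elAt x h))
    rw [ProjFamily.vecAt_elAt] at e
    refine le_trans e (mul_le_mul_of_nonneg_right (DReal.const_mono ?_) (H'.normSq_nonneg _))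
    exact pow_le_pow_left₀ (BoundedOp.exists_bound (adjoint t)).choose_spec.1.le
      (le_max_right _ _) 2

theorem sliceComponents_t_P (t : G.slice ⟶ G'.slice) {U : T} (x : U ⟶ X)
    (h : U ⟶ H.obj) : (G.sliceComponents G' t).t x (G.P x h) = (G.sliceComponents G' t).t x h := by
  simp only [sliceComponents, ProjFamily.elAt_P]

theorem sliceComponents_op_vecAt (hX : IsDecidable X) (t : G.slice ⟶ G'.slice)
    {U : T} (p : U ⟶ X) (z : Over.mk p ⟶ G.slice.obj) :
    BoundedOp.app ((G.sliceComponents G' t).op hX) (G.vecAt p z) =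
      G'.vecAt p (BoundedOp.app t z) := by
  rw [← G.P_vecAt, (G.sliceComponents G' t).op_comm hX (G.sliceComponents_t_P G' t),
    Components.P_op]
  change G'.vecAt p (BoundedOp.app t (G.elAt p (G.vecAt p z))) = _
  rw [ProjFamily.elAt_vecAt]

end Grading

variable [Limits.HasFiniteLimits T]

/-- The functor which sends a graded Hilbert space to its components. -/
def gradedToSlice (X : T) : GradedHilbert X ⥤ HilbertSpace (Over X) where
  obj A := A.grading.slice
  map {A B} t := A.grading.sliceMap B.grading (GradedHilbert.Hom.op t)
    (fun x h => GradedHilbert.Hom.comm t x h)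
  map_id A := BoundedOp.hom_ext fun U x => A.grading.toVec_injective (by
    refine (A.grading.toVec_sliceMap A.grading (𝟙 A.space) _ x).trans ?_
    rw [BoundedOp.app_id]
    exact congrArg _ (BoundedOp.app_id x).symm)
  map_comp {A B C} s t := BoundedOp.hom_ext fun U x => C.grading.toVec_injective (by
    refine (A.grading.toVec_sliceMap C.grading
      (GradedHilbert.Hom.op s ≫ GradedHilbert.Hom.op t) _ x).trans ?_
    rw [BoundedOp.app_comp, BoundedOp.app_comp, Grading.toVec_sliceMap, Grading.toVec_sliceMap])

theorem gradedToSlice_faithful : (gradedToSlice X).Faithful where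
  map_injective {A B} s t h := by
    apply GradedHilbert.Hom.ext
    refine BoundedOp.hom_ext_of_denseSpan A.grading.dense ?_
    rintro U _ ⟨x, h', rfl⟩
    have h1 := A.grading.toVec_sliceMap B.grading (GradedHilbert.Hom.op s)
      (fun x h => GradedHilbert.Hom.comm s x h) (A.grading.elAt x h')
    have h2 := A.grading.toVec_sliceMap B.grading (GradedHilbert.Hom.op t)
      (fun x h => GradedHilbert.Hom.comm t x h) (A.grading.elAt x h')
    have ha : A.grading.toVec (A.grading.elAt x h') = A.grading.P x h' :=
      A.grading.vecAt_elAt x h'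
    rw [ha] at h1 h2
    refine h1.symm.trans (Eq.trans ?_ h2)
    exact congrArg (fun r => B.grading.toVec (BoundedOp.app r _)) h

theorem gradedToSlice_full (hX : IsDecidable X) : (gradedToSlice X).Full where
  map_surjective {A B} t := by
    refine ⟨⟨(A.grading.sliceComponents B.grading t).op hX, fun x h =>
      (A.grading.sliceComponents B.grading t).op_comm hX
        (A.grading.sliceComponents_t_P B.grading t) x h⟩, ?_⟩
    refine BoundedOp.hom_ext fun U x => B.grading.toVec_injective ?_
    refine (A.grading.toVec_sliceMap B.grading _ (fun x h =>
      (A.grading.sliceComponents B.grading t).op_comm hX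
        (A.grading.sliceComponents_t_P B.grading t) x h) x).trans ?_
    obtain ⟨U, p, rfl⟩ := U.mk_surjective
    exact A.grading.sliceComponents_op_vecAt B.grading hX t p x

end


/-! ### Families of vectors of a Hilbert space of the slice -/

section Families

open Limits

variable {T : Type u} [Category.{v} T] [HasFiniteLimits T] {X U V W : T}

/-- The pullback of a stage to an object over the index object. -/
def st (X U : T) : Over X := Over.mk (prod.fst : X ⨯ U ⟶ X)

/-- The base change of a map of stages. -/
def stMap (X : T) (f : V ⟶ U) : st X V ⟶ st X U := Over.homMk (bc X f) (bc_fst f)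

theorem stMap_comp (f : V ⟶ U) (g : W ⟶ V) : stMap X (g ≫ f) = stMap X g ≫ stMap X f :=
  Over.OverMorphism.ext (bc_comp f g)

theorem stMap_id : stMap X (𝟙 U) = 𝟙 (st X U) := Over.OverMorphism.ext bc_id

/-- The map over the index object with a given second component. -/
def toSt {A : Over X} (f : A.left ⟶ U) : A ⟶ st X U :=
  Over.homMk (prod.lift A.hom f) (prod.lift_fst _ _)

theorem toSt_stMap {A : Over X} (g : A.left ⟶ V) (f : V ⟶ U) :
    toSt g ≫ stMap X f = toSt (g ≫ f) :=
  Over.OverMorphism.ext (by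
    change prod.lift A.hom g ≫ bc X f = prod.lift A.hom (g ≫ f)
    simp [bc])

theorem comp_toSt {A B : Over X} (h : B ⟶ A) (g : A.left ⟶ V) :
    h ≫ toSt g = toSt (h.left ≫ g) :=
  Over.OverMorphism.ext (by
    change h.left ≫ prod.lift A.hom g = prod.lift B.hom (h.left ≫ g)
    rw [prod.comp_lift, Over.w])

theorem eq_toSt {A : Over X} (h : A ⟶ st X U) :
    h = toSt ((h.left : A.left ⟶ X ⨯ U) ≫ prod.snd) := by
  apply Over.OverMorphism.ext
  change (h.left : A.left ⟶ X ⨯ U) = prod.lift A.hom ((h.left : A.left ⟶ X ⨯ U) ≫ prod.snd)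
  have : (h.left : A.left ⟶ X ⨯ U) ≫ prod.fst = A.hom := Over.w h
  apply Limits.prod.hom_ext
  · exact this.trans (prod.lift_fst _ _).symm
  · exact (prod.lift_snd _ _).symm

/-- A family of vectors of `K`, indexed by the index object, at the stage `U`. -/
def Fam (K : HilbertSpace (Over X)) (U : T) : Type v := st X U ⟶ K.obj

variable {K : HilbertSpace (Over X)}

instance : AddCommGroup (Fam K U) := K.addCommGroup (st X U)

/-- A family of scalars acts on a family of vectors. -/
instance : Module (Cx (can T) (X ⨯ U)) (Fam K U) :=
  letI := K.module (st X U)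
  Module.compHom (st X U ⟶ K.obj) (Cx.overEquiv (st X U)).toRingHom

namespace Fam

/-- Restriction of a family to a later stage. -/
def res (f : V ⟶ U) (k : Fam K U) : Fam K V := stMap X f ≫ (k : st X U ⟶ K.obj)

/-- The family of the scalar products of the members of two families. -/
def ip (k l : Fam K U) : Cx (can T) (X ⨯ U) := (Cx.overEquiv (st X U)).symm (K.inner k l)

/-- The family of the squares of the norms of the members of a family. -/
def nsq (k : Fam K U) : DReal (can T) (X ⨯ U) := (ip k k).re

variable (k l m : Fam K U)

theorem res_add (f : V ⟶ U) : res f (k + l) = res f k + res f l := K.comp_add _ _ _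

theorem res_sub (f : V ⟶ U) : res f (k - l) = res f k - res f l := K.comp_sub _ _ _

theorem res_smul (f : V ⟶ U) (c : Cx (can T) (X ⨯ U)) :
    res f (c • k) = c.restrict (bc X f) • res f k :=
  (K.comp_smul (stMap X f) (Cx.overEquiv (st X U) c) k).trans
    (congrArg (fun z : Cx (can (Over X)) (st X V) => z • (stMap X f ≫ k : st X V ⟶ K.obj))
      (Cx.overEquiv_restrict c (stMap X f)).symm)

theorem res_comp (f : V ⟶ U) (g : W ⟶ V) : res (g ≫ f) k = res g (res f k) :=
  (congrArg (· ≫ (k : st X U ⟶ K.obj)) (stMap_comp f g)).trans (Category.assoc _ _ _)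

theorem res_id : res (𝟙 U) k = k :=
  (congrArg (· ≫ (k : st X U ⟶ K.obj)) stMap_id).trans (Category.id_comp _)

theorem ip_res (f : V ⟶ U) : (ip k l).restrict (bc X f) = ip (res f k) (res f l) :=
  (Cx.overEquiv_symm_restrict (K.inner k l) (stMap X f)).symm.trans
    (congrArg _ (K.inner_restrict (stMap X f) k l))

theorem nsq_res (f : V ⟶ U) : (nsq k).restrict (bc X f) = nsq (res f k) :=
  congrArg Cx.re (ip_res k k f)

theorem ip_add_right : ip k (l + m) = ip k l + ip k m :=
  (congrArg _ (K.inner_add_right k l m)).trans (map_add _ _ _)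

theorem ip_smul_right (c : Cx (can T) (X ⨯ U)) : ip k (c • l) = c * ip k l :=
  (congrArg _ (K.inner_smul_right (Cx.overEquiv (st X U) c) k l)).trans
    ((map_mul _ _ _).trans (congrArg (· * ip k l) (RingEquiv.symm_apply_apply _ c)))

theorem star_ip : star (ip k l) = ip l k :=
  (Cx.overEquiv_symm_star _).symm.trans (congrArg _ (K.star_inner k l))

theorem ip_smul_left (c : Cx (can T) (X ⨯ U)) : ip (c • k) l = star c * ip k l := by
  rw [← star_ip, ip_smul_right, star_mul, star_ip, mul_comm]

theorem nsq_eq : nsq k = (DReal.overEquiv (st X U)).symm (K.normSq k) := rfl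

theorem nsq_nonneg : 0 ≤ nsq k := by
  have := DReal.overEquiv_symm_le_iff.2 (K.normSq_nonneg k)
  rwa [map_zero] at this

variable {k} in
theorem eq_zero_of_nsq_le (h : nsq k ≤ 0) : k = 0 := by
  refine K.eq_zero_of_normSq_le ?_
  rw [← DReal.overEquiv_symm_le_iff, map_zero]
  exact h

theorem nsq_zero : nsq (0 : Fam K U) = 0 := by
  rw [nsq_eq]
  exact (congrArg _ K.normSq_zero).trans (map_zero _)

theorem nsq_neg : nsq (-k) = nsq k := congrArg (DReal.overEquiv (st X U)).symm (K.normSq_neg k)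

theorem nsq_smul (c : Cx (can T) (X ⨯ U)) : nsq (c • k) = c.absSq * nsq k := by
  rw [nsq, ip_smul_right, ip_smul_left, ← mul_assoc, mul_comm c, Cx.star_mul_self,
    Cx.ofReal_mul_re, nsq]

theorem nsq_add_le {t : ℝ} (ht : 0 < t) :
    nsq (k + l) ≤ (DReal.const (1 + t) : DReal (can T) (X ⨯ U)) * nsq k +
      DReal.const (1 + t⁻¹) * nsq l := by
  have := DReal.overEquiv_symm_le_iff.2 (K.normSq_add_le k l ht)
  rwa [map_add, map_mul, map_mul, DReal.overEquiv_symm_const, DReal.overEquiv_symm_const] at this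

theorem two_mul_ip_re_le : 2 * (ip k l).re ≤ nsq k + nsq l := by
  have := DReal.overEquiv_symm_le_iff.2 (K.two_mul_inner_re_le k l one_pos)
  rwa [map_mul, map_add, map_mul, map_mul, inv_one, DReal.overEquiv_symm_const, DReal.const_one,
    one_mul, one_mul, map_ofNat] at this

theorem le_nsq_iff {r : ℝ} : nsq k ≤ DReal.const (r ^ 2) ↔ K.NormLE (k : st X U ⟶ K.obj) r := by
  have e : (DReal.const (r ^ 2) : DReal (can T) (X ⨯ U)) =
      (DReal.overEquiv (st X U)).symm (DReal.const (r ^ 2)) := (DReal.overEquiv_symm_const (U := st X U) _).symm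
  rw [e]
  exact DReal.overEquiv_symm_le_iff

end Fam

end Families


/-! ### Scalar products of square summable families -/

section DirectSum

open Limits

variable {T : Type u} [Category.{v} T] [HasFiniteLimits T] {X U V W : T}

/-- The sum of a family of complex numbers. -/
def CHasSum (hX : IsDecidable X) (a : Cx (can T) (X ⨯ U)) (z : Cx (can T) U) : Prop :=
  HasSum hX a.re z.re ∧ HasSum hX a.im z.im

namespace CHasSum

variable {hX : IsDecidable X} {a b : Cx (can T) (X ⨯ U)} {z w : Cx (can T) U}

theorem unique (h : CHasSum hX a z) (h' : CHasSum hX a w) : z = w :=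
  Cx.ext (h.1.unique h'.1) (h.2.unique h'.2)

theorem add (h : CHasSum hX a z) (h' : CHasSum hX b w) : CHasSum hX (a + b) (z + w) :=
  ⟨h.1.add h'.1, h.2.add h'.2⟩

theorem star (h : CHasSum hX a z) : CHasSum hX (star a) (star z) := ⟨h.1, h.2.neg⟩

theorem restrict (h : CHasSum hX a z) (f : V ⟶ U) :
    CHasSum hX (a.restrict (bc X f)) (z.restrict f) := ⟨h.1.restrict f, h.2.restrict f⟩

theorem mul_left (h : CHasSum hX a z) (c : Cx (can T) U) :
    CHasSum hX (c.restrict prod.snd * a) (c * z) := by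
  constructor
  · rw [Cx.mul_re, Cx.mul_re, sub_eq_add_neg, sub_eq_add_neg]
    exact (h.1.mul_left c.re).add (h.2.mul_left c.im).neg
  · exact (h.2.mul_left c.re).add (h.1.mul_left c.im)

theorem single (a : Cx (can T) (X ⨯ U)) (x : U ⟶ X) :
    CHasSum hX (Cx.ofReal (hX.single x) * a) (a.restrict (pt x)) := by
  constructor
  · rw [Cx.ofReal_mul_re]
    exact hasSum_single_mul a.re x
  · have : (Cx.ofReal (hX.single x) * a).im = hX.single x * a.im := by simp [Cx.ofReal]
    rw [this]
    exact hasSum_single_mul a.im x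

end CHasSum

theorem HasSum.nonneg {hX : IsDecidable X} {a : DReal (can T) (X ⨯ U)} {r : DReal (can T) U}
    (h : HasSum hX a r) (ha : 0 ≤ a) : 0 ≤ r := by
  have h0 := h.mul_left 0
  rw [DReal.restrict_zero, zero_mul, zero_mul] at h0
  exact h0.le h ha

theorem HasSum.ev_le {hX : IsDecidable X} {a : DReal (can T) (X ⨯ U)} {r : DReal (can T) U}
    (h : HasSum hX a r) (ha : 0 ≤ a) (x : U ⟶ X) : ev a x ≤ r := by
  refine (hasSum_single_mul (hX := hX) a x).le h ?_
  refine (mul_le_mul_of_nonneg_right (hX.kronRe_le_one _ _) ha).trans_eq (one_mul a)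

theorem HasSum.eq_zero {hX : IsDecidable X} {a : DReal (can T) (X ⨯ U)} (h : HasSum hX a 0)
    (ha : 0 ≤ a) : a = 0 := by
  refine le_antisymm (le_of_ev fun V f x => ?_) ha
  have h1 := (h.restrict f).ev_le ((DReal.restrict_zero _).symm.le.trans (DReal.restrict_mono ha _)) x
  rw [DReal.restrict_zero] at h1
  rw [DReal.restrict_zero]
  exact h1.trans_eq (DReal.restrict_zero _).symm

variable {K : HilbertSpace (Over X)}

/-- The scalars at the stage `U` act on families as constant families. -/
instance Fam.baseModule : Module (Cx (can T) U) (Fam K U) :=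
  Module.compHom (Fam K U)
    { toFun := fun c => c.restrict (prod.snd : X ⨯ U ⟶ U)
      map_one' := Cx.restrict_one _
      map_mul' := fun c d => Cx.restrict_mul _ c d
      map_zero' := Cx.restrict_zero _
      map_add' := fun c d => Cx.restrict_add _ c d : Cx (can T) U →+* Cx (can T) (X ⨯ U) }

theorem Fam.base_smul (c : Cx (can T) U) (k : Fam K U) :
    c • k = c.restrict (prod.snd : X ⨯ U ⟶ U) • k := rfl

variable (hX : IsDecidable X)

namespace Fam

theorem nsq_add_le_two (k l : Fam K U) :
    nsq (k + l) ≤ (DReal.const 2 : DReal (can T) U).restrict prod.snd * (nsq k + nsq l) := by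
  refine (nsq_add_le k l one_pos).trans_eq ?_
  rw [DReal.restrict_const, mul_add]
  norm_num

variable {hX} in
theorem small_add {k l : Fam K U} (hk : HasSmallTails hX (nsq k)) (hl : HasSmallTails hX (nsq l)) :
    HasSmallTails hX (nsq (k + l)) :=
  ((hk.add hl (nsq_nonneg k) (nsq_nonneg l)).const_mul (add_nonneg (nsq_nonneg k) (nsq_nonneg l))
    (DReal.const 2)).mono (nsq_add_le_two k l)

variable {hX} in
theorem small_smul {k : Fam K U} (hk : HasSmallTails hX (nsq k)) (c : Cx (can T) U) :
    HasSmallTails hX (nsq (c • k)) := by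
  rw [base_smul, nsq_smul, Cx.absSq_restrict]
  exact hk.const_mul (nsq_nonneg k) _

theorem small_single (x : U ⟶ X) (k : Fam K U) :
    HasSmallTails hX (nsq ((Cx.ofReal (hX.single x) : Cx (can T) (X ⨯ U)) • k)) := by
  have : (Cx.ofReal (hX.single x) : Cx (can T) (X ⨯ U)).absSq =
      hX.single x * hX.single x := by
    simp [Cx.absSq, Cx.ofReal]
  rw [nsq_smul, this, mul_assoc]
  exact hasSmallTails_single_mul _ x

variable {hX} in
theorem exists_hasSum_ip {k l : Fam K U} (hk : HasSmallTails hX (nsq k))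
    (hl : HasSmallTails hX (nsq l)) : ∃ z, CHasSum hX (ip k l) z := by
  have key : ∀ {k l : Fam K U}, HasSmallTails hX (nsq k) → HasSmallTails hX (nsq l) →
      ∃ r, HasSum hX (ip k l).re r := by
    intro k l hk hl
    have hle : ∀ k l : Fam K U, (ip k l).re ≤ nsq k + nsq l := by
      intro k l
      have h1 := two_mul_ip_re_le k l
      have h2 := add_nonneg (nsq_nonneg k) (nsq_nonneg l)
      apply DReal.le_of_const_mul_le two_pos
      rw [DReal.const_two]
      refine h1.trans ?_
      rw [two_mul]
      exact le_add_of_nonneg_right h2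
    refine (hk.add hl (nsq_nonneg k) (nsq_nonneg l)).exists_hasSum (hle k l) ?_
    have h := hle ((-1 : Cx (can T) (X ⨯ U)) • k) l
    rw [ip_smul_left, star_neg, star_one, neg_one_mul, Cx.neg_re, neg_one_smul, nsq_neg] at h
    exact h
  obtain ⟨r, hr⟩ := key hk hl
  obtain ⟨s, hs⟩ := key (small_smul hk Cx.I) hl
  refine ⟨⟨r, s⟩, hr, ?_⟩
  have : (ip ((Cx.I : Cx (can T) U) • k) l).re = (ip k l).im := by
    rw [base_smul, ip_smul_left, Cx.I_restrict]
    simp [Cx.I]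
  rwa [this] at hs

end Fam

theorem hasSmallTails_zero : HasSmallTails hX (0 : DReal (can T) (X ⨯ U)) :=
  fun ε hε => Locally.of_forall fun V f => ⟨[], fun W g m => by
    rw [DReal.restrict_zero, mul_zero, DReal.restrict_zero, finSum_zero]
    exact DReal.const_nonneg hε.le⟩

variable (K) (U) in
/-- The square summable families. -/
def sqSummable : Submodule (Cx (can T) U) (Fam K U) where
  carrier := {k | HasSmallTails hX (Fam.nsq k)}
  add_mem' := Fam.small_add
  zero_mem' := by
    change HasSmallTails hX (Fam.nsq (0 : Fam K U))
    rw [Fam.nsq_zero]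
    exact hasSmallTails_zero hX
  smul_mem' c k hk := Fam.small_smul hk c

end DirectSum


/-! ### The sheaf of square summable families -/

section DirectSum

open Limits

variable {T : Type u} [Category.{v} T] [HasFiniteLimits T] {X U V W : T}
  {K : HilbertSpace (Over X)}

namespace Fam

/-- The value of a family at a map to the stage, at a stage over the index object. -/
def val (k : Fam K U) {A : Over X} (f : A.left ⟶ U) : A ⟶ K.obj := toSt f ≫ (k : st X U ⟶ K.obj)

variable (k l : Fam K U)

theorem comp_val {A B : Over X} (g : B ⟶ A) (f : A.left ⟶ U) : g ≫ k.val f = k.val (g.left ≫ f) :=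
  (Category.assoc _ _ _).symm.trans (congrArg (· ≫ (k : st X U ⟶ K.obj)) (comp_toSt g f))

theorem val_res {A : Over X} (g : A.left ⟶ V) (f : V ⟶ U) : (res f k).val g = k.val (g ≫ f) :=
  (Category.assoc _ _ _).symm.trans (congrArg (· ≫ (k : st X U ⟶ K.obj)) (toSt_stMap g f))

theorem val_sub {A : Over X} (f : A.left ⟶ U) : (k - l).val f = k.val f - l.val f :=
  K.comp_sub _ _ _

theorem val_smul {A : Over X} (f : A.left ⟶ U) (c : Cx (can T) (X ⨯ U)) :
    (c • k).val f = Cx.overEquiv A (c.restrict (prod.lift A.hom f)) • k.val f :=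
  (K.comp_smul (toSt f) (Cx.overEquiv (st X U) c) k).trans
    (congrArg (fun z : Cx (can (Over X)) A => z • (toSt f ≫ k : A ⟶ K.obj))
      (Cx.overEquiv_restrict c (toSt f)).symm)

theorem inner_val {A : Over X} (f : A.left ⟶ U) :
    K.inner (k.val f) (l.val f) = Cx.overEquiv A ((ip k l).restrict (prod.lift A.hom f)) := by
  refine (K.inner_restrict (toSt f) k l).symm.trans ?_
  refine Eq.trans ?_ (Cx.overEquiv_restrict (ip k l) (toSt f)).symm
  exact congrArg (fun z : Cx (can (Over X)) (st X U) => z.restrict (toSt f))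
    (RingEquiv.apply_symm_apply _ _).symm

variable {k l} in
theorem ext_val (h : ∀ ⦃A : Over X⦄ (f : A.left ⟶ U), k.val f = l.val f) : k = l := by
  have e : ∀ k : Fam K U, k.val (A := st X U) (prod.snd : X ⨯ U ⟶ U) = k := fun k => by
    have : toSt (A := st X U) (prod.snd : X ⨯ U ⟶ U) = 𝟙 (st X U) := by
      apply Over.OverMorphism.ext
      change prod.lift prod.fst prod.snd = 𝟙 (X ⨯ U)
      simp
    exact (congrArg (· ≫ (k : st X U ⟶ K.obj)) this).trans (Category.id_comp _)
  have := h (A := st X U) (prod.snd : X ⨯ U ⟶ U)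
  rwa [e, e] at this

/-- A family is determined by a local description of its members. -/
theorem exists_of_locally_unique (P : ∀ ⦃A : Over X⦄, (A.left ⟶ U) → (A ⟶ K.obj) → Prop)
    (hres : ∀ ⦃A : Over X⦄ (f : A.left ⟶ U) (a : A ⟶ K.obj), P f a →
      ∀ ⦃B : Over X⦄ (g : B ⟶ A), P (g.left ≫ f) (g ≫ a))
    (hex : ∀ ⦃A : Over X⦄ (f : A.left ⟶ U), Locally (can (Over X)) (fun ⦃B : Over X⦄ (g : B ⟶ A) =>
      ∃ a, P (g.left ≫ f) a))
    (huniq : ∀ ⦃A : Over X⦄ (f : A.left ⟶ U) (a b : A ⟶ K.obj), P f a → P f b → a = b) :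
    ∃ k : Fam K U, ∀ ⦃A : Over X⦄ (f : A.left ⟶ U) (a : A ⟶ K.obj), P f a → k.val f = a := by
  obtain ⟨k, hk⟩ := ToposHilbert.exists_of_locally_unique (U := st X U) (Y := K.obj)
    (fun A (g : A ⟶ st X U) a => P ((g.left : A.left ⟶ X ⨯ U) ≫ prod.snd) a)
    (fun A f a ha B g => by
      convert hres _ _ ha g using 1
      exact Category.assoc _ _ _)
    (hex (A := st X U) (prod.snd : X ⨯ U ⟶ U)) (fun A f => huniq _)
  refine ⟨k, fun A f a ha => hom_ext_of_locally ((hk.restrict (toSt f)).mono fun B g hg => ?_)⟩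
  refine huniq (g.left ≫ f) _ _ ?_ (hres _ _ ha g)
  rw [Category.assoc] at hg
  convert hg using 1
  swap
  · rfl
  have : ((toSt f : A ⟶ st X U).left : A.left ⟶ X ⨯ U) ≫ prod.snd = f := prod.lift_snd _ _
  exact ((Category.assoc _ _ _).trans (congrArg (g.left ≫ ·) this)).symm

end Fam

variable (K) (hX : IsDecidable X)

/-- The presheaf of square summable families. -/
def sumFunctor : Tᵒᵖ ⥤ Type v where
  obj U := sqSummable (K := K) (U := U.unop) hX
  map f := ↾fun k => ⟨Fam.res f.unop k.1, by
    have := HasSmallTails.restrict k.2 f.unop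
    rwa [Fam.nsq_res] at this⟩
  map_id U := by
    ext k
    exact Fam.res_id _
  map_comp f g := by
    ext k
    exact Fam.res_comp k.1 f.unop g.unop

theorem isSheaf_sumFunctor : Presieve.IsSheaf (can T) (sumFunctor K hX) := by
  intro U S hS x hx
  have huniq : ∀ {A : Over X} {V V' : T} (g : V ⟶ U) (hg : S g) (g' : V' ⟶ U) (hg' : S g')
      (m : A.left ⟶ V) (m' : A.left ⟶ V'), m ≫ g = m' ≫ g' →
      Fam.val (x g hg).1 m = Fam.val (x g' hg').1 m' := by
    intro A V V' g hg g' hg' m m' e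
    have h : Fam.res m (x g hg).1 = Fam.res m' (x g' hg').1 :=
      congrArg Subtype.val (hx m m' hg hg' e)
    have h2 := congrArg (fun k : Fam K A.left => k.val (𝟙 A.left)) h
    simp only [Fam.val_res, Category.id_comp] at h2
    exact h2
  obtain ⟨k, hk⟩ := Fam.exists_of_locally_unique (K := K) (U := U)
    (fun A f a => ∃ (V : T) (g : V ⟶ U) (hg : S g) (m : A.left ⟶ V), m ≫ g = f ∧
      a = Fam.val (x g hg).1 m)
    (by
      rintro A _ _ ⟨V, g, hg, m, rfl, rfl⟩ B h
      exact ⟨V, g, hg, h.left ≫ m, Category.assoc _ _ _, Fam.comp_val _ _ _⟩)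
    (fun A f => locally_over_iff.2 ⟨S.pullback f, (can T).pullback_stable f hS, fun V g hg =>
      ⟨_, V, g ≫ f, hg, 𝟙 V, Category.id_comp _, rfl⟩⟩)
    (by
      rintro A _ _ _ ⟨V, g, hg, m, rfl, rfl⟩ ⟨V', g', hg', m', e, rfl⟩
      exact huniq _ _ _ _ _ _ e.symm)
  have hk' : ∀ ⦃V : T⦄ (g : V ⟶ U) (hg : S g), Fam.res g k = (x g hg).1 := fun V g hg =>
    Fam.ext_val fun A f => by
      rw [Fam.val_res]
      exact hk _ _ ⟨V, g, hg, f, rfl, rfl⟩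
  refine ⟨⟨k, HasSmallTails.of_locally ⟨S, hS, fun V g hg => ?_⟩⟩, fun V g hg =>
    Subtype.ext (hk' g hg), fun l hl => Subtype.ext (Fam.ext_val fun A f => ?_)⟩
  · change HasSmallTails hX ((Fam.nsq k).restrict (bc X g))
    rw [Fam.nsq_res, hk' g hg]
    exact (x g hg).2
  · refine hom_ext_of_locally (locally_over_iff.2 ⟨S.pullback f, (can T).pullback_stable f hS,
      fun V g hg => ?_⟩)
    have h : Fam.res (g ≫ f) l.1 = (x (g ≫ f) hg).1 := congrArg Subtype.val (hl (g ≫ f) hg)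
    have key : ∀ {f' : V ⟶ U}, f' = g ≫ f → Fam.val (A := Over.mk (g ≫ A.hom)) l.1 f' =
        Fam.val (A := Over.mk (g ≫ A.hom)) k f' := by
      rintro _ rfl
      have h1 := congrArg (fun k : Fam K V => k.val (A := Over.mk (g ≫ A.hom)) (𝟙 V))
        (h.trans (hk' (g ≫ f) hg).symm)
      simp only [Fam.val_res] at h1
      convert h1 using 2 <;> exact (Category.id_comp _).symm
    let g' : Over.mk (g ≫ A.hom) ⟶ A := Over.homMk g
    exact (Fam.comp_val l.1 g' f).trans ((key rfl).trans (Fam.comp_val k g' f).symm)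

end DirectSum


/-! ### The Hilbert space of square summable families -/

section DirectSum

open Limits

variable {T : Type u} [Category.{v} T] [HasFiniteLimits T] {X U V W : T}

/-- A family is summable if it is dominated, up to families with arbitrarily small sums, by
summable families. -/
theorem HasSmallTails.of_approx {hX : IsDecidable X} {a : DReal (can T) (X ⨯ U)}
    (h : ∀ η : ℝ, 0 < η → Locally (can T) (fun ⦃V : T⦄ (f : V ⟶ U) =>
      ∃ b c : DReal (can T) (X ⨯ V), HasSmallTails hX b ∧ 0 ≤ c ∧
        (∀ ⦃W : T⦄ (g : W ⟶ V) (l : List (W ⟶ X)),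
          finSum hX (c.restrict (bc X g)) l ≤ DReal.const η) ∧
        a.restrict (bc X f) ≤ b + c)) : HasSmallTails hX a := fun ε hε => by
  refine (h _ (half_pos hε)).bind fun V f ⟨b, c, hb, hc0, hc, hle⟩ =>
    (hb _ (half_pos hε)).mono fun W g ⟨l, hl⟩ => ⟨l, fun Z k m => ?_⟩
  have h1 : hX.co l * a.restrict (bc X (g ≫ f)) ≤
      hX.co l * b.restrict (bc X g) + hX.co l * c.restrict (bc X g) := by
    rw [bc_comp, DReal.restrict_comp, ← mul_add, ← DReal.restrict_add]
    exact mul_le_mul_of_nonneg_left (DReal.restrict_mono hle _) (hX.co_nonneg l)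
  have h2 := finSum_mono hX (DReal.restrict_mono h1 (bc X k)) m
  rw [DReal.restrict_add, finSum_add] at h2
  have h3 : finSum hX ((hX.co l * c.restrict (bc X g)).restrict (bc X k)) m ≤
      DReal.const (ε / 2) := by
    rw [DReal.restrict_mul, hX.co_restrict, ← DReal.restrict_comp, ← bc_comp]
    refine (finSum_co_le hX ?_ _ _).trans (hc _ _)
    exact (DReal.restrict_zero _).symm.le.trans (DReal.restrict_mono hc0 _)
  refine h2.trans ((add_le_add (hl k m) h3).trans_eq ?_)
  rw [← DReal.const_add, add_halves]

theorem HasSum.finSum_le {hX : IsDecidable X} {a : DReal (can T) (X ⨯ U)} {r : DReal (can T) U}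
    (h : HasSum hX a r) (ha : 0 ≤ a) (l : List (U ⟶ X)) : finSum hX a l ≤ r := by
  refine DReal.le_of_forall_pos_le_add fun ε hε => DReal.le_of_locally
    ((h ε hε).mono fun V f ⟨m, hm⟩ => ?_)
  have h1 := (hm (𝟙 V) (l.map (f ≫ ·))).2
  rw [Category.id_comp] at h1
  rw [DReal.restrict_add, DReal.restrict_const, finSum_restrict]
  refine le_trans ?_ h1
  rw [finSum_append_comm, finSum_append]
  refine le_add_of_nonneg_right (finSum_nonneg hX _ ?_ _)
  refine mul_nonneg (hX.co_nonneg _) ?_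
  exact (DReal.restrict_zero _).symm.le.trans (DReal.restrict_mono ha _)

omit [HasFiniteLimits T] in
/-- A bound for the sum of the squared norms which is obtained from approximations: the error terms
tend to `0` with `δ`. -/
theorem DReal.le_const_sq_of_forall_approx {x : DReal (can T) U} {n : ℕ} {ε : ℝ}
    (h : ∀ δ : ℚ, 0 < δ → x ≤ DReal.const ((1 + δ) * (ε + δ) ^ 2 + (1 + (δ : ℝ)⁻¹) * (n * δ ^ 2))) :
    x ≤ DReal.const (ε ^ 2) := by
  refine DReal.le_of_forall_pos_le_add fun η hη => ?_
  have hc : Filter.Tendsto (fun δ : ℝ => (1 + δ) * (ε + δ) ^ 2 + n * (δ ^ 2 + δ))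
      (nhds 0) (nhds (ε ^ 2)) := by
    have : Continuous (fun δ : ℝ => (1 + δ) * (ε + δ) ^ 2 + n * (δ ^ 2 + δ)) := by fun_prop
    convert this.tendsto 0 using 2
    simp
  obtain ⟨d, hd, H⟩ := Metric.eventually_nhds_iff.1
    (hc.eventually (gt_mem_nhds (show ε ^ 2 < ε ^ 2 + η by linarith)))
  obtain ⟨δ, hδ, hδd⟩ := exists_rat_btwn hd
  have h1 := H (y := δ) (by rwa [Real.dist_eq, sub_zero, abs_of_pos hδ])
  refine (h δ (by exact_mod_cast hδ)).trans ?_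
  rw [← DReal.const_add]
  refine DReal.const_mono (le_trans (le_of_eq ?_) h1.le)
  field_simp

variable (hT : IsGrothendieckTopos T) (K : HilbertSpace (Over X)) (hX : IsDecidable X)

variable {K hX} in
/-- The scalar product of two square summable families. -/
def sumInner (k l : sqSummable U K hX) : Cx (can T) U := (Fam.exists_hasSum_ip k.2 l.2).choose

variable {K hX} in
theorem hasSum_sumInner (k l : sqSummable U K hX) : CHasSum hX (Fam.ip k.1 l.1) (sumInner k l) :=
  (Fam.exists_hasSum_ip k.2 l.2).choose_spec

/-- The square summable families, as a presheaf of pre-Hilbert spaces. -/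
def sumPresheaf : PreHilbertPresheaf T where
  vec U := sqSummable U K hX
  addCommGroup U := inferInstance
  module U := inferInstance
  inner k l := sumInner k l
  res f k := ⟨Fam.res f k.1, by
    have := HasSmallTails.restrict k.2 f
    rwa [Fam.nsq_res] at this⟩
  res_add f k l := Subtype.ext (Fam.res_add _ _ f)
  res_smul f c k := Subtype.ext (by
    change Fam.res f (c • k.1) = c.restrict f • Fam.res f k.1
    rw [Fam.base_smul, Fam.res_smul, Fam.base_smul, ← Cx.restrict_comp, ← Cx.restrict_comp, bc_snd])
  inner_restrict f k l := by
    refine CHasSum.unique ?_ (hasSum_sumInner _ _)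
    have := (hasSum_sumInner k l).restrict f
    rwa [Fam.ip_res] at this
  inner_add_right k l m := by
    refine CHasSum.unique (hasSum_sumInner _ _) ?_
    have := (hasSum_sumInner k l).add (hasSum_sumInner k m)
    rwa [← Fam.ip_add_right] at this
  inner_smul_right c k l := by
    refine CHasSum.unique (hasSum_sumInner _ _) ?_
    have := (hasSum_sumInner k l).mul_left c
    rwa [← Fam.ip_smul_right] at this
  star_inner k l := by
    refine CHasSum.unique ?_ (hasSum_sumInner _ _)
    have := (hasSum_sumInner k l).star
    rwa [Fam.star_ip] at this
  inner_self_nonneg k := (hasSum_sumInner k k).1.nonneg (Fam.nsq_nonneg k.1)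
  eq_zero_of_inner_self k h := by
    have h1 := (hasSum_sumInner k k).1
    rw [h] at h1
    exact Subtype.ext (Fam.eq_zero_of_nsq_le (h1.eq_zero (Fam.nsq_nonneg k.1)).le)
  obj := (hT.exists_representableBy (isSheaf_sumFunctor K hX)).choose
  equiv := (hT.exists_representableBy (isSheaf_sumFunctor K hX)).choose_spec.some.homEquiv
  equiv_comp f x := (hT.exists_representableBy
    (isSheaf_sumFunctor K hX)).choose_spec.some.homEquiv_comp f x

/-- The direct sum, as a pre-Hilbert space. -/
def sumPre : PreHilbertSpace T := (sumPresheaf hT K hX).toPreHilbertSpace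

namespace SumPre

variable {hT K hX}

/-- The family of the components of an element of the direct sum. -/
def fam (x : U ⟶ (sumPre hT K hX).obj) : Fam K U := ((sumPresheaf hT K hX).equiv x).1

theorem small_fam (x : U ⟶ (sumPre hT K hX).obj) : HasSmallTails hX (Fam.nsq (fam x)) :=
  ((sumPresheaf hT K hX).equiv x).2

theorem fam_injective {x y : U ⟶ (sumPre hT K hX).obj} (h : fam x = fam y) : x = y :=
  (sumPresheaf hT K hX).equiv.injective (Subtype.ext h)

theorem exists_fam {k : Fam K U} (hk : HasSmallTails hX (Fam.nsq k)) :
    ∃ x : U ⟶ (sumPre hT K hX).obj, fam x = k :=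
  ⟨(sumPresheaf hT K hX).equiv.symm ⟨k, hk⟩, congrArg Subtype.val (Equiv.apply_symm_apply _ _)⟩

variable (x y : U ⟶ (sumPre hT K hX).obj)

theorem fam_comp (f : V ⟶ U) : fam (f ≫ x) = Fam.res f (fam x) :=
  congrArg Subtype.val ((sumPresheaf hT K hX).equiv_comp f x)

theorem fam_sub : fam (x - y) = fam x - fam y :=
  congrArg Subtype.val ((sumPresheaf hT K hX).equiv_sub x y)

theorem hasSum_inner : CHasSum hX (Fam.ip (fam x) (fam y)) ((sumPre hT K hX).inner x y) :=
  hasSum_sumInner _ _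

theorem hasSum_normSq : HasSum hX (Fam.nsq (fam x)) ((sumPre hT K hX).normSq x) :=
  (hasSum_inner x x).1

variable {x y} in
theorem nsq_fam_le {r : ℝ} (h : (sumPre hT K hX).NormLE x r) :
    Fam.nsq (fam x) ≤ DReal.const (r ^ 2) := by
  refine le_of_ev fun V f p => ?_
  rw [Fam.nsq_res, ← fam_comp, DReal.restrict_const]
  refine ((hasSum_normSq _).ev_le (Fam.nsq_nonneg _) p).trans ((h.comp f).trans_eq ?_)
  exact (DReal.restrict_const _ _).symm

variable {x y} in
theorem normLE_val_fam {r : ℝ} (h : (sumPre hT K hX).NormLE x r) {A : Over X} (f : A.left ⟶ U) :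
    K.NormLE ((fam x).val f) r :=
  ((Fam.le_nsq_iff _).1 (nsq_fam_le h)).comp (toSt f)

/-- A Cauchy approximation in the direct sum determines Cauchy approximations in the summands. -/
theorem exists_componentwise_limit
    (A : ℚ → ∀ ⦃V : T⦄, (V ⟶ U) → (V ⟶ (sumPre hT K hX).obj) → Prop)
    (hA : (sumPre hT K hX).IsCauchyApproximation A) :
    ∃ k : Fam K U, ∀ ε > 0, ∀ ⦃V : T⦄ (f : V ⟶ U) (a : V ⟶ (sumPre hT K hX).obj), A ε f a →
      Fam.nsq (Fam.res f k - fam a) ≤ DReal.const ((ε : ℝ) ^ 2) := by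
  let Q : ℚ → ∀ ⦃B : Over X⦄, (B.left ⟶ U) → (B ⟶ K.obj) → Prop := fun ε B f b =>
    Locally (can (Over X)) (fun ⦃Z : Over X⦄ (h : Z ⟶ B) =>
      ∃ a : Z.left ⟶ (sumPre hT K hX).obj, A ε (h.left ≫ f) a ∧ h ≫ b = (fam a).val (𝟙 Z.left))
  have hsnd : ∀ {B B' : Over X} (g : B' ⟶ B) (h : B ⟶ st X U),
      ((g ≫ h).left : B'.left ⟶ X ⨯ U) ≫ prod.snd =
        g.left ≫ (h.left : B.left ⟶ X ⨯ U) ≫ prod.snd := fun g h => Category.assoc _ _ _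
  have hQres : ∀ (ε : ℚ) ⦃B : Over X⦄ (f : B.left ⟶ U) (b : B ⟶ K.obj), Q ε f b →
      ∀ ⦃B' : Over X⦄ (g : B' ⟶ B), Q ε (g.left ≫ f) (g ≫ b) := fun ε B f b h B' g => by
    refine (h.restrict g).mono fun Z h' ⟨a, ha, e⟩ => ⟨a, ?_, ?_⟩
    · rw [← Category.assoc]
      exact ha
    · rw [← Category.assoc]
      exact e
  obtain ⟨k, hk⟩ := K.complete (U := st X U)
    (fun ε B g b => Q ε ((g.left : B.left ⟶ X ⨯ U) ≫ prod.snd) b)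
    { restrict := fun ε hε B g b h B' g' => by
        rw [hsnd]
        exact hQres ε _ b h g'
      glue := fun ε hε B g b h => h.bind fun B' g' h' => by
        rw [hsnd] at h'
        refine h'.mono fun Z h ⟨a, ha, e⟩ => ⟨a, ?_, ?_⟩
        · rw [← Category.assoc] at ha
          exact ha
        · rw [← Category.assoc] at e
          exact e
      inhabited := fun ε hε => by
        refine locally_over_iff.2 (((hA.inhabited ε hε).restrict
          (prod.snd : X ⨯ U ⟶ U)).mono fun V f ⟨a, ha⟩ => ?_)
        refine ⟨(fam a).val (A := Over.mk (f ≫ (st X U).hom)) (𝟙 V), Locally.of_forall fun Z h => ?_⟩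
        refine ⟨h.left ≫ a, hA.restrict ε hε _ _ ha _, ?_⟩
        rw [fam_comp, Fam.val_res]
        exact (Fam.comp_val (fam a) h (𝟙 V)).trans
          (congrArg _ ((Category.comp_id _).trans (Category.id_comp _).symm))
      cauchy := fun ε hε δ hδ B g b b' hb hb' => by
        refine PreHilbertSpace.NormLE.of_locally (hb.bind fun Z h ⟨a, ha, e⟩ =>
          (hb'.restrict h).mono fun Z' h' ⟨a', ha', e'⟩ => ?_)
        have h1 := hA.restrict ε hε _ _ ha h'.left
        have h2 : (h'.left ≫ h.left ≫ (g.left : B.left ⟶ X ⨯ U) ≫ prod.snd) =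
          (h' ≫ h).left ≫ (g.left : B.left ⟶ X ⨯ U) ≫ prod.snd := (Category.assoc _ _ _).symm
        rw [h2] at h1
        have h3 := normLE_val_fam (hA.cauchy ε hε δ hδ _ _ _ h1 ha') (A := Z') (𝟙 _)
        rw [fam_sub, Fam.val_sub, ← e', fam_comp, Fam.val_res] at h3
        have h4 : (fam a).val (A := Z') (𝟙 Z'.left ≫ h'.left) = (h' ≫ h) ≫ b := by
          rw [Category.assoc, e, Fam.comp_val]
          exact congrArg _ ((Category.id_comp _).trans (Category.comp_id _).symm)
        rw [h4, ← K.comp_sub] at h3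
        exact h3 }
  refine ⟨k, fun ε hε V f a ha => ?_⟩
  refine (Fam.le_nsq_iff _).2 (hk ε hε (stMap X f) (fam a : st X V ⟶ K.obj) (Locally.of_forall fun Z h => ?_))
  let m : Z.left ⟶ V := (h.left : Z.left ⟶ X ⨯ V) ≫ prod.snd
  refine ⟨m ≫ a, ?_, ?_⟩
  · convert hA.restrict ε hε f a ha m using 1
    have : ((stMap X f).left : X ⨯ V ⟶ X ⨯ U) ≫ prod.snd = prod.snd ≫ f := bc_snd f
    exact (congrArg (h.left ≫ ·) this).trans (Category.assoc _ _ _).symm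
  · rw [fam_comp, Fam.val_res, Category.id_comp]
    exact congrArg (· ≫ (fam a : st X V ⟶ K.obj)) (eq_toSt h)

/-- The direct sum is complete: a Cauchy approximation determines Cauchy approximations in the
summands, and the family of their limits is the limit. -/
theorem complete (A : ℚ → ∀ ⦃V : T⦄, (V ⟶ U) → (V ⟶ (sumPre hT K hX).obj) → Prop)
    (hA : (sumPre hT K hX).IsCauchyApproximation A) :
    ∃ x : U ⟶ (sumPre hT K hX).obj, ∀ ε > 0, ∀ ⦃V : T⦄ (f : V ⟶ U)
      (a : V ⟶ (sumPre hT K hX).obj), A ε f a → (sumPre hT K hX).NormLE (f ≫ x - a) ε := by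
  obtain ⟨k, hnear⟩ := exists_componentwise_limit A hA
  have hsum : ∀ ε > 0, ∀ ⦃V : T⦄ (f : V ⟶ U) (a : V ⟶ (sumPre hT K hX).obj), A ε f a →
      ∀ l : List (V ⟶ X), finSum hX (Fam.nsq (Fam.res f k - fam a)) l ≤
        DReal.const ((ε : ℝ) ^ 2) := fun ε hε V f a ha l => by
    refine DReal.le_const_sq_of_forall_approx (n := l.length) fun δ hδ => DReal.le_of_locally
      (((hA.inhabited δ hδ).restrict f).mono fun W g ⟨a', ha'⟩ => ?_)
    have hδ' : (0 : ℝ) < δ := by exact_mod_cast hδ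
    rw [finSum_restrict, Fam.nsq_res, Fam.res_sub, ← Fam.res_comp, ← fam_comp]
    have h1 : Fam.res (g ≫ f) k - fam (g ≫ a) =
        fam (a' - g ≫ a) + (Fam.res (g ≫ f) k - fam a') := by
      rw [fam_sub]; abel
    have h2 := finSum_mono hX (Fam.nsq_add_le (fam (a' - g ≫ a)) (Fam.res (g ≫ f) k - fam a') hδ')
      (l.map (g ≫ ·))
    have hc : ∀ r : ℝ, (DReal.const r : DReal (can T) (X ⨯ W)) =
        (DReal.const r : DReal (can T) W).restrict prod.snd := fun r =>
      (DReal.restrict_const _ _).symm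
    rw [finSum_add, hc, hc, finSum_const_mul, finSum_const_mul, ← h1] at h2
    have h3 := finSum_le_length_mul hX (sq_nonneg (δ : ℝ)) (hnear δ hδ _ _ ha') (l.map (g ≫ ·))
    have h4 := (hasSum_normSq (a' - g ≫ a)).finSum_le (Fam.nsq_nonneg _) (l.map (g ≫ ·))
    have h5 := hA.cauchy δ hδ ε hε _ _ _ ha' (hA.restrict ε hε _ _ ha g)
    refine h2.trans ((add_le_add
      (mul_le_mul_of_nonneg_left (h4.trans h5) (DReal.const_nonneg (by positivity)))
      (mul_le_mul_of_nonneg_left h3 (DReal.const_nonneg (by positivity)))).trans_eq ?_)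
    rw [← DReal.const_mul, ← DReal.const_mul, ← DReal.const_add, DReal.restrict_const]
    congr 1
    push_cast
    rw [List.length_map]
    ring
  have hcomp : ∀ ⦃V W : T⦄ (f : V ⟶ U) (g : W ⟶ V) (a : V ⟶ (sumPre hT K hX).obj),
      (Fam.nsq (Fam.res f k - fam a)).restrict (bc X g) =
        Fam.nsq (Fam.res (g ≫ f) k - fam (g ≫ a)) := fun V W f g a => by
    rw [Fam.nsq_res, Fam.res_sub, ← Fam.res_comp, ← fam_comp]
  have hsmall : HasSmallTails hX (Fam.nsq k) := by
    refine HasSmallTails.of_approx fun η hη => ?_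
    obtain ⟨ε, hε, hεη⟩ := exists_rat_btwn (Real.sqrt_pos.2 (half_pos hη))
    have hε0 : (0 : ℚ) < ε := by exact_mod_cast hε
    refine (hA.inhabited ε hε0).mono fun V f ⟨a, ha⟩ => ?_
    refine ⟨(DReal.const 2 : DReal (can T) V).restrict prod.snd * Fam.nsq (fam a),
      (DReal.const 2 : DReal (can T) V).restrict prod.snd * Fam.nsq (Fam.res f k - fam a),
      (small_fam a).const_mul (Fam.nsq_nonneg _) _, ?_, fun W g l => ?_, ?_⟩
    · rw [DReal.restrict_const]
      exact mul_nonneg (DReal.const_nonneg (by norm_num)) (Fam.nsq_nonneg _)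
    · rw [DReal.restrict_mul, ← DReal.restrict_comp, bc_snd, DReal.restrict_comp, finSum_const_mul,
        DReal.restrict_const, hcomp]
      refine (mul_le_mul_of_nonneg_left (hsum ε hε0 _ _ (hA.restrict ε hε0 _ _ ha g) l)
        (DReal.const_nonneg (by norm_num))).trans ?_
      rw [← DReal.const_mul]
      refine DReal.const_mono ?_
      have := (Real.lt_sqrt hε.le).1 hεη
      linarith
    · have h1 := Fam.nsq_add_le_two (fam a) (Fam.res f k - fam a)
      rwa [add_sub_cancel, mul_add, ← Fam.nsq_res] at h1
  obtain ⟨x, hx⟩ := exists_fam (hT := hT) hsmall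
  refine ⟨x, fun ε hε V f a ha => (hasSum_normSq _).le_const fun W g l => ?_⟩
  rw [fam_sub, fam_comp, hx, hcomp]
  exact hsum ε hε _ _ (hA.restrict ε hε _ _ ha g) l

end SumPre

/-- The internal direct sum of a Hilbert space of the slice over a decidable object. -/
def directSum : HilbertSpace T where
  toPreHilbertSpace := sumPre hT K hX
  complete := SumPre.complete

end DirectSum


/-! ### The summands of the direct sum -/

section DirectSum

open Limits

variable {T : Type u} [Category.{v} T] [HasFiniteLimits T] {X U V W : T}

theorem IsDecidable.single_mul_self (hX : IsDecidable X) (x : U ⟶ X) :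
    hX.single x * hX.single x = hX.single x := hX.kronRe_mul_self _ _

theorem IsDecidable.single_mul_single_of_ne (hX : IsDecidable X) {x y : U ⟶ X}
    (h : InternallyNe (can T) x y) : hX.single x * hX.single y = 0 := by
  refine DReal.eq_of_locally ((hX (prod.snd ≫ x) (prod.fst : X ⨯ U ⟶ X)).mono fun V f hf => ?_)
  rw [DReal.restrict_mul, DReal.restrict_zero, single, single, hX.kronRe_restrict,
    hX.kronRe_restrict]
  rcases hf with hf | hf
  · rw [← hf, hX.kronRe_ne (((h.restrict (prod.snd : X ⨯ U ⟶ U)).restrict f).symm), mul_zero]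
  · rw [hX.kronRe_ne hf, zero_mul]

theorem IsDecidable.single_restrict_lift (hX : IsDecidable X) (x : U ⟶ X) (y : V ⟶ X) (f : V ⟶ U) :
    (hX.single x).restrict (prod.lift y f) = hX.kronRe (f ≫ x) y := by
  rw [single, kronRe_restrict, prod.lift_fst, ← Category.assoc, prod.lift_snd]

namespace Fam

variable {K : HilbertSpace (Over X)} (hX : IsDecidable X)

/-- The family which is zero outside of the index `x`. -/
def cut (x : U ⟶ X) (k : Fam K U) : Fam K U :=
  (Cx.ofReal (hX.single x) : Cx (can T) (X ⨯ U)) • k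

theorem small_cut (x : U ⟶ X) (k : Fam K U) : HasSmallTails hX (nsq (cut hX x k)) :=
  small_single hX x k

theorem res_cut (f : V ⟶ U) (x : U ⟶ X) (k : Fam K U) :
    res f (cut hX x k) = cut hX (f ≫ x) (res f k) := by
  rw [cut, res_smul, Cx.restrict_ofReal, hX.single_restrict, cut]

theorem cut_cut (x : U ⟶ X) (k : Fam K U) : cut hX x (cut hX x k) = cut hX x k := by
  rw [cut, cut, smul_smul, ← Cx.ofReal_mul, hX.single_mul_self]

theorem cut_cut_of_ne {x y : U ⟶ X} (h : InternallyNe (can T) x y) (k : Fam K U) :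
    cut hX x (cut hX y k) = 0 := by
  rw [cut, cut, smul_smul, ← Cx.ofReal_mul, hX.single_mul_single_of_ne h, Cx.ofReal_zero, zero_smul]

theorem ip_cut_left (x : U ⟶ X) (k l : Fam K U) :
    ip (cut hX x k) l = Cx.ofReal (hX.single x) * ip k l := by
  rw [cut, ip_smul_left, Cx.star_ofReal]

theorem ip_cut_right (x : U ⟶ X) (k l : Fam K U) :
    ip k (cut hX x l) = Cx.ofReal (hX.single x) * ip k l := by
  rw [cut, ip_smul_right]

theorem val_cut (x : U ⟶ X) (k : Fam K U) {A : Over X} (f : A.left ⟶ U) :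
    (cut hX x k).val f = Cx.overEquiv A (Cx.ofReal (hX.kronRe (f ≫ x) A.hom)) • k.val f := by
  rw [cut, val_smul, Cx.restrict_ofReal, hX.single_restrict_lift]

theorem val_cut_self (k : Fam K U) {A : Over X} (f : A.left ⟶ U) (x : U ⟶ X) (h : f ≫ x = A.hom) :
    (cut hX x k).val f = k.val f := by
  rw [val_cut, h, hX.kronRe_self, Cx.ofReal_one, map_one, one_smul]

theorem val_cut_of_ne (k : Fam K U) {A : Over X} (f : A.left ⟶ U) (x : U ⟶ X)
    (h : InternallyNe (can T) (f ≫ x) A.hom) : (cut hX x k).val f = 0 := by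
  rw [val_cut, hX.kronRe_ne h, Cx.ofReal_zero, map_zero, zero_smul]

/-- A family which is zero outside of an index is determined by its value at that index. -/
theorem cut_eq_cut {A : Over X} {k l : Fam K A.left} (h : k.val (𝟙 A.left) = l.val (𝟙 A.left)) :
    cut hX A.hom k = cut hX A.hom l := by
  refine ext_val fun B f => hom_ext_of_locally (locally_over_iff.2
    ((hX (f ≫ A.hom) B.hom).mono fun V g hg => ?_))
  let g' : Over.mk (g ≫ B.hom) ⟶ B := Over.homMk g
  refine (comp_val _ g' f).trans (Eq.trans ?_ (comp_val _ g' f).symm)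
  have hgf : g'.left ≫ f = g ≫ f := rfl
  rw [hgf]
  rcases hg with hg | hg
  · have hg' : (g ≫ f) ≫ A.hom = g ≫ B.hom := (Category.assoc _ _ _).trans hg
    rw [val_cut_self hX k (A := Over.mk (g ≫ B.hom)) (g ≫ f) A.hom hg',
      val_cut_self hX l (A := Over.mk (g ≫ B.hom)) (g ≫ f) A.hom hg']
    let g'' : Over.mk (g ≫ B.hom) ⟶ A := Over.homMk (g ≫ f) hg'
    have e : g ≫ f = g''.left ≫ 𝟙 A.left := (Category.comp_id _).symm
    rw [e, ← comp_val, ← comp_val, h]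
  · have hg' : InternallyNe (can T) ((g ≫ f) ≫ A.hom) (g ≫ B.hom) := by rwa [Category.assoc]
    rw [val_cut_of_ne hX k (A := Over.mk (g ≫ B.hom)) (g ≫ f) A.hom hg',
      val_cut_of_ne hX l (A := Over.mk (g ≫ B.hom)) (g ≫ f) A.hom hg']

include hX in
/-- Every vector of `K` is a member of a family; the members with a different index are zero. -/
theorem exists_val_eq {A : Over X} (a : A ⟶ K.obj) : ∃ k : Fam K A.left, k.val (𝟙 A.left) = a := by
  obtain ⟨k, hk⟩ := exists_of_locally_unique (K := K) (U := A.left)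
    (fun B f b => Locally (can (Over X)) (fun ⦃Z : Over X⦄ (h : Z ⟶ B) =>
      (∃ l : Z ⟶ A, l.left = h.left ≫ f ∧ h ≫ b = l ≫ a) ∨
        (InternallyNe (can T) (h.left ≫ f ≫ A.hom) Z.hom ∧ h ≫ b = 0)))
    (fun B f b h B' g => (h.restrict g).mono fun Z h' hh => by
      have e : h'.left ≫ g.left ≫ f = (h' ≫ g).left ≫ f := (Category.assoc _ _ _).symm
      have e' : h'.left ≫ (g.left ≫ f) ≫ A.hom = (h' ≫ g).left ≫ f ≫ A.hom := by
        rw [← Category.assoc, e, Category.assoc]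
      rw [e, e', ← Category.assoc]
      exact hh)
    (fun B f => locally_over_iff.2 ((hX (f ≫ A.hom) B.hom).mono fun V g hg => by
      rcases hg with hg | hg
      · let g'' : Over.mk (g ≫ B.hom) ⟶ A :=
          Over.homMk (g ≫ f) ((Category.assoc _ _ _).trans hg)
        refine ⟨g'' ≫ a, Locally.of_forall fun Z h => .inl ⟨h ≫ g'', rfl, ?_⟩⟩
        rw [Category.assoc]
      · refine ⟨0, Locally.of_forall fun Z h => .inr ⟨?_, K.comp_zero _⟩⟩
        have := hg.restrict h.left
        have e : h.left ≫ g ≫ B.hom = Z.hom := Over.w h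
        rw [e, ← Category.assoc g] at this
        exact this))
    (fun B f b b' hb hb' => hom_ext_of_locally (hb.bind fun Z h hh =>
      (hb'.restrict h).bind fun Z' h' hh' => by
        have e : (h' ≫ h).left ≫ f = h'.left ≫ h.left ≫ f := Category.assoc _ _ _
        have e' : (h' ≫ h).left ≫ f ≫ A.hom = h'.left ≫ h.left ≫ f ≫ A.hom := Category.assoc _ _ _
        rcases hh with ⟨l, hl, hh⟩ | ⟨hl, hh⟩ <;> rcases hh' with ⟨l', hl', hh'⟩ | ⟨hl', hh'⟩
        · have : l' = h' ≫ l := Over.OverMorphism.ext (by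
            rw [hl', e, ← hl]; rfl)
          have e3 : (h' ≫ h) ≫ b = (h' ≫ h) ≫ b' := by
            rw [Category.assoc, hh, hh', this, Category.assoc]
          exact Locally.of_forall fun Z'' h'' => by
            simpa only [Category.assoc] using congrArg (h'' ≫ ·) e3
        · have : Inconsistent (can T) Z'.left := by
            have h2 := hl' (𝟙 _)
            rw [Category.id_comp, Category.id_comp] at h2
            refine h2 ?_
            rw [e', ← Category.assoc h.left, ← hl]
            have e2 : (l.left : Z.left ⟶ A.left) ≫ A.hom = Z.hom := Over.w l
            rw [e2]
            exact Over.w h'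
          exact (inconsistent_over_iff.2 this).locally _
        · have : Inconsistent (can T) Z'.left := by
            have h2 := hl h'.left
            refine h2 ?_
            rw [← e', ← Category.assoc (h' ≫ h).left, ← hl']
            have e2 : (l'.left : Z'.left ⟶ A.left) ≫ A.hom = Z'.hom := Over.w l'
            rw [e2]
            exact (Over.w h').symm
          exact (inconsistent_over_iff.2 this).locally _
        · have e3 : (h' ≫ h) ≫ b = (h' ≫ h) ≫ b' := by
            rw [Category.assoc, hh, hh', K.comp_zero]
          exact Locally.of_forall fun Z'' h'' => by
            simpa only [Category.assoc] using congrArg (h'' ≫ ·) e3))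
  refine ⟨k, hk _ a (Locally.of_forall fun Z h => .inl ⟨h, (Category.comp_id _).symm, rfl⟩)⟩

end Fam

variable {hT : IsGrothendieckTopos T} {K : HilbertSpace (Over X)} {hX : IsDecidable X}

namespace HilbertSum

/-- The family of the components of an element of the direct sum. -/
def fam (x : U ⟶ (directSum hT K hX).obj) : Fam K U := SumPre.fam (hT := hT) (hX := hX) x

theorem small_fam (x : U ⟶ (directSum hT K hX).obj) : HasSmallTails hX (Fam.nsq (fam x)) :=
  SumPre.small_fam x

theorem fam_injective {x y : U ⟶ (directSum hT K hX).obj} (h : fam x = fam y) : x = y :=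
  SumPre.fam_injective h

variable (hT) in
/-- The element of the direct sum given by a square summable family. -/
def mk (k : Fam K U) (hk : HasSmallTails hX (Fam.nsq k)) : U ⟶ (directSum hT K hX).obj :=
  (SumPre.exists_fam hk).choose

theorem fam_mk (k : Fam K U) (hk : HasSmallTails hX (Fam.nsq k)) : fam (mk hT k hk) = k :=
  (SumPre.exists_fam hk).choose_spec

variable (x y : U ⟶ (directSum hT K hX).obj)

theorem fam_comp (f : V ⟶ U) : fam (f ≫ x) = Fam.res f (fam x) := SumPre.fam_comp x f

theorem fam_sub : fam (x - y) = fam x - fam y := SumPre.fam_sub x y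

theorem hasSum_inner : CHasSum hX (Fam.ip (fam x) (fam y)) ((directSum hT K hX).inner x y) :=
  SumPre.hasSum_inner x y

theorem hasSum_normSq : HasSum hX (Fam.nsq (fam x)) ((directSum hT K hX).normSq x) :=
  (hasSum_inner x x).1

end HilbertSum

open HilbertSum

variable (hT K hX) in
/-- The projections of the direct sum to its summands. -/
def sumProj : ProjFamily (directSum hT K hX) X where
  P x h := mk hT (Fam.cut hX x (fam h)) (Fam.small_cut hX x (fam h))
  comp_P f x h := fam_injective (by rw [fam_comp, fam_mk, fam_mk, Fam.res_cut, fam_comp])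
  inner_P x h k := by
    refine (hasSum_inner _ _).unique ?_
    have := hasSum_inner h (mk hT (Fam.cut hX x (fam k)) (Fam.small_cut hX x (fam k)))
    rwa [fam_mk, Fam.ip_cut_right, ← Fam.ip_cut_left, ← fam_mk (hT := hT) _ (Fam.small_cut hX x (fam h))]
      at this
  P_P x h := fam_injective (by rw [fam_mk, fam_mk, Fam.cut_cut])

theorem fam_sumProj (x : U ⟶ X) (h : U ⟶ (directSum hT K hX).obj) :
    fam ((sumProj hT K hX).P x h) = Fam.cut hX x (fam h) :=
  fam_mk _ (Fam.small_cut hX x (fam h))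

variable (hT K hX) in
/-- The direct sum is graded. -/
def sumGrading : Grading (directSum hT K hX) X where
  toProjFamily := sumProj hT K hX
  P_ne x y h hxy := fam_injective (by
    rw [fam_sumProj, fam_sumProj, Fam.cut_cut_of_ne hX hxy, ← sub_self h, fam_sub, sub_self])
  dense U h ε hε := by
    have hε' : (0 : ℝ) < (ε : ℝ) ^ 2 := by positivity
    refine (small_fam h _ hε').mono fun V f ⟨l, hl⟩ => ?_
    have key : ∀ l : List (V ⟶ X), ∃ y ∈ Submodule.span (Cx (can T) V)
        {z | ∃ (x : V ⟶ X) (h : V ⟶ (directSum hT K hX).obj), z = (sumProj hT K hX).P x h},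
        fam (f ≫ h - y) = (Cx.ofReal (hX.co l) : Cx (can T) (X ⨯ V)) • fam (f ≫ h) := by
      intro l
      induction l with
      | nil =>
        refine ⟨0, Submodule.zero_mem _, ?_⟩
        rw [sub_zero, IsDecidable.co, List.map_nil, hX.chi_nil, Cx.ofReal_one, one_smul]
      | cons x l ih =>
        obtain ⟨y, hy, e⟩ := ih
        refine ⟨y + (sumProj hT K hX).P x (f ≫ h - y), Submodule.add_mem _ hy
          (Submodule.subset_span ⟨x, _, rfl⟩), ?_⟩
        rw [← sub_sub, fam_sub, fam_sumProj, e, Fam.cut, smul_smul, ← sub_smul, hX.co_cons,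
          Cx.ofReal_mul]
        congr 1
        have : (Cx.ofReal (1 - hX.single x) : Cx (can T) (X ⨯ V)) = 1 - Cx.ofReal (hX.single x) := by
          ext1
          · rw [Cx.sub_re]; rfl
          · rw [Cx.sub_im]; exact (sub_zero 0).symm
        rw [this]
        ring
    obtain ⟨y, hy, e⟩ := key l
    refine ⟨y, hy, (hasSum_normSq _).le_const fun W g m => ?_⟩
    rw [e, Fam.nsq_smul, fam_comp, ← Fam.nsq_res]
    have e2 : (Cx.ofReal (hX.co l) : Cx (can T) (X ⨯ V)).absSq = hX.co l := by
      simp [Cx.absSq, Cx.ofReal, hX.co_mul_self]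
    rw [e2]
    exact hl g m

/-- The scalar product with a vector in a summand only involves the component in that summand. -/
theorem inner_sumProj_left {A : Over X} (x y : A.left ⟶ (directSum hT K hX).obj) :
    Cx.overEquiv A ((directSum hT K hX).inner ((sumProj hT K hX).P A.hom x) y) =
      K.inner ((fam x).val (𝟙 A.left)) ((fam y).val (𝟙 A.left)) := by
  have h := hasSum_inner ((sumProj hT K hX).P A.hom x) y
  rw [fam_sumProj, Fam.ip_cut_left] at h
  rw [h.unique (CHasSum.single _ _), Fam.inner_val]
  rfl

variable (hT hX) in
/-- A vector of `K`, as a vector of the direct sum which lies in one summand. -/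
def incl {A : Over X} (a : A ⟶ K.obj) : A.left ⟶ (directSum hT K hX).obj :=
  mk hT (Fam.cut hX A.hom (Fam.exists_val_eq hX a).choose) (Fam.small_cut hX _ _)

theorem fam_incl_val {A : Over X} (a : A ⟶ K.obj) : (fam (incl hT hX a)).val (𝟙 A.left) = a := by
  rw [incl, fam_mk, Fam.val_cut_self hX _ _ _ (Category.id_comp _)]
  exact (Fam.exists_val_eq hX a).choose_spec

theorem sumProj_incl {A : Over X} (a : A ⟶ K.obj) :
    (sumProj hT K hX).P A.hom (incl hT hX a) = incl hT hX a :=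
  fam_injective (by rw [fam_sumProj, incl, fam_mk, Fam.cut_cut])

/-- Vectors in a summand are determined by their component. -/
theorem sumProj_eq {A : Over X} {x y : A.left ⟶ (directSum hT K hX).obj}
    (h : (fam x).val (𝟙 A.left) = (fam y).val (𝟙 A.left)) :
    (sumProj hT K hX).P A.hom x = (sumProj hT K hX).P A.hom y :=
  fam_injective (by rw [fam_sumProj, fam_sumProj, Fam.cut_eq_cut hX h])

theorem sumProj_eq_incl {A : Over X} (x : A.left ⟶ (directSum hT K hX).obj) :
    (sumProj hT K hX).P A.hom x = incl hT hX ((fam x).val (𝟙 A.left)) := by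
  rw [← sumProj_incl]
  exact sumProj_eq (fam_incl_val _).symm

theorem fam_comp_val {A B : Over X} (g : B ⟶ A) (x : A.left ⟶ (directSum hT K hX).obj) :
    (fam (g.left ≫ x)).val (𝟙 B.left) = g ≫ (fam x).val (𝟙 A.left) := by
  rw [fam_comp, Fam.val_res, Fam.comp_val]
  exact congrArg _ ((Category.id_comp _).trans (Category.comp_id _).symm)

theorem comp_incl {A B : Over X} (g : B ⟶ A) (a : A ⟶ K.obj) :
    g.left ≫ incl hT hX a = incl hT hX (g ≫ a) := by
  have h := (sumProj hT K hX).comp_P g.left A.hom (incl hT hX a)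
  rw [sumProj_incl, Over.w, sumProj_eq_incl, fam_comp_val, fam_incl_val] at h
  exact h

end DirectSum


/-! ### The slice Hilbert space of the direct sum -/

section SliceOfSum

open Limits HilbertSum

variable {T : Type u} [Category.{v} T] [HasFiniteLimits T] {X : T}
  (hT : IsGrothendieckTopos T) (hX : IsDecidable X) (K : HilbertSpace (Over X))

/-- The member of a vector in a summand of the direct sum. -/
def sliceSumVal {A : Over X} (x : A ⟶ (sumProj hT K hX).slice.obj) : A ⟶ K.obj :=
  (fam ((sumProj hT K hX).toVec x)).val (𝟙 A.left)

/-- The vector in a summand of the direct sum with a given member. -/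
def sliceSumEl {A : Over X} (a : A ⟶ K.obj) : A ⟶ (sumProj hT K hX).slice.obj :=
  (sumProj hT K hX).el (incl hT hX a)

variable {hT hX K} {A B : Over X}

theorem sliceSumVal_el (a : A ⟶ K.obj) : sliceSumVal hT hX K (sliceSumEl hT hX K a) = a := by
  rw [sliceSumVal, sliceSumEl, ProjFamily.toVec_el, sumProj_incl, fam_incl_val]

theorem sliceSumEl_val (x : A ⟶ (sumProj hT K hX).slice.obj) :
    sliceSumEl hT hX K (sliceSumVal hT hX K x) = x :=
  (sumProj hT K hX).toVec_injective (by
    rw [sliceSumEl, sliceSumVal, ProjFamily.toVec_el, sumProj_incl, ← sumProj_eq_incl,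
      ProjFamily.P_toVec])

theorem comp_sliceSumVal (f : B ⟶ A) (x : A ⟶ (sumProj hT K hX).slice.obj) :
    f ≫ sliceSumVal hT hX K x = sliceSumVal hT hX K (f ≫ x) := by
  rw [sliceSumVal, sliceSumVal, ProjFamily.toVec_comp, fam_comp_val]

theorem comp_sliceSumEl (f : B ⟶ A) (a : A ⟶ K.obj) :
    f ≫ sliceSumEl hT hX K a = sliceSumEl hT hX K (f ≫ a) := by
  rw [sliceSumEl, sliceSumEl, ProjFamily.comp_el, comp_incl]

theorem inner_sliceSumVal (x y : A ⟶ (sumProj hT K hX).slice.obj) :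
    K.inner (sliceSumVal hT hX K x) (sliceSumVal hT hX K y) =
      (sumProj hT K hX).slice.inner x y := by
  rw [sliceSumVal, sliceSumVal, ← inner_sumProj_left, ProjFamily.P_toVec, ProjFamily.inner_toVec]

variable (hT hX K)

/-- The summands of the direct sum of a Hilbert space of the slice form that space. -/
def sliceSumIso : (sumProj hT K hX).slice ≅ K where
  hom := opMk (sliceSumVal hT hX K) (sliceSumEl hT hX K) comp_sliceSumVal comp_sliceSumEl
    (fun x y => by
      rw [← inner_sliceSumVal x, sliceSumVal_el]) 1 zero_le_one
    (fun x => by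
      rw [one_pow, DReal.const_one, one_mul]
      exact (congrArg Cx.re (inner_sliceSumVal x x)).le)
  inv := opMk (sliceSumEl hT hX K) (sliceSumVal hT hX K) comp_sliceSumEl comp_sliceSumVal
    (fun x y => by
      rw [← inner_sliceSumVal, sliceSumVal_el]) 1 zero_le_one
    (fun x => by
      rw [one_pow, DReal.const_one, one_mul, PreHilbertSpace.normSq, ← inner_sliceSumVal,
        sliceSumVal_el]
      exact le_rfl)
  hom_inv_id := BoundedOp.hom_ext fun U x => by
    rw [BoundedOp.app_comp, opMk_app, opMk_app, sliceSumEl_val, BoundedOp.app_id]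
  inv_hom_id := BoundedOp.hom_ext fun U x => by
    rw [BoundedOp.app_comp, opMk_app, opMk_app, sliceSumVal_el, BoundedOp.app_id]

include hT hX in
/-- Every Hilbert space of the slice is formed by the components of a graded Hilbert space, its
direct sum. -/
theorem gradedToSlice_isEquivalence : (gradedToSlice X).IsEquivalence where
  faithful := gradedToSlice_faithful
  full := gradedToSlice_full hX
  essSurj := ⟨fun K => ⟨⟨directSum hT K hX, sumGrading hT K hX⟩, ⟨sliceSumIso hT hX K⟩⟩⟩

end SliceOfSum


/-! ### The complex numbers as a Hilbert space -/

namespace DReal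

section

variable {C : Type u} [Category.{v} C] {J : GrothendieckTopology C} {U : C}

theorem le_const_of_mul_self_le {x : DReal J U} {r : ℝ} (hr : 0 < r) (h : x * x ≤ const (r ^ 2)) :
    x ≤ const r := by
  apply le_of_const_mul_le (r := 2 * r) (by positivity)
  have h1 := mul_self_nonneg' (x - const r)
  have h2 : x * x - 2 * (const r * x) + const (r ^ 2) = (x - const r) * (x - const r) := by
    rw [pow_two, const_mul]; ring
  rw [← h2] at h1
  rw [const_mul, const_two, ← sub_nonneg]
  have h3 := add_nonneg h1 (sub_nonneg.2 h)
  refine h3.trans_eq ?_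
  rw [pow_two, const_mul]
  ring

theorem eq_zero_of_mul_self_le {x : DReal J U} (h : x * x ≤ 0) : x = 0 := by
  have key : ∀ x : DReal J U, x * x ≤ 0 → x ≤ 0 := fun x h => by
    refine le_of_forall_pos_le_add fun ε hε => ?_
    rw [zero_add]
    exact le_const_of_mul_self_le hε (h.trans (const_nonneg (sq_nonneg ε)))
  refine le_antisymm (key x h) ?_
  have := key (-x) (by rwa [neg_mul_neg])
  rwa [neg_nonpos] at this

theorem eq_of_forall_rat {x y : DReal J U}
    (h : ∀ ε : ℚ, 0 < ε → x ≤ y + const ε ∧ y ≤ x + const ε) : x = y := by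
  refine le_antisymm ?_ ?_ <;>
  · refine le_of_forall_pos_le_add fun ε hε => ?_
    obtain ⟨δ, hδ, hδε⟩ := exists_rat_btwn hε
    have := h δ (by exact_mod_cast hδ)
    first
    | exact this.1.trans (add_le_add le_rfl (const_mono hδε.le))
    | exact this.2.trans (add_le_add le_rfl (const_mono hδε.le))

/-- The Dedekind reals form a sheaf. -/
theorem exists_glue {S : Sieve U} (hS : S ∈ J U) (x : ∀ ⦃V : C⦄ (f : V ⟶ U), S f → DReal J V)
    (hx : ∀ ⦃V W : C⦄ (f : V ⟶ U) (hf : S f) (g : W ⟶ V) (h : S (g ≫ f)),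
      (x f hf).restrict g = x (g ≫ f) h) :
    ∃ r : DReal J U, ∀ ⦃V : C⦄ (f : V ⟶ U) (hf : S f), r.restrict f = x f hf := by
  obtain ⟨r, hr⟩ := exists_limit (J := J) (U := U)
    (fun _ V f a => ∀ ⦃W : C⦄ (g : W ⟶ V) (p : W ⟶ U) (_ : p = g ≫ f) (h : S p),
      a.restrict g = x p h)
    (fun ε _ V f a ha W g Z k p hp h => by
      rw [← restrict_comp]
      exact ha (k ≫ g) p (hp.trans (Category.assoc _ _ _).symm) h)
    (fun ε _ => ⟨S, hS, fun V f hf => ⟨x f hf, by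
      rintro W g _ rfl h
      exact hx f hf g h⟩⟩)
    (fun ε hε δ hδ V f a b ha hb => by
      have : a = b := eq_of_locally ⟨S.pullback f, J.pullback_stable f hS, fun W g hg =>
        (ha g _ rfl hg).trans (hb g _ rfl hg).symm⟩
      rw [this]
      refine le_add_of_nonneg_right (const_nonneg ?_)
      exact_mod_cast (add_pos hε hδ).le)
  refine ⟨r, fun V f hf => eq_of_forall_rat fun ε hε => hr ε hε f _ ?_⟩
  rintro W g _ rfl h
  exact hx f hf g h

end

end DReal

section Complex

variable {T : Type u} [Category.{v} T]

theorem IsGrothendieckTopos.small_cx (hT : IsGrothendieckTopos T) (U : T) :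
    Small.{v} (Cx (can T) U) := by
  have := hT.small_dReal U
  exact small_of_injective (f := fun z : Cx (can T) U => (z.re, z.im)) fun z w h =>
    Cx.ext (congrArg Prod.fst h) (congrArg Prod.snd h)

/-- The presheaf of complex numbers. -/
def cxFunctor (hT : IsGrothendieckTopos T) : Tᵒᵖ ⥤ Type v :=
  haveI := hT.small_cx
  { obj := fun U => Shrink.{v} (Cx (can T) U.unop)
    map := fun f => ↾fun z => equivShrink _ (((equivShrink _).symm z).restrict f.unop)
    map_id := fun U => ConcreteCategory.hom_ext _ _ fun z =>
      (congrArg (equivShrink (Cx (can T) U.unop)) (Cx.restrict_id _)).trans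
        (Equiv.apply_symm_apply _ _)
    map_comp := fun f g => ConcreteCategory.hom_ext _ _ fun z => by
      refine congrArg (equivShrink _) ?_
      refine Eq.trans ?_ (congrArg (fun w : Cx (can T) _ => w.restrict g.unop)
        (Equiv.symm_apply_apply (equivShrink _) _).symm)
      exact Cx.restrict_comp f.unop _ g.unop }

theorem isSheaf_cxFunctor (hT : IsGrothendieckTopos T) :
    Presieve.IsSheaf (can T) (cxFunctor hT) := by
  have := hT.small_cx
  intro U S hS x hx
  let y : ∀ ⦃V : T⦄ (f : V ⟶ U), S f → Cx (can T) V := fun V f hf => (equivShrink _).symm (x f hf)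
  have hmap : ∀ {V W : T} (g : W ⟶ V) (z : (cxFunctor hT).obj (Opposite.op V)),
      (equivShrink (Cx (can T) W)).symm ((cxFunctor hT).map g.op z) =
        ((equivShrink (Cx (can T) V)).symm z).restrict g := fun g z =>
    Equiv.symm_apply_apply _ _
  have hy : ∀ ⦃V W : T⦄ (f : V ⟶ U) (hf : S f) (g : W ⟶ V) (h : S (g ≫ f)),
      (y f hf).restrict g = y (g ≫ f) h := fun V W f hf g h => by
    have h1 := hx g (𝟙 W) hf h (Category.id_comp _).symm
    have h2 := congrArg (equivShrink (Cx (can T) W)).symm h1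
    rw [hmap, hmap, Cx.restrict_id] at h2
    exact h2
  obtain ⟨r, hr⟩ := DReal.exists_glue hS (fun V f hf => (y f hf).re) fun V W f hf g h =>
    congrArg Cx.re (hy f hf g h)
  obtain ⟨s, hs⟩ := DReal.exists_glue hS (fun V f hf => (y f hf).im) fun V W f hf g h =>
    congrArg Cx.im (hy f hf g h)
  refine ⟨equivShrink (Cx (can T) U) ⟨r, s⟩, fun V f hf => ?_, fun z hz => ?_⟩
  · apply (equivShrink (Cx (can T) V)).symm.injective
    refine (hmap f _).trans ?_
    rw [Equiv.symm_apply_apply]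
    exact Cx.ext (hr f hf) (hs f hf)
  · apply (equivShrink (Cx (can T) U)).symm.injective
    rw [Equiv.symm_apply_apply]
    refine Cx.eq_of_locally ⟨S, hS, fun V f hf => ?_⟩
    refine (hmap f z).symm.trans ?_
    refine (congrArg (equivShrink (Cx (can T) V)).symm (hz f hf)).trans ?_
    exact (Cx.ext (hr f hf) (hs f hf) : _ = _).symm

variable (hT : IsGrothendieckTopos T)

/-- The complex numbers, presented by their generalized elements. -/
def cxPresheaf : PreHilbertPresheaf T where
  vec U := Cx (can T) U
  addCommGroup U := inferInstance
  module U := inferInstance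
  inner z w := star z * w
  res f z := z.restrict f
  res_add f z w := Cx.restrict_add f z w
  res_smul f c z := Cx.restrict_mul f c z
  inner_restrict f z w := by rw [Cx.restrict_mul, Cx.restrict_star]
  inner_add_right z w w' := mul_add _ _ _
  inner_smul_right c z w := mul_left_comm _ _ _
  star_inner z w := by rw [star_mul, star_star, mul_comm]
  inner_self_nonneg z := by
    rw [Cx.star_mul_self]
    exact z.absSq_nonneg
  eq_zero_of_inner_self z h := by
    rw [Cx.star_mul_self] at h
    have h1 : z.re * z.re + z.im * z.im = 0 := congrArg Cx.re h
    have h2 := DReal.mul_self_nonneg' z.re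
    have h3 := DReal.mul_self_nonneg' z.im
    refine Cx.ext (DReal.eq_zero_of_mul_self_le ?_) (DReal.eq_zero_of_mul_self_le ?_)
    · rw [← h1]
      exact le_add_of_nonneg_right h3
    · rw [← h1]
      exact le_add_of_nonneg_left h2
  obj := (hT.exists_representableBy (isSheaf_cxFunctor hT)).choose
  equiv {U} :=
    haveI := hT.small_cx
    (hT.exists_representableBy (isSheaf_cxFunctor hT)).choose_spec.some.homEquiv.trans
      (equivShrink (Cx (can T) U)).symm
  equiv_comp {U V} f x := by
    have := hT.small_cx
    refine (congrArg (equivShrink (Cx (can T) V)).symm ((hT.exists_representableBy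
      (isSheaf_cxFunctor hT)).choose_spec.some.homEquiv_comp f x)).trans ?_
    exact Equiv.symm_apply_apply _ _

/-- The complex numbers as a Hilbert space. -/
def cxHilbert : HilbertSpace T where
  toPreHilbertSpace := (cxPresheaf hT).toPreHilbertSpace
  complete {U} A hA := by
    let P := cxPresheaf hT
    let c : ∀ {V : T}, (V ⟶ P.toPreHilbertSpace.obj) → Cx (can T) V := fun x => P.equiv x
    have hc : ∀ {V W : T} (f : W ⟶ V) (x : V ⟶ P.toPreHilbertSpace.obj),
      c (f ≫ x) = (c x).restrict f := fun f x => P.equiv_comp f x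
    have hsub : ∀ {V : T} (x y : V ⟶ P.toPreHilbertSpace.obj), c (x - y) = c x - c y :=
      fun x y => P.equiv_sub x y
    have hnorm : ∀ {V : T} (x : V ⟶ P.toPreHilbertSpace.obj),
        P.toPreHilbertSpace.normSq x = (c x).absSq := fun x =>
      congrArg Cx.re (Cx.star_mul_self (c x))
    have hpart : ∀ {V : T} {x : V ⟶ P.toPreHilbertSpace.obj} {r : ℝ}, 0 < r →
        P.toPreHilbertSpace.NormLE x r → (c x).re ≤ DReal.const r ∧ (c x).im ≤ DReal.const r :=
      fun {V x r} hr h => by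
        rw [PreHilbertSpace.NormLE, hnorm] at h
        exact ⟨DReal.le_const_of_mul_self_le hr
            ((le_add_of_nonneg_right (DReal.mul_self_nonneg' _)).trans h),
          DReal.le_const_of_mul_self_le hr
            ((le_add_of_nonneg_left (DReal.mul_self_nonneg' _)).trans h)⟩
    have hlim : ∀ p : ∀ {V : T}, Cx (can T) V → DReal (can T) V,
        (∀ {V W : T} (f : W ⟶ V) (z : Cx (can T) V), p (z.restrict f) = (p z).restrict f) →
        (∀ {V : T} (z w : Cx (can T) V), p (z - w) = p z - p w) →
        (∀ {V : T} {x : V ⟶ P.toPreHilbertSpace.obj} {r : ℝ}, 0 < r →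
          P.toPreHilbertSpace.NormLE x r → p (c x) ≤ DReal.const r) →
        ∃ r : DReal (can T) U, ∀ ε > 0, ∀ ⦃V : T⦄ (f : V ⟶ U) (a : V ⟶ P.toPreHilbertSpace.obj),
          A ε f a → r.restrict f ≤ p (c a) + DReal.const (ε : ℝ) ∧
            p (c a) ≤ r.restrict f + DReal.const (ε : ℝ) := by
      intro p hpres hpsub hple
      obtain ⟨r, hr⟩ := DReal.exists_limit (J := can T) (U := U)
        (fun ε V f s => ∃ a, A ε f a ∧ p (c a) = s)
        (by
          rintro ε hε V f _ ⟨a, ha, rfl⟩ W g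
          exact ⟨g ≫ a, hA.restrict ε hε f a ha g, by rw [hc, hpres]⟩)
        (fun ε hε => (hA.inhabited ε hε).mono fun V f ⟨a, ha⟩ => ⟨_, a, ha, rfl⟩)
        (by
          rintro ε hε δ hδ V f _ _ ⟨a, ha, rfl⟩ ⟨b, hb, rfl⟩
          have h := hple (by exact_mod_cast add_pos hε hδ) (hA.cauchy ε hε δ hδ f a b ha hb)
          rwa [hsub, hpsub, sub_le_iff_le_add'] at h)
      exact ⟨r, fun ε hε V f a ha => hr ε hε f _ ⟨a, ha, rfl⟩⟩
    obtain ⟨r, hr⟩ := hlim Cx.re (fun _ _ => rfl) Cx.sub_re fun h h' => (hpart h h').1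
    obtain ⟨s, hs⟩ := hlim Cx.im (fun _ _ => rfl) Cx.sub_im fun h h' => (hpart h h').2
    obtain ⟨x, hx⟩ : ∃ x : U ⟶ P.toPreHilbertSpace.obj, c x = ⟨r, s⟩ :=
      ⟨P.equiv.symm ⟨r, s⟩, P.equiv.apply_symm_apply _⟩
    -- bounds for the real and the imaginary part of the distance give a bound for the distance
    -- which is worse by a factor; better approximations remove it
    have h2 : ∀ ε > 0, ∀ ⦃V : T⦄ (f : V ⟶ U) (a : V ⟶ P.toPreHilbertSpace.obj), A ε f a →
        P.toPreHilbertSpace.NormLE (f ≫ x - a) (2 * ε) := by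
      intro ε hε V f a ha
      have hε' : (0 : ℝ) ≤ ε := by exact_mod_cast hε.le
      obtain ⟨h1, h2⟩ := hr ε hε f a ha
      obtain ⟨h3, h4⟩ := hs ε hε f a ha
      have sq : ∀ {x y : DReal (can T) V}, x ≤ y + DReal.const (ε : ℝ) →
          y ≤ x + DReal.const (ε : ℝ) → (x - y) * (x - y) ≤ DReal.const ((ε : ℝ) ^ 2) := by
        intro x y h h'
        have := mul_nonneg (sub_nonneg.2 h) (sub_nonneg.2 h')
        rw [← sub_nonneg]
        refine this.trans_eq ?_
        rw [pow_two, DReal.const_mul]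
        ring
      rw [PreHilbertSpace.NormLE, hnorm, hsub, hc, hx, Cx.absSq, Cx.sub_re, Cx.sub_im]
      refine (add_le_add (sq h1 h2) (sq h3 h4)).trans ?_
      rw [← DReal.const_add]
      exact DReal.const_mono (by nlinarith [sq_nonneg (ε : ℝ)])
    refine ⟨x, fun ε hε V f a ha => ?_⟩
    have hε' : (0 : ℝ) < ε := by exact_mod_cast hε
    refine PreHilbertSpace.NormLE.of_forall_add hε'.le fun η hη => ?_
    obtain ⟨δ, hδ, hδη⟩ := exists_rat_btwn (show (0 : ℝ) < η / 3 by positivity)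
    have hδ0 : (0 : ℚ) < δ := by exact_mod_cast hδ
    refine PreHilbertSpace.NormLE.of_locally (((hA.inhabited δ hδ0).restrict f).mono
      fun W g ⟨b, hb⟩ => ?_)
    have h3 := hA.cauchy δ hδ0 ε hε _ _ _ hb (hA.restrict ε hε f a ha g)
    have h4 := (h2 δ hδ0 _ _ hb).sub_trans h3 (by positivity) (by push_cast; positivity)
    rw [PreHilbertSpace.comp_sub, ← Category.assoc]
    refine h4.mono (by push_cast; positivity) ?_
    push_cast
    linarith

variable {hT}

/-- The complex number given by a vector of the Hilbert space of complex numbers. -/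
def toCx {U : T} (x : U ⟶ (cxHilbert hT).obj) : Cx (can T) U := (cxPresheaf hT).equiv x

variable (hT) in
/-- A complex number as a vector. -/
def ofCx {U : T} (z : Cx (can T) U) : U ⟶ (cxHilbert hT).obj := (cxPresheaf hT).equiv.symm z

variable {U V : T}

theorem toCx_ofCx (z : Cx (can T) U) : toCx (ofCx hT z) = z := Equiv.apply_symm_apply _ _

theorem ofCx_toCx (x : U ⟶ (cxHilbert hT).obj) : ofCx hT (toCx x) = x := Equiv.symm_apply_apply _ _

theorem toCx_comp (f : V ⟶ U) (x : U ⟶ (cxHilbert hT).obj) :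
    toCx (f ≫ x) = (toCx x).restrict f := (cxPresheaf hT).equiv_comp f x

theorem toCx_add (x y : U ⟶ (cxHilbert hT).obj) : toCx (x + y) = toCx x + toCx y :=
  (cxPresheaf hT).equiv_add x y

theorem toCx_smul (c : Cx (can T) U) (x : U ⟶ (cxHilbert hT).obj) : toCx (c • x) = c * toCx x :=
  (cxPresheaf hT).equiv_smul c x

theorem inner_toCx (x y : U ⟶ (cxHilbert hT).obj) :
    (cxHilbert hT).inner x y = star (toCx x) * toCx y := rfl

theorem normSq_toCx (x : U ⟶ (cxHilbert hT).obj) : (cxHilbert hT).normSq x = (toCx x).absSq :=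
  congrArg Cx.re (Cx.star_mul_self (toCx x))

theorem comp_ofCx_one (f : V ⟶ U) : f ≫ ofCx hT (1 : Cx (can T) U) = ofCx hT 1 := by
  rw [← ofCx_toCx (f ≫ ofCx hT (1 : Cx (can T) U)), toCx_comp, toCx_ofCx, Cx.restrict_one]

theorem smul_ofCx_one (x : U ⟶ (cxHilbert hT).obj) : toCx x • ofCx hT 1 = x := by
  rw [← ofCx_toCx (toCx x • ofCx hT 1), toCx_smul, toCx_ofCx, mul_one, ofCx_toCx]

end Complex


/-! ### Copowers of Hilbert spaces -/

/-- A copower of the Hilbert space `H` by the object `X`: a graded Hilbert space, the components of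
which are identified with `H`.  It serves as `H ⊗ ℓ²(X)`. -/
structure Copower {T : Type u} [Category.{v} T] (H : HilbertSpace T) (X : T) where
  space : HilbertSpace T
  grading : Grading space X
  π : ∀ {U : T}, (U ⟶ X) → (U ⟶ space.obj) → (U ⟶ H.obj)
  ι : ∀ {U : T}, (U ⟶ X) → (U ⟶ H.obj) → (U ⟶ space.obj)
  comp_π : ∀ {U V : T} (f : V ⟶ U) (x : U ⟶ X) (v : U ⟶ space.obj),
    f ≫ π x v = π (f ≫ x) (f ≫ v)
  comp_ι : ∀ {U V : T} (f : V ⟶ U) (x : U ⟶ X) (h : U ⟶ H.obj),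
    f ≫ ι x h = ι (f ≫ x) (f ≫ h)
  π_ι : ∀ {U : T} (x : U ⟶ X) (h : U ⟶ H.obj), π x (ι x h) = h
  ι_π : ∀ {U : T} (x : U ⟶ X) (v : U ⟶ space.obj), ι x (π x v) = grading.P x v
  inner_ι : ∀ {U : T} (x : U ⟶ X) (h : U ⟶ H.obj) (v : U ⟶ space.obj),
    space.inner (ι x h) v = H.inner h (π x v)

section Existence

open Limits HilbertSum

variable {T : Type u} [Category.{v} T]

/-- The family of identical projections. -/
def ProjFamily.refl (H : HilbertSpace T) (X : T) : ProjFamily H X where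
  P _ h := h
  comp_P _ _ _ := rfl
  inner_P _ _ _ := rfl
  P_P _ _ := rfl

/-- Over a Grothendieck topos, copowers by decidable objects exist: a copower is the direct sum of
the constant family. -/
def copower (hT : IsGrothendieckTopos T) {X : T} (hX : IsDecidable X) (H : HilbertSpace T) :
    Copower H X :=
  haveI := hT.hasFiniteLimits
  let Q := ProjFamily.refl H X
  let K := Q.slice
  { space := directSum hT K hX
    grading := sumGrading hT K hX
    π := fun {U} x v => Q.vecAt x ((fam v).val (A := Over.mk x) (𝟙 U))
    ι := fun x h => incl hT hX (Q.elAt x h)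
    comp_π := fun f x v => by
      rw [Q.comp_vecAt]
      exact congrArg _ (fam_comp_val (Over.homMk f : Over.mk (f ≫ x) ⟶ Over.mk x) v).symm
    comp_ι := fun f x h =>
      (comp_incl (Over.homMk f : Over.mk (f ≫ x) ⟶ Over.mk x) _).trans
        (congrArg _ (Q.comp_elAt x f h))
    π_ι := fun x h => (congrArg (Q.vecAt x) (fam_incl_val _)).trans (Q.vecAt_elAt x h)
    ι_π := fun x v => (congrArg (incl hT hX) (Q.elAt_vecAt x _)).trans
      (sumProj_eq_incl (A := Over.mk x) v).symm
    inner_ι := fun x h v => by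
      apply (Cx.overEquiv (Over.mk x)).injective
      have h1 := inner_sumProj_left (hT := hT) (hX := hX) (A := Over.mk x) (incl hT hX (Q.elAt x h)) v
      have h2 := sumProj_incl (hT := hT) (hX := hX) (Q.elAt x h)
      rw [h2, fam_incl_val] at h1
      refine h1.trans ((Q.inner_toVec _ _).trans (congrArg _ ?_))
      exact congrArg (fun z => H.inner z _) (Q.vecAt_elAt x h) }

end Existence

namespace Copower

variable {T : Type u} [Category.{v} T] {X : T} {H : HilbertSpace T} (C : Copower H X) {U V : T}

theorem inner_ι_right (x : U ⟶ X) (v : U ⟶ C.space.obj) (h : U ⟶ H.obj) :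
    C.space.inner v (C.ι x h) = H.inner (C.π x v) h := by
  rw [← C.space.star_inner, C.inner_ι, H.star_inner]

theorem π_add (x : U ⟶ X) (v w : U ⟶ C.space.obj) : C.π x (v + w) = C.π x v + C.π x w :=
  H.ext_inner _ _ fun h => by
    rw [H.inner_add_right, ← C.inner_ι, C.space.inner_add_right, C.inner_ι, C.inner_ι]

theorem π_smul (x : U ⟶ X) (c : Cx (can T) U) (v : U ⟶ C.space.obj) :
    C.π x (c • v) = c • C.π x v :=
  H.ext_inner _ _ fun h => by
    rw [H.inner_smul_right, ← C.inner_ι, C.space.inner_smul_right, C.inner_ι]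

theorem π_zero (x : U ⟶ X) : C.π x (0 : U ⟶ C.space.obj) = 0 := by
  have := C.π_add x 0 0
  rwa [add_zero, left_eq_add] at this

theorem ι_smul (x : U ⟶ X) (c : Cx (can T) U) (h : U ⟶ H.obj) : C.ι x (c • h) = c • C.ι x h :=
  C.space.ext_inner_left fun w => by
    rw [C.inner_ι, H.inner_smul_left, C.space.inner_smul_left, C.inner_ι]

theorem P_ι (x : U ⟶ X) (h : U ⟶ H.obj) : C.grading.P x (C.ι x h) = C.ι x h := by
  rw [← C.ι_π, C.π_ι]

theorem π_P (x : U ⟶ X) (v : U ⟶ C.space.obj) : C.π x (C.grading.P x v) = C.π x v := by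
  rw [← C.ι_π, C.π_ι]

theorem π_ι_ne {x y : U ⟶ X} (hxy : InternallyNe (can T) x y) (h : U ⟶ H.obj) :
    C.π x (C.ι y h) = 0 := by
  rw [← C.π_P, ← C.P_ι y, C.grading.P_ne _ _ _ hxy, C.π_zero]

theorem normSq_ι (x : U ⟶ X) (h : U ⟶ H.obj) : C.space.normSq (C.ι x h) = H.normSq h := by
  rw [PreHilbertSpace.normSq, C.inner_ι, C.π_ι, PreHilbertSpace.normSq]

theorem normSq_π (x : U ⟶ X) (v : U ⟶ C.space.obj) :
    H.normSq (C.π x v) = C.space.normSq (C.grading.P x v) := by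
  rw [← C.ι_π, normSq_ι]

theorem inner_P_left (x : U ⟶ X) (v w : U ⟶ C.space.obj) :
    C.space.inner (C.grading.P x v) w = H.inner (C.π x v) (C.π x w) := by
  rw [← C.ι_π, C.inner_ι]

theorem ext {v w : U ⟶ C.space.obj}
    (h : ∀ ⦃V : T⦄ (f : V ⟶ U) (x : V ⟶ X), C.π x (f ≫ v) = C.π x (f ≫ w)) : v = w :=
  C.grading.ext fun V f x => by rw [← C.ι_π, ← C.ι_π, h]

theorem hom_ext {L : HilbertSpace T} {s t : L ⟶ C.space}
    (h : ∀ ⦃U : T⦄ (x : U ⟶ X) (a : U ⟶ L.obj),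
      C.π x (BoundedOp.app s a) = C.π x (BoundedOp.app t a)) : s = t :=
  C.grading.ext_app fun U x a => by rw [← C.ι_π, ← C.ι_π, h]

variable (hX : IsDecidable X)

/-- An operator acts on the copowers componentwise. -/
def mapComponents {H' : HilbertSpace T} (C' : Copower H' X) (f : H ⟶ H') :
    Grading.Components C.grading C'.grading where
  t x v := C'.ι x (BoundedOp.app f (C.π x v))
  s x v := C.ι x (BoundedOp.app (adjoint f) (C'.π x v))
  comp_t g x v := by rw [C'.comp_ι, BoundedOp.comp_app, C.comp_π]
  comp_s g x v := by rw [C.comp_ι, BoundedOp.comp_app, C'.comp_π]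
  P_t x v := C'.P_ι x _
  P_s x v := C.P_ι x _
  inner_t x v w := by rw [C'.inner_ι, C.inner_ι_right, inner_adjoint]
  c := max (BoundedOp.exists_bound f).choose (BoundedOp.exists_bound (adjoint f)).choose
  c_nonneg := (BoundedOp.exists_bound f).choose_spec.1.le.trans (le_max_left _ _)
  bound_t x v := by
    rw [normSq_ι, ← normSq_π]
    refine ((BoundedOp.exists_bound f).choose_spec.2 _).trans
      (mul_le_mul_of_nonneg_right (DReal.const_mono ?_) (H.normSq_nonneg _))
    exact pow_le_pow_left₀ (BoundedOp.exists_bound f).choose_spec.1.le (le_max_left _ _) 2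
  bound_s x v := by
    rw [normSq_ι, ← normSq_π]
    refine ((BoundedOp.exists_bound (adjoint f)).choose_spec.2 _).trans
      (mul_le_mul_of_nonneg_right (DReal.const_mono ?_) (H'.normSq_nonneg _))
    exact pow_le_pow_left₀ (BoundedOp.exists_bound (adjoint f)).choose_spec.1.le (le_max_right _ _) 2

/-- The operator between copowers which acts by a given operator on the components. -/
def map {H' : HilbertSpace T} (C' : Copower H' X) (f : H ⟶ H') : C.space ⟶ C'.space :=
  (C.mapComponents C' f).op hX

theorem π_map {H' : HilbertSpace T} (C' : Copower H' X) (f : H ⟶ H') (x : U ⟶ X)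
    (v : U ⟶ C.space.obj) :
    C'.π x (BoundedOp.app (C.map hX C' f) v) = BoundedOp.app f (C.π x v) := by
  rw [← C'.π_P, map, Grading.Components.P_op]
  exact C'.π_ι x _

/-- The components of the operator which sends a vector of a graded Hilbert space to the family of
its components. -/
def diagComponents (G : Grading H X) : Grading.Components G C.grading where
  t x v := C.ι x (G.P x v)
  s x w := G.P x (C.π x w)
  comp_t g x v := by rw [C.comp_ι, G.comp_P]
  comp_s g x v := by rw [G.comp_P, C.comp_π]
  P_t x v := C.P_ι x _
  P_s x v := G.P_P x _
  inner_t x v w := by rw [C.inner_ι, G.inner_P]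
  c := 1
  c_nonneg := zero_le_one
  bound_t x v := by rw [normSq_ι, one_pow, DReal.const_one, one_mul]
  bound_s x v := by
    rw [one_pow, DReal.const_one, one_mul, ← normSq_π]
    exact G.normSq_P_le x _

/-- The operator which sends a vector of a graded Hilbert space to the family of its components. -/
def diag (G : Grading H X) : H ⟶ C.space := (C.diagComponents G).op hX

theorem π_diag (G : Grading H X) (x : U ⟶ X) (v : U ⟶ H.obj) :
    C.π x (BoundedOp.app (C.diag hX G) v) = G.P x v := by
  rw [← C.π_P, diag, Grading.Components.P_op]
  exact C.π_ι x _

theorem P_adjoint_diag (G : Grading H X) (x : U ⟶ X) (w : U ⟶ C.space.obj) :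
    G.P x (BoundedOp.app (adjoint (C.diag hX G)) w) = G.P x (C.π x w) :=
  (C.diagComponents G).P_adjoint_op hX x w

end Copower

/-! ### The tensor product with `ℓ²(X)` -/

section Tensor

variable {T : Type u} [Category.{v} T] {X : T} (hX : IsDecidable X)
  {hT : IsGrothendieckTopos T} (L : Copower (cxHilbert hT) X) {H : HilbertSpace T}
  (C : Copower H X) {U V : T}

namespace Copower

/-- The coordinate with index `x` of a vector of `ℓ²(X)`. -/
def coord (x : U ⟶ X) (a : U ⟶ L.space.obj) : Cx (can T) U := toCx (L.π x a)

/-- The basis vectors of `ℓ²(X)`. -/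
def basis (x : U ⟶ X) : U ⟶ L.space.obj := L.ι x (ofCx hT 1)

theorem coord_restrict (x : U ⟶ X) (a : U ⟶ L.space.obj) (f : V ⟶ U) :
    (L.coord x a).restrict f = L.coord (f ≫ x) (f ≫ a) := by
  rw [coord, ← toCx_comp, L.comp_π, coord]

theorem coord_add (x : U ⟶ X) (a b : U ⟶ L.space.obj) :
    L.coord x (a + b) = L.coord x a + L.coord x b := by
  rw [coord, L.π_add, toCx_add, coord, coord]

theorem coord_smul (x : U ⟶ X) (c : Cx (can T) U) (a : U ⟶ L.space.obj) :
    L.coord x (c • a) = c * L.coord x a := by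
  rw [coord, L.π_smul, toCx_smul, coord]

theorem comp_basis (f : V ⟶ U) (x : U ⟶ X) : f ≫ L.basis x = L.basis (f ≫ x) := by
  rw [basis, L.comp_ι, comp_ofCx_one, basis]

theorem P_eq_coord_smul (x : U ⟶ X) (a : U ⟶ L.space.obj) :
    L.grading.P x a = L.coord x a • L.basis x := by
  rw [← L.ι_π, basis, ← L.ι_smul, coord, smul_ofCx_one]

theorem P_basis (x : U ⟶ X) : L.grading.P x (L.basis x) = L.basis x := L.P_ι x _

theorem coord_P (x : U ⟶ X) (a : U ⟶ L.space.obj) :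
    L.coord x (L.grading.P x a) = L.coord x a := by
  rw [coord, L.π_P, coord]

theorem coord_basis (x : U ⟶ X) : L.coord x (L.basis x) = 1 := by
  rw [coord, basis, L.π_ι, toCx_ofCx]

theorem coord_basis_ne {x y : U ⟶ X} (h : InternallyNe (can T) x y) : L.coord x (L.basis y) = 0 := by
  rw [← L.coord_P, ← L.P_basis y, L.grading.P_ne _ _ _ h, ← zero_smul (Cx (can T) U) 0, coord_smul,
    zero_mul]

/-- The space `ℓ²(X)`. -/
def l2 : L2 X where
  space := L.space
  e := L.basis (𝟙 X)
  inner_eq x := by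
    rw [comp_basis, Category.comp_id, basis, L.inner_ι, L.π_ι, inner_toCx, toCx_ofCx, mul_one,
      star_one]
  inner_ne x y h := by
    rw [comp_basis, Category.comp_id, comp_basis, Category.comp_id, basis, L.inner_ι, basis,
      L.π_ι_ne h, PreHilbertSpace.inner_zero_right]
  dense := L.grading.dense.of_approx (fun V W g s ⟨x, hs⟩ => ⟨g ≫ x, by rw [hs, Category.assoc]⟩)
    (by
      rintro V _ ⟨x, a, rfl⟩ ε hε
      refine Locally.of_forall fun W f => ⟨f ≫ L.grading.P x a, ?_, ?_⟩
      · rw [L.grading.comp_P, P_eq_coord_smul]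
        refine Submodule.smul_mem _ _ (Submodule.subset_span ⟨f ≫ x, ?_⟩)
        rw [comp_basis, Category.comp_id]
      · rw [sub_self]
        exact PreHilbertSpace.normLE_zero)

/-- The family of the multiples of a vector by the coordinates of a vector of `ℓ²(X)`. -/
def tmulDominated (h : U ⟶ H.obj) (a : U ⟶ L.space.obj) :
    Grading.Dominated L.grading C.grading a where
  k V f x := C.ι x (L.coord x (f ≫ a) • (f ≫ h))
  comp_k V W f x g := by
    rw [C.comp_ι, H.comp_smul, coord_restrict, Category.assoc, Category.assoc]
  P_k V f x := C.P_ι x _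
  c := H.normSq h
  c_nonneg := H.normSq_nonneg h
  bound V f x := by
    rw [normSq_ι, H.normSq_smul, H.normSq_restrict, ← normSq_π, normSq_toCx, mul_comm, coord]

/-- The tensor of a vector of `H` and a vector of `ℓ²(X)`. -/
def tmul (h : U ⟶ H.obj) (a : U ⟶ L.space.obj) : U ⟶ C.space.obj :=
  (L.tmulDominated C h a).vector hX

theorem π_tmul (h : U ⟶ H.obj) (a : U ⟶ L.space.obj) (x : U ⟶ X) :
    C.π x (L.tmul hX C h a) = L.coord x a • h := by
  have h1 := (L.tmulDominated C h a).P_vector hX (𝟙 U) x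
  rw [Category.id_comp] at h1
  rw [tmul, ← C.π_P, h1]
  refine (C.π_ι x _).trans ?_
  rw [Category.id_comp, Category.id_comp]

theorem comp_tmul (f : V ⟶ U) (h : U ⟶ H.obj) (a : U ⟶ L.space.obj) :
    f ≫ L.tmul hX C h a = L.tmul hX C (f ≫ h) (f ≫ a) :=
  C.ext fun W g x => by
    have h1 := (L.tmulDominated C h a).P_vector hX (g ≫ f) x
    have h2 := (L.tmulDominated C (f ≫ h) (f ≫ a)).P_vector hX g x
    rw [tmul, tmul, ← Category.assoc, ← C.π_P, h1, ← C.π_P x (g ≫ _), h2]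
    simp only [tmulDominated, Category.assoc]

/-- Elementary tensors with a basis vector are the inclusions of the components. -/
theorem tmul_basis (h : U ⟶ H.obj) (x : U ⟶ X) : L.tmul hX C h (L.basis x) = C.ι x h :=
  C.ext fun V f y => by
    refine hom_ext_of_locally ((hX y (f ≫ x)).mono fun W g hg => ?_)
    rw [comp_tmul, π_tmul, H.comp_smul, coord_restrict, comp_basis, comp_basis, C.comp_ι, C.comp_π,
      C.comp_ι]
    rcases hg with hg | hg
    · rw [hg, coord_basis, C.π_ι, one_smul]
    · rw [coord_basis_ne _ hg, C.π_ι_ne hg, zero_smul]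

theorem add_tmul (h h' : U ⟶ H.obj) (a : U ⟶ L.space.obj) :
    L.tmul hX C (h + h') a = L.tmul hX C h a + L.tmul hX C h' a :=
  C.ext fun V f x => by
    rw [C.space.comp_add, C.π_add, comp_tmul, comp_tmul, comp_tmul, π_tmul, π_tmul, π_tmul,
      H.comp_add, smul_add]

theorem tmul_add (h : U ⟶ H.obj) (a a' : U ⟶ L.space.obj) :
    L.tmul hX C h (a + a') = L.tmul hX C h a + L.tmul hX C h a' :=
  C.ext fun V f x => by
    rw [C.space.comp_add, C.π_add, comp_tmul, comp_tmul, comp_tmul, π_tmul, π_tmul, π_tmul,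
      L.space.comp_add, coord_add, add_smul]

theorem smul_tmul (c : Cx (can T) U) (h : U ⟶ H.obj) (a : U ⟶ L.space.obj) :
    L.tmul hX C (c • h) a = c • L.tmul hX C h a :=
  C.ext fun V f x => by
    rw [C.space.comp_smul, C.π_smul, comp_tmul, comp_tmul, π_tmul, π_tmul, H.comp_smul, smul_comm]

theorem tmul_smul (c : Cx (can T) U) (h : U ⟶ H.obj) (a : U ⟶ L.space.obj) :
    L.tmul hX C h (c • a) = c • L.tmul hX C h a :=
  C.ext fun V f x => by
    rw [C.space.comp_smul, C.π_smul, comp_tmul, comp_tmul, π_tmul, π_tmul, smul_smul,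
      L.space.comp_smul, coord_smul]

theorem inner_tmul (h h' : U ⟶ H.obj) (a a' : U ⟶ L.space.obj) :
    C.space.inner (L.tmul hX C h a) (L.tmul hX C h' a') = H.inner h h' * L.space.inner a a' := by
  rw [← L.space.inner_smul_right]
  refine C.grading.inner_eq_of_P L.grading hX fun V f x => ?_
  rw [C.inner_P_left, comp_tmul, comp_tmul, π_tmul, π_tmul, L.space.comp_smul,
    L.space.inner_smul_right, L.inner_P_left, inner_toCx, H.inner_smul_left, H.inner_smul_right,
    H.inner_restrict, coord, coord]
  ring

/-- The copower as a tensor product. -/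
def tensor : HilbertTensor H L.l2.space where
  space := C.space
  tmul h a := L.tmul hX C h a
  comp_tmul f h a := L.comp_tmul hX C f h a
  add_tmul h h' a := L.add_tmul hX C h h' a
  tmul_add h a a' := L.tmul_add hX C h a a'
  smul_tmul c h a := L.smul_tmul hX C c h a
  tmul_smul c h a := L.tmul_smul hX C c h a
  inner_tmul h h' a a' := L.inner_tmul hX C h h' a a'
  dense := C.grading.dense.mono fun V => by
    rintro _ ⟨x, v, rfl⟩
    exact ⟨C.π x v, L.basis x, by rw [tmul_basis, C.ι_π]⟩

theorem map_tmul {H' : HilbertSpace T} (C' : Copower H' X) (f : H ⟶ H') (h : U ⟶ H.obj)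
    (a : U ⟶ L.space.obj) :
    BoundedOp.app (C.map hX C' f) (L.tmul hX C h a) = L.tmul hX C' (BoundedOp.app f h) a :=
  C'.ext fun V g x => by
    rw [BoundedOp.comp_app, π_map, comp_tmul, comp_tmul, π_tmul, π_tmul, BoundedOp.app_smul,
      BoundedOp.comp_app]

theorem map_id : C.map hX C (𝟙 H) = 𝟙 C.space :=
  C.hom_ext fun U x a => by rw [π_map, BoundedOp.app_id, BoundedOp.app_id]

theorem map_comp {H' H'' : HilbertSpace T} (C' : Copower H' X) (C'' : Copower H'' X) (f : H ⟶ H')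
    (g : H' ⟶ H'') : C.map hX C'' (f ≫ g) = C.map hX C' f ≫ C'.map hX C'' g :=
  C''.hom_ext fun U x a => by
    rw [π_map, BoundedOp.app_comp, BoundedOp.app_comp, π_map, π_map]

/-- The operator `Δ : e_x ↦ e_x ⊗ e_x` sends a vector to the family of its components. -/
theorem diag_basis (D : Copower L.space X) (x : U ⟶ X) :
    BoundedOp.app (D.diag hX L.grading) (L.basis x) = L.tmul hX D (L.basis x) (L.basis x) :=
  D.ext fun V f y => by
    rw [BoundedOp.comp_app, π_diag, comp_tmul, π_tmul, L.comp_basis, L.P_eq_coord_smul]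
    refine hom_ext_of_locally ((hX y (f ≫ x)).mono fun W g hg => ?_)
    rw [L.space.comp_smul, L.space.comp_smul, L.coord_restrict, L.comp_basis, L.comp_basis]
    rcases hg with hg | hg
    · rw [hg]
    · rw [L.coord_basis_ne hg, zero_smul, zero_smul]

theorem adjoint_diag_tmul (D : Copower L.space X) (E : Copower C.space X) (h : U ⟶ H.obj)
    (a b : U ⟶ L.space.obj) :
    BoundedOp.app (adjoint (E.diag hX C.grading)) (L.tmul hX E (L.tmul hX C h a) b) =
      L.tmul hX C h (BoundedOp.app (adjoint (D.diag hX L.grading)) (L.tmul hX D a b)) :=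
  C.ext fun V f x => by
    rw [BoundedOp.comp_app, comp_tmul, comp_tmul, comp_tmul, BoundedOp.comp_app, comp_tmul, π_tmul,
      ← C.π_P, P_adjoint_diag, π_tmul, C.π_P, C.π_smul, π_tmul,
      ← L.coord_P x (BoundedOp.app _ _), P_adjoint_diag, L.coord_P, π_tmul, L.coord_smul, smul_smul]

end Copower

end Tensor

/-- Over a Grothendieck topos, `ℓ²(X)` and the tensor products with it exist. -/
def l2Tensor {T : Type u} [Category.{v} T] {X : T} (hX : IsDecidable X)
    (hT : IsGrothendieckTopos T) : L2Tensor X :=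
  let L := copower hT hX (cxHilbert hT)
  let C := fun H : HilbertSpace T => copower hT hX H
  { l2 := L.l2
    tensor := fun H => L.tensor hX (C H)
    tensorMap := fun {H K} f => (C H).map hX (C K) f
    tensorMap_tmul := fun {H K} f {U} h a => L.map_tmul hX (C H) (C K) f h a
    tensorMap_id := fun H => (C H).map_id hX
    tensorMap_comp := fun {H K M} f g => (C H).map_comp hX (C K) (C M) f g
    comul := (C L.space).diag hX L.grading
    comul_e := fun {U} x => by
      have h1 : x ≫ L.l2.e = L.basis x := (L.comp_basis x (𝟙 X)).trans (by rw [Category.comp_id])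
      rw [h1]
      exact L.diag_basis hX (C L.space) x
    tensorMul := fun H => adjoint ((C (C H).space).diag hX (C H).grading)
    tensorMul_tmul := fun H {U} h a b =>
      L.adjoint_diag_tmul hX (C H) (C L.space) (C (C H).space) h a b }

end ToposHilbert

end

open CategoryTheory ToposHilbert in
theorem mainTheorem7 {T : Type u} [Category.{v} T] (hT : IsGrothendieckTopos T) (X : T)
    (hX : IsDecidable X) :
    Nonempty (L2Tensor X) ∧
      ∀ D : L2Tensor X,
        Nonempty (L2Module D ≌ CZeroRep X) ∧
          Nonempty (CZeroRep X ≌ HilbertSpace (Over X)) := by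
  have := hT.hasFiniteLimits
  have := cZeroRepToGraded_isEquivalence hX
  have := gradedToSlice_isEquivalence hT hX
  refine ⟨⟨l2Tensor hX hT⟩, fun D => ?_⟩
  have := l2ModuleToGraded_isEquivalence D hX
  exact ⟨⟨(l2ModuleToGraded D hX).asEquivalence.trans (cZeroRepToGraded hX).asEquivalence.symm⟩,
    ⟨(cZeroRepToGraded hX).asEquivalence.trans (gradedToSlice X).asEquivalence⟩⟩
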